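/- Conventions. Algorithms are partial recursive functions on codes (natural numbers) which halt with a correct answer on all correct inputs; dimensions and degrees are part of the input. A simplicial set is \emph{locally effective} if it is given with an encoding of its simplices (injective in every dimension) for which algorithms compute the face and degeneracy operators. A map of locally effective simplicial sets is \emph{computable} if an algorithm computes the code of the image of a simplex from the code of the simplex. A chain complex $C_*$ of abelian groups, $C_n=0$ for $n<0$, with an encoding of its elements (every element has a code, and a code determines the element) is \emph{locally effective} if algorithms compute zero, sums, inverses, integer multiples and the differential, and if it has a basis of homogeneous elements such that algorithms expand every chain as an integral combination of distinct basis elements and decide whether a chain belongs to the basis. It is \emph{effective} if moreover an algorithm lists, for given $n$, the finitely many elements of such a basis in degree $n$. A \emph{reduction} $C_*\Rightarrow C'_*$ is a triple $(\alpha,\beta,\eta)$ of chain maps $\alpha\colon C_*\to C'_*$, $\beta\colon C'_*\to C_*$ and a map $\eta\colon C_*\to C_{*+1}$ of graded groups with $\eta\beta=0$, $\alpha\eta=0$, $\alpha\beta=\mathrm{id}$, $\eta\eta=0$, $\partial\eta+\eta\partial=\mathrm{id}-\beta\alpha$; it is computable if $\alpha,\beta,\eta$ are. A locally effective chain complex $C_*$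 \emph{has effective homology} if there are computable reductions $C_*\Leftarrow\widehat C_*\Rightarrow C^{\mathrm{ef}}_*$ with $\widehat C_*$ locally effective and $C^{\mathrm{ef}}_*$ effective. A locally effective simplicial set $X$ has effective homology if its normalized integral chain complex $C_*(X)$ does, where a chain $\sum_j z_jx_j$ is encoded by a list of the pairs formed by $z_j$ and the code of the simplex $x_j$. For a category $\mathcal I$ and a functor $X\colon\mathcal I\to\mathsf{sSet}$, the Bousfield--Kan homotopy colimit is \[ \mathsf{hocolim}\,X=\bigsqcup_{m\ge 0}\ \bigsqcup_{i_0\to\cdots\to i_m}\Delta^m\times X(i_0)\,/\sim, \] where $\sim$ is generated, for all chains $i_0\to\cdots\to i_m$ of morphisms of $\mathcal I$, all monotone maps $\theta\colon[k]\to[m]$, all simplices $t$ of $\Delta^k$ and all simplices $x$ of $X(i_0)$ of the same dimension, by the identification of $(\theta_*t,x)$ over $i_0\to\cdots\to i_m$ with $(t,x')$ over $i_{\theta(0)}\to\cdots\to i_{\theta(k)}$, where $x'$ is the image of $x$ under $X(i_0)\to X(i_{\theta(0)})$. \textbf{Proposition.} Let $\mathcal I$ be a finite category, with a fixed encoding of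 its morphisms, and let $X\colon\mathcal I\to\mathsf{sSet}$ be a functor. Suppose that every $X(i)$, $i\in\mathcal I$, is a locally effective simplicial set with effective homology and that the map $X(f)$ is computable for every morphism $f$ of $\mathcal I$. Then $\mathsf{hocolim}\,X$ has the structure of a locally effective simplicial set with effective homology. Its encoding can be chosen compatible with the given ones: there are an algorithm which computes the code of the simplex of $\mathsf{hocolim}\,X$ represented by a given simplex of the disjoint union (given by its chain, the vertices of $t$, and the code of $x$), and an algorithm which computes such a representative of a given simplex of $\mathsf{hocolim}\,X$. -/

import Mathlib

open CategoryTheory Opposite Simplicial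

universe u v

noncomputable section

/-! ### Encodings and computable maps -/

/-- An encoding of the elements of `A` by natural numbers: every element has at least one code, and
a code determines the element. Neither uniqueness of the code of an element nor decidability of the
set of codes is required. -/
structure Coding (A : Type u) where
  /-- `IsCode k a` : the number `k` is a code of `a`. -/
  IsCode : ℕ → A → Prop
  exists_isCode : ∀ a, ∃ k, IsCode k a
  eq_of_isCode : ∀ k a b, IsCode k a → IsCode k b → a = b

/-- A sequence of maps `f n : A n → B n` is computable if one algorithm (a partial recursive
function), given `n` and a code of `a : A n`, halts with a code of `f n a`. -/
def ComputableMaps {A : ℕ → Type u} {B : ℕ → Type v} (K : ∀ n, Coding (A n))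
    (L : ∀ n, Coding (B n)) (f : ∀ n, A n → B n) : Prop :=
  ∃ φ : ℕ × ℕ →. ℕ, Partrec φ ∧
    ∀ (n k : ℕ) (a : A n), (K n).IsCode k a → ∃ l ∈ φ (n, k), (L n).IsCode l (f n a)

/-! ### Locally effective simplicial sets -/

/-- A locally effective simplicial set: an encoding of the simplices (injective in every
dimension), for which the face and the degeneracy operators are computed by algorithms. -/
structure LocallyEffective (X : SSet.{u}) where
  code : ∀ n : ℕ, X _⦋n⦌ → ℕ
  code_injective : ∀ n, Function.Injective (code n)
  face_computable : ∃ φ : ℕ × ℕ × ℕ →. ℕ, Partrec φ ∧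
    ∀ (n : ℕ) (i : Fin (n + 2)) (x : X _⦋n + 1⦌),
      code n (X.δ i x) ∈ φ (n, (i : ℕ), code (n + 1) x)
  degeneracy_computable : ∃ φ : ℕ × ℕ × ℕ →. ℕ, Partrec φ ∧
    ∀ (n : ℕ) (i : Fin (n + 1)) (x : X _⦋n⦌),
      code (n + 1) (X.σ i x) ∈ φ (n, (i : ℕ), code n x)

/-- A map of locally effective simplicial sets is computable if one algorithm, given the dimension
and the code of a simplex, returns the code of its image. -/
def IsComputableMap {X Y : SSet.{u}} (e : LocallyEffective X) (e' : LocallyEffective Y)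
    (f : X ⟶ Y) : Prop :=
  ∃ φ : ℕ × ℕ →. ℕ, Partrec φ ∧
    ∀ (n : ℕ) (x : X _⦋n⦌), e'.code n (f.app (op ⦋n⦌) x) ∈ φ (n, e.code n x)

/-! ### Locally effective and effective chain complexes -/

/-- An encoding of the elements of a (non-negatively graded) chain complex of abelian groups. -/
abbrev ChainCoding (C : ChainComplex AddCommGrpCat.{u} ℕ) := ∀ n, Coding (C.X n)

namespace ChainCoding

variable {C : ChainComplex AddCommGrpCat.{u} ℕ} (K : ChainCoding C)

/-- Zero, sums, inverses, integer multiples and the differential are computed by algorithms. -/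
structure HasOperations : Prop where
  zero : ∃ φ : ℕ →. ℕ, Partrec φ ∧ ∀ n, ∃ l ∈ φ n, (K n).IsCode l 0
  add : ∃ φ : ℕ × ℕ × ℕ →. ℕ, Partrec φ ∧ ∀ (n k k' : ℕ) (c c' : C.X n),
    (K n).IsCode k c → (K n).IsCode k' c' → ∃ l ∈ φ (n, k, k'), (K n).IsCode l (c + c')
  neg : ComputableMaps K K (fun _ c => -c)
  zsmul : ∃ φ : ℕ × ℤ × ℕ →. ℕ, Partrec φ ∧ ∀ (n : ℕ) (z : ℤ) (k : ℕ) (c : C.X n),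
    (K n).IsCode k c → ∃ l ∈ φ (n, z, k), (K n).IsCode l (z • c)
  d : ComputableMaps (fun n => K (n + 1)) K (fun n c => C.d (n + 1) n c)

/-- The homogeneous basis `b` is computable: one algorithm expands every chain as an integral
combination of distinct elements of the basis, and another one decides whether a chain belongs to
the basis. -/
structure IsComputableBasis {ι : ℕ → Type u} (b : ∀ n, Module.Basis (ι n) ℤ (C.X n)) : Prop where
  expand : ∃ φ : ℕ × ℕ →. List (ℤ × ℕ), Partrec φ ∧ ∀ (n k : ℕ) (c : C.X n),
    (K n).IsCode k c → ∃ l ∈ φ (n, k), ∃ s : List (ℤ × ι n),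
      (s.map Prod.snd).Nodup ∧ c = (s.map fun q => q.1 • b n q.2).sum ∧
      List.Forall₂ (fun p q => p.1 = q.1 ∧ (K n).IsCode p.2 (b n q.2)) l s
  mem : ∃ φ : ℕ × ℕ →. Bool, Partrec φ ∧ ∀ (n k : ℕ) (c : C.X n),
    (K n).IsCode k c → ∃ r ∈ φ (n, k), (r = true ↔ c ∈ Set.range (b n))

/-- A locally effective chain complex. -/
def IsLocallyEffective : Prop :=
  K.HasOperations ∧
    ∃ (ι : ℕ → Type u) (b : ∀ n, Module.Basis (ι n) ℤ (C.X n)), K.IsComputableBasis b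

/-- An effective chain complex: it is locally effective, and an algorithm lists, for given `n`, the
elements of a finite basis in degree `n`. -/
def IsEffective : Prop :=
  K.HasOperations ∧
    ∃ (ι : ℕ → Type u) (b : ∀ n, Module.Basis (ι n) ℤ (C.X n)), K.IsComputableBasis b ∧
      ∃ φ : ℕ →. List ℕ, Partrec φ ∧ ∀ n, ∃ l ∈ φ n, ∃ s : List (ι n),
        s.Nodup ∧ (∀ i, i ∈ s) ∧ List.Forall₂ (fun k i => (K n).IsCode k (b n i)) l s

end ChainCoding

/-! ### Reductions and effective homology -/

/-- A reduction `C ⇒ D`: chain maps `α : C ⟶ D`, `β : D ⟶ C` and a homotopy operator `η` of degree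
one on `C` with `∂η + η∂ = id - βα`, `αβ = id`, `ηβ = 0`, `αη = 0`, `ηη = 0`. (Compositions in a
category are written from left to right.) -/
structure Reduction (C D : ChainComplex AddCommGrpCat.{u} ℕ) where
  α : C ⟶ D
  β : D ⟶ C
  η : Homotopy (𝟙 C) (α ≫ β)
  β_α : β ≫ α = 𝟙 D
  β_η : ∀ n, β.f n ≫ η.hom n (n + 1) = 0
  η_α : ∀ n, η.hom n (n + 1) ≫ α.f (n + 1) = 0
  η_η : ∀ n, η.hom n (n + 1) ≫ η.hom (n + 1) (n + 2) = 0

/-- The three maps of a reduction are computable. -/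
structure Reduction.IsComputable {C D : ChainComplex AddCommGrpCat.{u} ℕ} (ρ : Reduction C D)
    (K : ChainCoding C) (L : ChainCoding D) : Prop where
  α : ComputableMaps K L (fun n c => ρ.α.f n c)
  β : ComputableMaps L K (fun n c => ρ.β.f n c)
  η : ComputableMaps K (fun n => K (n + 1)) (fun n c => ρ.η.hom n (n + 1) c)

/-- An encoded chain complex `C` has effective homology: it is locally effective, and there is a
strong equivalence `C ⇐ C' ⇒ D`, a span of computable reductions, in which `C'` is locally
effective and `D` is effective. -/
def ChainCoding.HasEffectiveHomology {C : ChainComplex AddCommGrpCat.{u} ℕ}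
    (K : ChainCoding C) : Prop :=
  K.IsLocallyEffective ∧
    ∃ (C' D : ChainComplex AddCommGrpCat.{u} ℕ) (K' : ChainCoding C') (L : ChainCoding D)
      (ρ : Reduction C' C) (ρ' : Reduction C' D),
      K'.IsLocallyEffective ∧ L.IsEffective ∧ ρ.IsComputable K' K ∧ ρ'.IsComputable K' L

/-- The normalized chain complex `C_*(X)` with integral coefficients: the nondegenerate `n`-simplices
form a basis in degree `n`. -/
abbrev normalizedChains (X : SSet.{u}) : ChainComplex AddCommGrpCat.{u} ℕ :=
  X.normalizedChainComplex (AddCommGrpCat.of (ULift.{u} ℤ))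

/-- The chain of a simplex; it is zero if the simplex is degenerate. -/
def simplexChain (X : SSet.{u}) {n : ℕ} (x : X _⦋n⦌) : (normalizedChains X).X n :=
  X.ιNormalizedChainComplex (R := AddCommGrpCat.of (ULift.{u} ℤ)) x (ULift.up 1)

lemma closure_range_simplexChain (X : SSet.{u}) (n : ℕ) :
    AddSubgroup.closure (Set.range fun x : X _⦋n⦌ => simplexChain X x) = ⊤ := by
  set S := AddSubgroup.closure (Set.range fun x : X _⦋n⦌ => simplexChain X x) with hS
  have key : (AddCommGrpCat.ofHom (QuotientAddGroup.mk' S) :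
      (normalizedChains X).X n ⟶ AddCommGrpCat.of ((normalizedChains X).X n ⧸ S)) = 0 := by
    apply SSet.normalizedChainComplex_hom_ext
    intro x _
    ext ⟨z⟩
    have h : (ULift.up z : ULift.{u} ℤ) = z • ULift.up 1 := by
      apply ULift.ext
      simp
    have h1 : simplexChain X x ∈ S := AddSubgroup.subset_closure ⟨x, rfl⟩
    have h2 : QuotientAddGroup.mk' S (simplexChain X x) = 0 :=
      (QuotientAddGroup.eq_zero_iff _).2 h1
    have h3 : QuotientAddGroup.mk' S
        (X.ιNormalizedChainComplex (R := AddCommGrpCat.of (ULift.{u} ℤ)) x (ULift.up z)) = 0 := by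
      rw [h, map_zsmul, map_zsmul]
      change z • QuotientAddGroup.mk' S (simplexChain X x) = 0
      rw [h2, smul_zero]
    exact h3
  rw [eq_top_iff]
  intro c _
  have h := ConcreteCategory.congr_hom key c
  exact (QuotientAddGroup.eq_zero_iff c).1 h

/-- The encoding of the chains of a locally effective simplicial set: a chain `∑ z_j x_j` is encoded
by the list of the pairs formed by a coefficient `z_j` and the code of the simplex `x_j`. -/
def LocallyEffective.chainCoding {X : SSet.{u}} (e : LocallyEffective X) :
    ChainCoding (normalizedChains X) := fun n =>
  { IsCode := fun k c => ∃ s : List (ℤ × X _⦋n⦌),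
      k = Encodable.encode (s.map fun q => (q.1, e.code n q.2)) ∧
      c = (s.map fun q => q.1 • simplexChain X q.2).sum
    exists_isCode := by
      intro c
      suffices h : ∃ s : List (ℤ × X _⦋n⦌), c = (s.map fun q => q.1 • simplexChain X q.2).sum by
        obtain ⟨s, hs⟩ := h
        exact ⟨_, s, rfl, hs⟩
      have hc : c ∈ AddSubgroup.closure (Set.range fun x : X _⦋n⦌ => simplexChain X x) := by
        rw [closure_range_simplexChain]
        trivial
      induction hc using AddSubgroup.closure_induction with
      | mem c hc =>
        obtain ⟨x, rfl⟩ := hc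
        exact ⟨[(1, x)], by simp⟩
      | zero => exact ⟨[], by simp⟩
      | add a b _ _ ha hb =>
        obtain ⟨s, rfl⟩ := ha
        obtain ⟨t, rfl⟩ := hb
        exact ⟨s ++ t, by simp⟩
      | neg a _ ha =>
        obtain ⟨s, rfl⟩ := ha
        refine ⟨s.map fun q => (-q.1, q.2), ?_⟩
        clear * -
        induction s with
        | nil => simp
        | cons q s ih => simp_all [add_comm]
    eq_of_isCode := by
      rintro k a b ⟨s, hs, rfl⟩ ⟨t, ht, rfl⟩
      have hinj : Function.Injective fun q : ℤ × X _⦋n⦌ => (q.1, e.code n q.2) := by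
        rintro ⟨z, x⟩ ⟨w, y⟩ h
        simp only [Prod.mk.injEq] at h
        exact Prod.ext h.1 (e.code_injective n h.2)
      have hst := Encodable.encode_injective (hs.symm.trans ht)
      rw [hinj.list_map hst] }

/-- A locally effective simplicial set has effective homology if its chain complex does. -/
def LocallyEffective.HasEffectiveHomology {X : SSet.{u}} (e : LocallyEffective X) : Prop :=
  e.chainCoding.HasEffectiveHomology

/-! ### The Bousfield–Kan homotopy colimit -/

section Hocolim

variable {I : Type u} [SmallCategory I] (X : I ⥤ SSet.{u})

/-- The simplices of `∐_m ∐_{i_0 → ⋯ → i_m} Δ[m] × X(i_0)`. -/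
structure HocolimCell (n : SimplexCategoryᵒᵖ) : Type u where
  /-- the length of the chain -/
  m : ℕ
  /-- the chain `i_0 → ⋯ → i_m` of morphisms of `I` -/
  chain : ComposableArrows I m
  t : (Δ[m] : SSet.{u}).obj n
  x : (X.obj (chain.obj 0)).obj n

/-- The relation generating the identifications. For a monotone map `θ : [k] → [m]`, it identifies
`(θ_* t, x)` over a chain `i_0 → ⋯ → i_m` with `(t, x')` over the chain
`i_{θ(0)} → ⋯ → i_{θ(k)}`, where `x'` is the image of `x` under `X(i_0) → X(i_{θ(0)})`. If `θ` is a
coface map, this composes two consecutive morphisms, drops the last one, or drops the first one and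
applies it to `x`; if `θ` is a codegeneracy map, this inserts an identity into the chain. -/
inductive HocolimRel (n : SimplexCategoryᵒᵖ) : HocolimCell X n → HocolimCell X n → Prop where
  | glue {k m : ℕ} (θ : ⦋k⦌ ⟶ ⦋m⦌) (chain : ComposableArrows I m)
      (t : (Δ[k] : SSet.{u}).obj n) (x : (X.obj (chain.obj 0)).obj n) :
      HocolimRel n
        ⟨m, chain, (SSet.stdSimplex.map θ).app n t, x⟩
        ⟨k, (nerve I).map θ.op chain, t,
          (X.map (chain.map (homOfLE (Fin.zero_le (θ.toOrderHom 0))))).app n x⟩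

variable {X} in
/-- The simplicial operators on the disjoint union. -/
def HocolimCell.map {n n' : SimplexCategoryᵒᵖ} (g : n ⟶ n') (z : HocolimCell X n) :
    HocolimCell X n' :=
  ⟨z.m, z.chain, (Δ[z.m] : SSet.{u}).map g z.t, (X.obj (z.chain.obj 0)).map g z.x⟩

lemma HocolimRel.map {n n' : SimplexCategoryᵒᵖ} (g : n ⟶ n') {z w : HocolimCell X n}
    (h : HocolimRel X n z w) : HocolimRel X n' (z.map g) (w.map g) := by
  obtain ⟨θ, chain, t, x⟩ := h
  have h1 := HocolimRel.glue (X := X) (n := n') θ chain ((Δ[_] : SSet.{u}).map g t)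
    ((X.obj (chain.obj 0)).map g x)
  have e1 : (X.map (chain.map (homOfLE (Fin.zero_le (θ.toOrderHom 0))))).app n'
      ((X.obj (chain.obj 0)).map g x) = (X.obj _).map g
        ((X.map (chain.map (homOfLE (Fin.zero_le (θ.toOrderHom 0))))).app n x) :=
    ConcreteCategory.congr_hom
      ((X.map (chain.map (homOfLE (Fin.zero_le (θ.toOrderHom 0))))).naturality g) x
  rw [e1] at h1
  exact h1

/-- The Bousfield–Kan homotopy colimit
`∐_m ∐_{i_0 → ⋯ → i_m} Δ[m] × X(i_0) / ∼` of a diagram of simplicial sets. -/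
def hocolim : SSet.{u} where
  obj n := Quot (HocolimRel X n)
  map g := ↾(Quot.map (HocolimCell.map g) fun _ _ h => h.map X g)
  map_id n := by
    ext y
    obtain ⟨z, rfl⟩ := Quot.exists_rep y
    simp [Quot.map, HocolimCell.map]
  map_comp f g := by
    ext y
    obtain ⟨z, rfl⟩ := Quot.exists_rep y
    simp [Quot.map, HocolimCell.map]

variable {X}

/-- The simplex of the homotopy colimit represented by a simplex of the disjoint union. -/
def hocolimMk {n : ℕ} (z : HocolimCell X (op ⦋n⦌)) : (hocolim X) _⦋n⦌ :=
  Quot.mk _ z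

/-- The code of an `n`-simplex `(t, x)` over the chain `i_0 → ⋯ → i_m`, for a given encoding `a` of
the morphisms of `I`: the codes of the identity of `i_0` and of the morphisms of the chain, the
vertices of `t`, and the code of `x`. -/
def HocolimCell.code (a : Arrow I ↪ ℕ) (e : ∀ i, LocallyEffective (X.obj i)) {n : ℕ}
    (z : HocolimCell X (op ⦋n⦌)) : ℕ :=
  Encodable.encode
    (a (Arrow.mk (𝟙 (z.chain.obj 0))),
      List.ofFn (fun j : Fin z.m => a (Arrow.mk (z.chain.map' j (j + 1)))),
      List.ofFn (fun j : Fin (n + 1) => (SSet.stdSimplex.objEquiv z.t).toOrderHom j |>.val),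
      (e (z.chain.obj 0)).code n z.x)

/-- An encoding of the simplices of the homotopy colimit is compatible with the given encodings of
the simplices of the diagram if one algorithm computes the simplex represented by a simplex of the
disjoint union, and another one computes a representative of a given simplex. -/
structure IsCompatible (a : Arrow I ↪ ℕ) (e : ∀ i, LocallyEffective (X.obj i))
    (E : LocallyEffective (hocolim X)) : Prop where
  mk_computable : ∃ φ : ℕ × ℕ →. ℕ, Partrec φ ∧
    ∀ (n : ℕ) (z : HocolimCell X (op ⦋n⦌)), E.code n (hocolimMk z) ∈ φ (n, z.code a e)
  rep_computable : ∃ φ : ℕ × ℕ →. ℕ, Partrec φ ∧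
    ∀ (n : ℕ) (y : (hocolim X) _⦋n⦌), ∃ z : HocolimCell X (op ⦋n⦌),
      hocolimMk z = y ∧ z.code a e ∈ φ (n, E.code n y)

end Hocolim

end

set_option linter.unusedSectionVars false
set_option linter.unusedSimpArgs false
set_option linter.unusedVariables false

noncomputable section

/-! The homotopy colimit is filtered by the length `p` of the nondegenerate chain of morphisms that
carries a simplex. The gluing relation, applied to the monotone map `t` of a representative `(t, x)`
itself, gives a normal form: an `n`-simplex is the same as an `n`-simplex of the nerve of `I`
together with an `n`-simplex of `X` over its first object (`hocolim_ext`). Writing the nerve simplex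
as a degeneracy of a nondegenerate one shows that every simplex is the image of a unique pair of a
nondegenerate chain `τ` and a simplex `(t, x)` of `Δ^p × X(i₀)`, `p = dim τ`, for which `t` hits all
vertices (`exists_adm`, `Adm.injective`), and that nondegeneracy is preserved in both directions
(`Adm.nD_iff`). So the normalized chains of the homotopy colimit and the direct sum over `τ` of the
relative chains of `(Δ^p, ∂Δ^p) × X(i₀)` have the same basis, and their differentials differ by
terms which lower `p` (`toCell_low`).

The relative chains of `(Δ^p, ∂Δ^p) × Y` are homotopy equivalent to `C_*(Y)` shifted by `p`, by an
algorithm uniform in `p`. Indeed, for `p > 0` the chains of `(Δ^p, Λ^p) × Y`, where the horn `Λ^p`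
omits the face opposite to the last vertex, are contracted by the prism operators which push the
vertex `p - 1` to `p`. They are an extension of the chains of `(Δ^p, ∂Δ^p) × Y` by those of
`(Δ^{p-1}, ∂Δ^{p-1}) × Y`, so the connecting map is an equivalence lowering `p` and the degree by
one; `gwTower` records it with its inverse and homotopy, and `Tower.heq` iterates it `p` times.

If `C_*(X(i))` is equivalent to an effective complex `D_i`, the associated graded complex is
therefore equivalent to the sum over `τ` of the shifts of `D_{i₀}` by `dim τ`. This is finite in
each degree, because a finite category has finitely many chains of each length and only lengths up
to `n` matter in degree `n` (`FinB.pull`). The true differential is a perturbation of the graded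
one. It is carried across the equivalence by the easy and the basic perturbation lemma; the series
in the latter terminates on each basis element since the perturbation lowers `p` while the
contraction preserves it (`HEq.perturbation`, `HEq.of_filtered`).

The intermediate notion is a computable homotopy equivalence rather than a span of reductions,
because equivalences compose and invert at once; the mapping cylinder turns an equivalence back into
a span of reductions (`HEq.exists_red`). Computability is handled by a calculus of functions tracked
on codes (`Coded`, `Cm`). Encoded chain complexes are replaced by free groups on coded bases, with
all degrees in one group, and `Pres` translates in both directions. -/

namespace EffHom

/-! ### Calculus of computable functions on coded types -/

section



/-! ### Coded types and computable functions between them -/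

/-- A type whose elements are encoded by natural numbers. -/
class Coded (A : Type*) where
  IsCode : ℕ → A → Prop
  exists_isCode : ∀ a, ∃ k, IsCode k a
  eq_of_isCode : ∀ {k} {a b : A}, IsCode k a → IsCode k b → a = b



open Coded

/-- A function between coded types is computable if it is tracked by a partial recursive function. -/
@[fun_prop]
def Cm {A B : Type*} [Coded A] [Coded B] (f : A → B) : Prop :=
  ∃ φ : ℕ →. ℕ, Partrec φ ∧ ∀ k a, IsCode k a → ∃ l ∈ φ k, IsCode l (f a)


section basic

variable {A B C X : Type*} [Coded A] [Coded B] [Coded C] [Coded X]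

@[fun_prop]
theorem Cm.id : Cm (fun a : A => a) := ⟨Part.some, Partrec.some, fun k _ h => ⟨k, Part.mem_some k, h⟩⟩

theorem Cm.congr {f g : A → B} (hf : Cm f) (h : ∀ a, f a = g a) : Cm g :=
  (funext h : f = g) ▸ hf

@[fun_prop]
theorem Cm.const (b : B) : Cm (fun _ : A => b) := by
  obtain ⟨k, hk⟩ := exists_isCode b
  exact ⟨fun _ => Part.some k, (Computable.const k).partrec, fun _ _ _ => ⟨k, Part.mem_some k, hk⟩⟩

@[fun_prop]
theorem Cm.comp {g : B → C} {f : A → B} (hg : Cm g) (hf : Cm f) : Cm (fun a => g (f a)) := by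
  obtain ⟨φ, h1, h2⟩ := hg
  obtain ⟨ψ, h3, h4⟩ := hf
  refine ⟨fun k => (ψ k).bind φ, h3.bind (h1.comp Computable.snd).to₂, fun k a h => ?_⟩
  obtain ⟨l, hl, h5⟩ := h4 k a h
  obtain ⟨m, hm, h6⟩ := h2 l _ h5
  exact ⟨m, Part.mem_bind hl hm, h6⟩

instance : Coded (A × B) where
  IsCode k p := IsCode k.unpair.1 p.1 ∧ IsCode k.unpair.2 p.2
  exists_isCode p := by
    obtain ⟨k, hk⟩ := exists_isCode p.1
    obtain ⟨l, hl⟩ := exists_isCode p.2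
    exact ⟨Nat.pair k l, by simpa using ⟨hk, hl⟩⟩
  eq_of_isCode h h' := Prod.ext (eq_of_isCode h.1 h'.1) (eq_of_isCode h.2 h'.2)

theorem partrec_unpair_fst : Partrec fun k : ℕ => Part.some k.unpair.1 :=
  (Computable.fst.comp Computable.unpair).partrec

theorem partrec_unpair_snd : Partrec fun k : ℕ => Part.some k.unpair.2 :=
  (Computable.snd.comp Computable.unpair).partrec

theorem partrec_pair {φ ψ : ℕ →. ℕ} (h1 : Partrec φ) (h2 : Partrec ψ) :
    Partrec fun k => (φ k).bind fun l => (ψ k).map fun m => Nat.pair l m := by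
  refine h1.bind ?_
  change Partrec fun p : ℕ × ℕ => (ψ p.1).map fun m => Nat.pair p.2 m
  refine (h2.comp Computable.fst).map ?_
  have h : Primrec fun q : (ℕ × ℕ) × ℕ => Nat.pair q.1.2 q.2 :=
    Primrec₂.natPair.comp (Primrec.snd.comp Primrec.fst) Primrec.snd
  exact h.to_comp

@[fun_prop]
theorem Cm.fst : Cm (fun p : A × B => p.1) :=
  ⟨_, partrec_unpair_fst, fun _ _ h => ⟨_, Part.mem_some _, h.1⟩⟩

@[fun_prop]
theorem Cm.snd : Cm (fun p : A × B => p.2) :=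
  ⟨_, partrec_unpair_snd, fun _ _ h => ⟨_, Part.mem_some _, h.2⟩⟩

@[fun_prop]
theorem Cm.pair {f : A → B} {g : A → C} (hf : Cm f) (hg : Cm g) : Cm (fun a => (f a, g a)) := by
  obtain ⟨φ, h1, h2⟩ := hf
  obtain ⟨ψ, h3, h4⟩ := hg
  refine ⟨_, partrec_pair h1 h3, fun k a h => ?_⟩
  obtain ⟨l, hl, h5⟩ := h2 k a h
  obtain ⟨m, hm, h6⟩ := h4 k a h
  exact ⟨Nat.pair l m, Part.mem_bind hl (Part.mem_map _ hm), by simpa using h5, by simpa using h6⟩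

/-- The encoding restricted along an injective map. -/
@[reducible]
def Coded.ofInj {A : Type*} (f : A → B) (hf : Function.Injective f) : Coded A where
  IsCode k a := IsCode k (f a)
  exists_isCode _ := exists_isCode _
  eq_of_isCode h h' := hf (eq_of_isCode h h')

/-- Elements of a subtype keep their codes. No algorithm has to decide `P`, and inclusion and
corestriction are tracked by the identity. -/
instance {P : A → Prop} : Coded {x // P x} := Coded.ofInj Subtype.val Subtype.val_injective

@[fun_prop]
theorem Cm.val {P : A → Prop} : Cm (fun a : {a // P a} => a.1) :=
  ⟨Part.some, Partrec.some, fun k _ h => ⟨k, Part.mem_some k, h⟩⟩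

theorem Cm.of_val {P : B → Prop} {f : A → {b // P b}} (hf : Cm fun a => (f a).1) : Cm f := hf

instance {ι : Type*} [Coded ι] {F : ι → Type*} [∀ i, Coded (F i)] : Coded (Σ i, F i) where
  IsCode k p := IsCode k.unpair.1 p.1 ∧ IsCode k.unpair.2 p.2
  exists_isCode p := by
    obtain ⟨k, hk⟩ := exists_isCode p.1
    obtain ⟨l, hl⟩ := exists_isCode p.2
    exact ⟨Nat.pair k l, by simpa using ⟨hk, hl⟩⟩
  eq_of_isCode := by
    rintro k ⟨i, a⟩ ⟨j, b⟩ ⟨h1, h2⟩ ⟨h3, h4⟩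
    obtain rfl : i = j := eq_of_isCode h1 h3
    obtain rfl : a = b := eq_of_isCode h2 h4
    rfl

@[fun_prop]
theorem Cm.sigma_fst {F : A → Type*} [∀ i, Coded (F i)] : Cm (fun p : Σ i, F i => p.1) :=
  ⟨_, partrec_unpair_fst, fun _ _ h => ⟨_, Part.mem_some _, h.1⟩⟩

/-- A function into a sigma type is computable if its two components are. -/
theorem Cm.sigma_mk {F : A → Type*} [∀ i, Coded (F i)] {f : X → A} {g : ∀ x, F (f x)}
    (hf : Cm f) (hg : ∃ φ : ℕ →. ℕ, Partrec φ ∧ ∀ k x, IsCode k x → ∃ l ∈ φ k, IsCode l (g x)) :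
    Cm (fun x => (⟨f x, g x⟩ : Σ i, F i)) := by
  obtain ⟨φ, h1, h2⟩ := hf
  obtain ⟨ψ, h3, h4⟩ := hg
  refine ⟨_, partrec_pair h1 h3, fun k a h => ?_⟩
  obtain ⟨l, hl, h5⟩ := h2 k a h
  obtain ⟨m, hm, h6⟩ := h4 k a h
  exact ⟨Nat.pair l m, Part.mem_bind hl (Part.mem_map _ hm), by simpa using h5, by simpa using h6⟩

theorem Cm.sigma_mk_const {F : A → Type*} [∀ i, Coded (F i)] (i : A) {g : X → F i} (hg : Cm g) :
    Cm (fun x => (⟨i, g x⟩ : Σ i, F i)) :=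
  Cm.sigma_mk (Cm.const i) hg

end basic

/-! ### Types encoded by a `Primcodable` instance -/

/-- The encoding of a type given by an `Encodable` instance. -/
@[reducible]
def Coded.ofEncodable (A : Type*) [Encodable A] : Coded A where
  IsCode k a := k = Encodable.encode a
  exists_isCode a := ⟨_, rfl⟩
  eq_of_isCode h h' := Encodable.encode_injective (h.symm.trans h')

instance : Coded ℕ := Coded.ofEncodable ℕ
instance : Coded ℤ := Coded.ofEncodable ℤ
instance : Coded Bool := Coded.ofEncodable Bool
instance : Coded Unit := Coded.ofEncodable Unit

/-- The codes agree with those of the `Primcodable` instance. -/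
class Lawful (A : Type*) [Primcodable A] [Coded A] : Prop where
  iff : ∀ (k : ℕ) (a : A), IsCode k a ↔ k = Encodable.encode a

instance : Lawful ℕ := ⟨fun _ _ => Iff.rfl⟩
instance : Lawful ℤ := ⟨fun _ _ => Iff.rfl⟩
instance : Lawful Bool := ⟨fun _ _ => Iff.rfl⟩
instance {A B : Type*} [Primcodable A] [Coded A] [Lawful A] [Primcodable B] [Coded B] [Lawful B] :
    Lawful (A × B) := by
  refine ⟨fun k p => ?_⟩
  change IsCode k.unpair.1 p.1 ∧ IsCode k.unpair.2 p.2 ↔ _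
  rw [Lawful.iff, Lawful.iff, Encodable.encode_prod_val]
  constructor
  · rintro ⟨h1, h2⟩
    rw [← h1, ← h2, Nat.pair_unpair]
  · rintro rfl
    simp

section list

variable {A B C X : Type*} [Coded A] [Coded B] [Coded C] [Coded X]

theorem forall₂_isCode_unique {ks : List ℕ} {l l' : List A} (h : List.Forall₂ IsCode ks l)
    (h' : List.Forall₂ IsCode ks l') : l = l' := by
  induction h generalizing l' with
  | nil => cases h'; rfl
  | cons h1 _ ih =>
    cases h' with
    | cons h3 h4 => rw [eq_of_isCode h1 h3, ih h4]

/-- The code is the standard encoding of a list of codes, one for each entry; equal entries may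
carry different codes. -/
instance : Coded (List A) where
  IsCode k l := ∃ ks : List ℕ, k = Encodable.encode ks ∧ List.Forall₂ IsCode ks l
  exists_isCode l := by
    suffices h : ∃ ks : List ℕ, List.Forall₂ IsCode ks l by
      obtain ⟨ks, h⟩ := h
      exact ⟨_, ks, rfl, h⟩
    induction l with
    | nil => exact ⟨[], .nil⟩
    | cons a l ih =>
      obtain ⟨ks, h⟩ := ih
      obtain ⟨k, hk⟩ := exists_isCode a
      exact ⟨k :: ks, .cons hk h⟩
  eq_of_isCode := by
    rintro k l l' ⟨ks, rfl, h⟩ ⟨ks', h1, h'⟩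
    obtain rfl := Encodable.encode_injective h1
    exact forall₂_isCode_unique h h'

theorem encode_map_encode {A : Type*} [Encodable A] (l : List A) :
    Encodable.encode (l.map Encodable.encode) = Encodable.encode l := by
  induction l with
  | nil => rfl
  | cons a l ih => simp [Encodable.encode_list_cons, ih]

instance {A : Type*} [Primcodable A] [Coded A] [Lawful A] : Lawful (List A) := by
  refine ⟨fun k l => ?_⟩
  have key : ∀ (ks : List ℕ) (l : List A), List.Forall₂ IsCode ks l ↔ ks = l.map Encodable.encode := by
    intro ks l
    induction l generalizing ks with
    | nil => simp
    | cons a l ih =>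
      cases ks with
      | nil => simp
      | cons k ks => simp [ih, Lawful.iff]
  constructor
  · rintro ⟨ks, rfl, h⟩
    rw [(key ks l).1 h, encode_map_encode]
  · rintro rfl
    exact ⟨_, (encode_map_encode l).symm, (key _ _).2 rfl⟩

instance : Coded (Option A) where
  IsCode k o := o.elim (k = 0) (fun a => ∃ l, k = l + 1 ∧ IsCode l a)
  exists_isCode o := by
    cases o with
    | none => exact ⟨0, rfl⟩
    | some a =>
      obtain ⟨k, hk⟩ := exists_isCode a
      exact ⟨k + 1, k, rfl, hk⟩
  eq_of_isCode := by
    intro k o o' h h'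
    cases o <;> cases o' <;> simp only [Option.elim] at h h'
    · rfl
    · obtain ⟨l, rfl, _⟩ := h'; omega
    · obtain ⟨l, rfl, _⟩ := h; omega
    · obtain ⟨l, rfl, h⟩ := h
      obtain ⟨l', e, h'⟩ := h'
      obtain rfl : l = l' := by omega
      rw [eq_of_isCode h h']

end list

theorem tracks_of_partrec {α β : Type*} [Primcodable α] [Primcodable β] {f : α →. β}
    (hf : Partrec f) : ∃ φ : ℕ →. ℕ, Partrec φ ∧ ∀ a, ∀ b ∈ f a,
      Encodable.encode b ∈ φ (Encodable.encode a) := by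
  refine ⟨_, Partrec.nat_iff.2 hf, fun a b hb => ?_⟩
  simp only [Encodable.encodek, Part.coe_some, Part.bind_some]
  exact Part.mem_map _ hb

theorem tracks_of_computable {α β : Type*} [Primcodable α] [Primcodable β] {f : α → β}
    (hf : Computable f) : ∃ φ : ℕ →. ℕ, Partrec φ ∧ ∀ a,
      Encodable.encode (f a) ∈ φ (Encodable.encode a) := by
  obtain ⟨φ, h1, h2⟩ := tracks_of_partrec hf
  exact ⟨φ, h1, fun a => h2 a _ (Part.mem_some _)⟩

theorem Cm.of_computable {A B : Type*} [Primcodable A] [Coded A] [Lawful A] [Primcodable B]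
    [Coded B] [Lawful B] {f : A → B} (hf : Computable f) : Cm f := by
  obtain ⟨φ, h1, h2⟩ := tracks_of_computable hf
  refine ⟨φ, h1, fun k a h => ?_⟩
  rw [Lawful.iff] at h
  exact ⟨_, h ▸ h2 a, (Lawful.iff _ _).2 rfl⟩

theorem Cm.of_primrec {A B : Type*} [Primcodable A] [Coded A] [Lawful A] [Primcodable B]
    [Coded B] [Lawful B] {f : A → B} (hf : Primrec f) : Cm f := Cm.of_computable hf.to_comp

section ops

variable {A B C X : Type*} [Coded A] [Coded B] [Coded C] [Coded X]

/-- The recursion is run on codes. The codes of the intermediate values may depend on the chosen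
code of `x`; the induction only keeps track of the fact that they code the right values. -/
theorem Cm.nat_rec {z : X → B} {s : X × ℕ × B → B} {n : X → ℕ} (hz : Cm z) (hs : Cm s)
    (hn : Cm n) : Cm (fun x => (n x).rec (motive := fun _ => B) (z x) fun k b => s (x, k, b)) := by
  suffices h : Cm (fun p : X × ℕ => p.2.rec (motive := fun _ => B) (z p.1) fun k b => s (p.1, k, b)) from
    h.comp (Cm.id.pair hn)
  obtain ⟨φ, h1, h2⟩ := hz
  obtain ⟨ψ, h3, h4⟩ := hs
  refine ⟨_, Partrec.nat_iff.2 (Nat.Partrec.prec (Partrec.nat_iff.1 h1) (Partrec.nat_iff.1 h3)), ?_⟩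
  rintro k ⟨x, n⟩ ⟨h5, h6⟩
  change k.unpair.2 = n at h6
  simp only [Nat.unpaired, h6]
  clear h6
  induction n with
  | zero => exact h2 _ _ h5
  | succ n ih =>
    obtain ⟨l, hl, h7⟩ := ih h5
    obtain ⟨m, hm, h8⟩ := h4 (Nat.pair k.unpair.1 (Nat.pair n l)) (x, n, _)
      ⟨by simpa using h5, by simp; rfl, by simpa using h7⟩
    exact ⟨m, Part.mem_bind hl hm, h8⟩

@[fun_prop]
theorem Cm.some : Cm (fun a : A => some a) :=
  ⟨fun k => Part.some (k + 1), Computable.succ.partrec, fun k _ h => ⟨_, Part.mem_some _, k, rfl, h⟩⟩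

theorem Cm.option_elim {o : X → Option A} {f : X → B} {g : X × A → B} (ho : Cm o) (hf : Cm f)
    (hg : Cm g) : Cm (fun x => (o x).elim (f x) fun a => g (x, a)) := by
  obtain ⟨φ, h1, h2⟩ := ho
  obtain ⟨ψ, h3, h4⟩ := hf
  obtain ⟨χ, h5, h6⟩ := hg
  -- The algorithm for `f` is run in both cases, which is harmless because it halts on every code of
  -- an `x`. Only the algorithm for `g` has to be guarded by the case distinction.
  refine ⟨fun k => (φ k).bind fun m => (ψ k).bind fun l => Nat.casesOn (motive := fun _ => Part ℕ) m
    (Part.some l) (fun j => χ (Nat.pair k j)), h1.bind ?_, fun k x h => ?_⟩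
  · change Partrec fun p : ℕ × ℕ => (ψ p.1).bind fun l => Nat.casesOn (motive := fun _ => Part ℕ) p.2
      (Part.some l) fun j => χ (Nat.pair p.1 j)
    refine (h3.comp Computable.fst).bind ?_
    refine Partrec.nat_casesOn_right (f := fun p : (ℕ × ℕ) × ℕ => p.1.2) (g := fun p => p.2)
      (h := fun (p : (ℕ × ℕ) × ℕ) j => χ (Nat.pair p.1.1 j)) ?_ Computable.snd ?_
    · exact Computable.snd.comp Computable.fst
    · refine Partrec.comp h5 (g := fun q : ((ℕ × ℕ) × ℕ) × ℕ => Nat.pair q.1.1.1 q.2) ?_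
      have h : Primrec fun q : ((ℕ × ℕ) × ℕ) × ℕ => Nat.pair q.1.1.1 q.2 :=
        Primrec₂.natPair.comp (Primrec.fst.comp (Primrec.fst.comp Primrec.fst)) Primrec.snd
      exact h.to_comp
  · obtain ⟨m, hm, h7⟩ := h2 k x h
    obtain ⟨l, hl, h8⟩ := h4 k x h
    dsimp only
    cases ho : o x with
    | none =>
      rw [ho] at h7
      obtain rfl : m = 0 := h7
      exact ⟨l, Part.mem_bind hm (Part.mem_bind hl (Part.mem_some l)), h8⟩
    | some a =>
      rw [ho] at h7
      obtain ⟨j, rfl, h7⟩ := h7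
      obtain ⟨l', hl', h9⟩ := h6 (Nat.pair k j) (x, a) ⟨by simpa using h, by simpa using h7⟩
      exact ⟨l', Part.mem_bind hm (Part.mem_bind hl hl'), h9⟩

@[fun_prop]
theorem Cm.list_length {l : X → List A} (hl : Cm l) : Cm fun x => (l x).length := by
  refine Cm.comp (g := fun l : List A => l.length) ?_ hl
  obtain ⟨φ, h1, h2⟩ := tracks_of_computable (Computable.list_length (α := ℕ))
  refine ⟨φ, h1, ?_⟩
  rintro _ l ⟨ks, rfl, h⟩
  exact ⟨_, h2 ks, by rw [h.length_eq]; rfl⟩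

@[fun_prop]
theorem Cm.list_getElem? {l : X → List A} {i : X → ℕ} (hl : Cm l) (hi : Cm i) :
    Cm fun x => (l x)[i x]? := by
  refine Cm.comp (g := fun p : List A × ℕ => p.1[p.2]?) ?_ (hl.pair hi)
  obtain ⟨φ, h1, h2⟩ := tracks_of_computable (Computable.list_getElem? (α := ℕ))
  refine ⟨φ, h1, ?_⟩
  rintro k ⟨l, i⟩ ⟨⟨ks, h3, h⟩, h4⟩
  have h5 := h2 (ks, i)
  have e : Encodable.encode (ks, i) = k := by
    rw [Encodable.encode_prod_val, ← h3]
    change k.unpair.2 = i at h4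
    rw [← h4]
    exact Nat.pair_unpair k
  rw [e] at h5
  refine ⟨_, h5, ?_⟩
  dsimp only
  by_cases hi : i < ks.length
  · have hi' : i < l.length := h.length_eq ▸ hi
    rw [List.getElem?_eq_getElem hi, List.getElem?_eq_getElem hi']
    exact ⟨_, rfl, List.Forall₂.get h hi hi'⟩
  · have hi' : ¬ i < l.length := h.length_eq ▸ hi
    rw [List.getElem?_eq_none (not_lt.1 hi), List.getElem?_eq_none (not_lt.1 hi')]
    rfl

@[fun_prop]
theorem Cm.list_cons {a : X → A} {l : X → List A} (ha : Cm a) (hl : Cm l) :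
    Cm fun x => a x :: l x := by
  refine Cm.comp (g := fun p : A × List A => p.1 :: p.2) ?_ (ha.pair hl)
  have h : Primrec fun k : ℕ => k + 1 := Primrec.succ
  refine ⟨_, h.to_comp.partrec, ?_⟩
  rintro k ⟨a, l⟩ ⟨h1, ks, h2, h3⟩
  refine ⟨_, Part.mem_some _, k.unpair.1 :: ks, ?_, .cons h1 h3⟩
  rw [Encodable.encode_list_cons, ← h2]
  simp

/-- Folding a computable function over a list. -/
theorem Cm.list_foldr {f : X × A × B → B} {c : X → B} {l : X → List A} (hf : Cm f) (hc : Cm c)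
    (hl : Cm l) : Cm fun x => (l x).foldr (fun a b => f (x, a, b)) (c x) := by
  -- The fold is a recursion on the number of processed entries, starting from the end of the list:
  -- step `k` reads the entry `length - 1 - k`. A missing entry leaves the value unchanged and never
  -- occurs in the range of the recursion.
  have hn : Cm fun q : X × ℕ × B => ((l q.1)[(l q.1).length - 1 - q.2.1]?).elim q.2.2
      fun a => f (q.1, a, q.2.2) := by
    have hs : Cm fun p : ℕ × ℕ => p.1 - 1 - p.2 :=
      Cm.of_primrec (Primrec.nat_sub.comp (Primrec.pred.comp Primrec.fst) Primrec.snd)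
    refine Cm.option_elim (g := fun r : (X × ℕ × B) × A => f (r.1.1, r.2, r.1.2.2)) ?_ ?_ ?_
    · refine Cm.list_getElem? (by fun_prop) (hs.comp (Cm.pair (by fun_prop) (by fun_prop)))
    · fun_prop
    · fun_prop
  have h := Cm.nat_rec hc hn (n := fun x => (l x).length) (by fun_prop)
  refine h.congr fun x => ?_
  dsimp only
  have key : ∀ k ≤ (l x).length, Nat.rec (motive := fun _ => B) (c x) (fun k b =>
      ((l x)[(l x).length - 1 - k]?).elim b fun a => f (x, a, b)) k =
      ((l x).drop ((l x).length - k)).foldr (fun a b => f (x, a, b)) (c x) := by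
    intro k hk
    induction k with
    | zero => simp
    | succ k ih =>
      dsimp only
      rw [ih (by omega), List.getElem?_eq_getElem (by omega), List.drop_eq_getElem_cons (i := (l x).length - (k + 1)) (by omega)]
      simp only [Option.elim, List.foldr_cons]
      have e1 : (l x).length - (k + 1) + 1 = (l x).length - k := by omega
      have e2 : (l x).length - 1 - k = (l x).length - (k + 1) := by omega
      simp only [e1, e2]
  rw [key _ le_rfl]
  simp

@[fun_prop]
theorem Cm.list_append {l l' : X → List A} (hl : Cm l) (hl' : Cm l') : Cm fun x => l x ++ l' x := by
  have h := Cm.list_foldr (f := fun q : X × A × List A => q.2.1 :: q.2.2) (by fun_prop) hl' hl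
  refine h.congr fun x => ?_
  simp

theorem Cm.list_map {f : X × A → B} {l : X → List A} (hf : Cm f) (hl : Cm l) :
    Cm fun x => (l x).map fun a => f (x, a) := by
  have h := Cm.list_foldr (f := fun q : X × A × List B => f (q.1, q.2.1) :: q.2.2) (by fun_prop)
    (Cm.const []) hl
  refine h.congr fun x => ?_
  dsimp only
  induction l x with
  | nil => rfl
  | cons a l ih => simp_all

theorem Cm.list_flatMap {f : X × A → List B} {l : X → List A} (hf : Cm f) (hl : Cm l) :
    Cm fun x => (l x).flatMap fun a => f (x, a) := by
  have h := Cm.list_foldr (f := fun q : X × A × List B => f (q.1, q.2.1) ++ q.2.2) (by fun_prop)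
    (Cm.const []) hl
  refine h.congr fun x => ?_
  dsimp only
  induction l x with
  | nil => rfl
  | cons a l ih => simp_all

end ops

/-! ### Computable predicates -/

section pred

variable {A B C X : Type*} [Coded A] [Coded B] [Coded C] [Coded X]

open Classical in
/-- A predicate is computable if it is decided by a computable function. -/
def CmP (P : A → Prop) : Prop := Cm fun a => decide (P a)

theorem CmP.comp {P : B → Prop} {f : A → B} (hP : CmP P) (hf : Cm f) : CmP fun a => P (f a) :=
  Cm.comp (g := fun b => @decide (P b) (Classical.dec _)) hP hf

theorem CmP.congr {P Q : A → Prop} (hP : CmP P) (h : ∀ a, P a ↔ Q a) : CmP Q :=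
  (funext fun a => propext (h a) : P = Q) ▸ hP

theorem CmP.of_bool {f : A → Bool} {P : A → Prop} (hf : Cm f) (h : ∀ a, f a = true ↔ P a) :
    CmP P := by
  classical
  refine Cm.congr hf fun a => ?_
  rw [Bool.eq_iff_iff, h]
  simp

theorem CmP.of_primrecPred {A : Type*} [Primcodable A] [Coded A] [Lawful A] {P : A → Prop}
    [DecidablePred P] (h : PrimrecPred P) : CmP P := by
  obtain ⟨_, h⟩ := h
  refine CmP.of_bool (Cm.of_primrec h) fun a => by simp

/-- A conditional is a recursion of length zero or one, so both branches have to be computable on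
all of `X`. Branches which make sense on one side only are handled by `Cm.glue_prop`. -/
theorem Cm.cond {c : X → Bool} {f g : X → A} (hc : Cm c) (hf : Cm f) (hg : Cm g) :
    Cm fun x => bif c x then f x else g x := by
  have e : Cm fun b : Bool => b.toNat := Cm.of_computable (Primrec.dom_finite _).to_comp
  have h := Cm.nat_rec (n := fun x => (c x).toNat) (s := fun q : X × ℕ × A => f q.1) hg
    (by fun_prop) (e.comp hc)
  refine h.congr fun x => ?_
  cases c x <;> rfl

theorem Cm.ite {P : X → Prop} [DecidablePred P] {f g : X → A} (hP : CmP P) (hf : Cm f)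
    (hg : Cm g) : Cm fun x => if P x then f x else g x := by
  refine (Cm.cond hP hf hg).congr fun x => ?_
  by_cases h : P x <;> simp [h]

theorem CmP.not {P : X → Prop} (hP : CmP P) : CmP fun x => ¬ P x := by
  refine CmP.of_bool (Cm.cond hP (Cm.const false) (Cm.const true)) fun x => ?_
  by_cases h : P x <;> simp [h]

theorem CmP.and {P Q : X → Prop} (hP : CmP P) (hQ : CmP Q) : CmP fun x => P x ∧ Q x := by
  refine CmP.of_bool (Cm.cond hP hQ (Cm.const false)) fun x => ?_
  by_cases h : P x <;> simp [h]

theorem CmP.const (P : Prop) : CmP fun _ : X => P := Cm.const _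

/-- A computable predicate on the elements of a list. -/
theorem CmP.forall_mem {P : X × A → Prop} {l : X → List A} (hP : CmP P) (hl : Cm l) :
    CmP fun x => ∀ a ∈ l x, P (x, a) := by
  classical
  have h := Cm.list_foldr (f := fun q : X × A × Bool => bif decide (P (q.1, q.2.1)) then q.2.2 else false)
    (c := fun _ => true) (l := l) (Cm.cond (CmP.comp hP (Cm.pair (by fun_prop) (by fun_prop))) (by fun_prop) (Cm.const _))
    (Cm.const _) hl
  refine CmP.of_bool h fun x => ?_
  dsimp only
  induction l x with
  | nil => simp
  | cons a l ih => by_cases h : P (x, a) <;> simp_all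

theorem CmP.exists_mem {P : X × A → Prop} {l : X → List A} (hP : CmP P) (hl : Cm l) :
    CmP fun x => ∃ a ∈ l x, P (x, a) := by
  refine (CmP.forall_mem hP.not hl).not.congr fun x => ?_
  push Not
  rfl

theorem Cm.list_filter {P : X × A → Prop} [DecidablePred P] {l : X → List A} (hP : CmP P)
    (hl : Cm l) : Cm fun x => (l x).filter fun a => P (x, a) := by
  have h := Cm.list_foldr (f := fun q : X × A × List A => if P (q.1, q.2.1) then q.2.1 :: q.2.2 else q.2.2)
    (Cm.ite (CmP.comp hP (Cm.pair (by fun_prop) (by fun_prop))) (by fun_prop) (by fun_prop))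
    (Cm.const []) hl
  refine h.congr fun x => ?_
  dsimp only
  induction l x with
  | nil => rfl
  | cons a l ih => by_cases h : P (x, a) <;> simp_all

/-- Equality of two elements can be decided. -/
class CEq (A : Type*) [Coded A] : Prop where
  cm : CmP fun p : A × A => p.1 = p.2

theorem CmP.eq [CEq A] {f g : X → A} (hf : Cm f) (hg : Cm g) : CmP fun x => f x = g x :=
  CmP.comp (f := fun x => (f x, g x)) CEq.cm (hf.pair hg)

theorem CEq.of_lawful (A : Type*) [Primcodable A] [Coded A] [Lawful A] : CEq A := by
  classical
  exact ⟨CmP.of_primrecPred Primrec.eq⟩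

instance : CEq ℕ := .of_lawful ℕ
instance : CEq ℤ := .of_lawful ℤ
instance : CEq Bool := .of_lawful Bool

instance [CEq A] [CEq B] : CEq (A × B) := by
  refine ⟨((CmP.eq (f := fun p : (A × B) × (A × B) => p.1.1) (g := fun p => p.2.1) (by fun_prop)
    (by fun_prop)).and (CmP.eq (f := fun p : (A × B) × (A × B) => p.1.2) (g := fun p => p.2.2)
    (by fun_prop) (by fun_prop))).congr fun p => ?_⟩
  exact Prod.ext_iff.symm

/-- Equality can be decided if it can be decided after a computable injective map. -/
theorem CEq.of_injective [CEq B] {f : A → B} (hf : Cm f) (h : Function.Injective f) : CEq A :=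
  ⟨(CmP.eq (f := fun p : A × A => f p.1) (g := fun p => f p.2) (by fun_prop)
    (by fun_prop)).congr fun _ => h.eq_iff⟩

instance [CEq A] {P : A → Prop} : CEq {a // P a} := .of_injective Cm.val Subtype.val_injective

theorem CmP.nat_le {f g : X → ℕ} (hf : Cm f) (hg : Cm g) : CmP fun x => f x ≤ g x :=
  CmP.comp (P := fun p : ℕ × ℕ => p.1 ≤ p.2) (f := fun x => (f x, g x))
    (CmP.of_primrecPred Primrec.nat_le) (hf.pair hg)

theorem CmP.nat_lt {f g : X → ℕ} (hf : Cm f) (hg : Cm g) : CmP fun x => f x < g x :=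
  CmP.comp (P := fun p : ℕ × ℕ => p.1 < p.2) (f := fun x => (f x, g x))
    (CmP.of_primrecPred Primrec.nat_lt) (hf.pair hg)

@[fun_prop]
theorem Cm.nat_add {f g : X → ℕ} (hf : Cm f) (hg : Cm g) : Cm fun x => f x + g x :=
  Cm.comp (g := fun p : ℕ × ℕ => p.1 + p.2) (Cm.of_primrec Primrec.nat_add) (hf.pair hg)

@[fun_prop]
theorem Cm.nat_sub {f g : X → ℕ} (hf : Cm f) (hg : Cm g) : Cm fun x => f x - g x :=
  Cm.comp (g := fun p : ℕ × ℕ => p.1 - p.2) (Cm.of_primrec Primrec.nat_sub) (hf.pair hg)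

theorem int_encode_natCast (n : ℕ) : Encodable.encode (n : ℤ) = 2 * n := rfl

theorem int_encode_negSucc (n : ℕ) : Encodable.encode (Int.negSucc n) = 2 * n + 1 := rfl

/-- The code of an integer is `2n` for `n` and `2n + 1` for `-(n + 1)`, so positive and negative
parts are read off from the parity. -/
theorem cm_int_toNat : Cm Int.toNat := by
  have h : Primrec fun k : ℕ => if k % 2 = 0 then k / 2 else 0 :=
    Primrec.ite (PrimrecRel.comp Primrec.eq (Primrec.nat_mod.comp Primrec.id (Primrec.const 2))
      (Primrec.const 0)) (Primrec.nat_div.comp Primrec.id (Primrec.const 2)) (Primrec.const 0)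
  refine ⟨_, h.to_comp.partrec, ?_⟩
  rintro _ z rfl
  refine ⟨_, Part.mem_some _, ?_⟩
  change _ = z.toNat
  cases z with
  | ofNat n => rw [Int.ofNat_eq_natCast, int_encode_natCast]; simp
  | negSucc n => rw [int_encode_negSucc]; dsimp only; rw [if_neg (by omega)]; simp

theorem cm_int_neg_toNat : Cm fun z : ℤ => (-z).toNat := by
  have h : Primrec fun k : ℕ => if k % 2 = 0 then 0 else k / 2 + 1 :=
    Primrec.ite (PrimrecRel.comp Primrec.eq (Primrec.nat_mod.comp Primrec.id (Primrec.const 2))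
      (Primrec.const 0)) (Primrec.const 0)
      (Primrec.succ.comp (Primrec.nat_div.comp Primrec.id (Primrec.const 2)))
  refine ⟨_, h.to_comp.partrec, ?_⟩
  rintro _ z rfl
  refine ⟨_, Part.mem_some _, ?_⟩
  change _ = (-z).toNat
  cases z with
  | ofNat n => rw [Int.ofNat_eq_natCast, int_encode_natCast]; simp
  | negSucc n =>
    rw [int_encode_negSucc]
    dsimp only
    rw [if_neg (by omega)]
    have : -(Int.negSucc n) = ((n + 1 : ℕ) : ℤ) := rfl
    rw [this, Int.toNat_natCast]
    omega

theorem cm_int_ofNat_sub : Cm fun p : ℕ × ℕ => (p.1 : ℤ) - p.2 := by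
  have h : Primrec fun p : ℕ × ℕ => if p.2 ≤ p.1 then 2 * (p.1 - p.2) else 2 * (p.2 - p.1 - 1) + 1 :=
    Primrec.ite (PrimrecRel.comp Primrec.nat_le Primrec.snd Primrec.fst)
      (Primrec.nat_mul.comp (Primrec.const 2) (Primrec.nat_sub.comp Primrec.fst Primrec.snd))
      (Primrec.succ.comp (Primrec.nat_mul.comp (Primrec.const 2)
        (Primrec.nat_sub.comp (Primrec.nat_sub.comp Primrec.snd Primrec.fst) (Primrec.const 1))))
  obtain ⟨φ, h1, h2⟩ := tracks_of_computable h.to_comp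
  refine ⟨φ, h1, fun k p hk => ?_⟩
  obtain rfl := (Lawful.iff k p).1 hk
  refine ⟨_, h2 p, ?_⟩
  change _ = Encodable.encode ((p.1 : ℤ) - p.2)
  split_ifs with hp
  · rw [← Nat.cast_sub hp, int_encode_natCast]; rfl
  · have e : (p.1 : ℤ) - p.2 = Int.negSucc (p.2 - p.1 - 1) := by omega
    rw [e, int_encode_negSucc]; rfl

/-- Reduces integer arithmetic to natural numbers: sums and products are formed from positive and
negative parts and reassembled by a single subtraction. -/
theorem int_eq_toNat_sub (z : ℤ) : z = (z.toNat : ℤ) - ((-z).toNat : ℤ) := by omega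

@[fun_prop]
theorem Cm.nat_mul {f g : X → ℕ} (hf : Cm f) (hg : Cm g) : Cm fun x => f x * g x :=
  Cm.comp (g := fun p : ℕ × ℕ => p.1 * p.2) (Cm.of_primrec Primrec.nat_mul) (hf.pair hg)

@[fun_prop]
theorem Cm.int_add {f g : X → ℤ} (hf : Cm f) (hg : Cm g) : Cm fun x => f x + g x := by
  have hf' := cm_int_neg_toNat.comp hf
  have hg' := cm_int_neg_toNat.comp hg
  replace hf := cm_int_toNat.comp hf
  replace hg := cm_int_toNat.comp hg
  refine (cm_int_ofNat_sub.comp ((hf.nat_add hg).pair (hf'.nat_add hg'))).congr fun x => ?_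
  push_cast
  omega

@[fun_prop]
theorem Cm.int_mul {f g : X → ℤ} (hf : Cm f) (hg : Cm g) : Cm fun x => f x * g x := by
  have hf' := cm_int_neg_toNat.comp hf
  have hg' := cm_int_neg_toNat.comp hg
  replace hf := cm_int_toNat.comp hf
  replace hg := cm_int_toNat.comp hg
  refine (cm_int_ofNat_sub.comp (((hf.nat_mul hg).nat_add (hf'.nat_mul hg')).pair
    ((hf.nat_mul hg').nat_add (hf'.nat_mul hg)))).congr fun x => ?_
  conv_rhs => rw [int_eq_toNat_sub (f x), int_eq_toNat_sub (g x)]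
  push_cast
  ring

@[fun_prop]
theorem Cm.neg_one_pow {n : X → ℕ} (hn : Cm n) : Cm fun x => (-1 : ℤ) ^ n x := by
  have h := Cm.nat_rec (z := fun _ => (1 : ℤ)) (s := fun q : X × ℕ × ℤ => q.2.2 * (-1)) (by fun_prop)
    (by fun_prop) hn
  refine h.congr fun x => ?_
  induction n x with
  | zero => rfl
  | succ n ih => rw [pow_succ, ← ih]

@[fun_prop]
theorem Cm.list_range {n : X → ℕ} (hn : Cm n) : Cm fun x => List.range (n x) :=
  Cm.comp (g := List.range) (Cm.of_primrec Primrec.list_range) hn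

open Classical in
/-- Unbounded search. -/
theorem Cm.nat_find {P : X × ℕ → Prop} (hP : CmP P) (h : ∀ x, ∃ n, P (x, n)) :
    Cm fun x => Nat.find (h x) := by
  obtain ⟨φ, h1, h2⟩ := hP
  -- The decision algorithm returns the code of a Boolean, and `true` has code `1`.
  have h3 : Partrec₂ fun (k : ℕ) (n : ℕ) => (φ (Nat.pair k n)).map fun m => decide (m = 1) := by
    refine Partrec.map (f := fun p : ℕ × ℕ => φ (Nat.pair p.1 p.2)) ?_ ?_
    · exact h1.comp (Primrec₂.natPair.comp Primrec.fst Primrec.snd).to_comp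
    · have h : Primrec fun q : (ℕ × ℕ) × ℕ => decide (q.2 = 1) :=
        (PrimrecRel.comp Primrec.eq Primrec.snd (Primrec.const 1)).decide
      exact h.to_comp
  refine ⟨_, Partrec.rfind h3, fun k x hk => ?_⟩
  have key : ∀ n, decide (P (x, n)) ∈ (φ (Nat.pair k n)).map fun m => decide (m = 1) := by
    intro n
    obtain ⟨l, hl, h4⟩ := h2 (Nat.pair k n) (x, n) ⟨by simpa using hk, by simp; rfl⟩
    refine (Part.mem_map_iff _).2 ⟨l, hl, ?_⟩
    change l = Encodable.encode (decide (P (x, n))) at h4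
    rw [h4]
    by_cases h : P (x, n) <;> simp [h]
  refine ⟨_, Nat.mem_rfind.2 ⟨?_, fun {m} hm => ?_⟩, rfl⟩
  · simpa [Nat.find_spec (h x)] using key (Nat.find (h x))
  · simpa [Nat.find_min (h x) hm] using key m

end pred

/-! ### Gluing functions along a finite index type -/

section glue

variable {I : Type*} [Coded I] [CEq I] {F : I → Type*} [∀ i, Coded (F i)]
  {C : Type*} [Coded C]

open Classical in
-- Once the index is known to be `i`, the second half of the code of the pair is already a code in
-- `F i`: the transport along the equality of indices does not touch codes.
theorem cm_fibre (i : I) : Cm fun x : Σ i, F i =>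
    if h : x.1 = i then some (h ▸ x.2 : F i) else none := by
  obtain ⟨k₀, hk₀⟩ := exists_isCode i
  obtain ⟨φ, h1, h2⟩ := CmP.eq (f := fun j : I => j) (g := fun _ => i) Cm.id (Cm.const i)
  refine ⟨fun k => (φ k.unpair.1).map fun m => bif decide (m = 1) then k.unpair.2 + 1 else 0, ?_, ?_⟩
  · refine Partrec.map (h1.comp (Computable.fst.comp Computable.unpair)) ?_
    have h : Primrec fun q : ℕ × ℕ => bif decide (q.2 = 1) then q.1.unpair.2 + 1 else 0 :=
      Primrec.cond (PrimrecRel.comp Primrec.eq Primrec.snd (Primrec.const 1)).decide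
        (Primrec.succ.comp (Primrec.snd.comp (Primrec.unpair.comp Primrec.fst))) (Primrec.const 0)
    exact h.to_comp
  · rintro k ⟨j, b⟩ ⟨h3, h4⟩
    obtain ⟨m, hm, h5⟩ := h2 _ _ h3
    change m = Encodable.encode (decide (j = i)) at h5
    refine ⟨_, Part.mem_map _ hm, ?_⟩
    dsimp only
    by_cases h : j = i
    · subst h
      simp only [decide_true] at h5
      subst h5
      simp only [dite_true]
      exact ⟨_, rfl, h4⟩
    · simp only [h, decide_false] at h5
      subst h5
      simp only [h, dite_false]
      rfl

/-- Finitely many algorithms, one for each index, can be wired into a single one. The induction over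
finite sets of indices overrides the function on one more fibre at a time, using `cm_fibre`. -/
theorem Cm.sigma_finite [Finite I] {f : ∀ i, F i → C} (hf : ∀ i, Cm (f i)) :
    Cm fun x : Σ i, F i => f x.1 x.2 := by
  classical
  cases isEmpty_or_nonempty C with
  | inl hC => exact ⟨Part.some, Partrec.some, fun k x _ => (hC.false (f x.1 x.2)).elim⟩
  | inr hC =>
  obtain ⟨c⟩ := hC
  have key : ∀ s : Finset I, ∃ g : (Σ i, F i) → C, Cm g ∧ ∀ x, x.1 ∈ s → g x = f x.1 x.2 := by
    intro s
    induction s using Finset.induction_on with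
    -- The constant `c` is a dummy value, taken on the fibres not yet treated.
    | empty => exact ⟨fun _ => c, Cm.const c, by simp⟩
    | insert i s _ ih =>
      obtain ⟨g, h1, h2⟩ := ih
      refine ⟨_, Cm.option_elim (g := fun p : (Σ i, F i) × F i => f i p.2) (cm_fibre i) h1
        ((hf i).comp Cm.snd), ?_⟩
      rintro ⟨j, b⟩ hj
      by_cases h : j = i
      · subst h; simp
      · simpa [h] using h2 ⟨j, b⟩ (by simpa [h] using hj)
  have := Fintype.ofFinite I
  obtain ⟨g, h1, h2⟩ := key Finset.univ
  exact h1.congr fun x => h2 x (Finset.mem_univ _)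

theorem Cm.sigma_assoc {X : Type*} [Coded X] :
    Cm fun p : (Σ i, F i) × X => (⟨p.1.1, (p.1.2, p.2)⟩ : Σ i, F i × X) := by
  have h : Primrec fun k : ℕ => Nat.pair k.unpair.1.unpair.1 (Nat.pair k.unpair.1.unpair.2 k.unpair.2) := by
    have h0 : Primrec fun k : ℕ => k.unpair.1 := Primrec.fst.comp Primrec.unpair
    have h1 : Primrec fun k : ℕ => k.unpair.2 := Primrec.snd.comp Primrec.unpair
    exact Primrec₂.natPair.comp (h0.comp h0) (Primrec₂.natPair.comp (h1.comp h0) h1)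
  refine ⟨_, h.to_comp.partrec, fun k p hk => ⟨_, Part.mem_some _, ?_⟩⟩
  obtain ⟨⟨h1, h2⟩, h3⟩ := hk
  exact ⟨by simpa using h1, by simpa using h2, by simpa using h3⟩

theorem Cm.sigma_finite_prod [Finite I] {X : Type*} [Coded X] {f : ∀ i, F i × X → C}
    (hf : ∀ i, Cm (f i)) : Cm fun x : (Σ i, F i) × X => f x.1.1 (x.1.2, x.2) :=
  (Cm.sigma_finite hf).comp Cm.sigma_assoc

instance CEq.sigma_finite [Finite I] [∀ i, CEq (F i)] : CEq (Σ i, F i) := by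
  classical
  have h := Cm.sigma_finite_prod (F := F) (X := Σ i, F i) (f := fun i p =>
    (if h : p.2.1 = i then some (h ▸ p.2.2 : F i) else none).elim false fun b => decide (p.1 = b))
    fun i => Cm.option_elim (g := fun q : (F i × Σ i, F i) × F i => decide (q.1.1 = q.2))
      ((cm_fibre i).comp Cm.snd) (Cm.const false) (CmP.eq (by fun_prop) (by fun_prop))
  refine ⟨CmP.of_bool h ?_⟩
  rintro ⟨⟨i, a⟩, ⟨j, b⟩⟩
  by_cases hij : j = i
  · subst hij; simp
  · have hij' : i ≠ j := fun h => hij h.symm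
    simp [hij, hij']

end glue

section sum

variable {A B C X : Type*} [Coded A] [Coded B] [Coded C] [Coded X]

/-- A disjoint union is encoded through its two partial projections, exactly one of which is
defined. -/
theorem option_prod_injective : Function.Injective
    fun s : A ⊕ B => (s.elim some fun _ => none, s.elim (fun _ => none) some) := by
  rintro (a | a) (b | b) h <;> simp_all

instance : Coded (A ⊕ B) := Coded.ofInj _ option_prod_injective

@[fun_prop]
theorem Cm.inl : Cm (Sum.inl : A → A ⊕ B) :=
  (Cm.some.pair (Cm.const none) : Cm fun a : A => (Option.some a, (none : Option B)))

@[fun_prop]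
theorem Cm.inr : Cm (Sum.inr : B → A ⊕ B) :=
  ((Cm.const none).pair Cm.some : Cm fun b : B => ((none : Option A), Option.some b))

theorem cm_left : Cm fun s : A ⊕ B => s.elim some fun _ => none :=
  Cm.comp (g := fun p : Option A × Option B => p.1) Cm.fst
    (f := fun s : A ⊕ B => (s.elim some fun _ => none, s.elim (fun _ => none) some))
    ⟨Part.some, Partrec.some, fun k _ h => ⟨k, Part.mem_some k, h⟩⟩

theorem cm_right : Cm fun s : A ⊕ B => s.elim (fun _ => none) some :=
  Cm.comp (g := fun p : Option A × Option B => p.2) Cm.snd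
    (f := fun s : A ⊕ B => (s.elim some fun _ => none, s.elim (fun _ => none) some))
    ⟨Part.some, Partrec.some, fun k _ h => ⟨k, Part.mem_some k, h⟩⟩

theorem Cm.sum_elim {f : A → C} {g : B → C} (hf : Cm f) (hg : Cm g) : Cm (Sum.elim f g) := by
  cases isEmpty_or_nonempty C with
  | inl hC => exact ⟨Part.some, Partrec.some, fun k x _ => (hC.false (Sum.elim f g x)).elim⟩
  | inr hC =>
  obtain ⟨c⟩ := hC
  have h := Cm.option_elim (g := fun p : (A ⊕ B) × A => f p.2) cm_left
    (Cm.option_elim (g := fun p : (A ⊕ B) × B => g p.2) cm_right (Cm.const c) (hg.comp Cm.snd))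
    (hf.comp Cm.snd)
  refine h.congr ?_
  rintro (a | b) <;> rfl

instance [CEq A] : CEq (Option A) := by
  classical
  have h := Cm.option_elim (X := Option A × Option A) (o := fun p => p.1)
    (f := fun p => p.2.elim true fun _ => false)
    (g := fun q => q.1.2.elim false fun b => decide (q.2 = b)) (by fun_prop)
    (Cm.option_elim (g := fun _ => false) (by fun_prop) (by fun_prop) (by fun_prop))
    (Cm.option_elim (g := fun r : ((Option A × Option A) × A) × A => decide (r.1.2 = r.2))
      (by fun_prop) (by fun_prop) (CmP.eq (by fun_prop) (by fun_prop)))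
  refine ⟨CmP.of_bool h ?_⟩
  rintro ⟨_ | a, _ | b⟩ <;> simp

instance [CEq A] [CEq B] : CEq (A ⊕ B) :=
  .of_injective (cm_left.pair cm_right) option_prod_injective

end sum

end

/-! ### Computable graded linear algebra over coded bases -/

section

open Coded Finsupp

/-! ### Free abelian groups on coded types -/

/-- The free abelian group on `B`. -/
abbrev V (B : Type*) := B →₀ ℤ

section coded

variable {A B C X : Type*} [Coded A] [Coded B] [Coded C] [Coded X]

/-- The linear combination described by a list of coefficients and basis elements. -/
def ev {B : Type*} (l : List (ℤ × B)) : V B := (l.map fun q => single q.2 q.1).sum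

@[simp] theorem ev_nil {B : Type*} : ev ([] : List (ℤ × B)) = 0 := rfl

@[simp] theorem ev_cons {B : Type*} (q : ℤ × B) (l) : ev (q :: l) = single q.2 q.1 + ev l := by
  simp [ev]

@[simp] theorem ev_append {B : Type*} (l l' : List (ℤ × B)) : ev (l ++ l') = ev l + ev l' := by
  simp [ev]

theorem ev_surjective {B : Type*} (v : V B) : ∃ l, v = ev l := by
  induction v using Finsupp.induction_linear with
  | zero => exact ⟨[], rfl⟩
  | add v w hv hw =>
    obtain ⟨l, rfl⟩ := hv
    obtain ⟨l', rfl⟩ := hw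
    exact ⟨l ++ l', by simp⟩
  | single b z => exact ⟨[(z, b)], by simp⟩

/-- Any list of terms with the right sum is a code; repetitions and cancellations are allowed. Hence
addition is concatenation, and no decidability of equality in `B` is needed. -/
instance : Coded (V B) where
  IsCode k v := ∃ l : List (ℤ × B), IsCode k l ∧ v = ev l
  exists_isCode v := by
    obtain ⟨l, h⟩ := ev_surjective v
    obtain ⟨k, hk⟩ := exists_isCode l
    exact ⟨k, l, hk, h⟩
  eq_of_isCode := by
    rintro k v w ⟨l, h1, rfl⟩ ⟨l', h2, rfl⟩
    rw [eq_of_isCode h1 h2]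

theorem cm_ev : Cm (ev : List (ℤ × B) → V B) :=
  ⟨Part.some, Partrec.some, fun k l h => ⟨k, Part.mem_some k, l, h, rfl⟩⟩

@[fun_prop]
theorem Cm.ev {l : X → List (ℤ × B)} (hl : Cm l) : Cm fun x => ev (l x) := cm_ev.comp hl

/-- A code of a chain is by definition a code of a list representing it, so it suffices to compute
on lists. Independence of the list is automatic because `g` is a function of the chain. -/
theorem Cm.of_ev {g : X × V B → C} (h : Cm fun p : X × List (ℤ × B) => g (p.1, EffHom.ev p.2)) : Cm g := by
  obtain ⟨φ, h1, h2⟩ := h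
  refine ⟨φ, h1, ?_⟩
  rintro k ⟨x, v⟩ ⟨h3, l, h4, h5⟩
  obtain rfl : v = EffHom.ev l := h5
  exact h2 k (x, l) ⟨h3, h4⟩

theorem Cm.of_ev' {g : V B → C} (h : Cm fun l : List (ℤ × B) => g (EffHom.ev l)) : Cm g := by
  obtain ⟨φ, h1, h2⟩ := h
  refine ⟨φ, h1, ?_⟩
  rintro k v ⟨l, h4, rfl⟩
  exact h2 k l h4

@[fun_prop]
theorem Cm.v_single {b : X → B} {z : X → ℤ} (hb : Cm b) (hz : Cm z) :
    Cm fun x => single (b x) (z x) :=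
  (cm_ev.comp ((hz.pair hb).list_cons (Cm.const []))).congr fun x => by simp

@[fun_prop]
theorem Cm.v_add {f g : X → V B} (hf : Cm f) (hg : Cm g) : Cm fun x => f x + g x := by
  suffices h : Cm fun p : V B × V B => p.1 + p.2 from h.comp (hf.pair hg)
  refine Cm.of_ev (Cm.comp (g := fun p : V B × List (ℤ × B) => p.1 + EffHom.ev p.2) ?_ Cm.id)
  refine Cm.comp (g := fun p : List (ℤ × B) × V B => p.2 + EffHom.ev p.1) ?_
    (Cm.pair (f := fun p : V B × List (ℤ × B) => p.2) (g := fun p => p.1) Cm.snd Cm.fst)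
  refine Cm.of_ev ((cm_ev.comp (Cm.list_append (l := fun p : List (ℤ × B) × List (ℤ × B) => p.2)
    (l' := fun p => p.1) Cm.snd Cm.fst)).congr fun p => by simp)

/-- A family of linear maps is computable if it is computable on the basis. -/
theorem Cm.linear_param {L : X → V B →ₗ[ℤ] V A} (h : Cm fun p : X × B => L p.1 (single p.2 1)) :
    Cm fun p : X × V B => L p.1 p.2 := by
  have hs : Cm fun p : ℤ × V A => p.1 • p.2 := by
    refine Cm.of_ev ((cm_ev.comp (Cm.list_map (f := fun q : (ℤ × List (ℤ × A)) × (ℤ × A) =>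
      (q.1.1 * q.2.1, q.2.2)) (l := fun p => p.2) (by fun_prop) Cm.snd)).congr fun p => ?_)
    dsimp only
    induction p.2 with
    | nil => simp
    | cons q l ih => simp [ih]
  have hf := Cm.list_foldr (X := X × List (ℤ × B)) (l := fun p => p.2) (c := fun _ => (0 : V A))
    (f := fun q : (X × List (ℤ × B)) × (ℤ × B) × V A => q.2.1.1 • L q.1.1 (single q.2.1.2 1) + q.2.2)
    (Cm.v_add (hs.comp (Cm.pair (by fun_prop) (h.comp (Cm.pair (by fun_prop) (by fun_prop)))))
      (by fun_prop)) (Cm.const 0) Cm.snd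
  refine Cm.of_ev (hf.congr fun p => ?_)
  dsimp only
  induction p.2 with
  | nil => simp
  | cons q l ih =>
    rw [List.foldr_cons, ih, ev_cons, map_add, ← map_zsmul, smul_single, smul_eq_mul, mul_one]

theorem Cm.linear {L : V B →ₗ[ℤ] V A} (h : Cm fun b : B => L (single b 1)) : Cm L := by
  have := Cm.linear_param (X := Unit) (L := fun _ => L) (h.comp Cm.snd)
  exact this.comp ((Cm.const ()).pair Cm.id)

@[fun_prop]
theorem Cm.v_smul {z : X → ℤ} {f : X → V B} (hz : Cm z) (hf : Cm f) : Cm fun x => z x • f x :=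
  (Cm.linear_param (L := fun z : ℤ => z • LinearMap.id (R := ℤ) (M := V B)) (by
    refine (Cm.v_single (b := fun p : ℤ × B => p.2) (z := fun p => p.1) Cm.snd Cm.fst).congr
      fun p => ?_
    simp)).comp (hz.pair hf)

@[fun_prop]
theorem Cm.v_neg {f : X → V B} (hf : Cm f) : Cm fun x => - f x :=
  ((Cm.const (-1)).v_smul hf).congr fun x => by simp

@[fun_prop]
theorem Cm.v_sub {f g : X → V B} (hf : Cm f) (hg : Cm g) : Cm fun x => f x - g x :=
  (hf.v_add hg.v_neg).congr fun x => by abel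

/-- Coefficients are computable. -/
theorem Cm.v_apply [CEq B] {f : X → V B} {b : X → B} (hf : Cm f) (hb : Cm b) :
    Cm fun x => f x (b x) := by
  classical
  suffices h : Cm fun p : B × V B => p.2 p.1 from h.comp (hb.pair hf)
  have h := Cm.list_foldr (X := B × List (ℤ × B)) (l := fun p => p.2) (c := fun _ => (0 : ℤ))
    (f := fun q : (B × List (ℤ × B)) × (ℤ × B) × ℤ =>
      (if q.2.1.2 = q.1.1 then q.2.1.1 else 0) + q.2.2)
    (Cm.int_add (Cm.ite (CmP.eq (by fun_prop) (by fun_prop)) (by fun_prop) (by fun_prop))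
      (by fun_prop)) (Cm.const 0) Cm.snd
  refine Cm.of_ev (h.congr fun p => ?_)
  dsimp only
  induction p.2 with
  | nil => simp
  | cons q l ih => simp [ih, Finsupp.single_apply]

/-- A coefficient can be nonzero only at a basis element occurring in the list, so vanishing of a
chain is a finite test. This makes equality in `V B` decidable. -/
theorem ev_eq_zero_iff (l : List (ℤ × B)) : ev l = 0 ↔ ∀ q ∈ l, ev l q.2 = 0 := by
  constructor
  · intro h; simp [h]
  · intro h
    ext b
    by_cases hb : ∃ q ∈ l, q.2 = b
    · obtain ⟨q, hq, rfl⟩ := hb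
      simpa using h q hq
    · clear h
      rw [Finsupp.zero_apply]
      induction l with
      | nil => rfl
      | cons q l ih =>
        push Not at hb
        simp only [List.mem_cons, forall_eq_or_imp] at hb
        rw [ev_cons, Finsupp.add_apply, single_eq_of_ne' hb.1, zero_add]
        exact ih (by push Not; exact hb.2)

theorem cmP_v_eq_zero [CEq B] : CmP fun v : V B => v = 0 := by
  refine Cm.of_ev' ?_
  change CmP fun l : List (ℤ × B) => EffHom.ev l = 0
  refine (CmP.forall_mem (P := fun p : List (ℤ × B) × (ℤ × B) => EffHom.ev p.1 p.2.2 = 0)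
    (CmP.eq (Cm.v_apply (by fun_prop) (by fun_prop)) (Cm.const 0)) Cm.id).congr fun l => ?_
  exact (ev_eq_zero_iff l).symm

instance [CEq B] : CEq (V B) :=
  ⟨(CmP.comp (f := fun p : V B × V B => p.1 - p.2) cmP_v_eq_zero (by fun_prop)).congr
    fun _ => sub_eq_zero⟩

end coded

/-! ### Supports of linear maps -/

section spt

variable {A B C : Type*}

/-- The value of `f` at every basis element `b` is supported in the elements related to `b`. -/
def Spt (R : A → B → Prop) (f : V A →ₗ[ℤ] V B) : Prop := ∀ a b, f (single a 1) b ≠ 0 → R a b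

theorem Spt.mono {R S : A → B → Prop} {f : V A →ₗ[ℤ] V B} (h : Spt R f) (hRS : ∀ a b, R a b → S a b) :
    Spt S f := fun a b hab => hRS a b (h a b hab)

/-- A coefficient of `f v` at `b` needs a contribution from some basis element of the support of
`v`. This is how degree and label bounds pass from basis elements to chains. -/
theorem Spt.apply {R : A → B → Prop} {f : V A →ₗ[ℤ] V B} (h : Spt R f) {v : V A} {b : B}
    (hb : f v b ≠ 0) : ∃ a, v a ≠ 0 ∧ R a b := by
  by_contra hcon
  push Not at hcon
  apply hb
  rw [← Finsupp.sum_single v, map_finsuppSum, Finsupp.sum, Finsupp.finsetSum_apply]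
  refine Finset.sum_eq_zero fun a ha => ?_
  have e : single a (v a) = v a • single a (1 : ℤ) := by simp
  rw [e, map_zsmul]
  by_contra h0
  refine hcon a (Finsupp.mem_support_iff.1 ha) (h a b fun h1 => h0 ?_)
  simp [h1]

theorem Spt.comp {R : A → B → Prop} {S : B → C → Prop} {T : A → C → Prop} {g : V B →ₗ[ℤ] V C}
    {f : V A →ₗ[ℤ] V B} (hg : Spt S g) (hf : Spt R f) (h : ∀ a b c, R a b → S b c → T a c) :
    Spt T (g ∘ₗ f) := by
  intro a c hac
  obtain ⟨b, hb, hbc⟩ := hg.apply hac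
  exact h a b c (hf a b hb) hbc

theorem Spt.add {R : A → B → Prop} {f g : V A →ₗ[ℤ] V B} (hf : Spt R f) (hg : Spt R g) :
    Spt R (f + g) := by
  intro a b hab
  by_contra h
  have h1 : f (single a 1) b = 0 := by by_contra h1; exact h (hf a b h1)
  have h2 : g (single a 1) b = 0 := by by_contra h1; exact h (hg a b h1)
  simp [h1, h2] at hab

theorem Spt.zero {R : A → B → Prop} : Spt R 0 := fun _ _ h => (h rfl).elim

theorem Spt.smul {R : A → B → Prop} {f : V A →ₗ[ℤ] V B} (hf : Spt R f) (z : ℤ) : Spt R (z • f) := by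
  intro a b hab
  refine hf a b fun h => hab ?_
  simp [h]

theorem Spt.lin {R : A → B → Prop} {f : A → V B} (h : ∀ a b, f a b ≠ 0 → R a b) :
    Spt R (Finsupp.linearCombination ℤ f) := by
  intro a b hab
  simp only [Finsupp.linearCombination_single, one_smul] at hab
  exact h a b hab

end spt

/-! ### Graded computable bases -/

/-- A coded set with decidable equality, a degree and a filtration label. -/
class CSet (B : Type*) extends Coded B where
  deg : B → ℕ
  lab : B → ℕ
  ceq : CEq B
  cm_deg : Cm deg
  cm_lab : Cm lab

attribute [instance] CSet.ceq
attribute [fun_prop] CSet.cm_deg CSet.cm_lab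

open CSet

/-- Computable linear maps which are homogeneous of degree `k` and, if `s` holds, preserve the
labels. -/
structure Good (s : Prop) (k : ℤ) {A B : Type*} [CSet A] [CSet B] (f : V A →ₗ[ℤ] V B) : Prop where
  spt : Spt (fun a b => (deg b : ℤ) = deg a + k ∧ (s → lab b = lab a)) f
  cm : Cm f

section good

variable {s : Prop} {k l : ℤ} {A B C : Type*} [CSet A] [CSet B] [CSet C]

theorem Good.comp {g : V B →ₗ[ℤ] V C} {f : V A →ₗ[ℤ] V B} (hg : Good s k g) (hf : Good s l f)
    {m : ℤ} (h : m = k + l) : Good s m (g ∘ₗ f) where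
  spt := hg.spt.comp hf.spt fun a b c h1 h2 =>
    ⟨by rw [h2.1, h1.1, h]; ring, fun hs => (h2.2 hs).trans (h1.2 hs)⟩
  cm := hg.cm.comp hf.cm

theorem Good.add {f g : V A →ₗ[ℤ] V B} (hf : Good s k f) (hg : Good s k g) : Good s k (f + g) :=
  ⟨hf.spt.add hg.spt, hf.cm.v_add hg.cm⟩

theorem Good.zero : Good s k (0 : V A →ₗ[ℤ] V B) := ⟨Spt.zero, Cm.const 0⟩

theorem Good.smul {f : V A →ₗ[ℤ] V B} (hf : Good s k f) (z : ℤ) : Good s k (z • f) :=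
  ⟨hf.spt.smul z, (Cm.const z).v_smul hf.cm⟩

theorem Good.neg {f : V A →ₗ[ℤ] V B} (hf : Good s k f) : Good s k (-f) := by
  have := hf.smul (-1); rwa [neg_one_smul] at this

theorem Good.sub {f g : V A →ₗ[ℤ] V B} (hf : Good s k f) (hg : Good s k g) : Good s k (f - g) := by
  have := hf.add hg.neg; rwa [← sub_eq_add_neg] at this

theorem Good.id : Good s 0 (LinearMap.id : V A →ₗ[ℤ] V A) := by
  refine ⟨fun a b h => ?_, Cm.id⟩
  rw [LinearMap.id_apply, single_apply_ne_zero] at h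
  obtain ⟨rfl, _⟩ := h
  simp

theorem Good.lin {f : A → V B} (hf : Cm f)
    (h : ∀ a b, f a b ≠ 0 → (deg b : ℤ) = deg a + k ∧ (s → lab b = lab a)) :
    Good s k (Finsupp.linearCombination ℤ f) :=
  ⟨Spt.lin h, Cm.linear (hf.congr fun a => by simp)⟩

theorem Good.weaken {f : V A →ₗ[ℤ] V B} (hf : Good s k f) : Good False k f :=
  ⟨hf.spt.mono fun _ _ h => ⟨h.1, False.elim⟩, hf.cm⟩

end good

end

/-! ### Reductions, homotopy equivalences and mapping cylinders -/

section

open Coded Finsupp CSet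

/-! ### Complexes with a computable graded basis -/

/-- A chain complex of free abelian groups with a computable homogeneous basis `B`, written as a
single group with a differential; if `s` holds, the differential preserves the labels. -/
structure Cx (s : Prop) where
  B : Type u
  [inst : CSet B]
  d : V B →ₗ[ℤ] V B
  d_d : ∀ v, d (d v) = 0
  good : Good s (-1) d

attribute [instance] Cx.inst

/-- A computable reduction. -/
structure Red {s : Prop} (C D : Cx.{u} s) where
  α : V C.B →ₗ[ℤ] V D.B
  β : V D.B →ₗ[ℤ] V C.B
  η : V C.B →ₗ[ℤ] V C.B
  α_d : ∀ v, α (C.d v) = D.d (α v)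
  β_d : ∀ v, β (D.d v) = C.d (β v)
  α_β : ∀ v, α (β v) = v
  α_η : ∀ v, α (η v) = 0
  η_β : ∀ v, η (β v) = 0
  η_η : ∀ v, η (η v) = 0
  hty : ∀ v, C.d (η v) + η (C.d v) = v - β (α v)
  good_α : Good s 0 α
  good_β : Good s 0 β
  good_η : Good s 1 η

/-- A computable homotopy equivalence. -/
structure HEq {s : Prop} (C D : Cx.{u} s) where
  f : V C.B →ₗ[ℤ] V D.B
  g : V D.B →ₗ[ℤ] V C.B
  h : V C.B →ₗ[ℤ] V C.B
  k : V D.B →ₗ[ℤ] V D.B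
  f_d : ∀ v, f (C.d v) = D.d (f v)
  g_d : ∀ v, g (D.d v) = C.d (g v)
  hty_h : ∀ v, C.d (h v) + h (C.d v) = v - g (f v)
  hty_k : ∀ v, D.d (k v) + k (D.d v) = v - f (g v)
  good_f : Good s 0 f
  good_g : Good s 0 g
  good_h : Good s 1 h
  good_k : Good s 1 k

section

variable {s : Prop} {C D E : Cx.{u} s}

/-- A reduction is a homotopy equivalence. -/
def Red.toHEq (r : Red C D) : HEq C D where
  f := r.α
  g := r.β
  h := r.η
  k := 0
  f_d := r.α_d
  g_d := r.β_d
  hty_h := r.hty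
  hty_k v := by simp [r.α_β]
  good_f := r.good_α
  good_g := r.good_β
  good_h := r.good_η
  good_k := Good.zero

/-- The inverse of a homotopy equivalence. -/
def HEq.symm (e : HEq C D) : HEq D C where
  f := e.g
  g := e.f
  h := e.k
  k := e.h
  f_d := e.g_d
  g_d := e.f_d
  hty_h := e.hty_k
  hty_k := e.hty_h
  good_f := e.good_g
  good_g := e.good_f
  good_h := e.good_k
  good_k := e.good_h

/-- The composition of two homotopy equivalences. -/
def HEq.trans (e : HEq C D) (e' : HEq D E) : HEq C E where
  f := e'.f ∘ₗ e.f
  g := e.g ∘ₗ e'.g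
  h := e.h + e.g ∘ₗ e'.h ∘ₗ e.f
  k := e'.k + e'.f ∘ₗ e.k ∘ₗ e'.g
  f_d v := by simp [e.f_d, e'.f_d]
  g_d v := by simp [e.g_d, e'.g_d]
  hty_h v := by
    have h1 := e.hty_h v
    have h2 := congrArg e.g (e'.hty_h (e.f v))
    simp only [map_add, map_sub, LinearMap.add_apply, LinearMap.comp_apply, ← e.g_d, e.f_d] at h1 h2 ⊢
    rw [show v - e.g (e'.g (e'.f (e.f v))) = (v - e.g (e.f v)) +
      (e.g (e.f v) - e.g (e'.g (e'.f (e.f v)))) by abel, ← h1, ← h2]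
    abel
  hty_k v := by
    have h1 := e'.hty_k v
    have h2 := congrArg e'.f (e.hty_k (e'.g v))
    simp only [map_add, map_sub, LinearMap.add_apply, LinearMap.comp_apply, ← e'.f_d, e'.g_d] at h1 h2 ⊢
    rw [show v - e'.f (e.f (e.g (e'.g v))) = (v - e'.f (e'.g v)) +
      (e'.f (e'.g v) - e'.f (e.f (e.g (e'.g v)))) by abel, ← h1, ← h2]
    abel
  good_f := e'.good_f.comp e.good_f (by norm_num)
  good_g := e.good_g.comp e'.good_g (by norm_num)
  good_h := e.good_h.add (e.good_g.comp (e'.good_h.comp e.good_f rfl) (by norm_num))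
  good_k := e'.good_k.add (e'.good_f.comp (e.good_k.comp e'.good_g rfl) (by norm_num))

end

/-! ### The mapping cylinder -/

section sum

variable {A B C : Type*}

/-- The inclusion of the first summand. -/
def inlV (A B : Type*) : V A →ₗ[ℤ] V (A ⊕ B) := Finsupp.lmapDomain ℤ ℤ Sum.inl

/-- The inclusion of the second summand. -/
def inrV (A B : Type*) : V B →ₗ[ℤ] V (A ⊕ B) := Finsupp.lmapDomain ℤ ℤ Sum.inr

/-- The linear map on a direct sum with given restrictions. -/
def elimV (f : V A →ₗ[ℤ] V C) (g : V B →ₗ[ℤ] V C) : V (A ⊕ B) →ₗ[ℤ] V C :=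
  Finsupp.linearCombination ℤ (Sum.elim (fun a => f (single a 1)) fun b => g (single b 1))

@[simp] theorem elimV_inl (f : V A →ₗ[ℤ] V C) (g : V B →ₗ[ℤ] V C) (v : V A) :
    elimV f g (inlV A B v) = f v := by
  suffices h : elimV f g ∘ₗ inlV A B = f from LinearMap.congr_fun h v
  ext a : 2
  simp [elimV, inlV]

@[simp] theorem elimV_inr (f : V A →ₗ[ℤ] V C) (g : V B →ₗ[ℤ] V C) (v : V B) :
    elimV f g (inrV A B v) = g v := by
  suffices h : elimV f g ∘ₗ inrV A B = g from LinearMap.congr_fun h v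
  ext a : 2
  simp [elimV, inrV]

theorem sumV_induction {P : V (A ⊕ B) → Prop} (hl : ∀ v, P (inlV A B v)) (hr : ∀ v, P (inrV A B v))
    (hadd : ∀ v w, P v → P w → P (v + w)) (v : V (A ⊕ B)) : P v := by
  induction v using Finsupp.induction_linear with
  | zero => simpa using hl 0
  | add v w hv hw => exact hadd v w hv hw
  | single b z =>
    cases b with
    | inl a => simpa [inlV] using hl (single a z)
    | inr a => simpa [inrV] using hr (single a z)

variable {s : Prop} {k : ℤ}

theorem Good.inlV [CSet A] [CSet (A ⊕ B)] (hc : Cm (Sum.inl : A → A ⊕ B))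
    (h : ∀ a : A, (deg (Sum.inl a : A ⊕ B) : ℤ) = deg a + k ∧ (s → lab (Sum.inl a : A ⊕ B) = lab a)) :
    Good s k (inlV A B) := by
  refine ⟨fun a b hab => ?_, Cm.linear ?_⟩
  · simp only [EffHom.inlV, lmapDomain_apply, mapDomain_single] at hab
    rw [single_apply_ne_zero] at hab
    obtain ⟨rfl, _⟩ := hab
    exact h a
  · simp only [EffHom.inlV, lmapDomain_apply, mapDomain_single]
    exact hc.v_single (Cm.const 1)

theorem Good.inrV [CSet B] [CSet (A ⊕ B)] (hc : Cm (Sum.inr : B → A ⊕ B))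
    (h : ∀ a : B, (deg (Sum.inr a : A ⊕ B) : ℤ) = deg a + k ∧ (s → lab (Sum.inr a : A ⊕ B) = lab a)) :
    Good s k (inrV A B) := by
  refine ⟨fun a b hab => ?_, Cm.linear ?_⟩
  · simp only [EffHom.inrV, lmapDomain_apply, mapDomain_single] at hab
    rw [single_apply_ne_zero] at hab
    obtain ⟨rfl, _⟩ := hab
    exact h a
  · simp only [EffHom.inrV, lmapDomain_apply, mapDomain_single]
    exact hc.v_single (Cm.const 1)

instance [CSet A] [CSet B] : CSet (A ⊕ B) where
  deg := Sum.elim deg deg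
  lab := Sum.elim lab lab
  ceq := inferInstance
  cm_deg := Cm.sum_elim (by fun_prop) (by fun_prop)
  cm_lab := Cm.sum_elim (by fun_prop) (by fun_prop)

theorem good_inlV [CSet A] [CSet B] : Good s 0 (inlV A B) :=
  Good.inlV Cm.inl fun _ => ⟨by simp [deg], fun _ => rfl⟩

theorem good_inrV [CSet A] [CSet B] : Good s 0 (inrV A B) :=
  Good.inrV Cm.inr fun _ => ⟨by simp [deg], fun _ => rfl⟩

theorem good_elimV [CSet A] [CSet B] [CSet C] {f : V A →ₗ[ℤ] V C} {g : V B →ₗ[ℤ] V C}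
    (hf : Good s k f) (hg : Good s k g) : Good s k (elimV f g) := by
  refine Good.lin (Cm.sum_elim (hf.cm.comp (by fun_prop)) (hg.cm.comp (by fun_prop))) ?_
  rintro (a | b) c h
  · exact hf.spt a c h
  · exact hg.spt b c h

end sum

/-- The same set with degrees raised by one. -/
def Sh (B : Type*) := B

instance {B : Type*} [h : Coded B] : Coded (Sh B) := h

instance {B : Type*} [CSet B] : CSet (Sh B) where
  deg b := deg (B := B) b + 1
  lab b := lab (B := B) b
  ceq := inferInstanceAs (CEq B)
  cm_deg := Cm.nat_add (X := B) CSet.cm_deg (Cm.const 1)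
  cm_lab := CSet.cm_lab (B := B)

section cyl

variable {s : Prop} {C D E : Cx.{u} s}

/-- The identity as a map into the shifted group. -/
def toSh (B : Type*) : V B →ₗ[ℤ] V (Sh B) := LinearMap.id (M := V B)

/-- The identity as a map from the shifted group. -/
def ofSh (B : Type*) : V (Sh B) →ₗ[ℤ] V B := LinearMap.id (M := V B)

@[simp] theorem ofSh_toSh {B : Type*} (v : V B) : ofSh B (toSh B v) = v := rfl

@[simp] theorem toSh_ofSh {B : Type*} (v : V (Sh B)) : toSh B (ofSh B v) = v := rfl

theorem good_toSh {B : Type*} [CSet B] : Good s 1 (toSh B) := by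
  refine ⟨fun a b h => ?_, Cm.id (A := V B)⟩
  change single (a : B) (1 : ℤ) (b : B) ≠ 0 at h
  obtain ⟨rfl, _⟩ := single_apply_ne_zero.1 h
  exact ⟨by simp [deg], fun _ => rfl⟩

theorem good_ofSh {B : Type*} [CSet B] : Good s (-1) (ofSh B) := by
  refine ⟨fun a b h => ?_, Cm.id (A := V B)⟩
  change single (a : B) (1 : ℤ) (b : B) ≠ 0 at h
  obtain ⟨rfl, _⟩ := single_apply_ne_zero.1 h
  exact ⟨by simp [deg], fun _ => rfl⟩

/-- The suspension of a complex. -/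
def Cx.shift (C : Cx.{u} s) : Cx.{u} s where
  B := Sh C.B
  d := -(toSh C.B ∘ₗ C.d ∘ₗ ofSh C.B)
  d_d v := by
    simp only [LinearMap.neg_apply, LinearMap.comp_apply, map_neg, ofSh_toSh, C.d_d, map_zero, neg_zero]
  good := (good_toSh.comp (C.good.comp good_ofSh rfl) (by norm_num)).neg

section raw

variable {A B : Type*} (dA : V A →ₗ[ℤ] V A) (dB : V B →ₗ[ℤ] V B) (τ : V B →ₗ[ℤ] V A)

/-- The differential of an extension. -/
def extD : V (A ⊕ B) →ₗ[ℤ] V (A ⊕ B) :=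
  elimV (inlV A B ∘ₗ dA) (inlV A B ∘ₗ τ + inrV A B ∘ₗ dB)

@[simp] theorem extD_inl (v : V A) : extD dA dB τ (inlV A B v) = inlV A B (dA v) := by simp [extD]

@[simp] theorem extD_inr (v : V B) :
    extD dA dB τ (inrV A B v) = inlV A B (τ v) + inrV A B (dB v) := by simp [extD]

variable {dA dB τ}

theorem extD_extD (hτ : ∀ v, dA (τ v) + τ (dB v) = 0) (hA : ∀ v, dA (dA v) = 0) (hB : ∀ v, dB (dB v) = 0) (v : V (A ⊕ B)) :
    extD dA dB τ (extD dA dB τ v) = 0 := by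
  induction v using sumV_induction with
  | hl v => simp [hA]
  | hr v =>
    have h := congrArg (inlV A B) (hτ v)
    simpa [hB] using h
  | hadd v w hv hw => simp [hv, hw]

/-- The identity on `A` extends over the contractible part by `-τ c`: the twist `τ` into `A` is
compensated by first contracting in `B`, and `τ d c + τ c d = τ` closes the computation. -/
theorem extD_α (hτ : ∀ v, dA (τ v) + τ (dB v) = 0) {c : V B →ₗ[ℤ] V B} (hc : ∀ v, dB (c v) + c (dB v) = v) (v : V (A ⊕ B)) :
    elimV LinearMap.id (-(τ ∘ₗ c)) (extD dA dB τ v) = dA (elimV LinearMap.id (-(τ ∘ₗ c)) v) := by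
  induction v using sumV_induction with
  | hl v => simp
  | hr v =>
    have h1 := hτ (c v)
    have h2 := congrArg τ (hc v)
    simp only [map_add] at h2
    simp only [extD_inr, elimV_inr, elimV_inl, LinearMap.comp_apply, map_add,
      LinearMap.id_apply, LinearMap.neg_apply, map_neg]
    linear_combination (norm := abel) h1 - h2
  | hadd v w hv hw => simp only [map_add, hv, hw]

theorem extD_η (hτ : ∀ v, dA (τ v) + τ (dB v) = 0) {c : V B →ₗ[ℤ] V B} (hc : ∀ v, dB (c v) + c (dB v) = v) (v : V (A ⊕ B)) :
    extD dA dB τ (elimV 0 (inrV A B ∘ₗ c) v) + elimV 0 (inrV A B ∘ₗ c) (extD dA dB τ v) =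
      v - inlV A B (elimV LinearMap.id (-(τ ∘ₗ c)) v) := by
  induction v using sumV_induction with
  | hl v => simp
  | hr v =>
    have h1 := congrArg (inrV A B) (hc v)
    simp only [map_add] at h1
    simp only [extD_inr, elimV_inr, elimV_inl, LinearMap.comp_apply, map_add,
      LinearMap.neg_apply, map_neg, LinearMap.zero_apply]
    linear_combination (norm := abel) h1
  | hadd v w hv hw =>
    simp only [map_add]
    linear_combination (norm := abel) hv + hw

theorem ext_α_η {c : V B →ₗ[ℤ] V B} (hcc : ∀ v, c (c v) = 0) (v : V (A ⊕ B)) :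
    elimV LinearMap.id (-(τ ∘ₗ c)) (elimV 0 (inrV A B ∘ₗ c) v) = 0 := by
  induction v using sumV_induction with
  | hl v => simp
  | hr v => simp [hcc]
  | hadd v w hv hw => rw [map_add, map_add, hv, hw, add_zero]

theorem ext_η_η {c : V B →ₗ[ℤ] V B} (hcc : ∀ v, c (c v) = 0) (v : V (A ⊕ B)) :
    elimV 0 (inrV A B ∘ₗ c) (elimV 0 (inrV A B ∘ₗ c) v) = 0 := by
  induction v using sumV_induction with
  | hl v => simp
  | hr v => simp [hcc]
  | hadd v w hv hw => rw [map_add, map_add, hv, hw, add_zero]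

end raw

/-- The extension of a complex by another one. -/
def Cx.ext (E Q : Cx.{u} s) (τ : V Q.B →ₗ[ℤ] V E.B) (hτ : ∀ v, E.d (τ v) + τ (Q.d v) = 0)
    (good_τ : Good s (-1) τ) : Cx.{u} s where
  B := E.B ⊕ Q.B
  d := extD E.d Q.d τ
  d_d v := extD_extD hτ E.d_d Q.d_d v
  good := good_elimV (good_inlV.comp E.good (by norm_num))
    ((good_inlV.comp good_τ (by norm_num)).add (good_inrV.comp Q.good (by norm_num)))

/-- An extension of `E` by a contractible complex reduces to `E`. -/
def Cx.extRed (E Q : Cx.{u} s) (τ : V Q.B →ₗ[ℤ] V E.B) (hτ : ∀ v, E.d (τ v) + τ (Q.d v) = 0)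
    (good_τ : Good s (-1) τ) (c : V Q.B →ₗ[ℤ] V Q.B) (hc : ∀ v, Q.d (c v) + c (Q.d v) = v)
    (hcc : ∀ v, c (c v) = 0) (good_c : Good s 1 c) : Red (Cx.ext E Q τ hτ good_τ) E where
  α := elimV LinearMap.id (-(τ ∘ₗ c))
  β := inlV E.B Q.B
  η := elimV 0 (inrV E.B Q.B ∘ₗ c)
  α_d := extD_α hτ hc
  β_d v := (extD_inl E.d Q.d τ v).symm
  α_β v := elimV_inl _ _ v
  α_η := ext_α_η hcc
  η_β v := elimV_inl _ _ v
  η_η := ext_η_η hcc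
  hty := extD_η hτ hc
  good_α := good_elimV Good.id (good_τ.comp good_c (by norm_num)).neg
  good_β := good_inlV
  good_η := good_elimV Good.zero (good_inrV.comp good_c (by norm_num))

section contract

variable {A B : Type*} {dA : V A →ₗ[ℤ] V A} {dB : V B →ₗ[ℤ] V B} {f : V A →ₗ[ℤ] V B}
  {g : V B →ₗ[ℤ] V A} {h : V A →ₗ[ℤ] V A} {k : V B →ₗ[ℤ] V B} 

/-- The contraction of the cone of a homotopy equivalence. -/
def coneC (f : V A →ₗ[ℤ] V B) (g : V B →ₗ[ℤ] V A) (h : V A →ₗ[ℤ] V A) (k : V B →ₗ[ℤ] V B) :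
    V (B ⊕ Sh A) →ₗ[ℤ] V (B ⊕ Sh A) :=
  elimV (inlV _ _ ∘ₗ (k - (k ∘ₗ f - f ∘ₗ h) ∘ₗ g) - inrV _ _ ∘ₗ toSh A ∘ₗ g)
    ((-(inrV _ _ ∘ₗ toSh A ∘ₗ h) - inlV _ _ ∘ₗ (k ∘ₗ f - f ∘ₗ h) ∘ₗ h) ∘ₗ ofSh A)

/-- The two homotopies of an equivalence need not be compatible: `θ = k f - f h` may be nonzero. It
anticommutes with the differentials, because `k f` and `f h` have the same boundary `f - f g f`, and
the correction terms `θ g` and `θ h` in `coneC` remove the resulting defect. -/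
theorem coneC_spec (f_d : ∀ v, f (dA v) = dB (f v)) (g_d : ∀ v, g (dB v) = dA (g v))
    (hty_h : ∀ v, dA (h v) + h (dA v) = v - g (f v)) (hty_k : ∀ v, dB (k v) + k (dB v) = v - f (g v))
    (v : V (B ⊕ Sh A)) :
    extD dB (-(toSh A ∘ₗ dA ∘ₗ ofSh A)) (-(f ∘ₗ ofSh A)) (coneC f g h k v) +
      coneC f g h k (extD dB (-(toSh A ∘ₗ dA ∘ₗ ofSh A)) (-(f ∘ₗ ofSh A)) v) = v := by
  obtain ⟨θ, hθ⟩ : ∃ θ : V A →ₗ[ℤ] V B, θ = k ∘ₗ f - f ∘ₗ h := ⟨_, rfl⟩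
  have θ_d : ∀ v, dB (θ v) + θ (dA v) = 0 := by
    intro v
    have h1 := hty_k (f v)
    have h2 := congrArg f (hty_h v)
    simp only [map_add, map_sub, f_d] at h1 h2
    simp only [hθ, LinearMap.sub_apply, LinearMap.comp_apply, map_sub, f_d]
    linear_combination (norm := abel) h1 - h2
  rw [coneC, ← hθ]
  induction v using sumV_induction with
  | hl v =>
    have h1 := congrArg (inlV B (Sh A)) (hty_k v)
    have h2 := congrArg (inlV B (Sh A)) (θ_d (g v))
    simp only [map_add, map_sub, map_zero] at h1 h2
    simp only [extD_inl, extD_inr, elimV_inl, elimV_inr, LinearMap.add_apply, LinearMap.sub_apply,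
      LinearMap.neg_apply, LinearMap.comp_apply, map_add, map_sub, map_neg, ofSh_toSh, g_d]
    linear_combination (norm := abel) h1 - h2
  | hr v =>
    obtain ⟨w, hw⟩ : ∃ w, v = toSh A w := ⟨ofSh A v, rfl⟩
    rw [hw]
    have h1 := congrArg (inrV B (Sh A) ∘ₗ toSh A) (hty_h w)
    have h2 := congrArg (inlV B (Sh A)) (θ_d (h w))
    have h3 := congrArg (inlV B (Sh A) ∘ₗ θ) (hty_h w)
    simp only [map_add, map_sub, map_zero, LinearMap.comp_apply] at h1 h2 h3
    simp only [extD_inl, extD_inr, elimV_inl, elimV_inr, LinearMap.add_apply, LinearMap.sub_apply,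
      LinearMap.neg_apply, LinearMap.comp_apply, map_add, map_sub, map_neg, ofSh_toSh]
    have h4 : inlV B (Sh A) (θ w) = inlV B (Sh A) (k (f w)) -
      inlV B (Sh A) (f (h w)) := by simp [hθ]
    linear_combination (norm := abel) h1 - h2 + h3 + h4
  | hadd v w hv hw =>
    simp only [map_add]
    linear_combination (norm := abel) hv + hw

end contract

theorem cone_aux {A B : Type*} {dA : V A →ₗ[ℤ] V A} {dB : V B →ₗ[ℤ] V B} {f : V A →ₗ[ℤ] V B}
    (f_d : ∀ v, f (dA v) = dB (f v)) (v : V (Sh A)) :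
    dB ((-(f ∘ₗ ofSh A)) v) + (-(f ∘ₗ ofSh A)) ((-(toSh A ∘ₗ dA ∘ₗ ofSh A)) v) = 0 := by
  simp [f_d]

variable (e : HEq C D)

/-- The mapping cone. -/
def HEq.cone : Cx.{u} s :=
  Cx.ext D C.shift (-(e.f ∘ₗ ofSh C.B)) (cone_aux e.f_d)
    (e.good_f.comp good_ofSh (by norm_num)).neg

/-- The mapping cone of a homotopy equivalence is contractible. -/
theorem HEq.cone_contractible : ∃ c : V e.cone.B →ₗ[ℤ] V e.cone.B, Good s 1 c ∧
    (∀ v, e.cone.d (c v) + c (e.cone.d v) = v) ∧ ∀ v, c (c v) = 0 := by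
  have hc : Good s 1 (coneC e.f e.g e.h e.k) := by
    have hθ : Good s 1 (e.k ∘ₗ e.f - e.f ∘ₗ e.h) :=
      (e.good_k.comp e.good_f rfl).sub (e.good_f.comp e.good_h rfl)
    refine good_elimV (Good.sub (good_inlV.comp (k := 0) (l := 1) ?_ rfl)
      (good_inrV.comp (good_toSh.comp e.good_g rfl) rfl)) (Good.comp (l := -1) (k := 2) ?_ good_ofSh rfl)
    · exact e.good_k.sub (hθ.comp e.good_g rfl)
    · exact (good_inrV.comp (good_toSh.comp e.good_h rfl) rfl).neg.sub
        (good_inlV.comp (hθ.comp e.good_h rfl) rfl)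
  obtain ⟨c, hc, h⟩ : ∃ c : V e.cone.B →ₗ[ℤ] V e.cone.B, Good s 1 c ∧
    ∀ v, e.cone.d (c v) + c (e.cone.d v) = v :=
    ⟨coneC e.f e.g e.h e.k, hc, coneC_spec e.f_d e.g_d e.hty_h e.hty_k⟩
  have hd := e.cone.d_d
  have hg := e.cone.good
  -- Replacing `c` by `c d c` keeps `d c + c d = 1`, since `d c d = d`. It also gives square zero:
  -- `d c c = c c d`, hence `d c c d = 0`.
  refine ⟨c ∘ₗ e.cone.d ∘ₗ c, hc.comp (hg.comp hc rfl) rfl, fun v => ?_, fun v => ?_⟩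
  · have h1 := h v
    have h2 := congrArg e.cone.d (h (c v))
    have h3 := congrArg c (h (e.cone.d v))
    simp only [LinearMap.comp_apply, map_add, hd, map_zero, zero_add, add_zero] at h1 h2 h3 ⊢
    rw [h2, h3, h1]
  · have h1 := congrArg e.cone.d (h (c (c v)))
    have h2 := congrArg (fun w => e.cone.d (c w)) (h (c v))
    simp only [LinearMap.comp_apply, map_add, hd, map_zero, zero_add, add_zero] at h1 h2 ⊢
    rw [h1, add_eq_left] at h2
    rw [h2, map_zero]

section cyl_raw

variable {A B : Type*} (f : V A →ₗ[ℤ] V B)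

/-- The projection of the cylinder of `f` to its target. -/
def cylα : V (A ⊕ (B ⊕ Sh A)) →ₗ[ℤ] V B := elimV f (elimV LinearMap.id 0)

/-- The homotopy contracting the cylinder onto the target. -/
def cylη (A B : Type*) : V (A ⊕ (B ⊕ Sh A)) →ₗ[ℤ] V (A ⊕ (B ⊕ Sh A)) :=
  elimV (inrV _ _ ∘ₗ inrV _ _ ∘ₗ toSh A) 0

theorem cylV_induction {P : V (A ⊕ (B ⊕ Sh A)) → Prop} (h1 : ∀ v, P (inlV _ _ v))
    (h2 : ∀ v, P (inrV _ _ (inlV _ _ v))) (h3 : ∀ v, P (inrV _ _ (inrV _ _ (toSh A v))))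
    (hadd : ∀ v w, P v → P w → P (v + w)) (v : V (A ⊕ (B ⊕ Sh A))) : P v := by
  induction v using sumV_induction with
  | hl v => exact h1 v
  | hr v =>
    induction v using sumV_induction with
    | hl v => exact h2 v
    | hr v => exact h3 (ofSh A v)
    | hadd v w hv hw => rw [map_add]; exact hadd _ _ hv hw
  | hadd v w hv hw => exact hadd _ _ hv hw

variable {f} {dA : V A →ₗ[ℤ] V A} {dB : V B →ₗ[ℤ] V B}

/-- The differential of the cylinder. -/
abbrev cylD (dA : V A →ₗ[ℤ] V A) (dB : V B →ₗ[ℤ] V B) (f : V A →ₗ[ℤ] V B) :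
    V (A ⊕ (B ⊕ Sh A)) →ₗ[ℤ] V (A ⊕ (B ⊕ Sh A)) :=
  extD dA (extD dB (-(toSh A ∘ₗ dA ∘ₗ ofSh A)) (-(f ∘ₗ ofSh A))) (elimV 0 (ofSh A))

theorem cyl_α_d (f_d : ∀ v, f (dA v) = dB (f v)) (v : V (A ⊕ (B ⊕ Sh A))) :
    cylα f (cylD dA dB f v) = dB (cylα f v) := by
  induction v using cylV_induction with
  | h1 v => simp [cylα, f_d]
  | h2 v => simp [cylα]
  | h3 v => simp [cylα]
  | hadd v w hv hw => simp only [map_add, hv, hw]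

theorem cyl_hty (v : V (A ⊕ (B ⊕ Sh A))) :
    cylD dA dB f (cylη A B v) + cylη A B (cylD dA dB f v) = v - inrV _ _ (inlV _ _ (cylα f v)) := by
  induction v using cylV_induction with
  | h1 v => simp [cylα, cylη]; abel
  | h2 v => simp [cylα, cylη]
  | h3 v => simp [cylα, cylη]
  | hadd v w hv hw =>
    simp only [map_add]
    linear_combination (norm := abel) hv + hw

theorem cyl_α_η (v : V (A ⊕ (B ⊕ Sh A))) : cylα f (cylη A B v) = 0 := by
  induction v using cylV_induction with
  | h1 v => simp [cylα, cylη]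
  | h2 v => simp [cylα, cylη]
  | h3 v => simp [cylα, cylη]
  | hadd v w hv hw => rw [map_add, map_add, hv, hw, add_zero]

theorem cyl_η_η (v : V (A ⊕ (B ⊕ Sh A))) : cylη A B (cylη A B v) = 0 := by
  induction v using cylV_induction with
  | h1 v => simp [cylη]
  | h2 v => simp [cylη]
  | h3 v => simp [cylη]
  | hadd v w hv hw => rw [map_add, map_add, hv, hw, add_zero]

end cyl_raw

/-- Homotopy equivalent complexes are dominated by a common one, the mapping cylinder. -/
theorem HEq.exists_red (e : HEq C D) : ∃ M : Cx.{u} s, Nonempty (Red M C) ∧ Nonempty (Red M D) := by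
  have hτ : ∀ v, C.d (elimV 0 (ofSh C.B) v) + elimV 0 (ofSh C.B)
      (extD D.d (-(toSh C.B ∘ₗ C.d ∘ₗ ofSh C.B)) (-(e.f ∘ₗ ofSh C.B)) v) = 0 := by
    intro v
    induction v using sumV_induction with
    | hl v => simp
    | hr v => simp
    | hadd v w hv hw =>
      simp only [map_add]
      linear_combination (norm := abel) hv + hw
  obtain ⟨c, gc, hc, hcc⟩ := e.cone_contractible
  -- The mapping cylinder is regarded as an extension of `C` by the cone of `f`. Since the cone is
  -- contractible it reduces to `C`; the usual deformation of a cylinder onto its target reduces it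
  -- to `D`.
  refine ⟨Cx.ext C e.cone (elimV 0 (ofSh C.B)) hτ (good_elimV Good.zero good_ofSh),
    ⟨Cx.extRed _ _ _ hτ _ c hc hcc gc⟩, ⟨?_⟩⟩
  exact
    { α := cylα e.f
      β := inrV _ _ ∘ₗ inlV _ _
      η := cylη C.B D.B
      α_d := cyl_α_d e.f_d
      β_d v := by
        change inrV _ _ (inlV _ _ (D.d v)) = cylD C.d D.d e.f (inrV _ _ (inlV _ _ v))
        simp
      α_β v := by
        change elimV e.f (elimV LinearMap.id 0) (inrV C.B (D.B ⊕ Sh C.B) (inlV D.B (Sh C.B) v)) = v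
        simp
      α_η := cyl_α_η
      η_β v := by
        change cylη C.B D.B (inrV _ _ (inlV _ _ v)) = 0
        simp [cylη]
      η_η := cyl_η_η
      hty := cyl_hty
      good_α := good_elimV e.good_f (good_elimV Good.id Good.zero)
      good_β := good_inrV.comp good_inlV (by norm_num)
      good_η := good_elimV (good_inrV.comp (good_inrV.comp good_toSh rfl) (by norm_num)) Good.zero }

end cyl

end

/-! ### Homological perturbation theory -/

section

open Coded Finsupp CSet

/-! ### Perturbation lemmas -/

section

variable {s : Prop} {C D M : Cx.{u} s}

/-- Perturbation of the differential. -/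
def Cx.pert (C : Cx.{u} s) (δ : V C.B →ₗ[ℤ] V C.B)
    (h : ∀ v, C.d (δ v) + δ (C.d v) + δ (δ v) = 0) (g : Good False (-1) δ) : Cx.{u} False where
  B := C.B
  d := C.d + δ
  d_d v := by
    simp only [LinearMap.add_apply, map_add, C.d_d]
    linear_combination (norm := abel) h v
  good := C.good.weaken.add g

/-- The easy perturbation lemma. -/
theorem Red.easy_perturbation (r : Red M C) (δ : V C.B →ₗ[ℤ] V C.B)
    (h : ∀ v, C.d (δ v) + δ (C.d v) + δ (δ v) = 0) (g : Good False (-1) δ)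
    (hl : Spt (fun a b => lab b < lab a) δ) (hs : s) :
    ∃ (δ' : V M.B →ₗ[ℤ] V M.B) (h' : ∀ v, M.d (δ' v) + δ' (M.d v) + δ' (δ' v) = 0)
      (g' : Good False (-1) δ'), Spt (fun a b => lab b < lab a) δ' ∧
      Nonempty (Red (M.pert δ' h' g') (C.pert δ h g)) := by
  have h' : ∀ v, M.d ((r.β ∘ₗ δ ∘ₗ r.α) v) + (r.β ∘ₗ δ ∘ₗ r.α) (M.d v) +
      (r.β ∘ₗ δ ∘ₗ r.α) ((r.β ∘ₗ δ ∘ₗ r.α) v) = 0 := by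
    intro v
    simp only [LinearMap.comp_apply, r.α_β, r.α_d, ← r.β_d, ← map_add, h, map_zero]
  -- The perturbation of the small complex is copied into the big one as `β δ α`. Because `α β = 1`,
  -- `α η = 0` and `η β = 0`, the same three maps remain a reduction. Since `α` and `β` preserve
  -- labels, the copy still lowers them, as the basic perturbation lemma will require.
  refine ⟨r.β ∘ₗ δ ∘ₗ r.α, h', r.good_β.weaken.comp (g.comp r.good_α.weaken rfl) (by norm_num), ?_, ⟨?_⟩⟩
  · refine r.good_β.spt.comp (hl.comp (T := fun a b => lab b < lab a) r.good_α.spt ?_) ?_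
    · intro a b c h1 h2
      have := h1.2 hs; omega
    · intro a b c h1 h2
      have := h2.2 hs; omega
  · exact
      { α := r.α
        β := r.β
        η := r.η
        α_d := fun v : V M.B => by
          change r.α (M.d v + r.β (δ (r.α v))) = C.d (r.α v) + δ (r.α v)
          rw [map_add, r.α_d, r.α_β]
        β_d := fun v : V C.B => by
          change r.β (C.d v + δ v) = M.d (r.β v) + r.β (δ (r.α (r.β v)))
          rw [map_add, r.β_d, r.α_β]
        α_β := r.α_β
        α_η := r.α_η
        η_β := r.η_β
        η_η := r.η_η
        hty := fun v : V M.B => by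
          change (M.d (r.η v) + r.β (δ (r.α (r.η v)))) + r.η (M.d v + r.β (δ (r.α v))) = v - r.β (r.α v)
          rw [r.α_η, map_zero, map_zero, map_add, r.η_β, add_zero, add_zero, r.hty]
        good_α := r.good_α.weaken
        good_β := r.good_β.weaken
        good_η := r.good_η.weaken }

section series

variable {B : Type*} (δ η : V B →ₗ[ℤ] V B)

/-- The partial sums of the series `∑ (-δη)^k δ`. -/
def pser (n : ℕ) : V B →ₗ[ℤ] V B :=
  match n with
  | 0 => 0
  | n + 1 => δ - δ ∘ₗ η ∘ₗ pser n

/-- Peeling off the factors from the right instead of from the left; this yields the second fixed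
point equation of the series. -/
theorem pser_succ' (n : ℕ) : pser δ η (n + 1) = δ - pser δ η n ∘ₗ η ∘ₗ δ := by
  induction n with
  | zero => simp [pser]
  | succ n ih =>
    conv_lhs => rw [pser, ih]
    refine LinearMap.ext fun v => ?_
    simp [pser]

variable [CSet B]

/-- The sum of the series `∑ (-δη)^k δ`. -/
def ser : V B →ₗ[ℤ] V B := Finsupp.linearCombination ℤ fun b => pser δ η (lab b) (single b 1)

variable {δ η} (hδ : Spt (fun a b : B => lab b < lab a) δ) (hη : Spt (fun a b : B => lab b = lab a) η)

include hδ hη in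
-- The `n`-th term of the series contains `n + 1` factors `δ`, each lowering the label by at least
-- one, while `η` preserves it.
theorem spt_pser_sub (n : ℕ) :
    Spt (fun a b : B => lab b + n < lab a) (pser δ η (n + 1) - pser δ η n) := by
  induction n with
  | zero => simpa [pser] using hδ
  | succ n ih =>
    have e : pser δ η (n + 1 + 1) - pser δ η (n + 1) = (-1 : ℤ) • (δ ∘ₗ η ∘ₗ (pser δ η (n + 1) - pser δ η n)) := by
      refine LinearMap.ext fun v => ?_
      simp [pser]
    rw [e]
    refine Spt.smul (hδ.comp (hη.comp (T := fun a b => lab b + n < lab a) ih ?_) ?_) _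
    · intro a b c h1 h2; omega
    · intro a b c h1 h2; omega

include hδ hη in
-- Labels are natural numbers, so all terms from index `lab b` on vanish on `b`.
theorem pser_stable {b : B} {n : ℕ} (h : lab b ≤ n) : pser δ η n (single b 1) = pser δ η (lab b) (single b 1) := by
  induction n, h using Nat.le_induction with
  | base => rfl
  | succ n hn ih =>
    rw [← ih, ← sub_eq_zero, ← LinearMap.sub_apply]
    ext c
    by_contra hc
    have := spt_pser_sub hδ hη n b c hc
    omega

include hδ hη in
theorem ser_eq {v : V B} {n : ℕ} (h : ∀ b, v b ≠ 0 → lab b ≤ n) : ser δ η v = pser δ η n v := by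
  rw [← Finsupp.sum_single v, map_finsuppSum, map_finsuppSum, Finsupp.sum, Finsupp.sum]
  refine Finset.sum_congr rfl fun b hb => ?_
  have e : single b (v b) = v b • single b (1 : ℤ) := by simp
  rw [e, map_zsmul, map_zsmul, pser_stable hδ hη (h b (Finsupp.mem_support_iff.1 hb))]
  simp [ser]

include hδ hη in
-- This equation and `ser_eq₂` say that the series `A` is `δ (1 + η δ)⁻¹`, written without an
-- inverse. They are all that the basic perturbation lemma uses about `A`, apart from its being
-- computable of degree `-1`.
theorem ser_eq₁ (v : V B) : ser δ η v = δ v - δ (η (ser δ η v)) := by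
  suffices h : ser δ η = δ - δ ∘ₗ η ∘ₗ ser δ η from LinearMap.congr_fun h v
  ext1 b
  ext1
  have e := pser_stable hδ hη (Nat.le_succ (lab b))
  simp only [LinearMap.comp_apply, lsingle_apply, LinearMap.sub_apply]
  rw [ser, linearCombination_single, one_smul]
  conv_lhs => rw [← e, Nat.succ_eq_add_one, pser]
  rfl

include hδ hη in
theorem ser_eq₂ (v : V B) : ser δ η v = δ v - ser δ η (η (δ v)) := by
  suffices h : ser δ η = δ - ser δ η ∘ₗ η ∘ₗ δ from LinearMap.congr_fun h v
  ext1 b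
  ext1
  have e := pser_stable hδ hη (Nat.le_succ (lab b))
  simp only [LinearMap.comp_apply, lsingle_apply, LinearMap.sub_apply]
  -- All basis elements in `η (δ b)` have label below `lab b`, so the partial sum of length `lab b`
  -- already computes the series there.
  rw [ser_eq hδ hη (v := η (δ (single b 1))) (n := lab b), ser, linearCombination_single, one_smul,
    ← e, pser_succ']
  · rfl
  · intro c hc
    obtain ⟨a, ha, h1⟩ := hη.apply hc
    have := hδ b a ha
    omega

/-- The number of summands needed on `b` is the computable number `lab b`, so the infinite series is
evaluated by a primitive recursion. -/
theorem cm_ser (cδ : Cm δ) (cη : Cm η) : Cm (ser δ η) := by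
  refine Cm.linear ?_
  have h := Cm.nat_rec (X := B) (n := fun b => lab b) (z := fun _ => (0 : V B))
    (s := fun p : B × ℕ × V B => δ (single p.1 1) - δ (η p.2.2)) (by fun_prop)
    (Cm.v_sub (cδ.comp (by fun_prop)) (cδ.comp (cη.comp (by fun_prop)))) (by fun_prop)
  refine h.congr fun b => ?_
  rw [ser, linearCombination_single, one_smul]
  induction lab b with
  | zero => rfl
  | succ n ih => simp [pser, ih]

end series

/-- The basic perturbation lemma. -/
theorem Red.basic_perturbation (r : Red M D) (δ : V M.B →ₗ[ℤ] V M.B)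
    (h : ∀ v, M.d (δ v) + δ (M.d v) + δ (δ v) = 0) (g : Good False (-1) δ)
    (hl : Spt (fun a b => lab b < lab a) δ) (hs : s) :
    ∃ (δ' : V D.B →ₗ[ℤ] V D.B) (h' : ∀ v, D.d (δ' v) + δ' (D.d v) + δ' (δ' v) = 0)
      (g' : Good False (-1) δ'), Nonempty (Red (M.pert δ h g) (D.pert δ' h' g')) := by
  have hη : Spt (fun a b : M.B => lab b = lab a) r.η := r.good_η.spt.mono fun _ _ h => h.2 hs
  -- With `A = δ - δηδ + ⋯`, the perturbed data are `δ' = αAβ`, `α' = α - αAη`, `β' = β - ηAβ` and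
  -- `η' = η - ηAη`.
  obtain ⟨A, hA⟩ : ∃ A, A = ser δ r.η := ⟨_, rfl⟩
  have A1 : ∀ v, A v = δ v - δ (r.η (A v)) := hA ▸ ser_eq₁ hl hη
  have A2 : ∀ v, A v = δ v - A (r.η (δ v)) := hA ▸ ser_eq₂ hl hη
  have gA : Good False (-1) A := by
    refine ⟨?_, hA ▸ cm_ser g.cm r.good_η.cm⟩
    have hp : ∀ n, Good False (-1) (pser δ r.η n) := by
      intro n
      induction n with
      | zero => exact Good.zero
      | succ n ih => exact g.sub (g.comp (r.good_η.weaken.comp ih rfl) (by norm_num))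
    rw [hA]
    exact Spt.lin fun a b hab => (hp _).spt a b hab
  -- The condition that `d + δ` squares to zero, rewritten for `A`. Applying `α` and `β` on the two
  -- sides gives the square-zero condition for `d + αAβ`, and every differential identity of the new
  -- reduction follows from it and the two fixed point equations.
  have key : ∀ v, A (r.β (r.α (A v))) + A (M.d v) + M.d (A v) = 0 := by
    intro v
    have h1 := h (v - r.η (A v))
    have h2 := A1 v
    rw [← map_sub] at h2
    rw [← h2] at h1
    have h3 := congrArg (fun w => A (r.η w)) h1
    have h4 := A2 (M.d (v - r.η (A v)))
    have h5 := A2 (A v)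
    have h6 := congrArg A (r.hty (A v))
    simp only [map_add, map_sub, map_zero] at h1 h3 h4 h5 h6
    linear_combination (norm := abel) h1 - h3 + h4 + h5 + h6
  have gα := r.good_α.weaken
  have gβ := r.good_β.weaken
  have gη := r.good_η.weaken
  have h' : ∀ v, D.d ((r.α ∘ₗ A ∘ₗ r.β) v) + (r.α ∘ₗ A ∘ₗ r.β) (D.d v) +
      (r.α ∘ₗ A ∘ₗ r.β) ((r.α ∘ₗ A ∘ₗ r.β) v) = 0 := by
    intro v
    have h1 := congrArg r.α (key (r.β v))
    simp only [map_add, map_zero] at h1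
    simp only [LinearMap.comp_apply, r.β_d, ← r.α_d]
    linear_combination (norm := abel) h1
  refine ⟨r.α ∘ₗ A ∘ₗ r.β, h', gα.comp (gA.comp gβ rfl) (by norm_num), ⟨?_⟩⟩
  exact
    { α := r.α - r.α ∘ₗ A ∘ₗ r.η
      β := r.β - r.η ∘ₗ A ∘ₗ r.β
      η := r.η - r.η ∘ₗ A ∘ₗ r.η
      α_d := fun v : V M.B => by
        change r.α (M.d v + δ v) - r.α (A (r.η (M.d v + δ v))) =
          D.d (r.α v - r.α (A (r.η v))) + r.α (A (r.β (r.α v - r.α (A (r.η v)))))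
        have h1 := congrArg r.α (A2 v)
        have h2 := congrArg (fun w => r.α (A w)) (r.hty v)
        have h3 := congrArg r.α (key (r.η v))
        simp only [map_add, map_sub, map_zero, r.α_d, ] at h1 h2 h3 ⊢
        linear_combination (norm := abel) h3 - h1 - h2
      β_d := fun v : V D.B => by
        change r.β (D.d v + r.α (A (r.β v))) - r.η (A (r.β (D.d v + r.α (A (r.β v))))) =
          M.d (r.β v - r.η (A (r.β v))) + δ (r.β v - r.η (A (r.β v)))
        have h1 := A1 (r.β v)
        have h2 := r.hty (A (r.β v))
        have h3 := congrArg r.η (key (r.β v))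
        simp only [map_add, map_sub, map_zero, r.β_d] at h1 h2 h3 ⊢
        linear_combination (norm := abel) h1 + h2 - h3
      α_β := fun v : V D.B => by
        change r.α (r.β v - r.η (A (r.β v))) - r.α (A (r.η (r.β v - r.η (A (r.β v))))) = v
        simp only [map_sub, r.α_β, r.α_η, r.η_β, r.η_η, map_zero, sub_zero]
      α_η := fun v : V M.B => by
        change r.α (r.η v - r.η (A (r.η v))) - r.α (A (r.η (r.η v - r.η (A (r.η v))))) = 0
        simp only [map_sub, r.α_η, r.η_η, map_zero, sub_zero]
      η_β := fun v : V D.B => by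
        change r.η (r.β v - r.η (A (r.β v))) - r.η (A (r.η (r.β v - r.η (A (r.β v))))) = 0
        simp only [map_sub, r.η_β, r.η_η, map_zero, sub_zero]
      η_η := fun v : V M.B => by
        change r.η (r.η v - r.η (A (r.η v))) - r.η (A (r.η (r.η v - r.η (A (r.η v))))) = 0
        simp only [map_sub, r.η_η, map_zero, sub_zero]
      hty := fun v : V M.B => by
        change M.d (r.η v - r.η (A (r.η v))) + δ (r.η v - r.η (A (r.η v))) +
          (r.η (M.d v + δ v) - r.η (A (r.η (M.d v + δ v)))) =
          v - (r.β (r.α v - r.α (A (r.η v))) - r.η (A (r.β (r.α v - r.α (A (r.η v))))))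
        have h1 := r.hty v
        have h2 := A1 (r.η v)
        have h3 := congrArg r.η (A2 v)
        have h4 := r.hty (A (r.η v))
        have h5 := congrArg (fun w => r.η (A w)) (r.hty v)
        have h6 := congrArg r.η (key (r.η v))
        simp only [map_add, map_sub, map_zero] at h1 h2 h3 h4 h5 h6 ⊢
        linear_combination (norm := abel) h1 - h2 - h3 - h4 - h5 + h6
      good_α := gα.sub (gα.comp (gA.comp gη rfl) (by norm_num))
      good_β := gβ.sub (gη.comp (gA.comp gβ rfl) (by norm_num))
      good_η := gη.sub (gη.comp (gA.comp gη rfl) (by norm_num)) }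

/-- A perturbation of a complex which is homotopy equivalent to `D`, lowering the labels, is
dominated by a complex which reduces to a perturbation of `D`. -/
theorem HEq.perturbation {C D : Cx.{u} True} (e : HEq C D) (δ : V C.B →ₗ[ℤ] V C.B)
    (h : ∀ v, C.d (δ v) + δ (C.d v) + δ (δ v) = 0) (g : Good False (-1) δ)
    (hl : Spt (fun a b => lab b < lab a) δ) :
    ∃ (M : Cx.{u} False) (δ' : V D.B →ₗ[ℤ] V D.B) (h' : ∀ v, D.d (δ' v) + δ' (D.d v) + δ' (δ' v) = 0)
      (g' : Good False (-1) δ'), Nonempty (Red M (C.pert δ h g)) ∧ Nonempty (Red M (D.pert δ' h' g')) := by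
  -- The perturbation is lifted to the cylinder along the first leg, where no series is needed, and
  -- pushed down along the second leg by the series. The perturbation found on `D` need not lower
  -- labels in the conclusion, only on the cylinder.
  obtain ⟨M, ⟨r⟩, ⟨r'⟩⟩ := e.exists_red
  obtain ⟨δ', h', g', l', R⟩ := r.easy_perturbation δ h g hl trivial
  obtain ⟨δ'', h'', g'', R'⟩ := r'.basic_perturbation δ' h' g' l' trivial
  exact ⟨_, δ'', h'', g'', R, R'⟩

end

end

/-! ### Direct sums of shifted pieces of a finite family of complexes -/

section

open Coded Finsupp CSet

/-! ### Definitions by finitely many cases -/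

section glue

variable {I X C : Type*} [Coded I] [CEq I] [Coded X] [Coded C]

/-- A function is computable if it is so on each of finitely many decidable pieces. -/
theorem Cm.glue [Finite I] {c : X → I} (hc : Cm c) {f : X → C}
    (h : ∀ i, Cm fun x : {x // c x = i} => f x.1) : Cm f :=
  (Cm.sigma_finite (F := fun i => {x // c x = i}) h).comp
    (f := fun x => (⟨c x, ⟨x, rfl⟩⟩ : Σ i, {x // c x = i})) (Cm.sigma_mk hc Cm.id)

/-- For case distinctions in which each branch uses the hypothesis of its case: the branches only
have to be computable on the corresponding subtypes. -/
theorem Cm.glue_prop {P : X → Prop} (hP : CmP P) {f : X → C} (h1 : Cm fun x : {x // P x} => f x.1)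
    (h2 : Cm fun x : {x // ¬ P x} => f x.1) : Cm f := by
  classical
  have hP' : Cm fun x => decide (P x) := hP
  refine Cm.glue hP' fun i => ?_
  cases i with
  | true =>
    exact h1.comp (f := fun x : {x // decide (P x) = true} => (⟨x.1, of_decide_eq_true x.2⟩ : {x // P x})) Cm.val
  | false =>
    exact h2.comp (f := fun x : {x // decide (P x) = false} => (⟨x.1, of_decide_eq_false x.2⟩ : {x // ¬ P x}))
      Cm.val

/-- Transport along an equality of indices. -/
def tr {I : Type*} (F : I → Type*) {i j : I} (h : i = j) (b : F i) : F j := h ▸ b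

@[simp] theorem tr_rfl {I : Type*} (F : I → Type*) {i : I} (b : F i) : tr F rfl b = b := rfl

/-- Transports leave codes unchanged, so algorithms may ignore them. -/
theorem isCode_tr {I : Type*} {F : I → Type*} [∀ i, Coded (F i)] {i j : I} (h : i = j) {k : ℕ}
    {b : F i} (hk : IsCode k b) : IsCode k (tr F h b) := by
  subst h; exact hk

end glue

/-! ### Pulling back a finite family of complexes -/

section pull

variable {I J : Type*} (π : J → I) (q : J → ℕ)

/-- Pairs of an element `j` of `J` and a basis element over `π j` with label `q j`. -/
abbrev PB (A : I → Type*) [∀ i, CSet (A i)] := Σ j : J, {b : A (π j) // lab b = q j}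

variable {A B C : I → Type*} [∀ i, CSet (A i)] [∀ i, CSet (B i)] [∀ i, CSet (C i)]

/-- The part with label `q j` of a chain, put over `j`. -/
def inP (j : J) : V (A (π j)) →ₗ[ℤ] V (PB π q A) :=
  Finsupp.lmapDomain ℤ ℤ (Sigma.mk j) ∘ₗ Finsupp.lsubtypeDomain {b | lab b = q j}

theorem inP_single {j : J} {b : A (π j)} (h : lab b = q j) (z : ℤ) :
    inP π q j (single b z) = single ⟨j, b, h⟩ z := by
  have : Finsupp.lsubtypeDomain (R := ℤ) {b | lab b = q j} (single b z) =
      single (⟨b, h⟩ : {b : A (π j) // lab b = q j}) z := by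
    ext c
    classical
    change (single b z) c.1 = _
    rw [Finsupp.single_apply, Finsupp.single_apply]
    exact if_congr ⟨fun e => Subtype.ext e, fun e => congrArg Subtype.val e⟩ rfl rfl
  simp only [inP, LinearMap.comp_apply, this]
  simp

theorem inP_single_of_ne {j : J} {b : A (π j)} (h : lab b ≠ q j) (z : ℤ) :
    inP π q j (single b z) = 0 := by
  have : Finsupp.lsubtypeDomain (R := ℤ) {b | lab b = q j} (single b z) = 0 := by
    ext ⟨c, hc⟩
    have : b ≠ c := by rintro rfl; exact h hc
    simp [Finsupp.lsubtypeDomain, this]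
  simp only [inP, LinearMap.comp_apply, this, map_zero]

theorem inP_apply (j : J) (v : V (A (π j))) (b : A (π j)) (h : lab b = q j) :
    inP π q j v ⟨j, b, h⟩ = v b := by
  simp only [inP, LinearMap.comp_apply, lmapDomain_apply]
  rw [mapDomain_apply sigma_mk_injective]
  rfl

theorem inP_apply_ne {j : J} {v : V (A (π j))} {x : PB π q A} (h : inP π q j v x ≠ 0) :
    ∃ (e : x.1 = j), v (e ▸ x.2.1) ≠ 0 := by
  obtain ⟨j', b, hb⟩ := x
  by_cases hj : j' = j
  · subst hj
    rw [inP_apply] at h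
    exact ⟨rfl, h⟩
  · exfalso
    apply h
    simp only [inP, LinearMap.comp_apply, lmapDomain_apply]
    refine mapDomain_of_notMem_range _ _ ?_
    rintro ⟨c, hc⟩
    exact hj (congrArg Sigma.fst hc).symm

theorem pull_induction {P : V (PB π q A) → Prop} (h0 : P 0) (h : ∀ j v, P (inP π q j v))
    (hadd : ∀ v w, P v → P w → P (v + w)) (v : V (PB π q A)) : P v := by
  induction v using Finsupp.induction_linear with
  | zero => exact h0
  | add v w hv hw => exact hadd v w hv hw
  | single x z =>
    obtain ⟨j, b, hb⟩ := x
    rw [← inP_single π q hb]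
    exact h _ _

/-- The map induced on the pull-backs by a family of maps. -/
def pullV (f : ∀ i, V (A i) →ₗ[ℤ] V (B i)) : V (PB π q A) →ₗ[ℤ] V (PB π q B) :=
  Finsupp.linearCombination ℤ fun x => inP π q x.1 (f (π x.1) (single x.2.1 1))

variable {π q} {k : ℤ}

/-- Cutting a chain down to its part of label `q j` commutes with every map that preserves labels.
All identities for pull-backs are deduced from the corresponding identities over each `i` through
this rule. -/
theorem pullV_inP {f : ∀ i, V (A i) →ₗ[ℤ] V (B i)} (hf : ∀ i, Good True k (f i)) (j : J)
    (v : V (A (π j))) : pullV π q f (inP π q j v) = inP π q j (f (π j) v) := by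
  suffices h : pullV π q f ∘ₗ inP π q j = inP π q j ∘ₗ f (π j) from LinearMap.congr_fun h v
  ext1 b
  ext1
  simp only [LinearMap.comp_apply, lsingle_apply]
  by_cases hb : lab b = q j
  · rw [inP_single π q hb]
    simp [pullV]
  · rw [inP_single_of_ne π q hb, map_zero]
    symm
    by_contra hne
    obtain ⟨x, hx⟩ := Finsupp.ne_iff.1 hne
    obtain ⟨j', c, hc⟩ := x
    obtain ⟨rfl, h2⟩ := inP_apply_ne π q hx
    exact hb (((hf _).spt b c h2).2 trivial ▸ hc)

theorem pullV_comm {D : I → Type*} [∀ i, CSet (D i)] {k l k' l' : ℤ}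
    {f : ∀ i, V (A i) →ₗ[ℤ] V (B i)} {g : ∀ i, V (B i) →ₗ[ℤ] V (D i)}
    {f' : ∀ i, V (A i) →ₗ[ℤ] V (C i)} {g' : ∀ i, V (C i) →ₗ[ℤ] V (D i)}
    (hf : ∀ i, Good True k (f i)) (hg : ∀ i, Good True l (g i)) (hf' : ∀ i, Good True k' (f' i))
    (hg' : ∀ i, Good True l' (g' i)) (h : ∀ i v, g i (f i v) = g' i (f' i v)) (v : V (PB π q A)) :
    pullV π q g (pullV π q f v) = pullV π q g' (pullV π q f' v) := by
  induction v using pull_induction with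
  | h0 => simp only [map_zero]
  | h j v => rw [pullV_inP hf, pullV_inP hg, pullV_inP hf', pullV_inP hg', h]
  | hadd v w hv hw => simp only [map_add, hv, hw]

theorem pullV_zero_sq {l : ℤ} {f : ∀ i, V (A i) →ₗ[ℤ] V (B i)} {g : ∀ i, V (B i) →ₗ[ℤ] V (C i)}
    (hf : ∀ i, Good True k (f i)) (hg : ∀ i, Good True l (g i)) (h : ∀ i v, g i (f i v) = 0)
    (v : V (PB π q A)) : pullV π q g (pullV π q f v) = 0 := by
  induction v using pull_induction with
  | h0 => simp only [map_zero]
  | h j v => rw [pullV_inP hf, pullV_inP hg, h, map_zero]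
  | hadd v w hv hw => rw [map_add, map_add, hv, hw, add_zero]

theorem pullV_hty {k l m n : ℤ} {d h : ∀ i, V (A i) →ₗ[ℤ] V (A i)}
    {f : ∀ i, V (A i) →ₗ[ℤ] V (B i)} {g : ∀ i, V (B i) →ₗ[ℤ] V (A i)}
    (hd : ∀ i, Good True k (d i)) (hh : ∀ i, Good True l (h i)) (hf : ∀ i, Good True m (f i))
    (hg : ∀ i, Good True n (g i)) (H : ∀ i v, d i (h i v) + h i (d i v) = v - g i (f i v))
    (v : V (PB π q A)) :
    pullV π q d (pullV π q h v) + pullV π q h (pullV π q d v) =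
      v - pullV π q g (pullV π q f v) := by
  induction v using pull_induction with
  | h0 => simp only [map_zero, add_zero, sub_zero]
  | h j v => rw [pullV_inP hh, pullV_inP hd, pullV_inP hd, pullV_inP hh, pullV_inP hf,
      pullV_inP hg, ← map_add, H, map_sub]
  | hadd v w hv hw =>
    simp only [map_add]
    linear_combination (norm := abel) hv + hw

variable [Coded I] [CEq I] [Finite I] [Coded J] [CEq J]

/-- Functions of the elements of a pull-back may be defined separately over the elements of `I`. -/
theorem Cm.pull {D : Type*} [Coded D] (hπ : Cm π) {f : PB π q A → D}
    (g : ∀ i, {j // π j = i} × A i → D) (hg : ∀ i, Cm (g i))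
    (h : ∀ x : PB π q A, f x = g (π x.1) (⟨x.1, rfl⟩, x.2.1)) : Cm f := by
  refine Cm.glue (c := fun x : PB π q A => π x.1) (hπ.comp Cm.sigma_fst) fun i => ?_
  refine ((hg i).comp (f := fun x : {x : PB π q A // π x.1 = i} =>
    ((⟨x.1.1, x.2⟩ : {j // π j = i}), tr A x.2 x.1.2.1)) ?_).congr ?_
  · refine Cm.pair (Cm.sigma_fst.comp Cm.val) ⟨_, partrec_unpair_snd, ?_⟩
    rintro k ⟨x, hx⟩ hk
    exact ⟨_, Part.mem_some _, isCode_tr hx hk.2⟩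
  · rintro ⟨x, rfl⟩
    exact (h x).symm

theorem CEq.pull (hπ : Cm π) : CEq (PB π q A) := by
  have := fun i => (inferInstance : CEq (A i))
  refine CEq.of_injective (B := J × Σ i, A i) (f := fun x => (x.1, ⟨π x.1, x.2.1⟩)) ?_ ?_
  · refine Cm.pair Cm.sigma_fst (Cm.pull hπ (fun i p => ⟨i, p.2⟩) (fun i => Cm.sigma_mk_const i Cm.snd)
      fun x => rfl)
  · rintro ⟨j, b, hb⟩ ⟨j', b', hb'⟩ h
    simp only [Prod.mk.injEq] at h
    obtain ⟨rfl, h⟩ := h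
    simp only [Sigma.mk.injEq, heq_eq_eq, true_and] at h
    subst h
    rfl

/-- The graded computable structure of a pull-back. -/
@[reducible] def CSet.pull (hπ : Cm π) (hq : Cm q) : CSet (PB π q A) where
  deg x := deg x.2.1
  lab x := q x.1
  ceq := CEq.pull hπ
  cm_deg := Cm.pull hπ (fun i p => deg p.2) (fun i => by fun_prop) fun _ => rfl
  cm_lab := hq.comp Cm.sigma_fst

/-- Uniform in the infinitely many `j` over a fixed `i`: the code of a basis element is paired with
the code of `j`, after testing whether its label is `q j`. -/
theorem cm_inP (hq : Cm q) (i : I) : Cm fun p : {j // π j = i} × V (B i) => inP π q p.1.1 (tr (fun i => V (B i)) p.1.2.symm p.2) := by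
  classical
  have hlin := Cm.linear_param (X := {j // π j = i}) (B := B i) (A := PB π q B)
    (L := fun j => inP π q j.1 ∘ₗ tr (fun k => V (B i) →ₗ[ℤ] V (B k)) j.2.symm LinearMap.id) ?_
  · refine hlin.congr ?_
    rintro ⟨⟨j, rfl⟩, v⟩
    rfl
  · refine Cm.glue_prop (P := fun p : {j // π j = i} × B i => lab p.2 = q p.1.1)
      (CmP.eq (by fun_prop) (by fun_prop)) ?_ ?_
    · refine (Cm.v_single (b := fun p : {p : {j // π j = i} × B i // lab p.2 = q p.1.1} =>
        (⟨p.1.1.1, ⟨tr B p.1.1.2.symm p.1.2, by obtain ⟨⟨⟨j, rfl⟩, b⟩, h⟩ := p; exact h⟩⟩ : PB π q B))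
        ?_ (Cm.const 1)).congr ?_
      · refine ⟨Part.some, Partrec.some, ?_⟩
        rintro k ⟨⟨⟨j, rfl⟩, b⟩, h⟩ hk
        exact ⟨k, Part.mem_some k, hk⟩
      · rintro ⟨⟨⟨j, rfl⟩, b⟩, h⟩
        exact (inP_single π q h 1).symm
    · refine (Cm.const 0).congr ?_
      rintro ⟨⟨⟨j, rfl⟩, b⟩, h⟩
      exact (inP_single_of_ne π q h 1).symm

theorem Good.pull (hπ : Cm π) (hq : Cm q) {f : ∀ i, V (A i) →ₗ[ℤ] V (B i)}
    (hf : ∀ i, Good True k (f i)) :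
    letI := CSet.pull (A := A) hπ hq
    letI := CSet.pull (A := B) hπ hq
    Good True k (pullV π q f) := by
  let _ := CSet.pull (A := A) hπ hq
  let _ := CSet.pull (A := B) hπ hq
  refine Good.lin (Cm.pull hπ (fun i p => inP π q p.1.1 (tr (fun i => V (B i)) p.1.2.symm (f i (single p.2 1)))) (fun i => ?_)
    fun x => rfl) ?_
  · exact (cm_inP hq i).comp (Cm.pair Cm.fst ((hf i).cm.comp (by fun_prop)))
  · rintro ⟨j, a, ha⟩ ⟨j', b, hb⟩ h
    obtain ⟨e, h⟩ := inP_apply_ne π q h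
    obtain rfl : j' = j := e
    have := (hf _).spt a b h
    exact ⟨this.1, fun _ => rfl⟩

/-- The pull-back of a finite family of complexes. -/
def Cx.pull (F : I → Cx.{u} True) {J : Type u} [Coded J] [CEq J] {π : J → I} {q : J → ℕ} (hπ : Cm π)
    (hq : Cm q) : Cx.{u} True where
  B := PB π q fun i => (F i).B
  inst := CSet.pull hπ hq
  d := pullV π q fun i => (F i).d
  d_d := pullV_zero_sq (fun i => (F i).good) (fun i => (F i).good) fun i => (F i).d_d
  good := Good.pull hπ hq fun i => (F i).good

/-- Pull-back preserves homotopy equivalences. -/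
def HEq.pull {F G : I → Cx.{u} True} (e : ∀ i, HEq (F i) (G i)) {J : Type u} [Coded J] [CEq J]
    {π : J → I} {q : J → ℕ} (hπ : Cm π) (hq : Cm q) : HEq (Cx.pull F hπ hq) (Cx.pull G hπ hq) where
  f := pullV π q fun i => (e i).f
  g := pullV π q fun i => (e i).g
  h := pullV π q fun i => (e i).h
  k := pullV π q fun i => (e i).k
  f_d := pullV_comm (A := fun i => (F i).B) (B := fun i => (F i).B) (C := fun i => (G i).B)
    (D := fun i => (G i).B) (f := fun i => (F i).d) (g := fun i => (e i).f) (f' := fun i => (e i).f)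
    (g' := fun i => (G i).d) (fun i => (F i).good) (fun i => (e i).good_f) (fun i => (e i).good_f)
    (fun i => (G i).good) fun i => (e i).f_d
  g_d := pullV_comm (A := fun i => (G i).B) (B := fun i => (G i).B) (C := fun i => (F i).B)
    (D := fun i => (F i).B) (f := fun i => (G i).d) (g := fun i => (e i).g) (f' := fun i => (e i).g)
    (g' := fun i => (F i).d) (fun i => (G i).good) (fun i => (e i).good_g) (fun i => (e i).good_g)
    (fun i => (F i).good) fun i => (e i).g_d
  hty_h := pullV_hty (A := fun i => (F i).B) (B := fun i => (G i).B) (d := fun i => (F i).d)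
    (h := fun i => (e i).h) (f := fun i => (e i).f) (g := fun i => (e i).g)
    (fun i => (F i).good) (fun i => (e i).good_h) (fun i => (e i).good_f)
    (fun i => (e i).good_g) fun i => (e i).hty_h
  hty_k := pullV_hty (A := fun i => (G i).B) (B := fun i => (F i).B) (d := fun i => (G i).d)
    (h := fun i => (e i).k) (f := fun i => (e i).g) (g := fun i => (e i).f)
    (fun i => (G i).good) (fun i => (e i).good_k) (fun i => (e i).good_g)
    (fun i => (e i).good_f) fun i => (e i).hty_k
  good_f := Good.pull hπ hq fun i => (e i).good_f
  good_g := Good.pull hπ hq fun i => (e i).good_g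
  good_h := Good.pull hπ hq fun i => (e i).good_h
  good_k := Good.pull hπ hq fun i => (e i).good_k

end pull

/-! ### Bases which are finite in every degree -/

/-- The elements of any given degree are finite in number and listed by an algorithm. -/
def FinB (B : Type*) [CSet B] : Prop := ∃ L : ℕ → List B, Cm L ∧ ∀ n b, b ∈ L n ↔ deg b = n

end

/-! ### Encoded chain complexes and their presentations by coded bases -/

section

open Coded Finsupp CSet

/-! ### Sequences of encodings -/

section tt

variable {A B : ℕ → Type*}

/-- The disjoint union of a sequence of encoded sets. -/
structure Tt (_ : ∀ n, Coding (A n)) where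
  fst : ℕ
  snd : A fst

instance (K : ∀ n, Coding (A n)) : Coded (Tt K) where
  IsCode k p := k.unpair.1 = p.1 ∧ (K p.1).IsCode k.unpair.2 p.2
  exists_isCode p := by
    obtain ⟨k, hk⟩ := (K p.1).exists_isCode p.2
    exact ⟨Nat.pair p.1 k, by simpa using hk⟩
  eq_of_isCode := by
    rintro k ⟨n, a⟩ ⟨m, b⟩ ⟨h1, h2⟩ ⟨h3, h4⟩
    obtain rfl : n = m := h1.symm.trans h3
    obtain rfl := (K n).eq_of_isCode _ _ _ h2 h4
    rfl

variable {K : ∀ n, Coding (A n)} {L : ∀ n, Coding (B n)}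

@[fun_prop]
theorem Cm.tt_fst : Cm fun p : Tt K => p.1 :=
  ⟨_, partrec_unpair_fst, fun _ _ h => ⟨_, Part.mem_some _, h.1⟩⟩

theorem partrec_natPair {α : Type*} [Primcodable α] {f g : α → ℕ} (hf : Computable f)
    (hg : Computable g) : Computable fun x => Nat.pair (f x) (g x) :=
  Primrec₂.natPair.to_comp.comp hf hg

theorem tt_isCode_pair {n k : ℕ} {a : A n} : IsCode (Nat.pair n k) (⟨n, a⟩ : Tt K) ↔ (K n).IsCode k a := by
  change (Nat.pair n k).unpair.1 = n ∧ (K n).IsCode (Nat.pair n k).unpair.2 a ↔ _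
  simp

theorem cm_tt_iff {Y : Type*} [Coded Y] {f : Tt K → Y} :
    Cm f ↔ ∃ φ : ℕ × ℕ →. ℕ, Partrec φ ∧ ∀ n k (a : A n), (K n).IsCode k a →
      ∃ l ∈ φ (n, k), IsCode l (f ⟨n, a⟩) := by
  constructor
  · rintro ⟨φ, h1, h2⟩
    exact ⟨fun p => φ (Nat.pair p.1 p.2), h1.comp (partrec_natPair Computable.fst Computable.snd),
      fun n k a h => h2 _ _ (tt_isCode_pair.2 h)⟩
  · rintro ⟨φ, h1, h2⟩
    refine ⟨fun k => φ k.unpair, h1.comp Computable.unpair, ?_⟩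
    rintro k ⟨n, a⟩ ⟨rfl, h⟩
    exact h2 _ _ a h

/-- Bridge between algorithms taking the degree as a separate input and computable functions on the
disjoint union of all degrees; `e` accounts for maps that change the degree. -/
theorem computableMaps_iff {e : ℕ → ℕ} (he : Computable e) {f : ∀ n, A n → B (e n)} :
    ComputableMaps K (fun n => L (e n)) f ↔ Cm (fun p : Tt K => (⟨e p.1, f p.1 p.2⟩ : Tt L)) := by
  rw [cm_tt_iff]
  constructor
  · rintro ⟨φ, h1, h2⟩
    refine ⟨fun p => (φ p).map fun l => Nat.pair (e p.1) l, h1.map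
      (partrec_natPair (he.comp (Computable.fst.comp Computable.fst)) Computable.snd).to₂, ?_⟩
    intro n k a h
    obtain ⟨l, hl, h3⟩ := h2 n k a h
    exact ⟨_, Part.mem_map _ hl, tt_isCode_pair.2 h3⟩
  · rintro ⟨φ, h1, h2⟩
    refine ⟨fun p => (φ p).map fun l => l.unpair.2, h1.map
      (Computable.snd.comp (Computable.unpair.comp Computable.snd)).to₂, ?_⟩
    intro n k a h
    obtain ⟨l, hl, h3⟩ := h2 n k a h
    exact ⟨_, Part.mem_map _ hl, h3.2⟩

@[fun_prop]
theorem Cm.tt_succ : Cm fun p : Tt (fun n => K (n + 1)) => (⟨p.1 + 1, p.2⟩ : Tt K) := by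
  have h : Computable fun k : ℕ => Nat.pair (k.unpair.1 + 1) k.unpair.2 :=
    partrec_natPair (Computable.succ.comp (Computable.fst.comp Computable.unpair))
      (Computable.snd.comp Computable.unpair)
  refine ⟨_, h.partrec, ?_⟩
  rintro k ⟨n, a⟩ ⟨h1, h2⟩
  refine ⟨_, Part.mem_some _, ?_⟩
  obtain rfl : k.unpair.1 = n := h1
  exact tt_isCode_pair.2 h2

/-- Reading the code of a list of coefficients and homogeneous elements. -/
theorem exists_decode_list : ∃ D : ℕ → List (ℤ × ℕ), Computable D ∧ ∀ (n k : ℕ) (s : List (ℤ × A n)),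
    IsCode k (s.map fun q => ((q.1, ⟨n, q.2⟩) : ℤ × Tt K)) →
      List.Forall₂ (fun p q => p.1 = q.1 ∧ (K n).IsCode p.2 q.2) (D k) s := by
  refine ⟨fun k => ((Encodable.decode (α := List ℕ) k).getD []).map fun k =>
    ((Encodable.decode (α := ℤ) k.unpair.1).getD 0, k.unpair.2.unpair.2), ?_, ?_⟩
  · refine Primrec.to_comp ?_
    refine Primrec.list_map (Primrec.option_getD.comp Primrec.decode (Primrec.const [])) ?_
    have h : Primrec fun k : ℕ => k.unpair.2 := Primrec.snd.comp Primrec.unpair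
    have h' : Primrec fun k : ℕ => k.unpair.1 := Primrec.fst.comp Primrec.unpair
    exact (Primrec.pair (Primrec.option_getD.comp (Primrec.decode.comp (h'.comp Primrec.snd))
      (Primrec.const 0)) (h.comp (h.comp Primrec.snd))).to₂
  · rintro n k s ⟨ks, rfl, h⟩
    simp only [Encodable.encodek, Option.getD_some]
    rw [List.forall₂_map_right_iff] at h
    rw [List.forall₂_map_left_iff]
    refine h.imp ?_
    rintro k ⟨z, a⟩ ⟨h1, h2⟩
    obtain h1 : k.unpair.1 = Encodable.encode z := h1
    exact ⟨by change (Encodable.decode (α := ℤ) k.unpair.1).getD 0 = z; rw [h1, Encodable.encodek]; rfl, h2.2⟩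

end tt

/-! ### Removing repetitions -/

section dedup

variable {A X : Type*} [Coded A] [Coded X] [CEq A]

theorem Cm.list_dedup [DecidableEq A] {l : X → List A} (hl : Cm l) : Cm fun x => (l x).dedup := by
  have h := Cm.list_foldr (X := X) (l := l) (c := fun _ => ([] : List A))
    (f := fun q : X × A × List A => if q.2.1 ∈ q.2.2 then q.2.2 else q.2.1 :: q.2.2)
    (Cm.ite ((CmP.exists_mem (P := fun p : (X × A × List A) × A => p.1.2.1 = p.2)
      (l := fun q => q.2.2) (CmP.eq (by fun_prop) (by fun_prop)) (by fun_prop)).congr fun q => by simp)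
      (by fun_prop) (by fun_prop)) (Cm.const []) hl
  refine h.congr fun x => ?_
  induction l x with
  | nil => rfl
  | cons a l ih =>
    rw [List.foldr_cons, ih]
    by_cases h : a ∈ l <;> simp [h]

theorem ev_eq_zero_of_notMem {l : List (ℤ × A)} {b : A} (h : ∀ q ∈ l, q.2 ≠ b) : ev l b = 0 := by
  induction l with
  | nil => rfl
  | cons q l ih =>
    simp only [List.mem_cons, forall_eq_or_imp] at h
    rw [ev_cons, Finsupp.add_apply, single_eq_of_ne' h.1, zero_add, ih h.2]

/-- A linear combination rewritten with distinct basis elements satisfying `P`. -/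
def nform (P : A → Prop) (l : List (ℤ × A)) : List (ℤ × A) := by
  classical
  exact (((l.map Prod.snd).filter fun b => P b).dedup).map fun b => (ev l b, b)

theorem nform_nodup (P : A → Prop) (l : List (ℤ × A)) : ((nform P l).map Prod.snd).Nodup := by
  classical
  simp only [nform, List.map_map]
  change (List.map (fun b => b) _).Nodup
  rw [List.map_id']
  exact List.nodup_dedup _

theorem nform_mem {P : A → Prop} {l : List (ℤ × A)} {q : ℤ × A} (h : q ∈ nform P l) : P q.2 := by
  classical
  simp only [nform, List.mem_map, List.mem_dedup, List.mem_filter] at h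
  obtain ⟨b, h, rfl⟩ := h
  simpa using h.2

theorem ev_map_nodup (v : V A) (s : List A) (hs : s.Nodup) (h : ∀ b, v b ≠ 0 → b ∈ s) :
    ev (s.map fun b => (v b, b)) = v := by
  classical
  ext b
  have key : ∀ s : List A, s.Nodup → ev (s.map fun b => (v b, b)) b = if b ∈ s then v b else 0 := by
    intro s hs
    induction s with
    | nil => rfl
    | cons a s ih =>
      rw [List.nodup_cons] at hs
      rw [List.map_cons, ev_cons, Finsupp.add_apply, ih hs.2]
      by_cases hab : a = b
      · subst hab
        simp [hs.1]
      · have hab' : ¬ b = a := fun h => hab h.symm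
        simp [Finsupp.single_apply, hab, hab']
  rw [key s hs]
  by_cases hb : b ∈ s
  · rw [if_pos hb]
  · rw [if_neg hb]
    by_contra hne
    exact hb (h b fun h0 => hne h0.symm)

/-- Collecting equal terms does not change the sum, and dropping the basis elements outside `P` does
no harm when all nonzero coefficients lie in `P`. -/
theorem ev_nform {P : A → Prop} {l : List (ℤ × A)} (h : ∀ b, ev l b ≠ 0 → P b) : ev (nform P l) = ev l := by
  classical
  refine ev_map_nodup (ev l) _ (List.nodup_dedup _) fun b hb => ?_
  simp only [List.mem_dedup, List.mem_filter, List.mem_map, decide_eq_true_eq]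
  refine ⟨?_, h b hb⟩
  by_contra hcon
  push Not at hcon
  exact hb (ev_eq_zero_of_notMem hcon)

theorem Cm.nform {P : X × A → Prop} (hP : CmP P) {l : X → List (ℤ × A)} (hl : Cm l) :
    Cm fun x => nform (fun b => P (x, b)) (l x) := by
  classical
  refine (Cm.list_map (f := fun q : X × A => (EffHom.ev (l q.1) q.2, q.2))
    (l := fun x => (((l x).map Prod.snd).filter fun b => P (x, b)).dedup) ?_ ?_).congr fun x => ?_
  · exact (Cm.v_apply ((cm_ev.comp (hl.comp Cm.fst))) Cm.snd).pair Cm.snd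
  · exact Cm.list_dedup (Cm.list_filter hP (Cm.list_map (f := fun q : X × ℤ × A => q.2.2)
      (by fun_prop) hl))
  · simp only [EffHom.nform]

end dedup

end

section

open Coded Finsupp CSet

/-! ### Presentations of chain complexes -/

/-- A presentation of an encoded chain complex by a complex with a computable basis. -/
structure Pres {C : ChainComplex AddCommGrpCat.{u} ℕ} (K : ChainCoding C) (F : Cx.{u} False) where
  toV : ∀ n, C.X n →+ V F.B
  ofV : ∀ n, V F.B →+ C.X n
  of_to : ∀ n c, ofV n (toV n c) = c
  to_of : ∀ b, toV (deg b) (ofV (deg b) (single b 1)) = single b 1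
  of_ne : ∀ n b, deg b ≠ n → ofV n (single b 1) = 0
  spt : ∀ n c b, toV n c b ≠ 0 → deg b = n
  d : ∀ n c, toV n (C.d (n + 1) n c) = F.d (toV (n + 1) c)
  cm_to : Cm fun p : Tt K => toV p.1 p.2
  cm_of : Cm fun p : ℕ × V F.B => (⟨p.1, ofV p.1 p.2⟩ : Tt K)

namespace Pres

variable {C D : ChainComplex AddCommGrpCat.{u} ℕ} {K : ChainCoding C} {L : ChainCoding D}
  {F G : Cx.{u} False} (P : Pres K F) (Q : Pres L G)

@[fun_prop]
theorem cm_to_comp {X : Type*} [Coded X] {f : X → Tt K} (hf : Cm f) :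
    Cm fun x => P.toV (f x).1 (f x).2 := P.cm_to.comp hf

theorem to_of_hom {n : ℕ} {v : V F.B} (h : ∀ b, v b ≠ 0 → deg b = n) : P.toV n (P.ofV n v) = v := by
  rw [← Finsupp.sum_single v, Finsupp.sum, map_sum, map_sum]
  refine Finset.sum_congr rfl fun b hb => ?_
  have e : single b (v b) = v b • single b (1 : ℤ) := by simp
  obtain rfl := h b (Finsupp.mem_support_iff.1 hb)
  rw [e, map_zsmul, map_zsmul, P.to_of]

theorem of_eq_zero {n : ℕ} {v : V F.B} (h : ∀ b, v b ≠ 0 → deg b ≠ n) : P.ofV n v = 0 := by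
  rw [← Finsupp.sum_single v, Finsupp.sum, map_sum]
  refine Finset.sum_eq_zero fun b hb => ?_
  have e : single b (v b) = v b • single b (1 : ℤ) := by simp
  rw [e, map_zsmul, P.of_ne _ _ (h b (Finsupp.mem_support_iff.1 hb)), smul_zero]

theorem to_injective (n : ℕ) : Function.Injective (P.toV n) :=
  Function.LeftInverse.injective (P.of_to n)

include P in
-- Each basis element is the image of a homogeneous chain by `to_of`, so identities may be checked
-- on images of chains of the presented complex.
theorem induction {p : V F.B → Prop} (h0 : p 0) (h : ∀ n c, p (P.toV n c))
    (hadd : ∀ v w, p v → p w → p (v + w)) (v : V F.B) : p v := by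
  induction v using Finsupp.induction_linear with
  | zero => exact h0
  | add v w hv hw => exact hadd v w hv hw
  | single b z =>
    have e : single b z = z • single b (1 : ℤ) := by simp
    rw [e, ← P.to_of, ← map_zsmul]
    exact h _ _

/-- A boundary would be supported in degree `-1`. The case is separate because the compatibility
with `C.d` only covers degrees `n + 1`. -/
theorem d_zero (c : C.X 0) : F.d (P.toV 0 c) = 0 := by
  ext b
  by_contra h
  obtain ⟨a, ha, h1, _⟩ := F.good.spt.apply h
  have := P.spt 0 c a ha
  omega

/-! #### The operations of a presented complex -/

include P in
-- Each operation is carried out on lists of basis elements and carried back by `ofV`, which is a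
-- left inverse of `toV`.
theorem hasOperations : K.HasOperations where
  zero := by
    obtain ⟨φ, h1, h2⟩ := P.cm_of.comp (f := fun n : ℕ => (n, (0 : V F.B))) (by fun_prop)
    refine ⟨fun n => (φ n).map fun k => k.unpair.2, h1.map
      (Computable.snd.comp (Computable.unpair.comp Computable.snd)).to₂, fun n => ?_⟩
    obtain ⟨l, hl, h3⟩ := h2 n n rfl
    refine ⟨_, Part.mem_map _ hl, ?_⟩
    have := h3.2
    dsimp only at this
    rwa [map_zero] at this
  add := by
    have h := P.cm_of.comp (f := fun p : Tt K × Tt K => (p.1.1, P.toV p.1.1 p.1.2 + P.toV p.2.1 p.2.2))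
      (Cm.pair (by fun_prop) (Cm.v_add (P.cm_to_comp Cm.fst) (P.cm_to_comp Cm.snd)))
    obtain ⟨φ, h1, h2⟩ := h
    refine ⟨fun p => (φ (Nat.pair (Nat.pair p.1 p.2.1) (Nat.pair p.1 p.2.2))).map fun k => k.unpair.2,
      (h1.comp ?_).map (Computable.snd.comp (Computable.unpair.comp Computable.snd)).to₂, ?_⟩
    · exact partrec_natPair (partrec_natPair Computable.fst (Computable.fst.comp Computable.snd))
        (partrec_natPair Computable.fst (Computable.snd.comp Computable.snd))
    · intro n k k' c c' hc hc'
      obtain ⟨l, hl, h3⟩ := h2 (Nat.pair (Nat.pair n k) (Nat.pair n k')) (⟨n, c⟩, ⟨n, c'⟩) ⟨by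
        rw [Nat.unpair_pair]; exact tt_isCode_pair.2 hc, by
        rw [Nat.unpair_pair]; exact tt_isCode_pair.2 hc'⟩
      refine ⟨_, Part.mem_map _ hl, ?_⟩
      have := h3.2
      dsimp only at this
      rwa [← map_add, P.of_to] at this
  neg := by
    refine (computableMaps_iff (e := fun n => n) (f := fun n c => -c) Computable.id).2 ?_
    refine (P.cm_of.comp (f := fun p : Tt K => (p.1, - P.toV p.1 p.2)) (by fun_prop)).congr fun p => ?_
    rw [← map_neg, P.of_to]
  zsmul := by
    have h := P.cm_of.comp (f := fun p : ℤ × Tt K => (p.2.1, p.1 • P.toV p.2.1 p.2.2))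
      (Cm.pair (by fun_prop) (Cm.v_smul Cm.fst (P.cm_to_comp Cm.snd)))
    obtain ⟨φ, h1, h2⟩ := h
    refine ⟨fun p => (φ (Nat.pair (Encodable.encode p.2.1) (Nat.pair p.1 p.2.2))).map fun k => k.unpair.2,
      (h1.comp ?_).map (Computable.snd.comp (Computable.unpair.comp Computable.snd)).to₂, ?_⟩
    · exact partrec_natPair (Computable.encode.comp (Computable.fst.comp Computable.snd))
        (partrec_natPair Computable.fst (Computable.snd.comp Computable.snd))
    · intro n z k c hc
      obtain ⟨l, hl, h3⟩ := h2 (Nat.pair (Encodable.encode z) (Nat.pair n k)) (z, ⟨n, c⟩) ⟨by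
        rw [Nat.unpair_pair]; rfl, by
        rw [Nat.unpair_pair]; exact tt_isCode_pair.2 hc⟩
      refine ⟨_, Part.mem_map _ hl, ?_⟩
      have := h3.2
      dsimp only at this
      rwa [← map_zsmul, P.of_to] at this
  d := by
    refine (computableMaps_iff (e := fun n => n) (f := fun n c => C.d (n + 1) n c) Computable.id).2 ?_
    have h : Cm fun p : Tt (fun n => K (n + 1)) => P.toV (p.1 + 1) p.2 := P.cm_to.comp Cm.tt_succ
    refine (P.cm_of.comp (f := fun p : Tt (fun n => K (n + 1)) => (p.1, F.d (P.toV (p.1 + 1) p.2)))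
      (Cm.pair (by fun_prop) (F.good.cm.comp h))).congr fun p => ?_
    rw [← P.d, P.of_to]

/-- The basis of a presented complex. -/
def basis (n : ℕ) : Module.Basis {b : F.B // deg b = n} ℤ (C.X n) :=
  Module.Basis.ofRepr <| AddEquiv.toIntLinearEquiv
    { toFun := fun c => Finsupp.lsubtypeDomain (R := ℤ) {b | deg b = n} (P.toV n c)
      invFun := fun v => P.ofV n (Finsupp.mapDomain Subtype.val v)
      left_inv := fun c => by
        refine Eq.trans (congrArg (P.ofV n) ?_) (P.of_to n c)
        ext b
        by_cases hb : deg b = n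
        · change Finsupp.mapDomain Subtype.val _ (Subtype.val (⟨b, hb⟩ : {b : F.B // deg b = n})) = _
          rw [Finsupp.mapDomain_apply Subtype.val_injective]
          rfl
        · rw [Finsupp.mapDomain_of_notMem_range _ _ (by rintro ⟨c, rfl⟩; exact hb c.2)]
          by_contra hcon
          exact hb (P.spt n c b fun h => hcon h.symm)
      right_inv := fun v => by
        dsimp only
        rw [P.to_of_hom]
        · ext ⟨b, hb⟩
          change (Finsupp.mapDomain Subtype.val v) (Subtype.val (⟨b, hb⟩ : {b : F.B // deg b = n})) = _
          rw [Finsupp.mapDomain_apply Subtype.val_injective]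
        · intro b hb
          by_contra hcon
          refine hb (Finsupp.mapDomain_of_notMem_range _ _ ?_)
          rintro ⟨⟨c, hc⟩, rfl⟩
          exact hcon hc
      map_add' := fun c c' => by rw [map_add, map_add] }

theorem basis_apply (n : ℕ) (b : {b : F.B // deg b = n}) : P.basis n b = P.ofV n (single b.1 1) := by
  rw [Module.Basis.apply_eq_iff]
  change Finsupp.lsubtypeDomain (R := ℤ) {b | deg b = n} (P.toV n (P.ofV n (single b.1 1))) = _
  rw [P.to_of_hom]
  · ext c
    classical
    change (single b.1 (1 : ℤ)) c.1 = _
    rw [Finsupp.single_apply, Finsupp.single_apply]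
    exact if_congr ⟨fun e => Subtype.ext e, fun e => congrArg Subtype.val e⟩ rfl rfl
  · intro c hc
    rw [single_apply_ne_zero] at hc
    rw [hc.1, b.2]

theorem exists_subtype_list {A : Type*} {p : A → Prop} (l : List (ℤ × A)) (h : ∀ q ∈ l, p q.2) :
    ∃ s : List (ℤ × {a // p a}), l = s.map fun q => (q.1, q.2.1) := by
  induction l with
  | nil => exact ⟨[], rfl⟩
  | cons q l ih =>
    simp only [List.mem_cons, forall_eq_or_imp] at h
    obtain ⟨s, rfl⟩ := ih h.2
    exact ⟨(q.1, ⟨q.2, h.1⟩) :: s, rfl⟩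

theorem of_ev (n : ℕ) (l : List (ℤ × F.B)) :
    P.ofV n (ev l) = (l.map fun q => q.1 • P.ofV n (single q.2 1)).sum := by
  induction l with
  | nil => simp
  | cons q l ih =>
    rw [ev_cons, map_add, ih, List.map_cons, List.sum_cons, ← map_zsmul]
    simp

theorem isComputableBasis : K.IsComputableBasis P.basis where
  expand := by
    have h : Cm fun p : ℕ × List (ℤ × F.B) =>
        (nform (fun b => deg b = p.1) p.2).map fun q => ((q.1, ⟨p.1, P.ofV p.1 (single q.2 1)⟩) : ℤ × Tt K) := by
      refine Cm.list_map (f := fun r : (ℕ × List (ℤ × F.B)) × ℤ × F.B =>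
        ((r.2.1, ⟨r.1.1, P.ofV r.1.1 (single r.2.2 1)⟩) : ℤ × Tt K)) ?_
        (Cm.nform (P := fun q : (ℕ × List (ℤ × F.B)) × F.B => deg q.2 = q.1.1)
          (CmP.eq (by fun_prop) (by fun_prop)) Cm.snd)
      exact Cm.pair (by fun_prop) (P.cm_of.comp
        (f := fun r : (ℕ × List (ℤ × F.B)) × ℤ × F.B => (r.1.1, single r.2.2 (1 : ℤ))) (by fun_prop))
    obtain ⟨φ, h1, h2⟩ := h
    obtain ⟨ψ, h3, h4⟩ := P.cm_to
    obtain ⟨E, h5, h6⟩ := exists_decode_list (K := K)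
    refine ⟨fun p => ((ψ (Nat.pair p.1 p.2)).bind fun k => φ (Nat.pair p.1 k)).map E, ?_, ?_⟩
    · refine Partrec.map (Partrec.bind (h3.comp (partrec_natPair Computable.fst Computable.snd)) ?_)
        (h5.comp Computable.snd).to₂
      exact (h1.comp (partrec_natPair (Computable.fst.comp Computable.fst) Computable.snd)).to₂
    · intro n k c hc
      obtain ⟨k', hk', l, hl, hl'⟩ := h4 (Nat.pair n k) ⟨n, c⟩ (tt_isCode_pair.2 hc)
      dsimp only at hl'
      obtain ⟨m, hm, h7⟩ := h2 (Nat.pair n k') (n, l) ⟨by rw [Nat.unpair_pair]; rfl, by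
        rw [Nat.unpair_pair]; exact hl⟩
      obtain ⟨s, hs⟩ := exists_subtype_list (p := fun b : F.B => deg b = n)
        (nform (fun b => deg b = n) l) fun q hq => nform_mem hq
      refine ⟨_, Part.mem_map _ (Part.mem_bind hk' hm), s, ?_, ?_, ?_⟩
      · have := nform_nodup (fun b => deg b = n) l
        rw [hs, List.map_map] at this
        refine List.Nodup.of_map Subtype.val ?_
        rw [List.map_map]
        exact this
      · have h8 := ev_nform (P := fun b => deg b = n) (l := l) (by rw [← hl']; exact P.spt n c)
        rw [← P.of_to n c, hl', ← h8, hs, P.of_ev, List.map_map]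
        congr 1
        refine List.map_congr_left fun q _ => ?_
        simp only [Function.comp_apply, basis_apply]
      · have h9 := h6 n m (s.map fun q => (q.1, P.basis n q.2)) (by
          convert h7 using 1
          dsimp only
          rw [hs, List.map_map, List.map_map]
          refine List.map_congr_left fun q _ => ?_
          simp only [Function.comp_apply, basis_apply])
        rw [List.forall₂_map_right_iff] at h9
        exact h9
  mem := by
    classical
    -- If a chain given by a list is a basis element, then that element occurs in the list, so only
    -- the finitely many entries have to be tried.
    have h : CmP fun v : V F.B => ∃ b, v = single b 1 := by
      refine Cm.of_ev' ?_
      change CmP fun l : List (ℤ × F.B) => ∃ b, EffHom.ev l = single b 1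
      refine (CmP.exists_mem (P := fun p : List (ℤ × F.B) × (ℤ × F.B) => ev p.1 = single p.2.2 1)
        (CmP.eq (by fun_prop) (by fun_prop)) Cm.id).congr fun l => ?_
      constructor
      · rintro ⟨q, _, hq⟩
        exact ⟨_, hq⟩
      · rintro ⟨b, hb⟩
        by_contra hcon
        push Not at hcon
        have h1 : ev l b ≠ 0 := by rw [hb]; simp
        apply h1
        refine ev_eq_zero_of_notMem ?_
        rintro q hq rfl
        exact hcon q hq hb
    obtain ⟨φ, h1, h2⟩ := cm_tt_iff.1 (h.comp P.cm_to)
    refine ⟨fun p => (φ p).map fun k => decide (k = 1), h1.map ?_, ?_⟩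
    · have : PrimrecPred fun k : ℕ => k = 1 := PrimrecRel.comp Primrec.eq Primrec.id (Primrec.const 1)
      exact (this.decide.to_comp.comp Computable.snd).to₂
    · intro n k c hc
      obtain ⟨l, hl, h3⟩ := h2 n k c hc
      refine ⟨_, Part.mem_map _ hl, ?_⟩
      change l = Encodable.encode (decide _) at h3
      have h4 : l = 1 ↔ ∃ b, P.toV n c = single b 1 := by
        by_cases h : ∃ b, P.toV n c = single b 1
        · simp only [h, iff_true]
          rw [h3]; simp [h]
        · simp only [h, iff_false]
          rw [h3]; simp [h]
      rw [decide_eq_true_iff, h4]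
      constructor
      · rintro ⟨b, hb⟩
        have hd : deg b = n := P.spt n c b (by rw [hb]; simp)
        refine ⟨⟨b, hd⟩, ?_⟩
        rw [basis_apply, ← hb, P.of_to]
      · rintro ⟨⟨b, rfl⟩, rfl⟩
        exact ⟨b, by rw [basis_apply, P.to_of]⟩

include P in
theorem isLocallyEffective : K.IsLocallyEffective :=
  ⟨P.hasOperations, _, P.basis, P.isComputableBasis⟩

include P in
theorem isEffective (h : FinB F.B) : K.IsEffective := by
  classical
  refine ⟨P.hasOperations, _, P.basis, P.isComputableBasis, ?_⟩
  obtain ⟨l, h1, h2⟩ := h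
  -- The coefficients `0` are dummies, inserted so that the decoding of lists of terms from
  -- `exists_decode_list` can be reused.
  have h : Cm fun n : ℕ => (l n).dedup.map fun b => ((0, ⟨n, P.ofV n (single b 1)⟩) : ℤ × Tt K) := by
    refine Cm.list_map (f := fun p : ℕ × F.B => ((0, ⟨p.1, P.ofV p.1 (single p.2 1)⟩) : ℤ × Tt K))
      (Cm.pair (by fun_prop) (P.cm_of.comp
        (f := fun p : ℕ × F.B => (p.1, single p.2 (1 : ℤ))) (by fun_prop))) (Cm.list_dedup h1)
  obtain ⟨φ, h3, h4⟩ := h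
  obtain ⟨E, h5, h6⟩ := exists_decode_list (K := K)
  refine ⟨fun n => (φ n).map fun k => (E k).map Prod.snd, h3.map ?_, fun n => ?_⟩
  · exact (Computable.comp (Primrec.list_map Primrec.id (Primrec.snd.comp Primrec.snd).to₂).to_comp
      (h5.comp Computable.snd)).to₂
  · obtain ⟨m, hm, h7⟩ := h4 n n rfl
    obtain ⟨s, hs⟩ : ∃ s : List {b : F.B // deg b = n}, (l n).dedup = s.map Subtype.val := by
      refine ⟨(l n).dedup.attach.map fun b => ⟨b.1, (h2 n b.1).1 (List.mem_dedup.1 b.2)⟩, ?_⟩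
      rw [List.map_map]
      exact (List.attach_map_subtype_val _).symm
    refine ⟨_, Part.mem_map _ hm, s, ?_, ?_, ?_⟩
    · have := List.nodup_dedup (l n)
      rw [hs] at this
      exact List.Nodup.of_map _ this
    · rintro ⟨b, hb⟩
      have := List.mem_dedup.2 ((h2 n b).2 hb)
      rw [hs, List.mem_map] at this
      obtain ⟨c, hc, rfl⟩ := this
      exact hc
    · have h9 := h6 n m (s.map fun b => (0, P.basis n b)) (by
        convert h7 using 1
        dsimp only
        rw [hs, List.map_map, List.map_map]
        refine List.map_congr_left fun q _ => ?_
        simp only [Function.comp_apply, basis_apply])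
      rw [List.forall₂_map_right_iff] at h9
      rw [List.forall₂_map_left_iff]
      exact h9.imp fun p b h => h.2

end Pres

end

section

open Coded Finsupp CSet

namespace Pres

variable {C D : ChainComplex AddCommGrpCat.{u} ℕ} {K : ChainCoding C} {L : ChainCoding D}
  {F G : Cx.{u} False} (P : Pres K F) (Q : Pres L G)

/-! ### Transfer of reductions -/

/-- The linear map presenting a family of maps of degree `k`. -/
def liftV {k : ℕ} (f : ∀ n, C.X n →+ D.X (n + k)) : V F.B →ₗ[ℤ] V G.B :=
  Finsupp.linearCombination ℤ fun b =>
    Q.toV (deg b + k) (f (deg b) (P.ofV (deg b) (single b 1)))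

variable {k : ℕ} (f : ∀ n, C.X n →+ D.X (n + k))

/-- Both sides are additive in a chain of degree `n`, so it suffices to compare them on basis
elements of degree `n`, where the definition applies. -/
theorem liftV_to (n : ℕ) (c : C.X n) : P.liftV Q f (P.toV n c) = Q.toV (n + k) (f n c) := by
  suffices h : ∀ v : V F.B, (∀ b, v b ≠ 0 → deg b = n) →
      P.liftV Q f v = Q.toV (n + k) (f n (P.ofV n v)) by
    rw [h _ (P.spt n c), P.of_to]
  intro v hv
  rw [← Finsupp.sum_single v, Finsupp.sum, map_sum, map_sum, map_sum, map_sum]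
  refine Finset.sum_congr rfl fun b hb => ?_
  have e : single b (v b) = v b • single b (1 : ℤ) := by simp
  obtain rfl := hv b (Finsupp.mem_support_iff.1 hb)
  rw [e, map_zsmul, map_zsmul, map_zsmul, map_zsmul]
  simp [liftV]

theorem good_liftV (hf : Cm fun p : Tt K => (⟨p.1 + k, f p.1 p.2⟩ : Tt L)) :
    Good False k (P.liftV Q f) := by
  refine Good.lin ?_ ?_
  · have h := hf.comp (P.cm_of.comp (f := fun b : F.B => (deg b, single b (1 : ℤ))) (by fun_prop))
    exact Q.cm_to_comp h
  · intro a b hab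
    exact ⟨by have := Q.spt _ _ _ hab; omega, False.elim⟩

theorem homotopy_apply {ρ : Reduction C D} (n : ℕ) (c : C.X (n + 1)) :
    C.d (n + 2) (n + 1) (ρ.η.hom (n + 1) (n + 2) c) + ρ.η.hom n (n + 1) (C.d (n + 1) n c) =
      c - ρ.β.f (n + 1) (ρ.α.f (n + 1) c) := by
  have h := ConcreteCategory.congr_hom (ρ.η.comm (n + 1)) c
  rw [Homotopy.dNext_succ_chainComplex, Homotopy.prevD_chainComplex] at h
  change c = ρ.η.hom n (n + 1) (C.d (n + 1) n c) + C.d (n + 2) (n + 1) (ρ.η.hom (n + 1) (n + 2) c) +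
    ρ.β.f (n + 1) (ρ.α.f (n + 1) c) at h
  rw [eq_sub_iff_add_eq, add_comm (C.d _ _ _)]
  exact h.symm

theorem homotopy_apply_zero {ρ : Reduction C D} (c : C.X 0) :
    C.d 1 0 (ρ.η.hom 0 1 c) = c - ρ.β.f 0 (ρ.α.f 0 c) := by
  have h := ConcreteCategory.congr_hom (ρ.η.comm 0) c
  rw [Homotopy.dNext_zero_chainComplex, Homotopy.prevD_chainComplex, zero_add] at h
  change c = C.d 1 0 (ρ.η.hom 0 1 c) + ρ.β.f 0 (ρ.α.f 0 c) at h
  rw [eq_sub_iff_add_eq]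
  exact h.symm

theorem chainMap_apply (φ : C ⟶ D) (n : ℕ) (c : C.X (n + 1)) :
    φ.f n (C.d (n + 1) n c) = D.d (n + 1) n (φ.f (n + 1) c) :=
  (ConcreteCategory.congr_hom (φ.comm (n + 1) n) c).symm

/-- In degree zero both sides vanish by `d_zero`; in positive degrees this is the chain map identity
transported along the presentations. -/
theorem liftV_d (φ : C ⟶ D) (v : V F.B) :
    P.liftV Q (k := 0) (fun n => (φ.f n).hom) (F.d v) = G.d (P.liftV Q (k := 0) (fun n => (φ.f n).hom) v) := by
  induction v using P.induction with
  | h0 => simp only [map_zero]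
  | hadd v w hv hw => simp only [map_add, hv, hw]
  | h n c =>
    cases n with
    | zero =>
      rw [P.d_zero, map_zero, liftV_to]
      exact (Q.d_zero _).symm
    | succ n =>
      rw [← P.d, liftV_to, liftV_to]
      refine Eq.trans ?_ (Q.d n _)
      exact congrArg (Q.toV n) (chainMap_apply φ n c)

/-- A computable reduction gives a computable reduction of the presenting complexes. -/
def toRed (ρ : Reduction C D) (h : ρ.IsComputable K L) : Red F G where
  α := P.liftV Q (k := 0) fun n => (ρ.α.f n).hom
  β := Q.liftV P (k := 0) fun n => (ρ.β.f n).hom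
  η := P.liftV P (k := 1) fun n => (ρ.η.hom n (n + 1)).hom
  α_d := P.liftV_d Q ρ.α
  β_d := Q.liftV_d P ρ.β
  α_β v := by
    induction v using Q.induction with
    | h0 => simp only [map_zero]
    | hadd v w hv hw => simp only [map_add, hv, hw]
    | h n c =>
      rw [liftV_to]
      refine (P.liftV_to Q _ n _).trans ?_
      refine congrArg (Q.toV n) ?_
      exact ConcreteCategory.congr_hom (HomologicalComplex.congr_hom ρ.β_α n) c
  α_η v := by
    induction v using P.induction with
    | h0 => simp only [map_zero]
    | hadd v w hv hw => rw [map_add, map_add, hv, hw, add_zero]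
    | h n c =>
      rw [liftV_to, liftV_to]
      refine (congrArg (Q.toV (n + 1)) ?_).trans (map_zero _)
      exact ConcreteCategory.congr_hom (ρ.η_α n) c
  η_β v := by
    induction v using Q.induction with
    | h0 => simp only [map_zero]
    | hadd v w hv hw => rw [map_add, map_add, hv, hw, add_zero]
    | h n c =>
      rw [liftV_to]
      refine (P.liftV_to P _ n _).trans ((congrArg (P.toV (n + 1)) ?_).trans (map_zero _))
      exact ConcreteCategory.congr_hom (ρ.β_η n) c
  η_η v := by
    induction v using P.induction with
    | h0 => simp only [map_zero]
    | hadd v w hv hw => rw [map_add, map_add, hv, hw, add_zero]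
    | h n c =>
      rw [liftV_to, liftV_to]
      refine (congrArg (P.toV (n + 2)) ?_).trans (map_zero _)
      exact ConcreteCategory.congr_hom (ρ.η_η n) c
  hty v := by
    induction v using P.induction with
    | h0 => simp only [map_zero, add_zero, sub_zero]
    | hadd v w hv hw =>
      simp only [map_add]
      linear_combination (norm := abel) hv + hw
    | h n c =>
      have e : Q.liftV P (k := 0) (fun n => (ρ.β.f n).hom) (P.liftV Q (k := 0) (fun n => (ρ.α.f n).hom)
          (P.toV n c)) = P.toV n (ρ.β.f n (ρ.α.f n c)) := by
        rw [liftV_to]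
        exact Q.liftV_to P _ n _
      rw [e, liftV_to, ← P.d]
      cases n with
      | zero =>
        rw [P.d_zero, map_zero, add_zero, ← map_sub]
        exact congrArg (P.toV 0) (homotopy_apply_zero c)
      | succ n =>
        rw [← P.d n c, liftV_to, ← map_sub, ← map_add]
        exact congrArg (P.toV (n + 1)) (homotopy_apply n c)
  good_α := P.good_liftV Q (k := 0) _ ((computableMaps_iff (e := fun n => n) Computable.id).1 h.α)
  good_β := Q.good_liftV P (k := 0) _ ((computableMaps_iff (e := fun n => n) Computable.id).1 h.β)
  good_η := P.good_liftV P (k := 1) _ ((computableMaps_iff (e := fun n => n + 1) Computable.succ).1 h.η)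

section ofRed

variable {P Q}

theorem good_to {k : ℤ} {f : V F.B →ₗ[ℤ] V G.B} (hf : Good False k f) {n m : ℕ} (h : (m : ℤ) = n + k)
    (c : C.X n) (b : G.B) (hb : f (P.toV n c) b ≠ 0) : deg b = m := by
  obtain ⟨a, ha, h1, _⟩ := hf.spt.apply hb
  have := P.spt n c a ha
  omega

theorem to_of_good {k : ℤ} {f : V F.B →ₗ[ℤ] V G.B} (hf : Good False k f) {n m : ℕ} (h : (m : ℤ) = n + k)
    (c : C.X n) : Q.toV m (Q.ofV m (f (P.toV n c))) = f (P.toV n c) :=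
  Q.to_of_hom (good_to hf h c)

variable (P Q)

/-- The chain map given by a map of presenting complexes. -/
def homOf (f : V F.B →ₗ[ℤ] V G.B) (hf : Good False 0 f) (hd : ∀ v, f (F.d v) = G.d (f v)) : C ⟶ D where
  f n := AddCommGrpCat.ofHom ((Q.ofV n).comp (f.toAddMonoidHom.comp (P.toV n)))
  comm' i j hij := by
    obtain rfl : j + 1 = i := hij
    ext c
    change D.d (j + 1) j (Q.ofV (j + 1) (f (P.toV (j + 1) c))) = Q.ofV j (f (P.toV j (C.d (j + 1) j c)))
    apply Q.to_injective
    rw [Q.d, to_of_good hf (by simp), to_of_good hf (by simp), P.d, hd]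

/-- A reduction of the presenting complexes gives a reduction. -/
def ofRed (r : Red F G) : Reduction C D where
  α := homOf P Q r.α r.good_α r.α_d
  β := homOf Q P r.β r.good_β r.β_d
  η :=
    { hom := fun n m => AddCommGrpCat.ofHom ((P.ofV m).comp (r.η.toAddMonoidHom.comp (P.toV n)))
      zero := by
        intro i j hij
        ext c
        refine P.of_eq_zero fun b hb hj => hij ?_
        have := good_to (P := P) r.good_η (m := i + 1) (by simp) c b hb
        exact this.symm.trans hj
      comm := by
        intro n
        rw [Homotopy.prevD_chainComplex]
        ext c
        -- The term `w = η d c` is kept general so that the same identity serves degree zero, where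
        -- it is `0`, and positive degrees, where it comes from the differential of `C`.
        have key : ∀ w : V F.B, w = r.η (F.d (P.toV n c)) →
            c = P.ofV n w + C.d (n + 1) n (P.ofV (n + 1) (r.η (P.toV n c))) +
              P.ofV n (r.β (Q.toV n (Q.ofV n (r.α (P.toV n c))))) := by
          rintro w rfl
          apply P.to_injective
          have h := r.hty (P.toV n c)
          have hw : P.toV n (P.ofV n (r.η (F.d (P.toV n c)))) = r.η (F.d (P.toV n c)) := by
            have hg : Good False 0 (r.η ∘ₗ F.d) := r.good_η.comp F.good (by norm_num)
            exact to_of_good (P := P) (Q := P) hg (by simp) c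
          rw [map_add, map_add, hw, P.d, to_of_good r.good_η (by simp), to_of_good r.good_α (by simp)]
          have hβ : P.toV n (P.ofV n (r.β (r.α (P.toV n c)))) = r.β (r.α (P.toV n c)) := by
            have hg : Good False 0 (r.β ∘ₗ r.α) := r.good_β.comp r.good_α (by norm_num)
            exact to_of_good (P := P) (Q := P) hg (by simp) c
          rw [hβ]
          linear_combination (norm := abel) -h
        cases n with
        | zero =>
          rw [Homotopy.dNext_zero_chainComplex]
          have := key 0 (by rw [P.d_zero, map_zero])
          rwa [map_zero] at this
        | succ n =>
          rw [Homotopy.dNext_succ_chainComplex]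
          exact key (r.η (P.toV n (C.d (n + 1) n c))) (by rw [P.d]) }
  β_α := by
    ext n c
    change Q.ofV n (r.α (P.toV n (P.ofV n (r.β (Q.toV n c))))) = c
    rw [to_of_good r.good_β (by simp), r.α_β, Q.of_to]
  β_η n := by
    ext c
    change P.ofV (n + 1) (r.η (P.toV n (P.ofV n (r.β (Q.toV n c))))) = 0
    rw [to_of_good r.good_β (by simp), r.η_β, map_zero]
  η_α n := by
    ext c
    change Q.ofV (n + 1) (r.α (P.toV (n + 1) (P.ofV (n + 1) (r.η (P.toV n c))))) = 0
    rw [to_of_good r.good_η (by simp), r.α_η, map_zero]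
  η_η n := by
    ext c
    change P.ofV (n + 2) (r.η (P.toV (n + 1) (P.ofV (n + 1) (r.η (P.toV n c))))) = 0
    rw [to_of_good r.good_η (by simp), r.η_η, map_zero]

theorem ofRed_isComputable (r : Red F G) : (ofRed P Q r).IsComputable K L where
  α := by
    refine (computableMaps_iff (e := fun n => n) Computable.id).2 ?_
    exact Q.cm_of.comp (f := fun p : Tt K => (p.1, r.α (P.toV p.1 p.2)))
      (Cm.pair (by fun_prop) (r.good_α.cm.comp (P.cm_to_comp Cm.id)))
  β := by
    refine (computableMaps_iff (e := fun n => n) Computable.id).2 ?_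
    exact P.cm_of.comp (f := fun p : Tt L => (p.1, r.β (Q.toV p.1 p.2)))
      (Cm.pair (by fun_prop) (r.good_β.cm.comp (Q.cm_to_comp Cm.id)))
  η := by
    refine (computableMaps_iff (e := fun n => n + 1) Computable.succ).2 ?_
    exact P.cm_of.comp (f := fun p : Tt K => (p.1 + 1, r.η (P.toV p.1 p.2)))
      (Cm.pair (by fun_prop) (r.good_η.cm.comp (P.cm_to_comp Cm.id)))

end ofRed

end Pres

end

section

open Coded Finsupp CSet

/-! ### The chain complex presented by a complex with a computable basis -/

/-- A change of type which does not change the code is free: the algorithm for `g` already computes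
`h`. -/
theorem Cm.of_isCode {X Y Z : Type*} [Coded X] [Coded Y] [Coded Z] {g : X → Y} {h : X → Z} (hg : Cm g)
    (H : ∀ x k, IsCode k (g x) → IsCode k (h x)) : Cm h := by
  obtain ⟨φ, h1, h2⟩ := hg
  refine ⟨φ, h1, fun k x hk => ?_⟩
  obtain ⟨l, hl, h3⟩ := h2 k x hk
  exact ⟨l, hl, H x l h3⟩

/-- The encoding of a coded type. -/
def Coded.toCoding (A : Type*) [Coded A] : Coding A where
  IsCode := IsCode
  exists_isCode := exists_isCode
  eq_of_isCode _ _ _ := eq_of_isCode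

theorem isCode_list_map {A B : Type*} [Coded A] [Coded B] {f : A → B}
    (h : ∀ a k, IsCode k (f a) ↔ IsCode k a) (l : List A) (k : ℕ) :
    IsCode k (l.map f) ↔ IsCode k l := by
  have : ∀ ks : List ℕ, List.Forall₂ IsCode ks (l.map f) ↔ List.Forall₂ IsCode ks l := by
    intro ks
    rw [List.forall₂_map_right_iff]
    constructor
    · exact fun H => H.imp fun k a => (h a k).1
    · exact fun H => H.imp fun k a => (h a k).2
  constructor
  · rintro ⟨ks, rfl, H⟩
    exact ⟨ks, rfl, (this ks).1 H⟩
  · rintro ⟨ks, rfl, H⟩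
    exact ⟨ks, rfl, (this ks).2 H⟩

section ofCx

variable (F : Cx.{u} False)

/-- The part of degree `n`. -/
def degPart (n : ℕ) : V F.B →ₗ[ℤ] V {b : F.B // deg b = n} :=
  Finsupp.lsubtypeDomain {b | deg b = n}

/-- The inclusion of the part of degree `n`. -/
def degIncl (n : ℕ) : V {b : F.B // deg b = n} →ₗ[ℤ] V F.B := Finsupp.lmapDomain ℤ ℤ Subtype.val

theorem degPart_degIncl (n : ℕ) (c : V {b : F.B // deg b = n}) : degPart F n (degIncl F n c) = c := by
  ext ⟨b, hb⟩
  change (Finsupp.mapDomain Subtype.val c) (Subtype.val (⟨b, hb⟩ : {b : F.B // deg b = n})) = _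
  rw [Finsupp.mapDomain_apply Subtype.val_injective]

theorem degIncl_spt (n : ℕ) (c : V {b : F.B // deg b = n}) (b : F.B) (h : degIncl F n c b ≠ 0) :
    deg b = n := by
  by_contra hb
  refine h (Finsupp.mapDomain_of_notMem_range _ _ ?_)
  rintro ⟨c, rfl⟩
  exact hb c.2

theorem degIncl_degPart {n : ℕ} {v : V F.B} (h : ∀ b, v b ≠ 0 → deg b = n) :
    degIncl F n (degPart F n v) = v := by
  ext b
  by_cases hb : deg b = n
  · change Finsupp.mapDomain Subtype.val _ (Subtype.val (⟨b, hb⟩ : {b : F.B // deg b = n})) = _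
    rw [Finsupp.mapDomain_apply Subtype.val_injective]
    rfl
  · have h1 : v b = 0 := by by_contra h1; exact hb (h b h1)
    rw [h1]
    by_contra h2
    exact hb (degIncl_spt F n _ b h2)

theorem degIncl_d (n : ℕ) (c : V {b : F.B // deg b = n + 1}) :
    degIncl F n (degPart F n (F.d (degIncl F (n + 1) c))) = F.d (degIncl F (n + 1) c) := by
  refine degIncl_degPart F fun b hb => ?_
  obtain ⟨a, ha, h1, _⟩ := F.good.spt.apply hb
  have := degIncl_spt F _ _ a ha
  omega

/-- The chain complex of a complex with a computable basis. -/
def Cx.chain : ChainComplex AddCommGrpCat.{u} ℕ :=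
  ChainComplex.of (fun n => AddCommGrpCat.of (V {b : F.B // deg b = n}))
    (fun n => AddCommGrpCat.ofHom ((degPart F n).toAddMonoidHom.comp
      (F.d.toAddMonoidHom.comp (degIncl F (n + 1)).toAddMonoidHom)))
    (fun n => by
      refine AddCommGrpCat.hom_ext (AddMonoidHom.ext fun c => ?_)
      change degPart F n (F.d (degIncl F (n + 1) (degPart F (n + 1) (F.d (degIncl F (n + 1 + 1) c))))) = 0
      rw [degIncl_d, F.d_d, map_zero])

theorem degPart_single_of_ne (n : ℕ) (b : F.B) (h : deg b ≠ n) : degPart F n (single b 1) = 0 := by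
  ext ⟨c, hc⟩
  have : b ≠ c := by rintro rfl; exact h hc
  exact Finsupp.single_eq_of_ne' this

theorem Cx.chain_d (n : ℕ) (c : V {b : F.B // deg b = n + 1}) :
    F.chain.d (n + 1) n c = degPart F n (F.d (degIncl F (n + 1) c)) :=
  ConcreteCategory.congr_hom (ChainComplex.of_d (fun n => AddCommGrpCat.of (V {b : F.B // deg b = n}))
    (fun n => AddCommGrpCat.ofHom ((degPart F n).toAddMonoidHom.comp
      (F.d.toAddMonoidHom.comp (degIncl F (n + 1)).toAddMonoidHom))) n) c

/-- The encoding of the chain complex of a complex with a computable basis. -/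
def Cx.coding : ChainCoding F.chain := fun n => Coded.toCoding (V {b : F.B // deg b = n})

/-- The homogeneous part of a chain is obtained by filtering the list, and the remaining list has
the same codes when its entries are read in the subtype. -/
theorem degPart_ev (n : ℕ) (l : List (ℤ × F.B)) : ∃ s : List (ℤ × {b : F.B // deg b = n}),
    degPart F n (ev l) = ev s ∧
      s.map (fun q => (q.1, q.2.1)) = l.filter fun q => deg q.2 = n := by
  classical
  induction l with
  | nil => exact ⟨[], by simp⟩
  | cons q l ih =>
    obtain ⟨s, h1, h2⟩ := ih
    by_cases hq : deg q.2 = n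
    · refine ⟨(q.1, ⟨q.2, hq⟩) :: s, ?_, by simp [h2, hq]⟩
      rw [ev_cons, ev_cons, map_add, h1]
      congr 1
      have := degPart_degIncl F n (single ⟨q.2, hq⟩ q.1)
      rw [degIncl, lmapDomain_apply, mapDomain_single] at this
      exact this
    · refine ⟨s, ?_, by simp [h2, hq]⟩
      rw [ev_cons, map_add, h1, add_eq_right]
      ext ⟨b, hb⟩
      have : q.2 ≠ b := by rintro rfl; exact hq hb
      exact Finsupp.single_eq_of_ne' this

/-- The chain complex of a complex with a computable basis is presented by it. -/
def Cx.pres : Pres F.coding F where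
  toV n := (degIncl F n).toAddMonoidHom
  ofV n := (degPart F n).toAddMonoidHom
  of_to := degPart_degIncl F
  to_of b := degIncl_degPart F fun c hc => by
    rw [single_apply_ne_zero] at hc
    rw [hc.1]
  of_ne := degPart_single_of_ne F
  spt := degIncl_spt F
  d n c := (congrArg (degIncl F n) (F.chain_d n c)).trans (degIncl_d F n c)
  cm_to := by
    refine ⟨_, partrec_unpair_snd, ?_⟩
    rintro k ⟨n, c⟩ ⟨_, h⟩
    obtain ⟨l, hl, rfl⟩ : ∃ l, IsCode k.unpair.2 l ∧ c = ev l := h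
    refine ⟨_, Part.mem_some _, l.map (fun q => (q.1, q.2.1)), ?_, ?_⟩
    · rwa [isCode_list_map]
      rintro ⟨z, b⟩ k
      exact Iff.rfl
    · change degIncl F n (ev l) = _
      clear * -
      induction l with
      | nil => simp
      | cons q l ih =>
        rw [ev_cons, map_add, ih]
        simp [degIncl]
  cm_of := by
    refine Cm.of_ev ?_
    refine Cm.of_isCode (g := fun p : ℕ × List (ℤ × F.B) => (p.1, p.2.filter fun q => deg q.2 = p.1))
      (Cm.pair Cm.fst (Cm.list_filter (P := fun q : (ℕ × List (ℤ × F.B)) × ℤ × F.B => deg q.2.2 = q.1.1)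
        (CmP.eq (by fun_prop) (by fun_prop)) Cm.snd)) ?_
    rintro ⟨n, l⟩ k ⟨h1, h2⟩
    obtain ⟨s, h3, h4⟩ := degPart_ev F n l
    refine ⟨h1, s, ?_, h3⟩
    dsimp only at h2
    rw [← h4, isCode_list_map] at h2
    · exact h2
    · rintro ⟨z, b⟩ k
      exact Iff.rfl

end ofCx

/-! ### The presentation of a locally effective chain complex -/

section ofBasis

variable {C : ChainComplex AddCommGrpCat.{u} ℕ} {K : ChainCoding C}

/-- The total sum, which is meaningful for elements of the same degree. -/
def addT (p : Tt K × Tt K) : Tt K := by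
  classical exact if h : p.2.1 = p.1.1 then ⟨p.1.1, p.1.2 + tr (fun n => C.X n) h p.2.2⟩ else p.1

theorem addT_mk (n : ℕ) (c c' : C.X n) : addT ((⟨n, c⟩, ⟨n, c'⟩) : Tt K × Tt K) = ⟨n, c + c'⟩ := by
  simp [addT, tr]

theorem cm_addT (h : K.HasOperations) : Cm (addT (K := K)) := by
  refine Cm.glue_prop (P := fun p : Tt K × Tt K => p.2.1 = p.1.1)
    (CmP.eq (by fun_prop) (by fun_prop)) ?_ ?_
  · obtain ⟨φ, h1, h2⟩ := h.add
    have h0 : Computable fun k : ℕ => k.unpair.1 := Computable.fst.comp Computable.unpair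
    have h0' : Computable fun k : ℕ => k.unpair.2 := Computable.snd.comp Computable.unpair
    refine ⟨fun k => (φ (k.unpair.1.unpair.1, k.unpair.1.unpair.2, k.unpair.2.unpair.2)).map fun l =>
      Nat.pair k.unpair.1.unpair.1 l, (h1.comp ?_).map ?_, ?_⟩
    · exact (h0.comp h0).pair ((h0'.comp h0).pair (h0'.comp h0'))
    · exact (partrec_natPair (h0.comp (h0.comp Computable.fst)) Computable.snd).to₂
    · rintro k ⟨⟨⟨n, c⟩, ⟨m, c'⟩⟩, h⟩ ⟨⟨h3, h4⟩, ⟨h5, h6⟩⟩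
      obtain rfl : m = n := h
      obtain ⟨l, hl, h7⟩ := h2 m _ _ c c' h4 h6
      obtain h3 : k.unpair.1.unpair.1 = m := h3
      refine ⟨Nat.pair k.unpair.1.unpair.1 l, Part.mem_map _ ?_, ?_⟩
      · rw [h3]
        exact hl
      · change IsCode _ (addT ((⟨m, c⟩, ⟨m, c'⟩) : Tt K × Tt K))
        rw [addT_mk, h3]
        exact tt_isCode_pair.2 h7
  · refine (Cm.fst.comp Cm.val).congr ?_
    rintro ⟨p, hp⟩
    simp [addT, hp]

theorem cm_zsmulT (h : K.HasOperations) : Cm fun p : ℤ × Tt K => (⟨p.2.1, p.1 • p.2.2⟩ : Tt K) := by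
  obtain ⟨φ, h1, h2⟩ := h.zsmul
  have h0 : Computable fun k : ℕ => k.unpair.1 := Computable.fst.comp Computable.unpair
  have h0' : Computable fun k : ℕ => k.unpair.2 := Computable.snd.comp Computable.unpair
  have hz : Computable fun k : ℕ => (Encodable.decode (α := ℤ) k).getD 0 :=
    Computable.option_getD Computable.decode (Computable.const 0)
  refine ⟨fun k => (φ (k.unpair.2.unpair.1, (Encodable.decode (α := ℤ) k.unpair.1).getD 0,
    k.unpair.2.unpair.2)).map fun l => Nat.pair k.unpair.2.unpair.1 l, (h1.comp ?_).map ?_, ?_⟩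
  · exact (h0.comp h0').pair ((hz.comp h0).pair (h0'.comp h0'))
  · exact (partrec_natPair (h0.comp (h0'.comp Computable.fst)) Computable.snd).to₂
  · rintro k ⟨z, ⟨n, c⟩⟩ ⟨h3, ⟨h4, h5⟩⟩
    obtain h3 : k.unpair.1 = Encodable.encode z := h3
    obtain h4 : k.unpair.2.unpair.1 = n := h4
    obtain ⟨l, hl, h6⟩ := h2 n z _ c h5
    refine ⟨Nat.pair k.unpair.2.unpair.1 l, Part.mem_map _ ?_, ?_⟩
    · rw [h3, Encodable.encodek, Option.getD_some, h4]
      exact hl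
    · rw [h4]
      exact tt_isCode_pair.2 h6

theorem cm_zeroT (h : K.HasOperations) : Cm fun n : ℕ => (⟨n, 0⟩ : Tt K) := by
  obtain ⟨φ, h1, h2⟩ := h.zero
  refine ⟨fun k => (φ k).map fun l => Nat.pair k l, h1.map (partrec_natPair Computable.fst Computable.snd).to₂, ?_⟩
  intro k n hk
  obtain rfl : k = n := hk
  obtain ⟨l, hl, h3⟩ := h2 k
  exact ⟨_, Part.mem_map _ hl, tt_isCode_pair.2 h3⟩

variable {ι : ℕ → Type u} (b : ∀ n, Module.Basis (ι n) ℤ (C.X n))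

theorem ev_apply_of_nodup {A : Type*} {s : List (ℤ × A)} (h : (s.map Prod.snd).Nodup) {q : ℤ × A}
    (hq : q ∈ s) : ev s q.2 = q.1 := by
  have hz : ∀ (s : List (ℤ × A)) (b : A), b ∉ s.map Prod.snd → ev s b = 0 := by
    intro s b hb
    induction s with
    | nil => rfl
    | cons q s ih =>
      simp only [List.map_cons, List.mem_cons, not_or] at hb
      rw [ev_cons, Finsupp.add_apply, single_eq_of_ne hb.1, zero_add, ih hb.2]
  induction s with
  | nil => simp at hq
  | cons r s ih =>
    rw [List.map_cons, List.nodup_cons] at h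
    rw [ev_cons, Finsupp.add_apply]
    rcases List.mem_cons.1 hq with rfl | hq
    · rw [hz s _ h.1]; simp
    · rw [ih h.2 hq, single_eq_of_ne, zero_add]
      rintro h0
      exact h.1 (h0 ▸ List.mem_map_of_mem hq)

theorem repr_sum {n : ℕ} (s : List (ℤ × ι n)) :
    (b n).repr (s.map fun q => q.1 • b n q.2).sum = ev s := by
  induction s with
  | nil => simp
  | cons q s ih => simp [ih]

/-- Equality of encoded chains is not assumed decidable. It becomes so because expansions use
distinct basis elements: a chain is zero exactly when all coefficients of its expansion vanish. -/
theorem cmP_zeroT (hb : K.IsComputableBasis b) : CmP fun p : Tt K => p.2 = 0 := by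
  classical
  obtain ⟨φ, h1, h2⟩ := hb.expand
  obtain ⟨f, hf, hf'⟩ : ∃ f : List (ℤ × ℕ) → Bool, Computable f ∧
      ∀ l, f l = true ↔ ∀ q ∈ l, q.1 = 0 := by
    have hP : PrimrecPred fun q : ℤ × ℕ => q.1 = 0 :=
      PrimrecRel.comp Primrec.eq Primrec.fst (Primrec.const 0)
    exact ⟨_, (PrimrecPred.decide (PrimrecPred.forall_mem_list hP)).to_comp, fun l => decide_eq_true_iff⟩
  refine cm_tt_iff.2 ⟨fun p => (φ p).map fun l => Encodable.encode (f l),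
    h1.map ((Computable.encode.comp hf).comp Computable.snd).to₂, ?_⟩
  intro n k c hc
  obtain ⟨l, hl, s, hs, rfl, h3⟩ := h2 n k c hc
  refine ⟨_, Part.mem_map _ hl, ?_⟩
  change Encodable.encode (f l) = Encodable.encode (decide _)
  refine congrArg Encodable.encode ?_
  rw [Bool.eq_iff_iff, hf', decide_eq_true_iff]
  have e : (∀ q ∈ l, q.1 = 0) ↔ ∀ q ∈ s, q.1 = 0 := by
    clear hl hs hc
    induction h3 with
    | nil => simp
    | cons h _ ih => simp only [List.mem_cons, forall_eq_or_imp, ih, h.1]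
  rw [e]
  constructor
  · intro h
    refine List.sum_eq_zero ?_
    intro x hx
    obtain ⟨q, hq, rfl⟩ := List.mem_map.1 hx
    rw [h q hq, zero_smul]
  · intro h q hq
    have h4 := congrArg (b n).repr h
    rw [repr_sum, map_zero] at h4
    rw [← ev_apply_of_nodup hs hq, h4]
    rfl

/-- The disjoint union of the homogeneous parts of a basis. -/
structure TotBasis (b : ∀ n, Module.Basis (ι n) ℤ (C.X n)) where
  fst : ℕ
  snd : ι fst

theorem totBasis_injective : Function.Injective fun x : TotBasis b => (⟨x.1, b x.1 x.2⟩ : Tt K) := by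
  rintro ⟨n, i⟩ ⟨m, j⟩ h
  simp only [Tt.mk.injEq] at h
  obtain ⟨rfl, h⟩ := h
  rw [(b n).injective (eq_of_heq h)]

/-- The encoding of the elements of a basis of an encoded complex. -/
@[reducible] def totBasisCoded (K : ChainCoding C) : Coded (TotBasis b) :=
  Coded.ofInj (fun x : TotBasis b => (⟨x.1, b x.1 x.2⟩ : Tt K)) (totBasis_injective b)

theorem totBasis_cm : @Cm _ _ (totBasisCoded b K) _ fun x : TotBasis b => (⟨x.1, b x.1 x.2⟩ : Tt K) :=
  ⟨_, Partrec.some, fun k _ h => ⟨k, Part.mem_some k, h⟩⟩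

theorem totBasis_ceq (h : K.HasOperations) (hb : K.IsComputableBasis b) :
    @CEq (TotBasis b) (totBasisCoded b K) := by
  let _ := totBasisCoded b K
  refine @CEq.mk _ _ ?_
  refine Cm.glue_prop (P := fun p : TotBasis b × TotBasis b => p.2.1 = p.1.1)
    (CmP.eq (Cm.tt_fst.comp ((totBasis_cm b).comp Cm.snd))
      (Cm.tt_fst.comp ((totBasis_cm b).comp Cm.fst))) ?_ ?_
  · have h1 := (cmP_zeroT b hb).comp ((cm_addT h).comp
      (f := fun p : {p : TotBasis b × TotBasis b // p.2.1 = p.1.1} =>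
        ((⟨p.1.1.1, b p.1.1.1 p.1.1.2⟩, ⟨p.1.2.1, (-1 : ℤ) • b p.1.2.1 p.1.2.2⟩) : Tt K × Tt K))
      (Cm.pair ((totBasis_cm b).comp (Cm.fst.comp Cm.val)) ((cm_zsmulT h).comp
        (f := fun p : {p : TotBasis b × TotBasis b // p.2.1 = p.1.1} =>
          ((-1, ⟨p.1.2.1, b p.1.2.1 p.1.2.2⟩) : ℤ × Tt K))
        (Cm.pair (Cm.const _) ((totBasis_cm b).comp (Cm.snd.comp Cm.val))))))
    refine CmP.congr h1 ?_
    rintro ⟨⟨⟨n, i⟩, ⟨m, j⟩⟩, h⟩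
    obtain rfl : m = n := h
    dsimp only
    rw [addT_mk, neg_one_smul, ← sub_eq_add_neg, sub_eq_zero]
    constructor
    · intro h
      rw [(b m).injective h]
    · intro h
      simp only [TotBasis.mk.injEq, heq_eq_eq, true_and] at h
      rw [h]
  · refine (Cm.const false).congr ?_
    rintro ⟨⟨x, y⟩, h⟩
    symm
    rw [decide_eq_false_iff_not]
    intro hxy
    exact h (congrArg TotBasis.fst hxy.symm)

/-- The graded structure of a basis of an encoded complex. -/
@[reducible] def totBasisCSet (h : K.HasOperations) (hb : K.IsComputableBasis b) : CSet (TotBasis b) where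
  toCoded := totBasisCoded b K
  deg x := x.1
  lab _ := 0
  ceq := totBasis_ceq b h hb
  cm_deg := by
    let _ := totBasisCoded b K
    exact Cm.tt_fst.comp (totBasis_cm b)
  cm_lab := by
    let _ := totBasisCoded b K
    exact Cm.const 0

/-- The expansion of a chain. -/
def basisTo (n : ℕ) : C.X n →ₗ[ℤ] V (TotBasis b) :=
  Finsupp.lmapDomain ℤ ℤ (TotBasis.mk n) ∘ₗ (b n).repr.toLinearMap

theorem basisTo_basis (n : ℕ) (i : ι n) : basisTo b n (b n i) = single ⟨n, i⟩ 1 := by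
  simp [basisTo]

/-- The chain with a given expansion. -/
def basisOf (n : ℕ) : V (TotBasis b) →ₗ[ℤ] C.X n := by
  classical
  exact Finsupp.linearCombination ℤ fun x : TotBasis b =>
    if h : x.1 = n then tr (fun n => C.X n) h (b x.1 x.2) else 0

theorem basisOf_single (n : ℕ) (i : ι n) : basisOf b n (single ⟨n, i⟩ 1) = b n i := by
  simp [basisOf]

theorem basisOf_single_of_ne {n : ℕ} {x : TotBasis b} (h : x.1 ≠ n) : basisOf b n (single x 1) = 0 := by
  simp [basisOf, h]

/-- The differential in terms of the basis. -/
def basisD : V (TotBasis b) →ₗ[ℤ] V (TotBasis b) :=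
  Finsupp.linearCombination ℤ fun x : TotBasis b =>
    match x with
    | ⟨0, _⟩ => 0
    | ⟨n + 1, i⟩ => basisTo b n (C.d (n + 1) n (b (n + 1) i))

theorem basisD_basisTo (n : ℕ) (c : C.X (n + 1)) :
    basisD b (basisTo b (n + 1) c) = basisTo b n (C.d (n + 1) n c) := by
  suffices h : basisD b ∘ₗ basisTo b (n + 1) =
      basisTo b n ∘ₗ (AddMonoidHom.toIntLinearMap (C.d (n + 1) n).hom) from LinearMap.congr_fun h c
  refine (b (n + 1)).ext fun i => ?_
  rw [LinearMap.comp_apply, basisTo_basis]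
  simp [basisD]

theorem basisTo_spt {n : ℕ} {c : C.X n} {x : TotBasis b} (h : basisTo b n c x ≠ 0) : x.1 = n := by
  by_contra hx
  refine h (Finsupp.mapDomain_of_notMem_range _ _ ?_)
  rintro ⟨i, rfl⟩
  exact hx rfl

theorem cm_basisTo (hb : K.IsComputableBasis b) :
    letI := totBasisCoded b K
    Cm fun p : Tt K => basisTo b p.1 p.2 := by
  let _ := totBasisCoded b K
  obtain ⟨φ, h1, h2⟩ := hb.expand
  have hd : Computable fun p : (ℕ × ℕ) × List (ℤ × ℕ) => Encodable.encode
      (p.2.map fun q => Nat.pair (Encodable.encode q.1) (Nat.pair p.1.1 q.2)) := by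
    refine Computable.encode.comp (Primrec.to_comp (Primrec.list_map Primrec.snd ?_))
    exact (Primrec₂.natPair.comp (Primrec.encode.comp (Primrec.fst.comp Primrec.snd))
      (Primrec₂.natPair.comp (Primrec.fst.comp (Primrec.fst.comp Primrec.fst))
        (Primrec.snd.comp Primrec.snd))).to₂
  refine cm_tt_iff.2 ⟨fun p => (φ p).map fun l => Encodable.encode
      (l.map fun q => Nat.pair (Encodable.encode q.1) (Nat.pair p.1 q.2)), h1.map hd.to₂, ?_⟩
  intro n k c hc
  obtain ⟨l, hl, s, hs, rfl, h3⟩ := h2 n k c hc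
  refine ⟨_, Part.mem_map _ hl, s.map (fun q => (q.1, ⟨n, q.2⟩)), ⟨_, rfl, ?_⟩, ?_⟩
  · rw [List.forall₂_map_left_iff, List.forall₂_map_right_iff]
    refine h3.imp ?_
    rintro p q ⟨h4, h5⟩
    refine ⟨?_, ?_⟩
    · rw [Nat.unpair_pair]
      change Encodable.encode p.1 = Encodable.encode q.1
      rw [h4]
    · rw [Nat.unpair_pair]
      exact tt_isCode_pair.2 h5
  · dsimp only
    rw [basisTo, LinearMap.comp_apply]
    change mapDomain _ ((b n).repr _) = _
    rw [repr_sum]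
    clear hs hl hc h3
    induction s with
    | nil => simp
    | cons q s ih => rw [ev_cons, mapDomain_add, ih]; simp

theorem cm_basisOf (h : K.HasOperations) :
    letI := totBasisCoded b K
    Cm fun p : ℕ × V (TotBasis b) => (⟨p.1, basisOf b p.1 p.2⟩ : Tt K) := by
  classical
  let _ := totBasisCoded b K
  refine Cm.of_ev ?_
  have hf := Cm.list_foldr (X := ℕ × List (ℤ × TotBasis b)) (l := fun p => p.2)
    (c := fun p => (⟨p.1, 0⟩ : Tt K))
    (f := fun q : (ℕ × List (ℤ × TotBasis b)) × (ℤ × TotBasis b) × Tt K =>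
      if q.2.1.2.1 = q.1.1 then addT (⟨q.2.1.2.1, q.2.1.1 • b q.2.1.2.1 q.2.1.2.2⟩, q.2.2) else q.2.2)
    (Cm.ite (CmP.eq (Cm.tt_fst.comp ((totBasis_cm b).comp (f := fun q : (ℕ × List (ℤ × TotBasis b)) ×
        (ℤ × TotBasis b) × Tt K => q.2.1.2) (by fun_prop))) (by fun_prop))
      ((cm_addT h).comp (Cm.pair ((cm_zsmulT h).comp (f := fun q : (ℕ × List (ℤ × TotBasis b)) ×
        (ℤ × TotBasis b) × Tt K => (q.2.1.1, (⟨q.2.1.2.1, b q.2.1.2.1 q.2.1.2.2⟩ : Tt K)))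
        (Cm.pair (by fun_prop) ((totBasis_cm b).comp (by fun_prop)))) (by fun_prop))) (by fun_prop))
    ((cm_zeroT h).comp Cm.fst) Cm.snd
  refine hf.congr ?_
  rintro ⟨n, l⟩
  dsimp only
  induction l with
  | nil => simp
  | cons q l ih =>
    rw [List.foldr_cons, ih]
    obtain ⟨z, m, i⟩ := q
    have e : single (⟨m, i⟩ : TotBasis b) z = z • single ⟨m, i⟩ (1 : ℤ) := by simp
    dsimp only
    rw [ev_cons, map_add, e, map_zsmul]
    by_cases hm : m = n
    · subst hm
      rw [if_pos rfl, addT_mk, basisOf_single]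
    · rw [if_neg hm, basisOf_single_of_ne b (x := ⟨m, i⟩) hm, smul_zero, zero_add]

theorem cm_basisD (h : K.HasOperations) (hb : K.IsComputableBasis b) :
    letI := totBasisCoded b K
    Cm (basisD b) := by
  let _ := totBasisCoded b K
  refine Cm.linear (Cm.glue_prop (P := fun x : TotBasis b => x.1 = 0)
    (CmP.eq (Cm.tt_fst.comp (totBasis_cm b)) (Cm.const 0)) ?_ ?_)
  · refine (Cm.const 0).congr ?_
    rintro ⟨⟨n, i⟩, h⟩
    obtain rfl : n = 0 := h
    simp [basisD]
  · have h1 := (cm_basisTo b hb).comp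
      ((computableMaps_iff (e := fun n => n) (f := fun n c => C.d (n + 1) n c) Computable.id).1 h.d)
    have hp : Computable fun k : ℕ => Nat.pair (k.unpair.1 - 1) k.unpair.2 :=
      partrec_natPair (Computable.comp Primrec.pred.to_comp (Computable.fst.comp Computable.unpair))
        (Computable.snd.comp Computable.unpair)
    have hs : ∀ x : {x : TotBasis b // ¬ x.1 = 0}, ∃ (n : ℕ) (i : ι (n + 1)), x.1 = ⟨n + 1, i⟩ := by
      rintro ⟨⟨n, i⟩, h⟩
      cases n with
      | zero => exact (h rfl).elim
      | succ n => exact ⟨n, i, rfl⟩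
    -- The choice of `n` and `i` need not be effective: on codes the predecessor is obtained by
    -- subtracting one from the degree and keeping the code of the chain.
    choose n i hx using hs
    refine (h1.comp (f := fun x : {x : TotBasis b // ¬ x.1 = 0} =>
      (⟨n x, b (n x + 1) (i x)⟩ : Tt fun n => K (n + 1))) ⟨_, hp.partrec, ?_⟩).congr ?_
    · intro k x hk
      refine ⟨_, Part.mem_some _, ?_⟩
      have hk' : IsCode k (⟨x.1.1, b x.1.1 x.1.2⟩ : Tt K) := hk
      rw [hx x] at hk'
      obtain ⟨h2, h3⟩ := hk'
      obtain h2 : k.unpair.1 = n x + 1 := h2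
      change IsCode (Nat.pair (k.unpair.1 - 1) k.unpair.2) _
      rw [h2]
      exact tt_isCode_pair.2 h3
    · intro x
      rw [hx x]
      simp [basisD]

/-- The complex of a locally effective chain complex. -/
def basisCx (h : K.HasOperations) (hb : K.IsComputableBasis b) : Cx.{u} False where
  B := TotBasis b
  inst := totBasisCSet b h hb
  d := basisD b
  d_d v := by
    suffices h : basisD b ∘ₗ basisD b = 0 from LinearMap.congr_fun h v
    ext1 x
    ext1
    obtain ⟨n, i⟩ := x
    simp only [LinearMap.comp_apply, lsingle_apply]
    rw [← basisTo_basis]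
    cases n with
    | zero => simp [basisTo_basis, basisD]
    | succ n =>
      rw [basisD_basisTo]
      cases n with
      | zero =>
        suffices h0 : ∀ c : C.X 0, basisD b (basisTo b 0 c) = 0 from h0 _
        intro c
        suffices h : basisD b ∘ₗ basisTo b 0 = 0 from LinearMap.congr_fun h c
        refine (b 0).ext fun i => ?_
        rw [LinearMap.comp_apply, basisTo_basis]
        simp [basisD]
      | succ n =>
        rw [basisD_basisTo]
        have := ConcreteCategory.congr_hom (C.d_comp_d (n + 2) (n + 1) n) (b (n + 2) i)
        exact (congrArg (basisTo b n) this).trans (map_zero _)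
  good := by
    let _ := totBasisCSet b h hb
    refine ⟨?_, cm_basisD b h hb⟩
    rintro ⟨n, i⟩ y hy
    refine ⟨?_, False.elim⟩
    cases n with
    | zero => simp [basisD] at hy
    | succ n =>
      simp only [basisD, linearCombination_single, one_smul] at hy
      have := basisTo_spt b hy
      change (y.1 : ℤ) = ((n + 1 : ℕ) : ℤ) + -1
      rw [this]
      simp

/-- A locally effective chain complex is presented by the complex of its basis. -/
def basisPres (h : K.HasOperations) (hb : K.IsComputableBasis b) : Pres K (basisCx b h hb) where
  toV n := (basisTo b n).toAddMonoidHom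
  ofV n := (basisOf b n).toAddMonoidHom
  of_to n c := by
    suffices h : basisOf b n ∘ₗ basisTo b n = LinearMap.id from LinearMap.congr_fun h c
    refine (b n).ext fun i => ?_
    rw [LinearMap.comp_apply, basisTo_basis, basisOf_single, LinearMap.id_apply]
  to_of := fun x : TotBasis b => by
    change basisTo b x.1 (basisOf b x.1 (single ⟨x.1, x.2⟩ 1)) = _
    rw [basisOf_single, basisTo_basis]
    rfl
  of_ne _ x hx := basisOf_single_of_ne b hx
  spt n c x hx := basisTo_spt b hx
  d n c := (basisD_basisTo b n c).symm
  cm_to := cm_basisTo b hb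
  cm_of := cm_basisOf b h

theorem basis_finB (h : K.HasOperations) (hb : K.IsComputableBasis b)
    (hfin : ∃ φ : ℕ →. List ℕ, Partrec φ ∧ ∀ n, ∃ l ∈ φ n, ∃ s : List (ι n),
        s.Nodup ∧ (∀ i, i ∈ s) ∧ List.Forall₂ (fun k i => (K n).IsCode k (b n i)) l s) :
    FinB (basisCx b h hb).B := by
  let _ := totBasisCoded b K
  obtain ⟨φ, h1, h2⟩ := hfin
  choose l hl s _ hs h3 using h2
  refine ⟨fun n => (s n).map (TotBasis.mk n), ?_, ?_⟩
  · have hd : Computable fun p : ℕ × List ℕ => Encodable.encode (p.2.map fun k => Nat.pair p.1 k) := by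
      refine Computable.encode.comp (Primrec.to_comp (Primrec.list_map Primrec.snd ?_))
      exact (Primrec₂.natPair.comp (Primrec.fst.comp Primrec.fst) Primrec.snd).to₂
    refine ⟨fun n => (φ n).map fun l => Encodable.encode (l.map fun k => Nat.pair n k),
      h1.map hd.to₂, ?_⟩
    intro k n hk
    obtain rfl : k = n := hk
    refine ⟨_, Part.mem_map _ (hl k), _, rfl, ?_⟩
    rw [List.forall₂_map_left_iff]
    refine List.forall₂_map_right_iff.2 ?_
    exact (h3 k).imp fun k i h => tt_isCode_pair.2 h
  · intro n x
    obtain ⟨m, i⟩ := x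
    change (⟨m, i⟩ : TotBasis b) ∈ (s n).map (TotBasis.mk n) ↔ m = n
    rw [List.mem_map]
    constructor
    · rintro ⟨j, _, hj⟩
      exact (congrArg TotBasis.fst hj).symm
    · intro h
      obtain rfl : m = n := h
      exact ⟨i, hs m i, rfl⟩

end ofBasis

end

/-! ### Normalized chains of simplicial sets, relative to a subcomplex -/

section

open Coded Finsupp CSet

/-! ### Simplices of all dimensions -/

/-- The simplices of all dimensions. -/
structure Tot (W : SSet.{u}) where
  dim : ℕ
  val : W _⦋dim⦌

/-- The truncation of `i` to an element of `Fin (n + 1)`. -/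
def clampFin (n i : ℕ) : Fin (n + 1) := ⟨min i n, by omega⟩

@[simp] theorem clampFin_val {n : ℕ} (i : Fin (n + 1)) : clampFin n i = i := by
  ext; simp [clampFin]; omega

theorem clampFin_coe {n i : ℕ} (h : i ≤ n) : (clampFin n i : ℕ) = i := by simp [clampFin, h]

namespace Tot

variable {W W' : SSet.{u}}

/-- The faces. -/
def face (i : ℕ) (w : Tot W) : Tot W := match w with
  | ⟨0, x⟩ => ⟨0, x⟩
  | ⟨n + 1, x⟩ => ⟨n, W.δ (clampFin (n + 1) i) x⟩

/-- The degeneracies. -/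
def degen (i : ℕ) (w : Tot W) : Tot W := ⟨w.dim + 1, W.σ (clampFin w.dim i) w.val⟩

theorem face_val {n : ℕ} (i : Fin (n + 2)) (x : W _⦋n + 1⦌) :
    face i ⟨n + 1, x⟩ = ⟨n, W.δ i x⟩ := by simp [face]

theorem degen_val {n : ℕ} (i : Fin (n + 1)) (x : W _⦋n⦌) :
    degen i ⟨n, x⟩ = ⟨n + 1, W.σ i x⟩ := by simp [degen]

/-- The map induced by a simplicial map. -/
def map (f : W ⟶ W') (w : Tot W) : Tot W' := ⟨w.dim, f.app (op ⦋w.dim⦌) w.val⟩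

/-- Nondegenerate simplices. -/
def ND (w : Tot W) : Prop := w.val ∈ W.nonDegenerate w.dim

theorem ext_val {n : ℕ} {x y : W _⦋n⦌} (h : (⟨n, x⟩ : Tot W) = ⟨n, y⟩) : x = y := by
  cases h; rfl

/-- If `x = s_i y` then `y = d_i x`, because `d_i s_i = 1`. So degeneracy is tested by finitely many
applications of the operators, without a search for `y`. -/
theorem not_nD_iff {n : ℕ} (x : W _⦋n + 1⦌) :
    ¬ ND ⟨n + 1, x⟩ ↔ ∃ i : Fin (n + 1), W.σ i (W.δ i.castSucc x) = x := by
  change ¬ x ∈ (W.degenerate (n + 1))ᶜ ↔ _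
  rw [Set.mem_compl_iff, not_not, SSet.degenerate_eq_iUnion_range_σ, Set.mem_iUnion]
  refine exists_congr fun i => ⟨?_, fun h => ⟨_, h⟩⟩
  rintro ⟨y, rfl⟩
  congr 1
  exact ConcreteCategory.congr_hom (W.δ_comp_σ_self (i := i)) y

theorem not_nD_σ {n : ℕ} (i : Fin (n + 1)) (x : W _⦋n⦌) : ¬ ND ⟨n + 1, W.σ i x⟩ := fun h =>
  h (W.σ_mem_degenerate i x)

theorem exists_σ {n : ℕ} {x : W _⦋n⦌} (h : ¬ ND ⟨n, x⟩) :
    ∃ m, ∃ _ : n = m + 1, ∃ i : Fin (m + 1), ∃ y : W _⦋m⦌, (⟨n, x⟩ : Tot W) = ⟨m + 1, W.σ i y⟩ := by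
  obtain _ | m := n
  · exact (h (by change x ∈ _; simp)).elim
  · obtain ⟨i, hi⟩ := (not_nD_iff x).1 h
    exact ⟨m, rfl, i, _, by rw [hi]⟩

theorem nD_iff (w : Tot W) : ND w ↔ ∀ i ∈ List.range w.dim, degen i (face i w) ≠ w := by
  obtain ⟨_ | n, x⟩ := w
  · simp [ND]
  · rw [← not_iff_not, not_nD_iff]
    simp only [List.mem_range, not_forall, not_not, exists_prop]
    constructor
    · rintro ⟨i, hi⟩
      refine ⟨i, i.2, ?_⟩
      have := face_val i.castSucc x
      rw [Fin.val_castSucc] at this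
      rw [this, degen_val, hi]
    · rintro ⟨i, hi, h⟩
      refine ⟨⟨i, hi⟩, ?_⟩
      have := face_val (Fin.castSucc ⟨i, hi⟩) x
      rw [Fin.val_castSucc] at this
      rw [this] at h
      have h2 := degen_val ⟨i, hi⟩ (W.δ (Fin.castSucc ⟨i, hi⟩) x)
      rw [h2] at h
      exact ext_val h

theorem not_nD_map (f : W ⟶ W') {w : Tot W} (h : ¬ ND w) : ¬ ND (map f w) := by
  have h1 : w.val ∈ W.degenerate w.dim := not_not.1 h
  exact fun h' => h' (SSet.degenerate_app_apply h1 f)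

end Tot

open Tot

/-- Simplicial sets with computable operators on coded simplices. -/
class EffS (W : SSet.{u}) extends Coded (Tot W) where
  ceq : CEq (Tot W)
  cm_dim : Cm (Tot.dim : Tot W → ℕ)
  cm_face : Cm fun p : ℕ × Tot W => p.2.face p.1
  cm_degen : Cm fun p : ℕ × Tot W => p.2.degen p.1

attribute [instance] EffS.ceq
attribute [fun_prop] EffS.cm_dim

section

variable {W : SSet.{u}} [EffS W] {X : Type*} [Coded X]

@[fun_prop]
theorem Cm.face {i : X → ℕ} {w : X → Tot W} (hi : Cm i) (hw : Cm w) : Cm fun x => (w x).face (i x) :=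
  EffS.cm_face.comp (hi.pair hw)

@[fun_prop]
theorem Cm.degen {i : X → ℕ} {w : X → Tot W} (hi : Cm i) (hw : Cm w) :
    Cm fun x => (w x).degen (i x) :=
  EffS.cm_degen.comp (hi.pair hw)

theorem cmP_nD : CmP fun w : Tot W => w.ND := by
  refine (CmP.forall_mem (P := fun p : Tot W × ℕ => degen p.2 (Tot.face p.2 p.1) ≠ p.1)
    (l := fun w => List.range w.dim) (CmP.not (CmP.eq (by fun_prop) (by fun_prop)))
    (by fun_prop)).congr fun w => ?_
  rw [nD_iff]

/-- Finite sums are computable. -/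
theorem Cm.v_sum_range {B : Type*} [Coded B] {n : X → ℕ} {f : X × ℕ → V B} (hn : Cm n) (hf : Cm f) :
    Cm fun x => ∑ i ∈ Finset.range (n x), f (x, i) := by
  refine (Cm.nat_rec (X := X) (z := fun _ => (0 : V B)) (s := fun p => p.2.2 + f (p.1, p.2.1)) (n := n)
    (Cm.const 0) (by fun_prop) hn).congr fun x => ?_
  induction n x with
  | zero => rfl
  | succ m ih => rw [Finset.sum_range_succ, ← ih]

end

theorem hom_sum_apply {ι : Type*} {A B : AddCommGrpCat.{u}} (t : Finset ι) (f : ι → (A ⟶ B)) (x : A) :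
    (∑ i ∈ t, f i) x = ∑ i ∈ t, f i x := by
  let φ : (A ⟶ B) →+ B := { toFun := fun g => g x, map_zero' := rfl, map_add' := fun _ _ => rfl }
  exact map_sum φ f t

theorem hom_zsmul_apply {A B : AddCommGrpCat.{u}} (z : ℤ) (f : A ⟶ B) (x : A) :
    (z • f) x = z • f x := by
  let φ : (A ⟶ B) →+ B := { toFun := fun g => g x, map_zero' := rfl, map_add' := fun _ _ => rfl }
  exact map_zsmul φ z f

theorem map_alternating_sum {A B : AddCommGrpCat.{u}} {M : Type*} [AddCommGroup M] (φ : B →+ M) {m : ℕ}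
    (f : Fin m → (A ⟶ B)) (x : A) :
    φ ((∑ i : Fin m, (-1 : ℤ) ^ (i : ℕ) • f i) x) = ∑ i : Fin m, (-1 : ℤ) ^ (i : ℕ) • φ (f i x) := by
  rw [hom_sum_apply, map_sum]
  exact Finset.sum_congr rfl fun i _ => by rw [hom_zsmul_apply, map_zsmul]

theorem map_neg_apply {A B : AddCommGrpCat.{u}} {M : Type*} [AddCommGroup M] (φ : B →+ M)
    (f : A ⟶ B) (x : A) : φ ((-f) x) = -φ (f x) :=
  map_neg φ _

theorem map_add_apply {A B : AddCommGrpCat.{u}} {M : Type*} [AddCommGroup M] (φ : B →+ M)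
    (f g : A ⟶ B) (x : A) : φ ((f + g) x) = φ (f x) + φ (g x) :=
  map_add φ _ _

/-- A simplicial set with a subcomplex `A` and a filtration label, preserved by the faces if `s`
holds. -/
structure CellData (s : Prop) where
  W : SSet.{u}
  [eff : EffS W]
  A : Tot W → Prop
  lab : Tot W → ℕ
  cm_A : CmP A
  cm_lab : Cm lab
  A_face : ∀ (n : ℕ) (i : Fin (n + 2)) (x : W _⦋n + 1⦌), A ⟨n + 1, x⟩ → A ⟨n, W.δ i x⟩
  lab_face : s → ∀ (n : ℕ) (i : Fin (n + 2)) (x : W _⦋n + 1⦌), lab ⟨n, W.δ i x⟩ = lab ⟨n + 1, x⟩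

attribute [instance] CellData.eff

namespace CellData

variable {s : Prop} (D D' : CellData.{u} s)

/-- The nondegenerate simplices outside of the subcomplex. -/
abbrev Cell : Type u := {w : Tot D.W // w.ND ∧ ¬ D.A w}

instance : CSet D.Cell where
  deg c := c.1.dim
  lab c := D.lab c.1
  ceq := inferInstance
  cm_deg := EffS.cm_dim.comp Cm.val
  cm_lab := D.cm_lab.comp Cm.val

variable {D}

theorem deg_def (c : D.Cell) : deg c = c.1.dim := rfl

theorem lab_def (c : D.Cell) : CSet.lab c = D.lab c.1 := rfl

@[fun_prop]
theorem cm_val : Cm fun c : D.Cell => c.1 := Cm.val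

variable (D)

open Classical in
/-- The chain of a simplex. -/
def br (w : Tot D.W) : V D.Cell := if h : w.ND ∧ ¬ D.A w then single ⟨w, h⟩ 1 else 0

variable {D}

theorem br_cell (c : D.Cell) : D.br c.1 = single c 1 := by
  rw [br, dif_pos c.2]

theorem br_of_not_nD {w : Tot D.W} (h : ¬ w.ND) : D.br w = 0 := dif_neg fun h' => h h'.1

theorem br_of_A {w : Tot D.W} (h : D.A w) : D.br w = 0 := dif_neg fun h' => h'.2 h

theorem br_apply {w : Tot D.W} {c : D.Cell} (h : D.br w c ≠ 0) : c.1 = w := by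
  by_cases hw : w.ND ∧ ¬ D.A w
  · rw [br, dif_pos hw, single_apply_ne_zero] at h
    rw [h.1]
  · rw [br, dif_neg hw] at h
    exact (h rfl).elim

theorem cm_br : Cm D.br := by
  refine Cm.glue_prop (P := fun w : Tot D.W => w.ND ∧ ¬ D.A w)
    (cmP_nD.and D.cm_A.not) ?_ ?_
  · refine (Cm.v_single (b := fun x : {w : Tot D.W // w.ND ∧ ¬ D.A w} => (x : D.Cell)) (z := fun _ => 1)
      Cm.id (Cm.const 1)).congr fun x => ?_
    exact (br_cell x).symm
  · refine (Cm.const 0).congr fun x => ?_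
    rw [br, dif_neg x.2]

@[fun_prop]
theorem _root_.EffHom.Cm.br {X : Type*} [Coded X] {w : X → Tot D.W} (hw : Cm w) : Cm fun x => D.br (w x) :=
  cm_br.comp hw

theorem hom_ext {M : Type*} [AddCommGroup M] {f g : V D.Cell →ₗ[ℤ] M}
    (h : ∀ (n : ℕ) (x : D.W _⦋n⦌), f (D.br ⟨n, x⟩) = g (D.br ⟨n, x⟩)) : f = g := by
  refine Finsupp.lhom_ext' fun c => LinearMap.ext_ring ?_
  change f (single c 1) = g (single c 1)
  rw [← br_cell]
  exact h _ _

theorem hom_ext' {M : Type*} [AddCommGroup M] {f g : V D.Cell →ₗ[ℤ] M}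
    (h : ∀ (n : ℕ) (x : D.W _⦋n⦌), f (D.br ⟨n, x⟩) = g (D.br ⟨n, x⟩)) (v : V D.Cell) : f v = g v := by
  rw [hom_ext h]

variable (D)

/-- The linear extension of the chains of simplices. -/
def brN (n : ℕ) : FreeAbelianGroup (D.W _⦋n⦌) →+ V D.Cell := FreeAbelianGroup.lift fun x => D.br ⟨n, x⟩

/-- The boundary of a simplex. -/
def dT (w : Tot D.W) : V D.Cell := match w with
  | ⟨0, _⟩ => 0
  | ⟨n + 1, x⟩ => ∑ i : Fin (n + 2), (-1 : ℤ) ^ (i : ℕ) • D.br ⟨n, D.W.δ i x⟩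

variable {D}

theorem cm_dT : Cm D.dT := by
  classical
  refine (Cm.ite (CmP.eq (f := fun w : Tot D.W => w.dim) (g := fun _ => 0) (by fun_prop) (by fun_prop)) (Cm.const 0)
    (Cm.v_sum_range (n := fun w => w.dim + 1)
      (f := fun p => (-1 : ℤ) ^ p.2 • D.br (face p.2 p.1))
      (by fun_prop) (Cm.v_smul (by fun_prop) (by fun_prop)))).congr fun w => ?_
  obtain ⟨_ | n, x⟩ := w
  · rfl
  · rw [if_neg (by simp), Finset.sum_range, dT]
    exact Finset.sum_congr rfl fun i _ => by rw [face_val]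

/-- The differential. -/
def dV : V D.Cell →ₗ[ℤ] V D.Cell := Finsupp.linearCombination ℤ fun c : D.Cell => D.dT c.1

/-- The boundary formula is definitional only for basis elements. It extends to simplices of `A`
because `A` is closed under faces, and to degenerate ones by the usual cancellation; afterwards no
case distinction between simplices is needed. -/
theorem dV_br (w : Tot D.W) : dV (D.br w) = D.dT w := by
  by_cases hw : w.ND ∧ ¬ D.A w
  · rw [show D.br w = _ from br_cell ⟨w, hw⟩, dV, linearCombination_single, one_smul]
  rw [show D.br w = 0 from dif_neg hw, map_zero]
  obtain ⟨n, x⟩ := w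
  by_cases hA : D.A ⟨n, x⟩
  · obtain _ | n := n
    · rfl
    · refine (Finset.sum_eq_zero fun i _ => ?_).symm
      rw [br_of_A (D.A_face n i x hA), smul_zero]
  · obtain ⟨m, hm, j, y, h⟩ := exists_σ (W := D.W) (x := x) (fun h => hw ⟨h, hA⟩)
    rw [h]
    change 0 = ∑ i : Fin (m + 2), (-1 : ℤ) ^ (i : ℕ) • D.br ⟨m, D.W.δ i (D.W.σ j y)⟩
    -- Of the faces of `s_j y`, all but those with index `j` and `j + 1` are degenerate. These two
    -- are both `y` and occur with opposite signs.
    have key : ∀ i : Fin (m + 2), i ≠ j.castSucc → i ≠ j.succ → D.br ⟨m, D.W.δ i (D.W.σ j y)⟩ = 0 := by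
      intro i h1 h2
      refine br_of_not_nD ?_
      obtain _ | m := m
      · exfalso
        obtain rfl : j = 0 := Fin.eq_zero j
        fin_cases i
        · exact h1 rfl
        · exact h2 rfl
      rcases lt_or_gt_of_ne h1 with h3 | h3
      · obtain ⟨j, rfl⟩ : ∃ j', j = Fin.succ j' :=
          Fin.exists_succ_eq.2 (by rintro rfl; simp at h3) |>.imp fun _ => Eq.symm
        obtain ⟨i, rfl⟩ : ∃ i', i = Fin.castSucc i' :=
          Fin.exists_castSucc_eq.2 (by rintro rfl; exact absurd h3 (by simp [Fin.lt_def]; omega)) |>.imp fun _ => Eq.symm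
        have := ConcreteCategory.congr_hom (D.W.δ_comp_σ_of_le (i := i) (j := j)
          (by simp only [Fin.lt_def, Fin.le_def, Fin.val_castSucc, Fin.val_succ] at *; omega)) y
        simp only [ConcreteCategory.comp_apply] at this
        rw [this]
        exact not_nD_σ _ _
      · have h4 : j.succ < i := lt_of_le_of_ne
          (by simp only [Fin.lt_def, Fin.le_def, Fin.val_castSucc, Fin.val_succ] at *; omega) (Ne.symm h2)
        obtain ⟨i, rfl⟩ : ∃ i', i = Fin.succ i' :=
          Fin.exists_succ_eq.2 (by rintro rfl; simp at h4) |>.imp fun _ => Eq.symm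
        obtain ⟨j, rfl⟩ : ∃ j', j = Fin.castSucc j' :=
          Fin.exists_castSucc_eq.2 (by rintro rfl; simp [Fin.lt_def] at h4; omega) |>.imp fun _ => Eq.symm
        have := ConcreteCategory.congr_hom (D.W.δ_comp_σ_of_gt (i := i) (j := j)
          (by simp only [Fin.lt_def, Fin.le_def, Fin.val_castSucc, Fin.val_succ] at *; omega)) y
        simp only [ConcreteCategory.comp_apply] at this
        rw [this]
        exact not_nD_σ _ _
    have e1 : D.W.δ j.castSucc (D.W.σ j y) = y := ConcreteCategory.congr_hom (D.W.δ_comp_σ_self (i := j)) y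
    have e2 : D.W.δ j.succ (D.W.σ j y) = y := ConcreteCategory.congr_hom (D.W.δ_comp_σ_succ (i := j)) y
    rw [← Finset.sum_subset (Finset.subset_univ {j.castSucc, j.succ}), Finset.sum_pair (by simp [Fin.ext_iff]),
      e1, e2]
    · simp [pow_succ]
    · intro i _ hi
      simp only [Finset.mem_insert, Finset.mem_singleton, not_or] at hi
      rw [key i hi.1 hi.2, smul_zero]

theorem dV_br_succ {n : ℕ} (x : D.W _⦋n + 1⦌) :
    dV (D.br ⟨n + 1, x⟩) = ∑ i : Fin (n + 2), (-1 : ℤ) ^ (i : ℕ) • D.br ⟨n, D.W.δ i x⟩ := dV_br _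

theorem dV_br_zero (x : D.W _⦋0⦌) : dV (D.br ⟨0, x⟩) = 0 := dV_br _

variable (D)

/-- The complex of free abelian groups on the simplices. -/
abbrev free : SimplicialObject AddCommGrpCat.{u} :=
  ((SimplicialObject.whiskering _ _).obj AddCommGrpCat.free).obj D.W

variable {D}

theorem brN_of {n : ℕ} (x : D.W _⦋n⦌) : D.brN n (FreeAbelianGroup.of x) = D.br ⟨n, x⟩ :=
  FreeAbelianGroup.lift_apply_of _ _

/-- The chains are a quotient of the unnormalized chain complex of free abelian groups, from which
the vanishing of `d²` and the chain homotopy formula are inherited. -/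
theorem dV_brN (n : ℕ) (c : FreeAbelianGroup (D.W _⦋n + 1⦌)) :
    dV (D.brN (n + 1) c) =
      D.brN n (((AlgebraicTopology.alternatingFaceMapComplex AddCommGrpCat.{u}).obj D.free).d (n + 1) n c) := by
  have : ((dV : V D.Cell →ₗ[ℤ] V D.Cell).toAddMonoidHom.comp (D.brN (n + 1))) =
      (D.brN n).comp (((AlgebraicTopology.alternatingFaceMapComplex AddCommGrpCat.{u}).obj D.free).d (n + 1) n).hom := by
    refine FreeAbelianGroup.lift_ext (β := V D.Cell) _ _ ?_
    intro x
    change dV (D.brN (n + 1) (FreeAbelianGroup.of x)) = D.brN n ((((AlgebraicTopology.alternatingFaceMapComplex AddCommGrpCat.{u}).obj D.free).d (n + 1) n) (FreeAbelianGroup.of x))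
    rw [brN_of, dV_br_succ, AlgebraicTopology.alternatingFaceMapComplex_obj_d,
      AlgebraicTopology.AlternatingFaceMapComplex.objD]
    refine Eq.trans ?_ (map_alternating_sum (B := D.free _⦋n⦌) (D.brN n) _ _).symm
    refine Finset.sum_congr rfl fun i _ => ?_
    rw [← brN_of]
    rfl
  exact DFunLike.congr_fun this c

theorem dV_dV (v : V D.Cell) : dV (dV v) = 0 := by
  have : (dV ∘ₗ dV : V D.Cell →ₗ[ℤ] V D.Cell) = 0 := by
    refine hom_ext fun n x => ?_
    change dV (dV (D.br ⟨n, x⟩)) = 0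
    obtain _ | _ | n := n
    · rw [dV_br_zero, map_zero]
    · rw [dV_br_succ, map_sum]
      exact Finset.sum_eq_zero fun i _ => by rw [map_zsmul, dV_br_zero, smul_zero]
    · rw [← brN_of, dV_brN]
      refine (dV_brN n _).trans ?_
      have h := ConcreteCategory.congr_hom
        (((AlgebraicTopology.alternatingFaceMapComplex AddCommGrpCat.{u}).obj D.free).d_comp_d
          (n + 2) (n + 1) n) (FreeAbelianGroup.of x)
      exact (congrArg (D.brN n) h).trans (map_zero _)
  exact LinearMap.congr_fun this v

theorem dV_apply_ne {w : Tot D.W} {c : D.Cell} (h : D.dT w c ≠ 0) :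
    w.dim = c.1.dim + 1 ∧ (s → D.lab c.1 = D.lab w) := by
  obtain ⟨_ | n, x⟩ := w
  · exact (h rfl).elim
  · rw [dT, Finsupp.finsetSum_apply] at h
    obtain ⟨i, _, hi⟩ := Finset.exists_ne_zero_of_sum_ne_zero h
    have h1 : D.br ⟨n, D.W.δ i x⟩ c ≠ 0 := fun h0 => hi (by rw [Finsupp.smul_apply, h0, smul_zero])
    rw [br_apply h1]
    exact ⟨rfl, fun hs => D.lab_face hs _ _ _⟩

theorem good_dV : Good s (-1) (dV : V D.Cell →ₗ[ℤ] V D.Cell) :=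
  Good.lin (cm_dT.comp cm_val) fun a b hab => by
    obtain ⟨h1, h2⟩ := dV_apply_ne hab
    refine ⟨?_, h2⟩
    rw [deg_def, deg_def, h1]
    push_cast
    ring

variable (D) in
/-- The complex of chains. -/
def cx : Cx.{u} s where
  B := D.Cell
  d := dV
  d_d := dV_dV
  good := good_dV

section map

variable {s' : Prop} {D' : CellData.{u} s'} (f : D.W ⟶ D'.W)

/-- The map of chains induced by a simplicial map. -/
def mapV : V D.Cell →ₗ[ℤ] V D'.Cell := Finsupp.linearCombination ℤ fun c : D.Cell => D'.br (c.1.map f)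

variable {f} (hA : ∀ w, D.A w → D'.A (w.map f))

include hA in
theorem mapV_br (w : Tot D.W) : mapV f (D.br w) = D'.br (w.map f) := by
  by_cases hw : w.ND ∧ ¬ D.A w
  · rw [show D.br w = _ from br_cell ⟨w, hw⟩, mapV, linearCombination_single, one_smul]
  · rw [show D.br w = 0 from dif_neg hw, map_zero]
    rw [not_and_or, not_not] at hw
    rcases hw with h | h
    · exact (br_of_not_nD (not_nD_map f h)).symm
    · exact (br_of_A (hA _ h)).symm

include hA in
theorem mapV_dV (v : V D.Cell) : mapV f (dV v) = (dV (mapV f v) : V D'.Cell) := by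
  refine hom_ext' (f := mapV f ∘ₗ dV) (g := dV ∘ₗ mapV f) (fun n x => ?_) v
  change mapV f (dV (D.br _)) = dV (mapV f (D.br _))
  rw [mapV_br hA]
  obtain _ | n := n
  · rw [dV_br_zero, map_zero]
    exact (dV_br_zero _).symm
  · rw [dV_br_succ, map_sum]
    refine Eq.trans ?_ (dV_br_succ _).symm
    refine Finset.sum_congr rfl fun i _ => ?_
    rw [map_zsmul, mapV_br hA]
    congr 2
    rw [Tot.map, Tot.mk.injEq]
    exact ⟨rfl, heq_of_eq (ConcreteCategory.congr_hom (SimplicialObject.δ_naturality f i) x)⟩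

theorem cm_mapV (hf : Cm fun w : Tot D.W => w.map f) : Cm (mapV f : V D.Cell → V D'.Cell) :=
  Cm.linear ((cm_br.comp (hf.comp cm_val)).congr fun c => by
    rw [mapV, linearCombination_single, one_smul])

theorem good_mapV {D' : CellData.{u} s} {f : D.W ⟶ D'.W} (hf : Cm fun w : Tot D.W => w.map f)
    (hl : s → ∀ w : Tot D.W, D'.lab (w.map f) = D.lab w) : Good s 0 (mapV f : V D.Cell →ₗ[ℤ] V D'.Cell) :=
  Good.lin (cm_br.comp (hf.comp cm_val)) fun a b hab => by
    have h := br_apply hab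
    rw [deg_def, deg_def, lab_def, lab_def, h]
    exact ⟨by simp [Tot.map], fun hs => hl hs _⟩

end map

section homotopy

variable {D' : CellData.{u} s} {f g : D.W ⟶ D'.W} (H : SimplicialObject.Homotopy f g)

/-- The operators of a simplicial homotopy. -/
def homT (i : ℕ) (w : Tot D.W) : Tot D'.W := ⟨w.dim + 1, H.h (clampFin w.dim i) w.val⟩

/-- The chain homotopy on simplices. -/
def hT (w : Tot D.W) : V D'.Cell :=
  -∑ i : Fin (w.dim + 1), (-1 : ℤ) ^ (i : ℕ) • D'.br ⟨w.dim + 1, H.h i w.val⟩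

/-- The chain homotopy induced by a simplicial homotopy. -/
def hV : V D.Cell →ₗ[ℤ] V D'.Cell := Finsupp.linearCombination ℤ fun c : D.Cell => hT H c.1

theorem cm_hT (hH : Cm fun p : ℕ × Tot D.W => homT H p.1 p.2) : Cm (hT H) := by
  refine (Cm.v_neg (Cm.v_sum_range (n := fun w : Tot D.W => w.dim + 1)
      (f := fun p => (-1 : ℤ) ^ p.2 • D'.br (homT H p.2 p.1))
      (by fun_prop) (Cm.v_smul (by fun_prop)
        (cm_br.comp (hH.comp (Cm.snd.pair Cm.fst)))))).congr fun w => ?_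
  rw [Finset.sum_range, hT]
  congr 1
  exact Finset.sum_congr rfl fun i _ => by rw [homT, clampFin_val]

variable {H} (hA : ∀ n (i : Fin (n + 1)) (x : D.W _⦋n⦌), D.A ⟨n, x⟩ → D'.A ⟨n + 1, H.h i x⟩)

include hA in
-- The operators of a simplicial homotopy send degenerate simplices to degenerate ones, since each
-- `h_i s_j` can be rewritten as some `s_k h_l`, and they respect the subcomplexes by assumption. So
-- the homotopy descends to normalized relative chains.
theorem hV_br (w : Tot D.W) : hV H (D.br w) = hT H w := by
  by_cases hw : w.ND ∧ ¬ D.A w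
  · rw [show D.br w = _ from br_cell ⟨w, hw⟩, hV, linearCombination_single, one_smul]
  rw [show D.br w = 0 from dif_neg hw, map_zero, hT]
  obtain ⟨n, x⟩ := w
  symm
  rw [neg_eq_zero]
  refine Finset.sum_eq_zero fun i _ => ?_
  rw [not_and_or, not_not] at hw
  rcases hw with h | h
  · obtain ⟨m, hm, j, y, hy⟩ := exists_σ h
    subst hm
    obtain rfl := ext_val hy
    suffices h : ¬ ND (⟨m + 1 + 1, H.h i (D.W.σ j y)⟩ : Tot D'.W) from
      (congrArg _ (br_of_not_nD h)).trans (smul_zero _)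
    have key : ∃ k l, H.h i (D.W.σ j y) = D'.W.σ k (H.h l y) := by
      rcases le_or_gt i j.castSucc with h3 | h3
      · obtain ⟨i, rfl⟩ : ∃ i', i = Fin.castSucc i' :=
          Fin.exists_castSucc_eq.2 (by rintro rfl; simp [Fin.le_def] at h3; omega) |>.imp fun _ => Eq.symm
        exact ⟨_, _, (ConcreteCategory.congr_hom (H.h_comp_σ_succ_of_lt j i
          (by simp only [Fin.le_def, Fin.val_castSucc] at *; omega)) y).symm⟩
      · obtain ⟨i, rfl⟩ : ∃ i', i = Fin.succ i' :=
          Fin.exists_succ_eq.2 (by rintro rfl; simp at h3) |>.imp fun _ => Eq.symm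
        exact ⟨_, _, (ConcreteCategory.congr_hom (H.h_comp_σ_castSucc_of_le j i
          (by simp only [Fin.le_def, Fin.lt_def, Fin.val_castSucc, Fin.val_succ] at *; omega)) y).symm⟩
    obtain ⟨k, l, e⟩ := key
    rw [e]
    exact not_nD_σ _ _
  · rw [br_of_A (hA _ _ _ h), smul_zero]

theorem good_hV (hH : Cm fun p : ℕ × Tot D.W => homT H p.1 p.2)
    (hl : s → ∀ n (i : Fin (n + 1)) (x : D.W _⦋n⦌), D'.lab ⟨n + 1, H.h i x⟩ = D.lab ⟨n, x⟩) :
    Good s 1 (hV H) :=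
  Good.lin ((cm_hT H hH).comp cm_val) fun a b hab => by
    obtain ⟨w, hw⟩ := a
    rw [hT, Finsupp.neg_apply, neg_ne_zero, Finsupp.finsetSum_apply] at hab
    obtain ⟨i, _, hi⟩ := Finset.exists_ne_zero_of_sum_ne_zero hab
    have h1 : D'.br ⟨w.dim + 1, H.h i w.val⟩ b ≠ 0 :=
      fun h0 => hi (by rw [Finsupp.smul_apply, h0, smul_zero])
    have h := br_apply h1
    rw [deg_def, deg_def, lab_def, lab_def, h]
    exact ⟨by push_cast; rfl, fun hs => hl hs _ _ _⟩

include hA in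
-- Comparison with the chain homotopy between unnormalized chains; the minus sign in `hT` is the one
-- occurring there and makes `dh + hd` equal to `f - g`.
theorem hT_brN (n : ℕ) (c : FreeAbelianGroup (D.W _⦋n⦌)) :
    hV H (D.brN n c) =
      D'.brN (n + 1) ((H.whiskerRight AddCommGrpCat.free).toChainHomotopy.hom n (n + 1) c) := by
  have : ((hV H : V D.Cell →ₗ[ℤ] V D'.Cell).toAddMonoidHom.comp (D.brN n)) =
      (D'.brN (n + 1)).comp ((H.whiskerRight AddCommGrpCat.free).toChainHomotopy.hom n (n + 1)).hom := by
    refine FreeAbelianGroup.lift_ext (β := V D'.Cell) _ _ ?_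
    intro x
    change hV H (D.brN n (FreeAbelianGroup.of x)) = D'.brN (n + 1) (((H.whiskerRight AddCommGrpCat.free).toChainHomotopy.hom n (n + 1)) (FreeAbelianGroup.of x))
    rw [brN_of, hV_br hA,
      show (H.whiskerRight AddCommGrpCat.free).toChainHomotopy.hom n (n + 1) = _ from
      SimplicialObject.Homotopy.ToChainHomotopy.hom_eq _ _]
    refine Eq.trans ?_ ((map_neg_apply (B := D'.free _⦋n + 1⦌) (D'.brN (n + 1)) _ _).trans
      (congrArg _ (map_alternating_sum (B := D'.free _⦋n + 1⦌) (D'.brN (n + 1)) _ _))).symm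
    rw [hT]
    congr 1
    refine Finset.sum_congr rfl fun i _ => ?_
    dsimp only
    rw [← brN_of]
    rfl
  exact DFunLike.congr_fun this c

include hA in
/-- The homotopy identity. -/
theorem hV_hty (hf : ∀ w, D.A w → D'.A (w.map f)) (hg : ∀ w, D.A w → D'.A (w.map g)) (v : V D.Cell) :
    (dV (hV H v) : V D'.Cell) + hV H (dV v) = mapV f v - mapV g v := by
  refine hom_ext' (f := dV ∘ₗ hV H + hV H ∘ₗ dV) (g := mapV f - mapV g) (fun n x => ?_) v
  change dV (hV H (D.br _)) + hV H (dV (D.br _)) = mapV f (D.br _) - mapV g (D.br _)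
  rw [mapV_br hf, mapV_br hg, eq_sub_iff_add_eq]
  have e1 : ∀ (f : D.W ⟶ D'.W), D'.br (Tot.map f ⟨n, x⟩) = D'.brN n
      ((((AlgebraicTopology.alternatingFaceMapComplex AddCommGrpCat.{u}).map
        (((SimplicialObject.whiskering _ _).obj AddCommGrpCat.free).map f)).f n)
          (FreeAbelianGroup.of x)) := fun f => (brN_of (D := D') _).symm
  let K := (H.whiskerRight AddCommGrpCat.free).toChainHomotopy
  rw [e1 f, e1 g, K.comm n, prevD_eq (f := K.hom) (j' := n + 1) (w := by simp)]
  have e2 : (dV (hV H (D.br ⟨n, x⟩)) : V D'.Cell) =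
      D'.brN n ((K.hom n (n + 1) ≫ ((AlgebraicTopology.alternatingFaceMapComplex AddCommGrpCat.{u}).obj D'.free).d (n + 1) n) (FreeAbelianGroup.of x)) := by
    rw [← brN_of, hT_brN hA]
    exact dV_brN n _
  have e3 : hV H (dV (D.br ⟨n, x⟩)) = D'.brN n ((dNext n K.hom) (FreeAbelianGroup.of x)) := by
    obtain _ | n := n
    · rw [dV_br_zero, dNext_eq_zero _ _ (by simp), map_zero]
      exact (map_zero _).symm
    · rw [dNext_eq (f := K.hom) (i' := n) (w := by simp), ← brN_of, dV_brN]
      exact hT_brN hA n _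
  rw [e2, e3]
  refine Eq.trans ?_ ((map_add_apply (B := D'.free _⦋n⦌) (D'.brN n) _ _ _).trans
    (congrArg (· + _) (map_add_apply (B := D'.free _⦋n⦌) (D'.brN n) _ _ _))).symm
  exact congrArg (· + _) (add_comm _ _)

end homotopy

end CellData

end

section

open Coded Finsupp CSet Tot

theorem Cm.fst' {X A B : Type*} [Coded X] [Coded A] [Coded B] {f : X → A} {g : X → B}
    (h : Cm fun x => (f x, g x)) : Cm f := Cm.fst.comp h

theorem Cm.snd' {X A B : Type*} [Coded X] [Coded A] [Coded B] {f : X → A} {g : X → B}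
    (h : Cm fun x => (f x, g x)) : Cm g := Cm.snd.comp h

theorem Cm.of_partrec {X A B : Type*} [Coded X] [Primcodable A] [Coded A] [Lawful A] [Primcodable B]
    [Coded B] [Lawful B] {φ : A →. B} (hφ : Partrec φ) {g : X → A} {f : X → B} (hg : Cm g)
    (h : ∀ x, f x ∈ φ (g x)) : Cm f := by
  obtain ⟨φ', h1, h2⟩ := tracks_of_partrec hφ
  obtain ⟨γ, h3, h4⟩ := hg
  refine ⟨fun k => (γ k).bind φ', h3.bind (h1.comp Computable.snd), fun k x hk => ?_⟩
  obtain ⟨l, hl, h5⟩ := h4 k x hk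
  rw [Lawful.iff] at h5
  subst h5
  exact ⟨_, Part.mem_bind hl (h2 _ _ (h x)), (Lawful.iff _ _).2 rfl⟩

/-- All nondegenerate simplices. -/
@[reducible] def allCells (W : SSet.{u}) [EffS W] : CellData.{u} False where
  W := W
  A := fun _ => False
  lab := fun _ => 0
  cm_A := CmP.const _
  cm_lab := Cm.const _
  A_face := fun _ _ _ h => h
  lab_face := fun h => h.elim

/-! ### The normalized chains of a locally effective simplicial set -/

section

variable {W : SSet.{u}} (e : LocallyEffective W)

theorem totCode_injective : Function.Injective fun w : Tot W => (w.dim, e.code w.dim w.val) := by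
  rintro ⟨n, x⟩ ⟨m, y⟩ h
  simp only [Prod.mk.injEq] at h
  obtain ⟨rfl, h⟩ := h
  rw [e.code_injective _ h]

/-- The simplices of a locally effective simplicial set. -/
@[reducible] def totCoded : Coded (Tot W) := Coded.ofInj _ (totCode_injective e)

/-- A locally effective simplicial set has computable operators. -/
@[reducible] def _root_.LocallyEffective.effS : EffS W :=
  letI := totCoded e
  have h0 : Cm fun w : Tot W => (w.dim, e.code w.dim w.val) := Cm.id
  have h1 : Cm (Tot.dim : Tot W → ℕ) := Cm.fst.comp h0
  { toCoded := totCoded e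
    ceq := .of_injective h0 (totCode_injective e)
    cm_dim := h1
    cm_face := by
      obtain ⟨φ, hφ, h⟩ := e.face_computable
      refine Cm.glue_prop (P := fun p : ℕ × Tot W => p.2.dim = 0)
        (CmP.eq (h1.comp Cm.snd) (Cm.const 0)) (Cm.congr (Cm.snd.comp Cm.val) ?_) ?_
      · rintro ⟨⟨i, n, x⟩, hn⟩
        obtain rfl : n = 0 := hn
        rfl
      · have h2 : Cm fun p : {p : ℕ × Tot W // ¬ p.2.dim = 0} =>
            (p.1.2.dim, e.code p.1.2.dim p.1.2.val) := h0.comp (Cm.snd.comp Cm.val)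
        have hi : Cm fun p : {p : ℕ × Tot W // ¬ p.2.dim = 0} => p.1.1 := Cm.fst.comp Cm.val
        have hm : Cm fun p : {p : ℕ × Tot W // ¬ p.2.dim = 0} => min p.1.1 p.1.2.dim :=
          (Cm.of_primrec (Primrec.nat_min.comp Primrec.fst Primrec.snd)).comp (hi.pair h2.fst')
        refine Cm.pair (Cm.nat_sub h2.fst' (Cm.const 1) |>.congr ?_)
          (Cm.of_partrec hφ (g := fun p => (p.1.2.dim - 1, min p.1.1 p.1.2.dim, e.code p.1.2.dim p.1.2.val))
            ((h2.fst'.nat_sub (Cm.const 1)).pair (hm.pair h2.snd')) ?_)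
        · rintro ⟨⟨i, _ | n, x⟩, hx⟩
          · exact (hx rfl).elim
          · rfl
        · rintro ⟨⟨i, _ | n, x⟩, hx⟩
          · exact (hx rfl).elim
          · exact h n (clampFin (n + 1) i) x
    cm_degen := by
      obtain ⟨φ, hφ, h⟩ := e.degeneracy_computable
      have h2 : Cm fun p : ℕ × Tot W => (p.2.dim, e.code p.2.dim p.2.val) := h0.comp Cm.snd
      have hm : Cm fun p : ℕ × Tot W => min p.1 p.2.dim :=
        (Cm.of_primrec (Primrec.nat_min.comp Primrec.fst Primrec.snd)).comp (Cm.fst.pair h2.fst')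
      refine Cm.pair (Cm.nat_add h2.fst' (Cm.const 1))
        (Cm.of_partrec hφ (g := fun p => (p.2.dim, min p.1 p.2.dim, e.code p.2.dim p.2.val))
          (h2.fst'.pair (hm.pair h2.snd')) ?_)
      rintro ⟨i, n, x⟩
      exact h n (clampFin n i) x }

/-- All nondegenerate simplices of a locally effective simplicial set. -/
@[reducible] def _root_.LocallyEffective.cells : CellData.{u} False :=
  letI := e.effS
  allCells W

/-- The nondegenerate simplices. -/
abbrev _root_.LocallyEffective.Nd : Type u := e.cells.Cell

/-- The coordinates of a normalized chain. -/
def normTo (n : ℕ) : (normalizedChains W).X n →+ V e.Nd :=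
  ((W.isColimitCofanNormalizedChainComplex (AddCommGrpCat.of (ULift.{u} ℤ)) n).desc
    (Limits.Cofan.mk (AddCommGrpCat.of (V e.Nd)) fun x : W.nonDegenerate n =>
      AddCommGrpCat.ofHom (((zmultiplesHom _ (e.cells.br ⟨n, x.1⟩)).comp
        AddEquiv.ulift.toAddMonoidHom)))).hom

theorem normTo_simplexChain {n : ℕ} (x : W _⦋n⦌) : normTo e n (simplexChain W x) = e.cells.br ⟨n, x⟩ := by
  by_cases hx : x ∈ W.nonDegenerate n
  · have h := ConcreteCategory.congr_hom
      ((W.isColimitCofanNormalizedChainComplex (AddCommGrpCat.of (ULift.{u} ℤ)) n).fac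
        (Limits.Cofan.mk (AddCommGrpCat.of (V e.Nd)) fun x : W.nonDegenerate n =>
          AddCommGrpCat.ofHom (((zmultiplesHom _ (e.cells.br ⟨n, x.1⟩)).comp
            AddEquiv.ulift.toAddMonoidHom))) ⟨⟨x, hx⟩⟩) (ULift.up 1)
    refine Eq.trans h ?_
    change (1 : ℤ) • e.cells.br ⟨n, x⟩ = _
    rw [one_smul]
  · rw [CellData.br_of_not_nD (D := e.cells) (w := ⟨n, x⟩) hx, simplexChain, SSet.ιNormalizedChainComplex_eq_zero _ _ (not_not.1 hx)]
    exact map_zero _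

theorem simplexChain_of_degenerate {n : ℕ} {x : W _⦋n⦌} (hx : ¬ ND ⟨n, x⟩) : simplexChain W x = 0 := by
  rw [simplexChain, SSet.ιNormalizedChainComplex_eq_zero _ _ (not_not.1 hx)]
  rfl

theorem norm_induction {n : ℕ} {P : (normalizedChains W).X n → Prop} (h0 : P 0)
    (h : ∀ x : W _⦋n⦌, P (simplexChain W x)) (ha : ∀ a b, P a → P b → P (a + b))
    (hn : ∀ a, P a → P (-a)) (c) : P c := by
  have hc : c ∈ AddSubgroup.closure (Set.range fun x : W _⦋n⦌ => simplexChain W x) := by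
    rw [closure_range_simplexChain]
    trivial
  induction hc using AddSubgroup.closure_induction with
  | mem c hc =>
    obtain ⟨x, rfl⟩ := hc
    exact h x
  | zero => exact h0
  | add a b _ _ h1 h2 => exact ha a b h1 h2
  | neg a _ h1 => exact hn a h1

theorem norm_hom_ext {n : ℕ} {M : Type*} [AddCommGroup M] {f g : (normalizedChains W).X n →+ M}
    (h : ∀ x : W _⦋n⦌, f (simplexChain W x) = g (simplexChain W x)) (c) : f c = g c := by
  refine norm_induction (P := fun c => f c = g c) (by simp) h ?_ ?_ c
  · intro a b h1 h2
    rw [map_add, map_add, h1, h2]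
  · intro a h1
    rw [map_neg, map_neg, h1]

/-- The part of degree `n` of the chain of a simplex. -/
def chainT (n : ℕ) (w : Tot W) : (normalizedChains W).X n := by
  classical exact if h : w.dim = n then simplexChain W (h ▸ w.val) else 0

theorem chainT_mk {n : ℕ} (x : W _⦋n⦌) : chainT n ⟨n, x⟩ = simplexChain W x := by
  rw [chainT, dif_pos rfl]

theorem chainT_ne {n : ℕ} {w : Tot W} (h : w.dim ≠ n) : chainT n w = 0 := by
  rw [chainT, dif_neg h]

/-- The normalized chain with given coordinates. -/
def normOf (n : ℕ) : V e.Nd →ₗ[ℤ] (normalizedChains W).X n :=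
  Finsupp.linearCombination ℤ fun c : e.Nd => chainT n c.1

theorem normOf_br {n : ℕ} (x : W _⦋n⦌) : normOf e n (e.cells.br ⟨n, x⟩) = simplexChain W x := by
  by_cases hx : ND ⟨n, x⟩
  · rw [show e.cells.br ⟨n, x⟩ = _ from CellData.br_cell (D := e.cells) ⟨⟨n, x⟩, hx, not_false⟩, normOf,
      linearCombination_single, one_smul, chainT_mk]
  · rw [CellData.br_of_not_nD (D := e.cells) hx, map_zero, simplexChain_of_degenerate hx]

theorem normOf_single_of_ne {n : ℕ} {b : e.Nd} (h : b.1.dim ≠ n) (z : ℤ) : normOf e n (single b z) = 0 := by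
  rw [normOf, linearCombination_single, chainT_ne h, smul_zero]

theorem normTo_sum (n : ℕ) (s : List (ℤ × W _⦋n⦌)) :
    (s.map fun q => (q.1, (⟨n, q.2⟩ : Tot W))).foldr (fun a b => a.1 • e.cells.br a.2 + b) 0 =
      normTo e n (s.map fun q => q.1 • simplexChain W q.2).sum := by
  induction s with
  | nil => exact (map_zero _).symm
  | cons q s ih =>
    rw [List.map_cons, List.foldr_cons, ih, List.map_cons, List.sum_cons, map_add, map_zsmul,
      normTo_simplexChain]

theorem normOf_ev (n : ℕ) (l : List (ℤ × e.Nd)) :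
    ((l.flatMap fun q => if h : q.2.1.dim = n then [(q.1, (h ▸ q.2.1.val : W _⦋n⦌))] else []).map
      fun q => q.1 • simplexChain W q.2).sum = normOf e n (ev l) := by
  induction l with
  | nil => exact (map_zero _).symm
  | cons q l ih =>
    rw [List.flatMap_cons, List.map_append, List.sum_append, ih, ev_cons, map_add]
    congr 1
    rw [normOf, linearCombination_single]
    obtain ⟨z, ⟨m, x⟩, hc⟩ := q
    by_cases h : m = n
    · subst h
      simp [chainT_mk]
    · simp [h, chainT_ne]

theorem simplexChain_d {n : ℕ} (x : W _⦋n + 1⦌) :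
    (normalizedChains W).d (n + 1) n (simplexChain W x) =
      ∑ i : Fin (n + 2), (-1 : ℤ) ^ (i : ℕ) • simplexChain W (W.δ i x) := by
  have h := ConcreteCategory.congr_hom
    (W.ιNormalizedChainComplex_d (R := AddCommGrpCat.of (ULift.{u} ℤ)) x) (ULift.up 1)
  refine Eq.trans h ?_
  exact map_alternating_sum (AddMonoidHom.id _) _ _

/-- Formal sums of simplices of the same dimension. -/
structure FormalChain (W : SSet.{u}) where
  dim : ℕ
  terms : List (ℤ × W _⦋dim⦌)

theorem formalChain_injective : Function.Injective fun r : FormalChain W =>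
    (r.dim, r.terms.map fun q => (q.1, e.code r.dim q.2)) := by
  rintro ⟨n, s⟩ ⟨m, t⟩ h
  simp only [Prod.mk.injEq] at h
  obtain ⟨rfl, h⟩ := h
  have hinj : Function.Injective fun q : ℤ × W _⦋n⦌ => (q.1, e.code n q.2) := by
    rintro ⟨z, x⟩ ⟨w, y⟩ h
    simp only [Prod.mk.injEq] at h
    exact Prod.ext h.1 (e.code_injective n h.2)
  rw [hinj.list_map h]

@[reducible] def formalCoded : Coded (FormalChain W) := Coded.ofInj _ (formalChain_injective e)

theorem tt_isCode_iff {k : ℕ} {p : Tt e.chainCoding} :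
    IsCode k p ↔ ∃ r : FormalChain W, @IsCode _ (formalCoded e) k r ∧
      p = ⟨r.dim, (r.terms.map fun q => q.1 • simplexChain W q.2).sum⟩ := by
  obtain ⟨n, c⟩ := p
  have h1 : ∀ r : FormalChain W, @IsCode _ (formalCoded e) k r ↔ k.unpair.1 = r.dim ∧
      k.unpair.2 = Encodable.encode (r.terms.map fun q => (q.1, e.code r.dim q.2)) := fun r =>
    and_congr (Lawful.iff _ _) (Lawful.iff _ _)
  constructor
  · rintro ⟨h, s, hs, hc⟩
    exact ⟨⟨n, s⟩, (h1 _).2 ⟨h, hs⟩, congrArg _ hc⟩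
  · rintro ⟨⟨m, s⟩, hr, h⟩
    cases h
    exact ⟨((h1 _).1 hr).1, s, ((h1 _).1 hr).2, rfl⟩

/-- A code of a normalized chain is the code of a literal list of terms, possibly with degenerate
simplices and repetitions, so algorithms on such lists suffice. -/
theorem cm_tt_of_formal {Y : Type*} [Coded Y] {f : Tt e.chainCoding → Y}
    (h : @Cm _ _ (formalCoded e) _ fun r : FormalChain W =>
      f ⟨r.dim, (r.terms.map fun q => q.1 • simplexChain W q.2).sum⟩) : Cm f := by
  obtain ⟨φ, h1, h2⟩ := h
  refine ⟨φ, h1, fun k p hk => ?_⟩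
  obtain ⟨r, hr, rfl⟩ := (tt_isCode_iff e).1 hk
  exact h2 k r hr

theorem cm_formal_to_tt : @Cm _ _ (formalCoded e) _ fun r : FormalChain W =>
    (⟨r.dim, (r.terms.map fun q => q.1 • simplexChain W q.2).sum⟩ : Tt e.chainCoding) :=
  ⟨Part.some, Partrec.some, fun k r hk => ⟨k, Part.mem_some k, (tt_isCode_iff e).2 ⟨r, hk, rfl⟩⟩⟩

theorem cm_formal_terms : @Cm _ _ (formalCoded e) (@instCodedList _ (@instCodedProd _ _ _ (totCoded e)))
    fun r : FormalChain W => r.terms.map fun q => (q.1, (⟨r.dim, q.2⟩ : Tot W)) := by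
  let := formalCoded e
  let := totCoded e
  have h0 : Cm fun r : FormalChain W => (r.dim, r.terms.map fun q => (q.1, e.code r.dim q.2)) := Cm.id
  have h1 : Cm fun r : FormalChain W => (r.terms.map fun q => (q.1, e.code r.dim q.2)).map
      fun q => (q.1, (r.dim, q.2)) :=
    Cm.list_map (f := fun p : FormalChain W × (ℤ × ℕ) => (p.2.1, (p.1.dim, p.2.2)))
      (Cm.pair (by fun_prop) (Cm.pair (h0.fst'.comp Cm.fst) (by fun_prop))) h0.snd'
  refine h1.of_isCode fun r k hk => ?_
  refine (isCode_list_map (f := fun q : ℤ × Tot W => (q.1, (q.2.dim, e.code q.2.dim q.2.val)))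
    (fun _ _ => Iff.rfl) _ k).1 ?_
  simpa only [List.map_map, Function.comp_def] using hk

/-- The basis of nondegenerate simplices of the normalized chains. -/
def normPres : Pres e.chainCoding e.cells.cx where
  toV := normTo e
  ofV n := (normOf e n).toAddMonoidHom
  of_to n c := norm_hom_ext (f := (normOf e n).toAddMonoidHom.comp (normTo e n)) (g := AddMonoidHom.id _)
    (fun x => by
      change normOf e n (normTo e n (simplexChain W x)) = _
      rw [normTo_simplexChain, normOf_br]; rfl) c
  to_of b := by
    obtain ⟨⟨n, x⟩, hb⟩ := b
    change normTo e n (normOf e n (single (⟨⟨n, x⟩, hb⟩ : e.Nd) 1)) = single (⟨⟨n, x⟩, hb⟩ : e.Nd) 1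
    rw [← CellData.br_cell, normOf_br, normTo_simplexChain]
  of_ne n b h := by
    exact normOf_single_of_ne e h 1
  spt n c b h := by
    refine norm_induction (P := fun c => ∀ b : e.Nd, normTo e n c b ≠ 0 → b.1.dim = n) ?_ ?_ ?_ ?_ c b h
    · intro b hb
      rw [map_zero] at hb
      exact (hb rfl).elim
    · intro x b hb
      rw [normTo_simplexChain] at hb
      rw [CellData.br_apply hb]
    · intro a b h1 h2 i hi
      by_contra h3
      rw [map_add, Finsupp.add_apply, not_not.1 (mt (h1 i) h3), not_not.1 (mt (h2 i) h3)] at hi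
      exact hi rfl
    · intro a h1 i hi
      refine h1 i ?_
      rwa [map_neg, Finsupp.neg_apply, neg_ne_zero] at hi
  d n c := norm_hom_ext (f := (normTo e n).comp ((normalizedChains W).d (n + 1) n).hom)
    (g := (CellData.dV : V e.Nd →ₗ[ℤ] V e.Nd).toAddMonoidHom.comp (normTo e (n + 1))) (fun x => by
      change normTo e n ((normalizedChains W).d (n + 1) n (simplexChain W x)) =
        CellData.dV (normTo e (n + 1) (simplexChain W x))
      rw [normTo_simplexChain, simplexChain_d, map_sum, CellData.dV_br_succ]
      exact Finset.sum_congr rfl fun i _ => by rw [map_zsmul, normTo_simplexChain]) c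
  cm_to := by
    let := e.effS
    refine cm_tt_of_formal e ?_
    let := formalCoded e
    have h := Cm.list_foldr (X := List (ℤ × Tot W)) (l := fun p => p) (c := fun _ => (0 : V e.Nd))
      (f := fun q : List (ℤ × Tot W) × (ℤ × Tot W) × V e.Nd => q.2.1.1 • e.cells.br q.2.1.2 + q.2.2)
      (Cm.v_add (Cm.v_smul (by fun_prop) (CellData.cm_br.comp (by fun_prop))) (by fun_prop))
      (Cm.const 0) Cm.id
    refine (h.comp (cm_formal_terms e)).congr fun r => ?_
    exact normTo_sum e r.dim r.terms
  cm_of := by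
    let := e.effS
    let := formalCoded e
    classical
    refine Cm.of_ev ?_
    let F : ℕ × List (ℤ × e.Nd) → FormalChain W := fun p =>
      ⟨p.1, p.2.flatMap fun q => if h : q.2.1.dim = p.1 then [(q.1, h ▸ q.2.1.val)] else []⟩
    have hF : Cm F := by
      have h1 : Cm fun c : e.Nd => (c.1.dim, e.code c.1.dim c.1.val) := CellData.cm_val (D := e.cells)
      refine Cm.pair Cm.fst ((Cm.list_map (f := fun q : (ℕ × List (ℤ × e.Nd)) × (ℤ × e.Nd) =>
        (q.2.1, e.code q.2.2.1.dim q.2.2.1.val))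
        (l := fun p => p.2.filter fun q => q.2.1.dim = p.1)
        (Cm.pair (by fun_prop) (h1.snd'.comp (by fun_prop)))
        (Cm.list_filter (P := fun p : (ℕ × List (ℤ × e.Nd)) × (ℤ × e.Nd) => p.2.2.1.dim = p.1.1)
          (CmP.eq (h1.fst'.comp (by fun_prop)) (by fun_prop)) (by fun_prop))).congr fun p => ?_)
      obtain ⟨n, l⟩ := p
      dsimp only [F]
      induction l with
      | nil => rfl
      | cons q l ih =>
        rw [List.flatMap_cons, List.map_append, ← ih, List.filter_cons]
        obtain ⟨z, ⟨m, x⟩, hc⟩ := q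
        by_cases h : m = n
        · subst h
          simp
        · simp [h]
    refine ((cm_formal_to_tt e).comp hF).congr fun p => ?_
    exact congrArg (fun c => (⟨p.1, c⟩ : Tt e.chainCoding)) (normOf_ev e p.1 p.2)

end

end

/-! ### Sums of shifts, and iteration of an equivalence which lowers labels -/

section

open Coded Finsupp CSet

/-! ### The sum of all shifts of a complex -/

section shift

variable {A B : Type*} [CSet A] [CSet B]

instance : CSet (ℕ × B) where
  deg x := x.1 + deg x.2
  lab x := x.1
  ceq := inferInstance
  cm_deg := by fun_prop
  cm_lab := by fun_prop

/-- The inclusion of the `p`-th shift. -/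
def inT (p : ℕ) : V B →ₗ[ℤ] V (ℕ × B) := Finsupp.lmapDomain ℤ ℤ (Prod.mk p)

theorem inT_single (p : ℕ) (b : B) (z : ℤ) : inT p (single b z) = single (p, b) z :=
  Finsupp.mapDomain_single

theorem inT_apply_ne {p : ℕ} {v : V B} {x : ℕ × B} (h : inT p v x ≠ 0) : x.1 = p ∧ v x.2 ≠ 0 := by
  obtain ⟨q, b⟩ := x
  have h1 : q = p := by
    by_contra hq
    refine h (Finsupp.mapDomain_of_notMem_range v (q, b) ?_)
    rintro ⟨c, hc⟩
    exact hq (Prod.ext_iff.1 hc).1.symm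
  subst h1
  refine ⟨rfl, fun h0 => h ?_⟩
  exact (Finsupp.mapDomain_apply (Prod.mk_right_injective q) v b).trans h0

theorem cm_inT : Cm fun x : ℕ × V B => inT x.1 x.2 :=
  Cm.linear_param (L := inT)
    ((Cm.v_single (b := fun p : ℕ × B => p) (z := fun _ => 1) Cm.id (Cm.const 1)).congr
      fun _ => (inT_single _ _ _).symm)

theorem shift_ext {M : Type*} [AddCommGroup M] {f g : V (ℕ × B) →ₗ[ℤ] M}
    (h : ∀ p v, f (inT p v) = g (inT p v)) (v : V (ℕ × B)) : f v = g v := by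
  have : f = g := by
    refine Finsupp.lhom_ext' fun ⟨p, b⟩ => LinearMap.ext_ring ?_
    have := h p (single b 1)
    rwa [inT_single] at this
  rw [this]

/-- The map which is `ε p • f` on the `p`-th shift. -/
def shiftV (ε : ℕ → ℤ) (f : V A →ₗ[ℤ] V B) : V (ℕ × A) →ₗ[ℤ] V (ℕ × B) :=
  Finsupp.linearCombination ℤ fun x => ε x.1 • inT x.1 (f (single x.2 1))

theorem shiftV_inT (ε : ℕ → ℤ) (f : V A →ₗ[ℤ] V B) (p : ℕ) (v : V A) :
    shiftV ε f (inT p v) = ε p • inT p (f v) := by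
  have : shiftV ε f ∘ₗ inT p = ε p • (inT p ∘ₗ f) := by
    refine Finsupp.lhom_ext' fun b => LinearMap.ext_ring ?_
    change shiftV ε f (inT p (single b 1)) = ε p • inT p (f (single b 1))
    rw [inT_single, shiftV, linearCombination_single, one_smul]
  exact LinearMap.congr_fun this v

theorem good_shiftV {ε : ℕ → ℤ} (hε : Cm ε) {k : ℤ} {f : V A →ₗ[ℤ] V B} (hf : Good False k f) :
    Good True k (shiftV ε f) := by
  refine Good.lin ((hε.comp Cm.fst).v_smul (cm_inT.comp (Cm.fst.pair (hf.cm.comp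
    (Cm.v_single Cm.snd (Cm.const 1)))))) ?_
  rintro ⟨p, a⟩ ⟨q, b⟩ h
  have h1 : inT p (f (single a 1)) (q, b) ≠ 0 := fun h0 => h (by simp [h0])
  obtain ⟨h2, h3⟩ := inT_apply_ne h1
  dsimp only at h2 h3
  subst h2
  have := (hf.spt _ _ h3).1
  refine ⟨?_, fun _ => rfl⟩
  change ((q + deg b : ℕ) : ℤ) = (q + deg a : ℕ) + k
  push_cast
  omega

/-- The alternating sign. -/
def sgn (p : ℕ) : ℤ := (-1) ^ p

theorem cm_sign : Cm sgn := Cm.neg_one_pow Cm.id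

theorem sgn_smul_self {M : Type*} [AddCommGroup M] (p : ℕ) (x : M) : sgn p • sgn p • x = x := by
  rw [smul_smul, sgn, ← mul_pow]
  simp

theorem shiftV_sq {d : V A →ₗ[ℤ] V A} (h : ∀ v, d (d v) = 0) (v : V (ℕ × A)) :
    shiftV sgn d (shiftV sgn d v) = 0 :=
  shift_ext (f := shiftV sgn d ∘ₗ shiftV sgn d) (g := 0) (fun p v => by
    change shiftV _ _ (shiftV _ _ _) = 0
    rw [shiftV_inT, map_zsmul, shiftV_inT, h, map_zero, smul_zero, smul_zero]) v

end shift

/-- The sum of all shifts of a complex. -/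
def shiftCx (C : Cx.{u} False) : Cx.{u} True where
  B := ℕ × C.B
  d := shiftV sgn C.d
  d_d := shiftV_sq C.d_d
  good := good_shiftV cm_sign C.good

theorem shiftV_hty {A : Type*} [CSet A] {d h g : V A →ₗ[ℤ] V A}
    (H : ∀ v, d (h v) + h (d v) = v - g v) (v : V (ℕ × A)) :
    shiftV sgn d (shiftV sgn h v) +
      shiftV sgn h (shiftV sgn d v) = v - shiftV (fun _ => 1) g v :=
  shift_ext (f := shiftV sgn d ∘ₗ shiftV sgn h +
      shiftV sgn h ∘ₗ shiftV sgn d)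
    (g := LinearMap.id - shiftV (fun _ => 1) g) (fun p v => by
      change shiftV _ _ (shiftV _ _ _) + shiftV _ _ (shiftV _ _ _) = inT p v - shiftV _ _ _
      simp only [shiftV_inT, map_zsmul, sgn_smul_self, one_smul]
      rw [← map_add, H, map_sub]) v

theorem shiftV_comp {A B C : Type*} [CSet A] [CSet B] [CSet C] {ε ε' : ℕ → ℤ} (g : V B →ₗ[ℤ] V C)
    (f : V A →ₗ[ℤ] V B) (v) :
    shiftV ε g (shiftV ε' f v) = shiftV (fun p => ε' p * ε p) (g ∘ₗ f) v :=
  shift_ext (f := shiftV ε g ∘ₗ shiftV ε' f) (fun p v => by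
    change shiftV _ _ (shiftV _ _ _) = _
    simp only [shiftV_inT, map_zsmul, smul_smul]
    rfl) v

/-- Homotopy equivalent complexes have homotopy equivalent sums of shifts. -/
def HEq.shift {C D : Cx.{u} False} (e : HEq C D) : HEq (shiftCx C) (shiftCx D) where
  f := shiftV (fun _ => 1) e.f
  g := shiftV (fun _ => 1) e.g
  -- The homotopies carry the same sign `(-1)^p` as the differential, so that the signs cancel in
  -- `dh + hd`, while the maps of degree zero carry none.
  h := shiftV sgn e.h
  k := shiftV sgn e.k
  f_d v := by
    refine (shiftV_comp e.f C.d v).trans ((shiftV_comp D.d e.f v).trans ?_).symm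
    rw [show D.d ∘ₗ e.f = e.f ∘ₗ C.d from LinearMap.ext fun v => (e.f_d v).symm]
    simp [sgn]
  g_d v := by
    refine (shiftV_comp e.g D.d v).trans ((shiftV_comp C.d e.g v).trans ?_).symm
    rw [show C.d ∘ₗ e.g = e.g ∘ₗ D.d from LinearMap.ext fun v => (e.g_d v).symm]
    simp
  hty_h v := by
    refine (shiftV_hty (d := C.d) (h := e.h) (g := e.g ∘ₗ e.f) e.hty_h v).trans ?_
    congr 1
    refine Eq.trans ?_ (shiftV_comp e.g e.f v).symm
    simp
  hty_k v := by
    refine (shiftV_hty (d := D.d) (h := e.k) (g := e.f ∘ₗ e.g) e.hty_k v).trans ?_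
    congr 1
    refine Eq.trans ?_ (shiftV_comp e.f e.g v).symm
    simp
  good_f := good_shiftV (Cm.const _) e.good_f
  good_g := good_shiftV (Cm.const _) e.good_g
  good_h := good_shiftV cm_sign e.good_h
  good_k := good_shiftV cm_sign e.good_k

/-- Data which reduce a labelled complex to its part of label `0`, up to shifts. -/
structure Tower (G : Cx.{u} True) (C : Cx.{u} False) where
  κ : V G.B →ₗ[ℤ] V G.B
  β : V G.B →ₗ[ℤ] V G.B
  η : V G.B →ₗ[ℤ] V G.B
  φ : V C.B →ₗ[ℤ] V G.B
  ψ : V G.B →ₗ[ℤ] V C.B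
  spt_κ : Spt (fun a b => deg b + 1 = deg a ∧ lab b + 1 = lab a) κ
  spt_β : Spt (fun a b => deg b = deg a + 1 ∧ lab b = lab a + 1) β
  spt_φ : Spt (fun a b => deg b = deg a ∧ lab b = 0) φ
  good_η : Good True 1 η
  good_ψ : Good False 0 ψ
  cm_κ : Cm κ
  cm_β : Cm β
  cm_φ : Cm φ
  κ_β : ∀ v, κ (β v) = v
  κ_d : ∀ v, κ (G.d v) + G.d (κ v) = 0
  β_d : ∀ v, G.d (β v) + β (G.d v) = 0
  hty : ∀ b, lab b ≠ 0 → G.d (η (single b 1)) + η (G.d (single b 1)) + β (κ (single b 1)) = single b 1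
  φ_d : ∀ v, φ (C.d v) = G.d (φ v)
  ψ_d : ∀ v, ψ (G.d v) = C.d (ψ v)
  ψ_φ : ∀ v, ψ (φ v) = v
  φ_ψ : ∀ b, lab b = 0 → φ (ψ (single b 1)) = single b 1

namespace Tower

variable {G : Cx.{u} True} {C : Cx.{u} False} (T : Tower G C)

/-- Chains of label `p`. -/
def IsLab (p : ℕ) (v : V G.B) : Prop := ∀ b, v b ≠ 0 → lab b = p

theorem isLab_single (b : G.B) (z : ℤ) : IsLab (lab b) (single b z) := by
  intro c hc
  rw [single_apply_ne_zero] at hc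
  rw [hc.1]

theorem IsLab.d {p : ℕ} {v : V G.B} (h : IsLab p v) : IsLab p (G.d v) := fun b hb => by
  obtain ⟨a, ha, h1⟩ := G.good.spt.apply hb
  rw [h1.2 trivial, h a ha]

theorem isLab_κ {p : ℕ} {v : V G.B} (h : IsLab (p + 1) v) : IsLab p (T.κ v) := fun b hb => by
  obtain ⟨a, ha, h1⟩ := T.spt_κ.apply hb
  have := h a ha
  omega

theorem isLab_β {p : ℕ} {v : V G.B} (h : IsLab p v) : IsLab (p + 1) (T.β v) := fun b hb => by
  obtain ⟨a, ha, h1⟩ := T.spt_β.apply hb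
  have := h a ha
  omega

theorem isLab_φ (v : V C.B) : IsLab 0 (T.φ v) := fun b hb => by
  obtain ⟨a, ha, h1⟩ := T.spt_φ.apply hb
  exact h1.2

/-- Maps which agree on the basis elements of label `p` agree on chains of label `p`. -/
theorem IsLab.ext {p : ℕ} {M : Type*} [AddCommGroup M] {f g : V G.B →ₗ[ℤ] M}
    (h : ∀ b, lab b = p → f (single b 1) = g (single b 1)) {v : V G.B} (hv : IsLab p v) : f v = g v := by
  rw [← Finsupp.sum_single v, Finsupp.sum, map_sum, map_sum]
  refine Finset.sum_congr rfl fun b hb => ?_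
  have e : single b (v b) = v b • single b (1 : ℤ) := by simp
  rw [e, map_zsmul, map_zsmul, h b (hv b (Finsupp.mem_support_iff.1 hb))]

theorem lab_ext {M : Type*} [AddCommGroup M] {f g : V G.B →ₗ[ℤ] M}
    (h : ∀ p v, IsLab p v → f v = g v) (v : V G.B) : f v = g v := by
  have : f = g := Finsupp.lhom_ext' fun b => LinearMap.ext_ring (h _ _ (isLab_single b 1))
  rw [this]

theorem cm_pow {B : Type*} [CSet B] {f : V B →ₗ[ℤ] V B} (hf : Cm f) : Cm fun x : ℕ × V B => (f ^ x.1) x.2 := by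
  refine (Cm.nat_rec (X := ℕ × V B) (z := fun x => x.2) (s := fun p => f p.2.2) (n := fun x => x.1)
    Cm.snd (hf.comp (by fun_prop)) Cm.fst).congr fun x => ?_
  obtain ⟨n, v⟩ := x
  dsimp only
  induction n with
  | zero => rfl
  | succ n ih => rw [pow_succ']; exact congrArg f ih

/-- The homotopy on chains of label `p`. -/
def H (p : ℕ) : V G.B →ₗ[ℤ] V G.B :=
  ∑ k ∈ Finset.range p, (-1 : ℤ) ^ k • ((T.β ^ k) ∘ₗ T.η ∘ₗ (T.κ ^ k))

theorem H_apply (p : ℕ) (v : V G.B) :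
    T.H p v = ∑ k ∈ Finset.range p, (-1 : ℤ) ^ k • (T.β ^ k) (T.η ((T.κ ^ k) v)) := by
  rw [H, LinearMap.sum_apply]
  rfl

/-- The recursion behind `H`: contract once with `η`, and conjugate the homotopy of the next lower
label by `κ` and `β`. The sign appears because `β` anticommutes with the differential. -/
theorem H_succ (p : ℕ) (v : V G.B) : T.H (p + 1) v = T.η v - T.β (T.H p (T.κ v)) := by
  rw [H_apply, Finset.sum_range_succ', H_apply, map_sum, sub_eq_add_neg, add_comm, ← Finset.sum_neg_distrib]
  congr 1
  · simp
  · refine Finset.sum_congr rfl fun k _ => ?_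
    rw [pow_succ T.κ, pow_succ' T.β, map_zsmul, pow_succ, mul_neg_one, neg_smul]
    rfl

theorem pow_κ_d (p : ℕ) (v : V G.B) : (T.κ ^ p) (G.d v) = sgn p • G.d ((T.κ ^ p) v) := by
  induction p with
  | zero => simp [sgn]
  | succ p ih =>
    rw [pow_succ']
    change T.κ ((T.κ ^ p) (G.d v)) = _ • G.d (T.κ ((T.κ ^ p) v))
    rw [ih, map_zsmul, eq_neg_of_add_eq_zero_left (T.κ_d _), sgn, sgn, pow_succ, mul_neg_one, neg_smul, smul_neg]

theorem pow_β_d (p : ℕ) (v : V G.B) : (T.β ^ p) (G.d v) = sgn p • G.d ((T.β ^ p) v) := by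
  induction p with
  | zero => simp [sgn]
  | succ p ih =>
    rw [pow_succ']
    change T.β ((T.β ^ p) (G.d v)) = _ • G.d (T.β ((T.β ^ p) v))
    rw [ih, map_zsmul, eq_neg_of_add_eq_zero_right (T.β_d _), sgn, sgn, pow_succ, mul_neg_one, neg_smul, smul_neg]

theorem pow_κ_β (p : ℕ) (v : V G.B) : (T.κ ^ p) ((T.β ^ p) v) = v := by
  induction p with
  | zero => rfl
  | succ p ih =>
    rw [pow_succ, pow_succ']
    change (T.κ ^ p) (T.κ (T.β ((T.β ^ p) v))) = v
    rw [T.κ_β, ih]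

theorem isLab_pow_β {p : ℕ} {v : V G.B} (h : IsLab 0 v) : IsLab p ((T.β ^ p) v) := by
  induction p with
  | zero => exact h
  | succ p ih =>
    rw [pow_succ']
    exact T.isLab_β ih

/-- Substituting the identity `dη + ηd = 1 - βκ` into itself along `κ` leaves `β^p κ^p` after `p`
steps. At label zero `φ ψ = 1`, so this factors through `C`. -/
theorem H_hty (p : ℕ) {v : V G.B} (hv : IsLab p v) :
    G.d (T.H p v) + T.H p (G.d v) = v - (T.β ^ p) (T.φ (T.ψ ((T.κ ^ p) v))) := by
  induction p generalizing v with
  | zero =>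
    have := hv.ext (f := T.φ ∘ₗ T.ψ) (g := LinearMap.id) T.φ_ψ
    change T.φ (T.ψ v) = v at this
    simp [H, this]
  | succ p ih =>
    have h1 := hv.ext (f := G.d ∘ₗ T.η + T.η ∘ₗ G.d + T.β ∘ₗ T.κ) (g := LinearMap.id)
      fun b hb => T.hty b (by omega)
    change G.d (T.η v) + T.η (G.d v) + T.β (T.κ v) = v at h1
    have h2 := congrArg T.β (ih (T.isLab_κ hv))
    rw [map_add, map_sub] at h2
    rw [H_succ, H_succ, eq_neg_of_add_eq_zero_left (T.κ_d v), map_neg, map_neg, map_sub,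
      eq_neg_of_add_eq_zero_left (T.β_d _), pow_succ T.κ, pow_succ' T.β]
    change G.d (T.η v) - -T.β (G.d (T.H p (T.κ v))) + (T.η (G.d v) - -T.β (T.H p (G.d (T.κ v)))) =
      v - T.β ((T.β ^ p) (T.φ (T.ψ ((T.κ ^ p) (T.κ v)))))
    linear_combination (norm := abel) h1 + h2

/-- The map to the sum of the shifts. -/
def f : V G.B →ₗ[ℤ] V (ℕ × C.B) :=
  Finsupp.linearCombination ℤ fun b => inT (lab b) (T.ψ ((T.κ ^ lab b) (single b 1)))

/-- The map from the sum of the shifts. -/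
def g : V (ℕ × C.B) →ₗ[ℤ] V G.B :=
  Finsupp.linearCombination ℤ fun x => (T.β ^ x.1) (T.φ (single x.2 1))

/-- The homotopy. -/
def h : V G.B →ₗ[ℤ] V G.B :=
  Finsupp.linearCombination ℤ fun b => T.H (lab b) (single b 1)

theorem f_lab {p : ℕ} {v : V G.B} (hv : IsLab p v) : T.f v = inT p (T.ψ ((T.κ ^ p) v)) :=
  hv.ext (g := inT p ∘ₗ T.ψ ∘ₗ (T.κ ^ p)) fun b hb => by
    rw [f, linearCombination_single, one_smul, hb]
    rfl

theorem h_lab {p : ℕ} {v : V G.B} (hv : IsLab p v) : T.h v = T.H p v :=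
  hv.ext fun b hb => by rw [h, linearCombination_single, one_smul, hb]

theorem g_inT (p : ℕ) (v : V C.B) : T.g (inT p v) = (T.β ^ p) (T.φ v) := by
  have : T.g ∘ₗ inT p = (T.β ^ p) ∘ₗ T.φ := by
    refine Finsupp.lhom_ext' fun b => LinearMap.ext_ring ?_
    change T.g (inT p (single b 1)) = (T.β ^ p) (T.φ (single b 1))
    rw [inT_single, g, linearCombination_single, one_smul]
  exact LinearMap.congr_fun this v

theorem spt_pow_κ (p : ℕ) : Spt (fun a b => deg b + p = deg a ∧ lab b + p = lab a) (T.κ ^ p) := by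
  induction p with
  | zero => exact Good.id (s := True).spt.mono fun a b h => ⟨by have := h.1; omega, by have := h.2 trivial; omega⟩
  | succ p ih =>
    rw [pow_succ]
    exact ih.comp T.spt_κ fun a b c h1 h2 => by omega

theorem spt_pow_β (p : ℕ) : Spt (fun a b => deg b = deg a + p ∧ lab b = lab a + p) (T.β ^ p) := by
  induction p with
  | zero => exact Good.id (s := True).spt.mono fun a b h => ⟨by have := h.1; omega, by have := h.2 trivial; omega⟩
  | succ p ih =>
    rw [pow_succ']
    exact T.spt_β.comp ih fun a b c h1 h2 => by omega

theorem good_f : Good True 0 T.f := by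
  refine Good.lin (cm_inT.comp ((CSet.cm_lab).pair (T.good_ψ.cm.comp ((cm_pow T.cm_κ).comp
    ((CSet.cm_lab).pair (Cm.v_single Cm.id (Cm.const 1))))))) ?_
  rintro a ⟨q, b⟩ h
  obtain ⟨h1, h2⟩ := inT_apply_ne h
  obtain ⟨c, hc, h3⟩ := T.good_ψ.spt.apply h2
  have h4 := T.spt_pow_κ _ _ _ hc
  dsimp only at *
  refine ⟨?_, fun _ => h1⟩
  change ((q + deg b : ℕ) : ℤ) = _
  have := h3.1
  omega

theorem good_g : Good True 0 T.g := by
  refine Good.lin ((cm_pow T.cm_β).comp (Cm.fst.pair (T.cm_φ.comp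
    (Cm.v_single Cm.snd (Cm.const 1))))) ?_
  rintro ⟨p, a⟩ b h
  obtain ⟨c, hc, h3⟩ := (T.spt_pow_β _).apply h
  have h4 := T.spt_φ _ _ hc
  dsimp only at *
  refine ⟨?_, fun _ => ?_⟩
  · change _ = ((p + deg a : ℕ) : ℤ) + 0
    omega
  · change _ = p
    omega

theorem cm_H : Cm fun x : ℕ × V G.B => T.H x.1 x.2 := by
  let F : (ℕ × V G.B) × ℕ → V G.B := fun y => (-1 : ℤ) ^ y.2 • (T.β ^ y.2) (T.η ((T.κ ^ y.2) y.1.2))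
  have hF : Cm F := by
    have h1 : Cm fun y : (ℕ × V G.B) × ℕ => (T.κ ^ y.2) y.1.2 :=
      Cm.comp (f := fun y : (ℕ × V G.B) × ℕ => (y.2, y.1.2)) (cm_pow T.cm_κ) (by fun_prop)
    have h2 : Cm fun y : (ℕ × V G.B) × ℕ => T.η ((T.κ ^ y.2) y.1.2) := T.good_η.cm.comp h1
    have h3 : Cm fun y : (ℕ × V G.B) × ℕ => (T.β ^ y.2) (T.η ((T.κ ^ y.2) y.1.2)) :=
      Cm.comp (f := fun y : (ℕ × V G.B) × ℕ => (y.2, T.η ((T.κ ^ y.2) y.1.2))) (cm_pow T.cm_β)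
        (Cm.snd.pair h2)
    exact Cm.v_smul (Cm.neg_one_pow Cm.snd) h3
  have hFe : ∀ x i, F (x, i) = (-1 : ℤ) ^ i • (T.β ^ i) (T.η ((T.κ ^ i) x.2)) := fun _ _ => rfl
  clear_value F
  have h5 : Cm fun x : ℕ × V G.B => ∑ i ∈ Finset.range x.1, F (x, i) := Cm.v_sum_range Cm.fst hF
  refine h5.congr fun x => ?_
  rw [H_apply]
  exact Finset.sum_congr rfl fun i _ => hFe x i

theorem good_h : Good True 1 T.h := by
  refine Good.lin ?_ ?_
  · exact T.cm_H.comp (Cm.pair CSet.cm_lab (Cm.v_single Cm.id (Cm.const 1)))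
  · intro a b hab
    rw [H_apply, Finsupp.finsetSum_apply] at hab
    obtain ⟨k, _, hk⟩ := Finset.exists_ne_zero_of_sum_ne_zero hab
    have h1 : (T.β ^ k) (T.η ((T.κ ^ k) (single a 1))) b ≠ 0 := fun h0 => hk (by simp [h0])
    obtain ⟨c, hc, h2⟩ := (T.spt_pow_β _).apply h1
    obtain ⟨c', hc', h3⟩ := T.good_η.spt.apply hc
    have h4 := T.spt_pow_κ _ _ _ hc'
    have := h3.1
    have := h3.2 trivial
    exact ⟨by omega, fun _ => by omega⟩

/-- A complex with such data is homotopy equivalent to a sum of shifts. -/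
def heq : HEq G (shiftCx C) where
  f := T.f
  g := T.g
  h := T.h
  -- On this side the composite is strictly the identity, because `κ^p β^p = 1` and `ψ φ = 1`.
  k := 0
  f_d := lab_ext (f := T.f ∘ₗ G.d) (g := shiftV sgn C.d ∘ₗ T.f) fun p v hv => by
    change T.f (G.d v) = shiftV _ C.d (T.f v)
    rw [T.f_lab hv.d, T.f_lab hv, shiftV_inT, pow_κ_d, map_zsmul, T.ψ_d, map_zsmul]
  g_d := shift_ext (f := T.g ∘ₗ shiftV sgn C.d) (g := G.d ∘ₗ T.g) fun p v => by
    change T.g (shiftV _ C.d (inT p v)) = G.d (T.g (inT p v))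
    rw [shiftV_inT, map_zsmul, g_inT, g_inT, T.φ_d, pow_β_d, sgn_smul_self]
  hty_h := lab_ext (f := G.d ∘ₗ T.h + T.h ∘ₗ G.d) (g := LinearMap.id - T.g ∘ₗ T.f) fun p v hv => by
    change G.d (T.h v) + T.h (G.d v) = v - T.g (T.f v)
    rw [T.h_lab hv, T.h_lab hv.d, T.f_lab hv, g_inT, T.H_hty p hv]
  hty_k v := by
    refine Eq.trans ?_ (shift_ext (f := 0) (g := LinearMap.id - T.f ∘ₗ T.g) (fun p v => ?_) v)
    · change shiftV sgn C.d 0 + 0 = 0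
      rw [map_zero, add_zero]
    · change 0 = inT p v - T.f (T.g (inT p v))
      rw [g_inT, T.f_lab (T.isLab_pow_β (T.isLab_φ v)), pow_κ_β, T.ψ_φ, sub_self]
  good_f := T.good_f
  good_g := T.good_g
  good_h := T.good_h
  good_k := Good.zero

end Tower

end

/-! ### Products of standard simplices with a simplicial set -/

section

open Coded Finsupp CSet Tot

/-! ### Monotone maps described by their values -/

section hom

variable {n m p : ℕ}

/-- The values of a monotone map. -/
def hv (t : ⦋n⦌ ⟶ ⦋p⦌) (j : ℕ) : ℕ := (t.toOrderHom (clampFin n j)).val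

/-- The monotone map with given values. -/
def homMk (n p : ℕ) (f : ℕ → ℕ) (h1 : ∀ i j, i ≤ j → j ≤ n → f i ≤ f j) (h2 : f n ≤ p) : ⦋n⦌ ⟶ ⦋p⦌ :=
  SimplexCategory.Hom.mk
    { toFun := fun j => ⟨f j, Nat.lt_succ_of_le ((h1 j n (Nat.le_of_lt_succ j.2) le_rfl).trans h2)⟩
      monotone' := fun i j h => h1 i j h (Nat.le_of_lt_succ j.2) }

theorem hv_homMk {f : ℕ → ℕ} (h1 : ∀ i j, i ≤ j → j ≤ n → f i ≤ f j) (h2 : f n ≤ p) {j : ℕ} (hj : j ≤ n) :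
    hv (homMk n p f h1 h2) j = f j := by
  change f (clampFin n j) = f j
  rw [clampFin_coe hj]

theorem hv_clamp (t : ⦋n⦌ ⟶ ⦋p⦌) (j : ℕ) : hv t (min j n) = hv t j := by
  have : clampFin n (min j n) = clampFin n j := by simp [clampFin]
  rw [hv, hv, this]

theorem hv_fin (t : ⦋n⦌ ⟶ ⦋p⦌) (j : Fin (n + 1)) : hv t j = (t.toOrderHom j).val := by
  rw [hv, clampFin_val]

theorem hv_ext {t t' : ⦋n⦌ ⟶ ⦋p⦌} (h : ∀ j ≤ n, hv t j = hv t' j) : t = t' := by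
  ext j
  have := h j (Nat.le_of_lt_succ j.2)
  rwa [hv_fin, hv_fin] at this

theorem hv_mono (t : ⦋n⦌ ⟶ ⦋p⦌) {i j : ℕ} (h : i ≤ j) : hv t i ≤ hv t j :=
  t.toOrderHom.monotone (by simp [clampFin, Fin.le_def]; omega)

theorem hv_le (t : ⦋n⦌ ⟶ ⦋p⦌) (j : ℕ) : hv t j ≤ p := Nat.le_of_lt_succ (Fin.is_lt _)

theorem hv_comp (t : ⦋n⦌ ⟶ ⦋m⦌) (s : ⦋m⦌ ⟶ ⦋p⦌) (j : ℕ) : hv (t ≫ s) j = hv s (hv t j) := by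
  rw [hv, hv, hv, clampFin_val]
  rfl

theorem hv_id {j : ℕ} (h : j ≤ n) : hv (𝟙 ⦋n⦌) j = j := clampFin_coe h

theorem hv_δ (i : Fin (n + 2)) {j : ℕ} (h : j ≤ n) :
    hv (SimplexCategory.δ i) j = if j < i then j else j + 1 := by
  change (i.succAbove (clampFin n j)).val = _
  rw [Fin.succAbove]
  simp only [Fin.lt_def, Fin.val_castSucc, clampFin_coe h]
  split_ifs <;> simp [clampFin_coe h]

theorem hv_σ (i : Fin (n + 1)) {j : ℕ} (h : j ≤ n + 1) :
    hv (SimplexCategory.σ i) j = if j ≤ i then j else j - 1 := by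
  change (i.predAbove (clampFin (n + 1) j)).val = _
  rw [Fin.predAbove]
  simp only [Fin.lt_def, Fin.val_castSucc, clampFin_coe h]
  split_ifs <;> simp [clampFin_coe h] <;> omega

end hom

/-! ### Products with standard simplices -/

/-- A simplex of the product of a standard simplex with `Y`. -/
structure GS (Y : SSet.{u}) (n : SimplexCategoryᵒᵖ) : Type u where
  p : ℕ
  t : n.unop ⟶ ⦋p⦌
  y : Y.obj n

/-- The disjoint union of the products of the standard simplices with `Y`. -/
def gw (Y : SSet.{u}) : SSet.{u} where
  obj n := GS Y n
  map g := ↾fun x => ⟨x.p, g.unop ≫ x.t, Y.map g x.y⟩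
  map_id n := by ext x; simp
  map_comp f g := by ext x; simp

variable {Y : SSet.{u}}

/-- The dimension of the standard simplex. -/
def tp (w : Tot (gw Y)) : ℕ := GS.p w.val

/-- The vertices of the simplex of the standard simplex. -/
def tv (w : Tot (gw Y)) (j : ℕ) : ℕ := hv (GS.t w.val) j

/-- The simplex of `Y`. -/
def ty (w : Tot (gw Y)) : Tot Y := ⟨w.dim, GS.y w.val⟩

theorem gs_ext {n : ℕ} {x y : GS Y (op ⦋n⦌)} (h1 : x.p = y.p) (h2 : ∀ j ≤ n, hv x.t j = hv y.t j)
    (h3 : x.y = y.y) : x = y := by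
  obtain ⟨p, t, x⟩ := x
  obtain ⟨q, s, y⟩ := y
  obtain rfl : p = q := h1
  obtain rfl : x = y := h3
  obtain rfl : t = s := hv_ext h2
  rfl

theorem gw_ext {w w' : Tot (gw Y)} (h1 : tp w = tp w') (h2 : ∀ j ≤ w.dim, tv w j = tv w' j)
    (h3 : ty w = ty w') : w = w' := by
  obtain ⟨n, x⟩ := w
  obtain ⟨m, y⟩ := w'
  obtain rfl : n = m := congrArg (Tot.dim (W := Y)) h3
  exact congrArg (Tot.mk n) (gs_ext h1 h2 (ext_val h3))

/-- All dimensions `p` of the standard simplex are kept in one coded set, with `p` as part of the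
data. This is what makes the later algorithms uniform in `p`. -/
theorem gw_code_injective : Function.Injective fun w : Tot (gw Y) =>
    (tp w, (List.range (w.dim + 1)).map (tv w), ty w) := by
  intro w w' h
  simp only [Prod.mk.injEq] at h
  obtain ⟨h1, h2, h3⟩ := h
  have h4 : w.dim = w'.dim := congrArg (Tot.dim (W := Y)) h3
  refine gw_ext h1 (fun j hj => ?_) h3
  rw [← h4] at h2
  exact List.map_inj_left.1 h2 j (by simpa using hj)

theorem tv_le (w : Tot (gw Y)) (j : ℕ) : tv w j ≤ tp w := hv_le _ _

theorem tv_mono (w : Tot (gw Y)) {i j : ℕ} (h : i ≤ j) : tv w i ≤ tv w j := hv_mono _ h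

theorem tv_clamp (w : Tot (gw Y)) (j : ℕ) : tv w (min j w.dim) = tv w j := hv_clamp _ _

section coded

variable [EffS Y] {X : Type*} [Coded X]

instance : Coded (Tot (gw Y)) := Coded.ofInj _ gw_code_injective

theorem cm_gw_code : Cm fun w : Tot (gw Y) => (tp w, (List.range (w.dim + 1)).map (tv w), ty w) := Cm.id

@[fun_prop]
theorem cm_tp : Cm (tp : Tot (gw Y) → ℕ) := cm_gw_code.fst'

@[fun_prop]
theorem cm_ty : Cm (ty : Tot (gw Y) → Tot Y) := cm_gw_code.snd'.snd'

theorem cm_gw_dim : Cm fun w : Tot (gw Y) => w.dim :=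
  (EffS.cm_dim (W := Y)).comp cm_ty

theorem cm_nat_min : Cm fun p : ℕ × ℕ => min p.1 p.2 :=
  Cm.of_primrec (Primrec.nat_min.comp Primrec.fst Primrec.snd)

@[fun_prop]
theorem Cm.nat_min {f g : X → ℕ} (hf : Cm f) (hg : Cm g) : Cm fun x => min (f x) (g x) :=
  cm_nat_min.comp (hf.pair hg)

theorem cm_tv : Cm fun p : Tot (gw Y) × ℕ => tv p.1 p.2 := by
  have h1 := (Cm.list_getElem? (X := Tot (gw Y) × ℕ) (l := fun p => (List.range (p.1.dim + 1)).map (tv p.1))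
    (i := fun p => min p.2 p.1.dim) (cm_gw_code.snd'.fst'.comp Cm.fst)
    (Cm.nat_min Cm.snd (cm_gw_dim.comp Cm.fst)))
  refine (Cm.option_elim (f := fun _ => 0) (g := fun q : (Tot (gw Y) × ℕ) × ℕ => q.2) h1 (Cm.const 0) Cm.snd).congr
    fun p => ?_
  rw [List.getElem?_map, List.getElem?_range (by omega)]
  exact tv_clamp _ _

@[fun_prop]
theorem Cm.tv {f : X → Tot (gw Y)} {i : X → ℕ} (hf : Cm f) (hi : Cm i) : Cm fun x => tv (f x) (i x) :=
  cm_tv.comp (hf.pair hi)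

theorem Cm.gw {f : X → Tot (gw Y)} (h1 : Cm fun x => tp (f x))
    (h2 : Cm fun p : X × ℕ => EffHom.tv (f p.1) p.2) (h3 : Cm fun x => ty (f x)) : Cm f := by
  have h4 : Cm fun x => (tp (f x), (List.range ((f x).dim + 1)).map (EffHom.tv (f x)), ty (f x)) :=
    h1.pair (Cm.pair (Cm.list_map (f := fun p : X × ℕ => EffHom.tv (f p.1) p.2) h2
      (Cm.list_range (Cm.nat_add ((EffS.cm_dim (W := Y)).comp h3) (Cm.const 1)))) h3)
  exact h4

theorem tp_face (i : ℕ) (w : Tot (gw Y)) : tp (w.face i) = tp w := by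
  obtain ⟨_ | n, x⟩ := w <;> rfl

theorem ty_face (i : ℕ) (w : Tot (gw Y)) : ty (w.face i) = (ty w).face i := by
  obtain ⟨_ | n, x⟩ := w <;> rfl

theorem tv_δ {n : ℕ} (i : Fin (n + 2)) (x : (gw Y) _⦋n + 1⦌) {j : ℕ} (h : j ≤ n) :
    tv ⟨n, (gw Y).δ i x⟩ j = tv ⟨n + 1, x⟩ (if j < i then j else j + 1) := by
  change hv (SimplexCategory.δ i ≫ GS.t x) j = _
  rw [hv_comp, hv_δ i h]
  rfl

theorem tv_σ {n : ℕ} (i : Fin (n + 1)) (x : (gw Y) _⦋n⦌) {j : ℕ} (h : j ≤ n + 1) :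
    tv ⟨n + 1, (gw Y).σ i x⟩ j = tv ⟨n, x⟩ (if j ≤ i then j else j - 1) := by
  change hv (SimplexCategory.σ i ≫ GS.t x) j = _
  rw [hv_comp, hv_σ i h]
  rfl

theorem tv_face (i : ℕ) (w : Tot (gw Y)) (j : ℕ) :
    tv (w.face i) j = if w.dim = 0 then tv w j else
      tv w (if min j (w.dim - 1) < min i w.dim then min j (w.dim - 1) else min j (w.dim - 1) + 1) := by
  obtain ⟨_ | n, x⟩ := w
  · rfl
  · rw [if_neg (by simp)]
    change tv ⟨n, (gw Y).δ (clampFin (n + 1) i) x⟩ j = tv ⟨n + 1, x⟩ (if min j n < min i (n + 1) then min j n else min j n + 1)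
    rw [← tv_clamp, tv_δ _ _ (min_le_right _ _)]
    rfl

theorem tv_degen (i : ℕ) (w : Tot (gw Y)) (j : ℕ) :
    tv (w.degen i) j = tv w (if min j (w.dim + 1) ≤ min i w.dim then min j (w.dim + 1)
      else min j (w.dim + 1) - 1) := by
  obtain ⟨n, x⟩ := w
  change tv ⟨n + 1, (gw Y).σ (clampFin n i) x⟩ j = tv ⟨n, x⟩ (if min j (n + 1) ≤ min i n then min j (n + 1) else min j (n + 1) - 1)
  rw [← tv_clamp, tv_σ _ _ (min_le_right _ _)]
  rfl

instance : CEq (List ℕ) := .of_lawful _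

instance : EffS (gw Y) where
  ceq := .of_injective cm_gw_code gw_code_injective
  cm_dim := cm_gw_dim
  cm_face := by
    classical
    have hd := cm_gw_dim (Y := Y)
    refine Cm.gw ((cm_tp.comp Cm.snd).congr fun p => (tp_face _ _).symm) ?_
      ((Cm.face Cm.fst (cm_ty.comp Cm.snd)).congr fun p => (ty_face _ _).symm)
    refine Cm.congr ?_ fun p : (ℕ × Tot (gw Y)) × ℕ => (tv_face p.1.1 p.1.2 p.2).symm
    have h1 : Cm fun p : (ℕ × Tot (gw Y)) × ℕ => p.1.2.dim := hd.comp (by fun_prop)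
    exact Cm.ite (CmP.eq h1 (Cm.const 0)) (by fun_prop) (Cm.tv (by fun_prop)
      (Cm.ite (CmP.nat_lt (by fun_prop) (by fun_prop)) (by fun_prop) (by fun_prop)))
  cm_degen := by
    classical
    have hd := cm_gw_dim (Y := Y)
    refine Cm.gw ((cm_tp.comp Cm.snd).congr fun p => rfl) ?_
      ((Cm.degen Cm.fst (cm_ty.comp Cm.snd)).congr fun p => rfl)
    refine Cm.congr ?_ fun p : (ℕ × Tot (gw Y)) × ℕ => (tv_degen p.1.1 p.1.2 p.2).symm
    have h1 : Cm fun p : (ℕ × Tot (gw Y)) × ℕ => p.1.2.dim := hd.comp (by fun_prop)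
    exact Cm.tv (by fun_prop)
      (Cm.ite (CmP.nat_le (by fun_prop) (by fun_prop)) (by fun_prop) (by fun_prop))

/-- The vertices smaller than `m` all occur. -/
def Covers (w : Tot (gw Y)) (m : ℕ) : Prop := ∀ v ∈ List.range m, ∃ j ∈ List.range (w.dim + 1), tv w j = v

theorem covers_iff {w : Tot (gw Y)} {m : ℕ} : Covers w m ↔ ∀ v < m, ∃ j, tv w j = v := by
  simp only [Covers, List.mem_range]
  refine forall₂_congr fun v _ => ⟨fun ⟨j, _, h⟩ => ⟨j, h⟩, fun ⟨j, h⟩ => ⟨min j w.dim, by omega, ?_⟩⟩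
  rw [tv_clamp, h]

/-- The products of the standard simplices (for `s = 1`), or of the faces opposite to the last vertex
(for `s = 0`), with `Y`, relative to the remaining faces. -/
@[reducible] def gwData (Y : SSet.{u}) [EffS Y] (s : ℕ) : CellData.{u} True where
  W := gw Y
  -- For `s = 1` the subcomplex consists of the simplices missing some vertex of `Δ^p`, which is
  -- `∂Δ^p × Y`. For `s = 0` it consists of those missing a vertex other than the last one, which is
  -- the horn obtained from `∂Δ^p` by omitting the face opposite to the last vertex, times `Y`.
  A w := ¬ Covers w (tp w + s)
  lab := tp
  cm_A := by
    refine CmP.not ?_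
    refine CmP.forall_mem (P := fun p : Tot (gw Y) × ℕ => ∃ j ∈ List.range (p.1.dim + 1), tv p.1 j = p.2)
      (l := fun w => List.range (tp w + s)) ?_ (by fun_prop)
    exact CmP.exists_mem (P := fun q : (Tot (gw Y) × ℕ) × ℕ => tv q.1.1 q.2 = q.1.2)
      (l := fun p => List.range (p.1.dim + 1)) (CmP.eq (by fun_prop) (by fun_prop))
      (by fun_prop)
  cm_lab := cm_tp
  A_face n i x h := by
    rw [covers_iff] at h ⊢
    refine mt (fun h' v hv => ?_) h
    obtain ⟨j, hj⟩ := h' v hv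
    rw [← tv_clamp, tv_δ _ _ (min_le_right _ _)] at hj
    exact ⟨_, hj⟩
  lab_face _ _ _ _ := rfl

end coded

end

section

open Coded Finsupp CSet Tot

/-! ### Pushing the last but one vertex to the last one -/

/-- The map which moves the vertex `p - 1` to `p`. -/
def sN (p v : ℕ) : ℕ := if v + 1 = p then p else v

theorem sN_mono (p : ℕ) {v w : ℕ} (h : v ≤ w) (hw : w ≤ p) : sN p v ≤ sN p w := by
  unfold sN; split_ifs <;> omega

theorem le_sN (p v : ℕ) : v ≤ sN p v := by unfold sN; split_ifs <;> omega

theorem sN_le {p v : ℕ} (h : v ≤ p) : sN p v ≤ p := by unfold sN; split_ifs <;> omega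

/-- The map which moves the vertex `p - 1` to `p`. -/
def sHom (p : ℕ) : ⦋p⦌ ⟶ ⦋p⦌ := homMk p p (sN p) (fun _ _ => sN_mono p) (sN_le le_rfl)

theorem hv_sHom {p j : ℕ} (h : j ≤ p) : hv (sHom p) j = sN p j := hv_homMk _ _ h

/-- The prism operators on monotone maps. -/
def hHom {n p : ℕ} (k : ℕ) (t : ⦋n⦌ ⟶ ⦋p⦌) : ⦋n + 1⦌ ⟶ ⦋p⦌ :=
  homMk (n + 1) p (fun j => if j ≤ k then hv t j else sN p (hv t (j - 1)))
    (fun i j hij _ => by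
      have h2 := hv_mono t hij
      have h3 := hv_mono t (Nat.sub_le_sub_right hij 1)
      have h4 := sN_mono p h3 (hv_le t _)
      split_ifs with h5 h6
      · exact h2
      · exact (hv_mono t (by omega)).trans (le_sN p _)
      · omega
      · exact h4)
    (by
      split_ifs
      · exact hv_le _ _
      · exact sN_le (hv_le _ _))

theorem hv_hHom {n p : ℕ} (k : ℕ) (t : ⦋n⦌ ⟶ ⦋p⦌) {j : ℕ} (h : j ≤ n + 1) :
    hv (hHom k t) j = if j ≤ k then hv t j else sN p (hv t (j - 1)) := hv_homMk _ _ h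

section

variable (Y : SSet.{u})

/-- The simplicial map which moves the last but one vertex to the last one. -/
def sMap : gw Y ⟶ gw Y where
  app _ := ↾fun x => ⟨x.p, x.t ≫ sHom x.p, x.y⟩
  naturality _ g h := ConcreteCategory.hom_ext _ _ fun x =>
    congrArg (fun t => (⟨GS.p x, t, Y.map h (GS.y x)⟩ : GS Y g)) (Category.assoc _ _ _)

/-- The prism operators. -/
def prism {n : ℕ} (k : Fin (n + 1)) : (gw Y) _⦋n⦌ ⟶ (gw Y) _⦋n + 1⦌ :=
  ↾fun x => ⟨GS.p x, hHom k (GS.t x), Y.σ k (GS.y x)⟩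

variable {Y} in
theorem sset_congr_hom {m n : ℕ} {f g : Y _⦋m⦌ ⟶ Y _⦋n⦌} (h : f = g) (y : Y _⦋m⦌) : f y = g y := by
  rw [h]

/-- The homotopy from the identity to `sMap`. -/
def sHomotopy : SimplicialObject.Homotopy (𝟙 (gw Y)) (sMap Y) where
  -- In the factor `Y` the homotopy is constant, given by degeneracies, and its identities are taken
  -- from `SimplicialObject.Homotopy.refl`. What remains is to compare lists of vertices.
  h k := prism Y k
  h_zero_comp_δ_zero n := by
    refine ConcreteCategory.hom_ext _ _ fun x => ?_
    refine gs_ext (Y := Y) ?_ (fun j hj => ?_) (sset_congr_hom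
      ((SimplicialObject.Homotopy.refl (𝟙 Y)).h_zero_comp_δ_zero n) (GS.y (Y := Y) x))
    · rfl
    change hv (SimplexCategory.δ 0 ≫ hHom ((0 : Fin (n + 1)) : ℕ) (GS.t x)) j = hv (GS.t x ≫ sHom _) j
    rw [hv_comp, hv_δ _ hj, hv_comp, hv_sHom (hv_le _ _), hv_hHom _ _ (by split_ifs <;> omega)]
    simp
  h_last_comp_δ_last n := by
    refine ConcreteCategory.hom_ext _ _ fun x => ?_
    refine gs_ext (Y := Y) ?_ (fun j hj => ?_) (sset_congr_hom
      ((SimplicialObject.Homotopy.refl (𝟙 Y)).h_last_comp_δ_last n) (GS.y (Y := Y) x))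
    · rfl
    change hv (SimplexCategory.δ (Fin.last (n + 1)) ≫ hHom (Fin.last n : Fin (n + 1)) (GS.t x)) j = hv (GS.t x) j
    rw [hv_comp, hv_δ _ hj, hv_hHom _ _ (by simp only [Fin.val_last]; split_ifs <;> omega)]
    simp only [Fin.val_last]
    rw [if_pos (by omega : j < n + 1), if_pos hj]
  h_succ_comp_δ_castSucc_of_lt {n} i k hik := by
    refine ConcreteCategory.hom_ext _ _ fun x => ?_
    refine gs_ext (Y := Y) ?_ (fun j hj => ?_) (sset_congr_hom
      ((SimplicialObject.Homotopy.refl (𝟙 Y)).h_succ_comp_δ_castSucc_of_lt i k hik) (GS.y (Y := Y) x))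
    · rfl
    change hv (SimplexCategory.δ i.castSucc ≫ hHom k.succ (GS.t x)) j =
      hv (hHom k (SimplexCategory.δ i ≫ GS.t x)) j
    rw [hv_comp, hv_δ _ hj, hv_hHom _ _ (by split_ifs <;> omega), hv_hHom _ _ hj, hv_comp, hv_comp]
    simp only [Fin.val_castSucc, Fin.val_succ, Fin.le_def, Fin.lt_def] at *
    have hk := k.2
    have hi := i.2
    by_cases h : j ≤ k
    · rw [if_pos h, hv_δ _ (by omega)]
      split_ifs <;> first | rfl | omega
    · rw [if_neg h, hv_δ _ (by omega)]
      split_ifs <;> first | omega | rfl | (congr 2; omega)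
  h_succ_comp_δ_castSucc_succ {n} k := by
    refine ConcreteCategory.hom_ext _ _ fun x => ?_
    refine gs_ext (Y := Y) ?_ (fun j hj => ?_) (sset_congr_hom
      ((SimplicialObject.Homotopy.refl (𝟙 Y)).h_succ_comp_δ_castSucc_succ k) (GS.y (Y := Y) x))
    · rfl
    change hv (SimplexCategory.δ k.castSucc.succ ≫ hHom k.succ (GS.t x)) j =
      hv (SimplexCategory.δ k.castSucc.succ ≫ hHom k.castSucc (GS.t x)) j
    rw [hv_comp, hv_comp, hv_δ _ hj, hv_hHom _ _ (by split_ifs <;> omega),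
      hv_hHom _ _ (by split_ifs <;> omega)]
    simp only [Fin.val_castSucc, Fin.val_succ]
    split_ifs <;> first | rfl | omega
  h_castSucc_comp_δ_succ_of_lt {n} i k hik := by
    refine ConcreteCategory.hom_ext _ _ fun x => ?_
    refine gs_ext (Y := Y) ?_ (fun j hj => ?_) (sset_congr_hom
      ((SimplicialObject.Homotopy.refl (𝟙 Y)).h_castSucc_comp_δ_succ_of_lt i k hik) (GS.y (Y := Y) x))
    · rfl
    change hv (SimplexCategory.δ i.succ ≫ hHom k.castSucc (GS.t x)) j =
      hv (hHom k (SimplexCategory.δ i ≫ GS.t x)) j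
    rw [hv_comp, hv_δ _ hj, hv_hHom _ _ (by split_ifs <;> omega), hv_hHom _ _ hj, hv_comp, hv_comp]
    simp only [Fin.val_castSucc, Fin.val_succ, Fin.le_def, Fin.lt_def] at *
    have hk := k.2
    have hi := i.2
    by_cases h : j ≤ k
    · rw [if_pos h, hv_δ _ (by omega)]
      split_ifs <;> first | rfl | omega
    · rw [if_neg h, hv_δ _ (by omega)]
      split_ifs <;> first | omega | rfl | (congr 2; omega)
  h_comp_σ_castSucc_of_le {n} i k hik := by
    refine ConcreteCategory.hom_ext _ _ fun x => ?_
    refine gs_ext (Y := Y) ?_ (fun j hj => ?_) (sset_congr_hom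
      ((SimplicialObject.Homotopy.refl (𝟙 Y)).h_comp_σ_castSucc_of_le i k hik) (GS.y (Y := Y) x))
    · rfl
    change hv (SimplexCategory.σ i.castSucc ≫ hHom k (GS.t x)) j =
      hv (hHom k.succ (SimplexCategory.σ i ≫ GS.t x)) j
    rw [hv_comp, hv_σ _ hj, hv_hHom _ _ (by split_ifs <;> omega), hv_hHom _ _ hj, hv_comp, hv_comp]
    simp only [Fin.val_castSucc, Fin.val_succ, Fin.le_def, Fin.lt_def] at *
    have hk := k.2
    have hi := i.2
    by_cases h : j ≤ k + 1
    · rw [if_pos h, hv_σ _ (by omega)]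
      split_ifs <;> first | rfl | omega
    · rw [if_neg h, hv_σ _ (by omega)]
      split_ifs <;> omega
  h_comp_σ_succ_of_lt {n} i k hik := by
    refine ConcreteCategory.hom_ext _ _ fun x => ?_
    refine gs_ext (Y := Y) ?_ (fun j hj => ?_) (sset_congr_hom
      ((SimplicialObject.Homotopy.refl (𝟙 Y)).h_comp_σ_succ_of_lt i k hik) (GS.y (Y := Y) x))
    · rfl
    change hv (SimplexCategory.σ i.succ ≫ hHom k (GS.t x)) j =
      hv (hHom k.castSucc (SimplexCategory.σ i ≫ GS.t x)) j
    rw [hv_comp, hv_σ _ hj, hv_hHom _ _ (by split_ifs <;> omega), hv_hHom _ _ hj, hv_comp, hv_comp]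
    simp only [Fin.val_castSucc, Fin.val_succ, Fin.le_def, Fin.lt_def] at *
    have hk := k.2
    have hi := i.2
    by_cases h : j ≤ k
    · rw [if_pos h, hv_σ _ (by omega)]
      split_ifs <;> first | rfl | omega
    · rw [if_neg h, hv_σ _ (by omega)]
      split_ifs <;> omega

end

end

/-! ### The horn extension and the connecting map in each dimension -/

section

open Coded Finsupp CSet Tot

section

variable (Y : SSet.{u})

/-- The inclusion of the standard simplices as the faces opposite to the last vertex. -/
def upMap : gw Y ⟶ gw Y where
  app _ := ↾fun x => ⟨x.p + 1, x.t ≫ SimplexCategory.δ (Fin.last _), x.y⟩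
  naturality _ g h := ConcreteCategory.hom_ext _ _ fun x =>
    congrArg (fun t => (⟨GS.p x + 1, t, Y.map h (GS.y x)⟩ : GS Y g)) (Category.assoc _ _ _)

/-- The inclusion of `Y` over the standard simplex of dimension `0`. -/
def baseMap : Y ⟶ gw Y where
  app n := ↾fun y => ⟨0, SimplexCategory.const n.unop ⦋0⦌ 0, y⟩
  naturality _ _ _ := ConcreteCategory.hom_ext _ _ fun _ => rfl

variable {Y}

theorem tv_sMap (w : Tot (gw Y)) (j : ℕ) : tv (w.map (sMap Y)) j = sN (tp w) (tv w j) := by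
  change hv (GS.t w.val ≫ sHom _) j = _
  rw [hv_comp, hv_sHom (hv_le _ _)]
  rfl

theorem tp_sMap (w : Tot (gw Y)) : tp (w.map (sMap Y)) = tp w := rfl

theorem tv_upMap (w : Tot (gw Y)) (j : ℕ) : tv (w.map (upMap Y)) j = tv w j := by
  change hv (GS.t w.val ≫ SimplexCategory.δ (Fin.last _)) j = _
  rw [hv_comp, hv_δ _ (hv_le _ _), if_pos]
  · rfl
  · exact Nat.lt_succ_of_le (hv_le _ _)

theorem tp_upMap (w : Tot (gw Y)) : tp (w.map (upMap Y)) = tp w + 1 := rfl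

/-- The restriction to the face opposite to the last vertex. -/
def low (w : Tot (gw Y)) : Tot (gw Y) :=
  ⟨w.dim, GS.mk (tp w - 1) (homMk w.dim (tp w - 1) (fun j => min (tv w j) (tp w - 1))
    (fun _ _ h _ => min_le_min_right _ (tv_mono w h)) (min_le_right _ _)) (GS.y w.val)⟩

theorem tp_low (w : Tot (gw Y)) : tp (low w) = tp w - 1 := rfl

theorem tv_low (w : Tot (gw Y)) (j : ℕ) : tv (low w) j = min (tv w j) (tp w - 1) := by
  rw [← tv_clamp]
  refine (hv_homMk (n := w.dim) (p := tp w - 1) (f := fun j => min (tv w j) (tp w - 1))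
    (fun _ _ h _ => min_le_min_right _ (tv_mono w h)) (min_le_right _ _) (min_le_right _ _)).trans ?_
  rw [tv_clamp]

theorem low_up (w : Tot (gw Y)) : low (w.map (upMap Y)) = w :=
  gw_ext rfl (fun j _ => by
    rw [tv_low, tv_upMap, tp_upMap, Nat.add_sub_cancel, min_eq_left (tv_le _ _)]) rfl

theorem up_low {w : Tot (gw Y)} (h : ∀ j, tv w j ≠ tp w) : (low w).map (upMap Y) = w := by
  have h0 : tp w ≠ 0 := fun h0 => h 0 (le_antisymm (tv_le w 0) (by omega))
  refine gw_ext ?_ (fun j _ => ?_) rfl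
  · rw [tp_upMap, tp_low]; omega
  · rw [tv_upMap, tv_low]
    have := tv_le w j
    have := h j
    omega

theorem tv_prism {n : ℕ} (k : Fin (n + 1)) (x : (gw Y) _⦋n⦌) {j : ℕ} (h : j ≤ n + 1) :
    tv ⟨n + 1, prism Y k x⟩ j = if j ≤ k then tv ⟨n, x⟩ j else sN (tp ⟨n, x⟩) (tv ⟨n, x⟩ (j - 1)) :=
  hv_hHom _ _ h

/-- The criterion `s_i d_i x = x` for degeneracy is reflected by injective simplicial maps. -/
theorem nD_map {W W' : SSet.{u}} {f : W ⟶ W'} (hf : ∀ n, Function.Injective (f.app (op ⦋n⦌)))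
    {w : Tot W} (h : ND w) : ND (w.map f) := by
  obtain ⟨_ | n, x⟩ := w
  · change f.app _ x ∈ W'.nonDegenerate 0
    simp
  · by_contra h'
    obtain ⟨i, hi⟩ := (not_nD_iff (f.app (op ⦋n + 1⦌) x)).1 h'
    refine (not_nD_iff x).2 ⟨i, hf _ ?_⟩ h
    rw [← hi]
    have h1 := ConcreteCategory.congr_hom (SimplicialObject.δ_naturality f i.castSucc) x
    have h2 := ConcreteCategory.congr_hom (SimplicialObject.σ_naturality f i) (W.δ i.castSucc x)
    simp only [ConcreteCategory.comp_apply] at h1 h2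
    rw [h2, h1]

theorem upMap_injective (n : ℕ) : Function.Injective ((upMap Y).app (op ⦋n⦌)) := by
  intro x y h
  have := congrArg low (congrArg (Tot.mk (W := gw Y) n) h)
  exact ext_val ((low_up ⟨n, x⟩).symm.trans (this.trans (low_up ⟨n, y⟩)))

theorem baseMap_injective (n : ℕ) : Function.Injective ((baseMap Y).app (op ⦋n⦌)) := by
  intro x y h
  exact congrArg (GS.y (Y := Y)) h

theorem ty_baseMap (w : Tot Y) : ty (w.map (baseMap Y)) = w := rfl

theorem tp_baseMap (w : Tot Y) : tp (w.map (baseMap Y)) = 0 := rfl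

theorem baseMap_ty {w : Tot (gw Y)} (h : tp w = 0) : (ty w).map (baseMap Y) = w :=
  gw_ext h.symm (fun j _ => by
    have h1 := tv_le w j
    have h2 := tv_le ((ty w).map (baseMap Y)) j
    rw [tp_baseMap] at h2
    omega) rfl

variable [EffS Y]

theorem cm_upMap : Cm fun w : Tot (gw Y) => w.map (upMap Y) := by
  refine Cm.gw ((cm_tp.nat_add (Cm.const 1)).congr fun _ => rfl) ?_ (cm_ty.congr fun _ => rfl)
  exact Cm.congr (by fun_prop) fun p : Tot (gw Y) × ℕ => (tv_upMap p.1 p.2).symm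

theorem cm_low : Cm (low : Tot (gw Y) → Tot (gw Y)) := by
  refine Cm.gw ((cm_tp.nat_sub (Cm.const 1)).congr fun _ => rfl) ?_ (cm_ty.congr fun _ => rfl)
  exact Cm.congr (by fun_prop) fun p : Tot (gw Y) × ℕ => (tv_low p.1 p.2).symm

theorem cm_baseMap : Cm fun w : Tot Y => w.map (baseMap Y) := by
  refine Cm.gw ((Cm.const 0).congr fun _ => rfl) ?_ (Cm.id.congr fun _ => rfl)
  refine Cm.congr (Cm.const 0) fun p : Tot Y × ℕ => ?_
  exact (Nat.le_zero.1 (tv_le (p.1.map (baseMap Y)) p.2)).symm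

theorem tv_homT {s s' : ℕ} (i : ℕ) (w : Tot (gw Y)) (j : ℕ) :
    tv (CellData.homT (D := gwData Y s) (D' := gwData Y s') (sHomotopy Y) i w) j =
      if min j (w.dim + 1) ≤ min i w.dim then tv w (min j (w.dim + 1))
      else sN (tp w) (tv w (min j (w.dim + 1) - 1)) := by
  rw [← tv_clamp]
  exact tv_prism (clampFin w.dim i) w.val (min_le_right _ _)

theorem cm_sN : Cm fun p : ℕ × ℕ => sN p.1 p.2 := by
  classical
  exact Cm.ite (CmP.eq (f := fun p : ℕ × ℕ => p.2 + 1) (g := fun p => p.1) (by fun_prop) (by fun_prop))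
    (by fun_prop) (by fun_prop)

theorem cm_homT (s s' : ℕ) : Cm fun p : ℕ × Tot (gw Y) =>
    CellData.homT (D := gwData Y s) (D' := gwData Y s') (sHomotopy Y) p.1 p.2 := by
  classical
  refine Cm.gw ((cm_tp.comp Cm.snd).congr fun _ => rfl) ?_
    ((Cm.degen Cm.fst (cm_ty.comp Cm.snd)).congr fun _ => rfl)
  refine Cm.congr ?_ fun p : (ℕ × Tot (gw Y)) × ℕ => (tv_homT p.1.1 p.1.2 p.2).symm
  have h1 : Cm fun p : (ℕ × Tot (gw Y)) × ℕ => p.1.2.dim := cm_gw_dim.comp (by fun_prop)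
  refine Cm.ite (CmP.nat_le (by fun_prop) (by fun_prop)) (by fun_prop) ?_
  exact cm_sN.comp (f := fun p : (ℕ × Tot (gw Y)) × ℕ =>
    (tp p.1.2, tv p.1.2 (min p.2 (p.1.2.dim + 1) - 1))) (Cm.pair (by fun_prop) (by fun_prop))

instance (s : ℕ) : CSet (gwData Y s).Cell := CellData.instCSetCell (gwData Y s)

instance : CSet (allCells Y).Cell := CellData.instCSetCell (allCells Y)

local notation "GD" => gwData Y 1
local notation "RD" => gwData Y 0

theorem gw_A (s : ℕ) (w : Tot (gw Y)) : (gwData Y s).A w ↔ ¬ ∀ v < tp w + s, ∃ j, tv w j = v :=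
  not_congr covers_iff

theorem sN_eq {p v u : ℕ} (h : sN p v = u) (hu : u < p) : v = u := by
  unfold sN at h; split_ifs at h <;> omega

theorem gw_A_mono {w : Tot (gw Y)} (h : (RD).A w) : (GD).A w := by
  rw [gw_A] at h ⊢
  exact mt (fun h v hv => h v (by omega)) h

theorem gw_A_sMap {w : Tot (gw Y)} (h : (RD).A w) : (RD).A (w.map (sMap Y)) := by
  rw [gw_A] at h ⊢
  refine mt (fun h' v hv => ?_) h
  rw [tp_sMap] at h'
  obtain ⟨j, hj⟩ := h' v hv
  rw [tv_sMap] at hj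
  exact ⟨j, sN_eq hj hv⟩

theorem gw_A_prism (n : ℕ) (k : Fin (n + 1)) (x : (gw Y) _⦋n⦌) (h : (RD).A ⟨n, x⟩) :
    (RD).A ⟨n + 1, (sHomotopy Y).h k x⟩ := by
  rw [gw_A] at h ⊢
  refine mt (fun h' v hv => ?_) h
  obtain ⟨j, hj⟩ := h' v hv
  rw [← tv_clamp] at hj
  have := (tv_prism k x (min_le_right j (n + 1))).symm.trans hj
  split_ifs at this
  · exact ⟨_, this⟩
  · exact ⟨_, sN_eq this hv⟩

theorem gw_A_upMap {w : Tot (gw Y)} (h : (GD).A w) : (RD).A (w.map (upMap Y)) := by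
  rw [gw_A] at h ⊢
  refine mt (fun h' v hv => ?_) h
  obtain ⟨j, hj⟩ := h' v hv
  rw [tv_upMap] at hj
  exact ⟨j, hj⟩

/-- After pushing `p - 1` to `p`, the vertex `p - 1` is missed, so the image lies in the horn. For
`p = 0` there is no such vertex and the push is the identity; hence label zero is the end of the
tower. -/
theorem gw_A_sMap_of_pos {w : Tot (gw Y)} (h : tp w ≠ 0) : (RD).A (w.map (sMap Y)) := by
  rw [gw_A]
  intro h'
  rw [tp_sMap] at h'
  obtain ⟨j, hj⟩ := h' (tp w - 1) (by omega)
  rw [tv_sMap] at hj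
  unfold sN at hj
  split_ifs at hj <;> omega

/-- The last vertex occurs. -/
def HitsTop (w : Tot (gw Y)) : Prop := tv w w.dim = tp w

theorem hitsTop_iff {w : Tot (gw Y)} : HitsTop w ↔ ∃ j, tv w j = tp w := by
  refine ⟨fun h => ⟨_, h⟩, fun ⟨j, h⟩ => le_antisymm (tv_le _ _) ?_⟩
  rw [← h, ← tv_clamp w j]
  exact tv_mono w (min_le_right _ _)

theorem cmP_hitsTop : CmP (HitsTop : Tot (gw Y) → Prop) :=
  CmP.eq (f := fun w : Tot (gw Y) => tv w w.dim) (g := fun w => tp w) (by fun_prop) (by fun_prop)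

theorem hitsTop_of_not_A {w : Tot (gw Y)} (h : ¬ (GD).A w) : HitsTop w := by
  rw [gw_A, not_not] at h
  exact hitsTop_iff.2 (h _ (by omega))

theorem not_A_of_hitsTop {w : Tot (gw Y)} (h : ¬ (RD).A w) (h' : HitsTop w) : ¬ (GD).A w := by
  rw [gw_A, not_not] at h ⊢
  intro v hv
  rcases Nat.lt_succ_iff_lt_or_eq.1 hv with h1 | h1
  · exact h v h1
  · rw [h1]; exact hitsTop_iff.1 h'

/-- A simplex outside the horn hits every vertex below `p`, so its last vertex is at least `p - 1`;
the prism operator appends the push of that vertex, which is `p`. -/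
theorem hitsTop_prism {n : ℕ} (k : Fin (n + 1)) {x : (gw Y) _⦋n⦌} (h : ¬ (RD).A ⟨n, x⟩) :
    HitsTop ⟨n + 1, prism Y k x⟩ := by
  rw [gw_A, not_not] at h
  refine (tv_prism k x le_rfl).trans ?_
  have hk := k.2
  rw [if_neg (by omega), Nat.add_sub_cancel]
  change _ = tp ⟨n, x⟩
  have h1 := tv_le ⟨n, x⟩ n
  have h2 : tp ⟨n, x⟩ ≤ tv ⟨n, x⟩ n + 1 := by
    by_contra h3
    obtain ⟨j, hj⟩ := h (tp ⟨n, x⟩ - 1) (by omega)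
    have h4 : tv ⟨n, x⟩ j ≤ tv ⟨n, x⟩ n := by
      rw [← tv_clamp]
      exact tv_mono _ (min_le_right _ _)
    omega
  unfold sN
  split_ifs <;> omega

variable (Y)

/-- The inclusion of the absolute cells. -/
def gwι : V (GD).Cell →ₗ[ℤ] V (RD).Cell := Finsupp.linearCombination ℤ fun c : (GD).Cell => (RD).br c.1

/-- The projection to the absolute cells. -/
def gwπ : V (RD).Cell →ₗ[ℤ] V (GD).Cell := CellData.mapV (𝟙 (gw Y))

/-- The inclusion of the face opposite to the last vertex. -/
def gwι' : V (GD).Cell →ₗ[ℤ] V (RD).Cell := CellData.mapV (upMap Y)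

open Classical in
/-- The projection of a simplex to the face opposite to the last vertex. -/
def lowBr (w : Tot (gw Y)) : V (GD).Cell := if HitsTop w then 0 else (GD).br (low w)

/-- The projection to the face opposite to the last vertex. -/
def gwπ' : V (RD).Cell →ₗ[ℤ] V (GD).Cell := Finsupp.linearCombination ℤ fun c : (RD).Cell => lowBr Y c.1

/-- The homotopy. -/
def gwP : V (RD).Cell →ₗ[ℤ] V (RD).Cell := CellData.hV (D := RD) (D' := RD) (sHomotopy Y)

/-- The projection of chains induced by `sMap`. -/
def gwS : V (RD).Cell →ₗ[ℤ] V (RD).Cell := CellData.mapV (sMap Y)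

variable {Y}

theorem gw_br_cell {s : ℕ} (c : (gwData Y s).Cell) : (gwData Y s).br c.1 = single c 1 :=
  CellData.br_cell c

theorem gwι_single (c : (GD).Cell) : gwι Y (single c 1) = (RD).br c.1 := by
  rw [gwι, linearCombination_single, one_smul]

theorem gwπ'_single (c : (RD).Cell) : gwπ' Y (single c 1) = lowBr Y c.1 := by
  rw [gwπ', linearCombination_single, one_smul]

theorem gwπ_br (w : Tot (gw Y)) : gwπ Y ((RD).br w) = (GD).br w :=
  CellData.mapV_br (D := RD) (D' := GD) (f := 𝟙 (gw Y)) (fun _ h => gw_A_mono h) w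

theorem gwι'_br (w : Tot (gw Y)) : gwι' Y ((GD).br w) = (RD).br (w.map (upMap Y)) :=
  CellData.mapV_br (D := GD) (D' := RD) (f := upMap Y) (fun _ h => gw_A_upMap h) w

theorem gwS_br (w : Tot (gw Y)) : gwS Y ((RD).br w) = (RD).br (w.map (sMap Y)) :=
  CellData.mapV_br (D := RD) (D' := RD) (f := sMap Y) (fun _ h => gw_A_sMap h) w

theorem gwι'_d (v : V (GD).Cell) : gwι' Y (CellData.dV v) = CellData.dV (gwι' Y v) :=
  CellData.mapV_dV (D := GD) (D' := RD) (f := upMap Y) (fun _ h => gw_A_upMap h) v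

theorem gwπ_d (v : V (RD).Cell) : gwπ Y (CellData.dV v) = CellData.dV (gwπ Y v) :=
  CellData.mapV_dV (D := RD) (D' := GD) (f := 𝟙 (gw Y)) (fun _ h => gw_A_mono h) v

theorem gwP_hty (v : V (RD).Cell) :
    CellData.dV (gwP Y v) + gwP Y (CellData.dV v) = v - gwS Y v := by
  refine (CellData.hV_hty (D := RD) (D' := RD) (H := sHomotopy Y) gw_A_prism (fun _ h => h)
    (fun _ h => gw_A_sMap h) v).trans ?_
  have : CellData.mapV (D := RD) (D' := RD) (𝟙 (gw Y)) v = v :=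
    CellData.hom_ext' (D := RD) (f := CellData.mapV (D := RD) (D' := RD) (𝟙 (gw Y))) (g := LinearMap.id)
      (fun n x => CellData.mapV_br (D := RD) (D' := RD) (f := 𝟙 (gw Y)) (fun _ h => h) ⟨n, x⟩) v
  rw [this]
  rfl

theorem gwS_br_of_pos {w : Tot (gw Y)} (h : tp w ≠ 0) : gwS Y ((RD).br w) = 0 := by
  rw [gwS_br]
  exact CellData.br_of_A (D := RD) (gw_A_sMap_of_pos h)

theorem gwS_ι' (v : V (GD).Cell) : gwS Y (gwι' Y v) = 0 :=
  CellData.hom_ext' (D := GD) (f := gwS Y ∘ₗ gwι' Y) (g := 0) (fun n x => by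
    change gwS Y (gwι' Y _) = 0
    rw [gwι'_br]
    exact gwS_br_of_pos (by rw [tp_upMap]; omega)) v

theorem gwπ_ι (v : V (GD).Cell) : gwπ Y (gwι Y v) = v := by
  have : gwπ Y ∘ₗ gwι Y = LinearMap.id := by
    refine Finsupp.lhom_ext' fun c => LinearMap.ext_ring ?_
    change gwπ Y (gwι Y (single c 1)) = single c 1
    rw [gwι_single, gwπ_br, gw_br_cell]
  exact LinearMap.congr_fun this v

theorem gwπ_ι' (v : V (GD).Cell) : gwπ Y (gwι' Y v) = 0 :=
  CellData.hom_ext' (D := GD) (f := gwπ Y ∘ₗ gwι' Y) (g := 0) (fun n x => by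
    change gwπ Y (gwι' Y _) = 0
    rw [gwι'_br, gwπ_br]
    refine CellData.br_of_A (D := GD) ?_
    intro h
    have h1 := hitsTop_of_not_A (fun h' => h' h)
    have h2 := tv_le (⟨n, x⟩ : Tot (gw Y)) n
    have h3 : tv (Tot.map (upMap Y) ⟨n, x⟩) n = tp (⟨n, x⟩ : Tot (gw Y)) + 1 := h1
    rw [tv_upMap] at h3
    omega) v

theorem gwπ'_br_of_hitsTop {w : Tot (gw Y)} (h : HitsTop w) : gwπ' Y ((RD).br w) = 0 := by
  by_cases hw : w.ND ∧ ¬ (RD).A w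
  · rw [show (RD).br w = _ from gw_br_cell (s := 0) ⟨w, hw⟩, gwπ'_single, lowBr, if_pos h]
  · rw [show (RD).br w = 0 from dif_neg hw, map_zero]

theorem not_hitsTop_upMap (w : Tot (gw Y)) : ¬ HitsTop (w.map (upMap Y)) := fun h => by
  have h3 : tv (w.map (upMap Y)) _ = tp w + 1 := h
  rw [tv_upMap] at h3
  have := tv_le w (w.map (upMap Y)).dim
  omega

theorem gwπ'_ι' (v : V (GD).Cell) : gwπ' Y (gwι' Y v) = v := by
  have : gwπ' Y ∘ₗ gwι' Y = LinearMap.id := by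
    refine Finsupp.lhom_ext' fun c => LinearMap.ext_ring ?_
    change gwπ' Y (gwι' Y (single c 1)) = single c 1
    rw [← gw_br_cell, gwι'_br]
    have hw : (c.1.map (upMap Y)).ND ∧ ¬ (RD).A (c.1.map (upMap Y)) := by
      refine ⟨nD_map upMap_injective c.2.1, fun h => c.2.2 ?_⟩
      rw [gw_A] at h ⊢
      refine mt (fun h' v hv => ?_) h
      obtain ⟨j, hj⟩ := h' v hv
      exact ⟨j, by rw [tv_upMap, hj]⟩
    rw [show (RD).br (c.1.map (upMap Y)) = _ from gw_br_cell (s := 0) ⟨_, hw⟩, gwπ'_single, lowBr,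
      if_neg (not_hitsTop_upMap _), low_up]
  exact LinearMap.congr_fun this v

/-- The cells outside the horn are of two kinds: those hitting the last vertex, which are the cells
of `Δ^p` relative to its boundary, and those missing it, which are the cells of the last face
relative to its boundary. So the extension is split as graded groups. -/
theorem gwι_π (v : V (RD).Cell) : gwι Y (gwπ Y v) = v - gwι' Y (gwπ' Y v) := by
  have : gwι Y ∘ₗ gwπ Y = LinearMap.id - gwι' Y ∘ₗ gwπ' Y := by
    refine Finsupp.lhom_ext' fun c => LinearMap.ext_ring ?_
    change gwι Y (gwπ Y (single c 1)) = single c 1 - gwι' Y (gwπ' Y (single c 1))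
    rw [gwπ'_single, ← gw_br_cell, gwπ_br]
    by_cases h : HitsTop c.1
    · have hc : c.1.ND ∧ ¬ (GD).A c.1 := ⟨c.2.1, not_A_of_hitsTop c.2.2 h⟩
      rw [show (GD).br c.1 = _ from gw_br_cell (s := 1) ⟨c.1, hc⟩, gwι_single, lowBr, if_pos h, map_zero, sub_zero]
    · have h1 : (GD).br c.1 = 0 := by
        refine CellData.br_of_A (D := GD) ?_
        intro h'
        exact h (hitsTop_of_not_A (fun h1 => h1 h'))
      rw [h1, lowBr, if_neg h, gwι'_br, up_low (fun j hj => h (hitsTop_iff.2 ⟨j, hj⟩)), sub_self, map_zero]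
  exact LinearMap.congr_fun this v

/-- Every simplex of a prism hits the last vertex, so it has no component on the last face. This is
why the inverse of the connecting map is strict on one side. -/
theorem gwπ'_P (v : V (RD).Cell) : gwπ' Y (gwP Y v) = 0 := by
  have : gwπ' Y ∘ₗ gwP Y = 0 := by
    refine Finsupp.lhom_ext' fun c => LinearMap.ext_ring ?_
    change gwπ' Y (gwP Y (single c 1)) = 0
    rw [gwP, CellData.hV, linearCombination_single, one_smul, CellData.hT, map_neg, map_sum, neg_eq_zero]
    refine Finset.sum_eq_zero fun i _ => ?_
    rw [map_zsmul]
    have : gwπ' Y ((RD).br ⟨_, prism Y i c.1.val⟩) = 0 := gwπ'_br_of_hitsTop (hitsTop_prism i c.2.2)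
    exact (congrArg _ this).trans (smul_zero _)
  exact LinearMap.congr_fun this v

theorem gwι_good : Good True 0 (gwι Y) :=
  Good.lin (CellData.cm_br.comp CellData.cm_val) fun a b hab => by
    have h := CellData.br_apply hab
    rw [CellData.deg_def, CellData.deg_def, CellData.lab_def, CellData.lab_def, h]
    exact ⟨by simp, fun _ => rfl⟩

theorem gwπ_good : Good True 0 (gwπ Y) :=
  CellData.good_mapV (D := RD) (D' := GD) (f := 𝟙 (gw Y)) Cm.id (fun _ _ => rfl)

theorem gwP_good : Good True 1 (gwP Y) :=
  CellData.good_hV (D := RD) (D' := RD) (H := sHomotopy Y) (cm_homT 0 0) (fun _ _ _ _ => rfl)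

theorem cm_gwι' : Cm (gwι' Y) := CellData.cm_mapV (D := GD) (D' := RD) cm_upMap

theorem spt_gwι' : Spt (fun a b => deg b = deg a ∧ CSet.lab b = CSet.lab a + 1) (gwι' Y) := by
  refine Spt.lin fun a b hab => ?_
  have h := CellData.br_apply hab
  rw [CellData.deg_def, CellData.deg_def, CellData.lab_def, CellData.lab_def, h]
  exact ⟨rfl, rfl⟩

theorem cm_gwπ' : Cm (gwπ' Y) := by
  have h : Cm (lowBr Y) := by
    classical
    refine Cm.congr (f := fun w => if HitsTop w then (0 : V (GD).Cell) else (GD).br (low w)) ?_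
      fun w => by unfold lowBr; congr
    exact Cm.ite cmP_hitsTop (Cm.const 0) (CellData.cm_br.comp cm_low)
  exact Cm.linear ((h.comp CellData.cm_val).congr fun c => (gwπ'_single c).symm)

theorem spt_gwπ' : Spt (fun a b => deg b = deg a ∧ CSet.lab b + 1 = CSet.lab a) (gwπ' Y) := by
  refine Spt.lin fun a b hab => ?_
  rw [lowBr] at hab
  split_ifs at hab with h0
  · exact (hab rfl).elim
  · have h := CellData.br_apply hab
    rw [CellData.deg_def, CellData.deg_def, CellData.lab_def, CellData.lab_def, h]
    refine ⟨rfl, ?_⟩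
    change tp (low a.1) + 1 = tp a.1
    rw [tp_low]
    have : tp a.1 ≠ 0 := fun h1 => h0 (le_antisymm (tv_le _ _) (by omega))
    omega

variable (Y)

/-- The inclusion of the chains of `Y`. -/
def gwφ : V (allCells Y).Cell →ₗ[ℤ] V (GD).Cell := CellData.mapV (baseMap Y)

open Classical in
/-- The projection to the chains of `Y`. -/
def gwψ : V (GD).Cell →ₗ[ℤ] V (allCells Y).Cell :=
  Finsupp.linearCombination ℤ fun c : (GD).Cell => if tp c.1 = 0 then (allCells Y).br (ty c.1) else 0

variable {Y}

theorem gwφ_br (w : Tot Y) : gwφ Y ((allCells Y).br w) = (GD).br (w.map (baseMap Y)) :=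
  CellData.mapV_br (D := allCells Y) (D' := GD) (f := baseMap Y) (fun _ h => h.elim) w

theorem gwφ_d (v : V (allCells Y).Cell) : gwφ Y (CellData.dV v) = CellData.dV (gwφ Y v) :=
  CellData.mapV_dV (D := allCells Y) (D' := GD) (f := baseMap Y) (fun _ h => h.elim) v

theorem gwψ_single (c : (GD).Cell) (h : tp c.1 = 0) : gwψ Y (single c 1) = (allCells Y).br (ty c.1) := by
  rw [gwψ, linearCombination_single, one_smul, if_pos h]

theorem gwψ_single_of_ne (c : (GD).Cell) (h : tp c.1 ≠ 0) (z : ℤ) : gwψ Y (single c z) = 0 := by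
  rw [gwψ, linearCombination_single, if_neg h, smul_zero]

theorem gwψ_φ (v : V (allCells Y).Cell) : gwψ Y (gwφ Y v) = v := by
  have : gwψ Y ∘ₗ gwφ Y = LinearMap.id := by
    refine Finsupp.lhom_ext' fun c => LinearMap.ext_ring ?_
    change gwψ Y (gwφ Y (single c 1)) = single c 1
    rw [← CellData.br_cell, gwφ_br]
    have hw : (c.1.map (baseMap Y)).ND ∧ ¬ (GD).A (c.1.map (baseMap Y)) := by
      refine ⟨nD_map baseMap_injective c.2.1, ?_⟩
      rw [gw_A, not_not]
      intro v hv
      rw [tp_baseMap] at hv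
      refine ⟨0, ?_⟩
      have := tv_le (c.1.map (baseMap Y)) 0
      rw [tp_baseMap] at this
      omega
    rw [show (GD).br (c.1.map (baseMap Y)) = _ from gw_br_cell (s := 1) ⟨_, hw⟩, gwψ_single _ (tp_baseMap _),
      ty_baseMap]
  exact LinearMap.congr_fun this v

theorem gwφ_ψ (c : (GD).Cell) (h : tp c.1 = 0) : gwφ Y (gwψ Y (single c 1)) = single c 1 := by
  rw [gwψ_single c h, gwφ_br, baseMap_ty h, gw_br_cell]

theorem gwψ_of_lab {v : V (GD).Cell} (h : ∀ c, v c ≠ 0 → tp c.1 ≠ 0) : gwψ Y v = 0 := by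
  rw [← Finsupp.sum_single v, Finsupp.sum, map_sum]
  exact Finset.sum_eq_zero fun c hc => gwψ_single_of_ne c (h c (Finsupp.mem_support_iff.1 hc)) _

/-- At label zero the map inverts the chain map `φ`; at positive labels both sides vanish because
the relative boundary preserves the label. -/
theorem gwψ_d (v : V (GD).Cell) : gwψ Y (CellData.dV v) = CellData.dV (gwψ Y v) := by
  have : gwψ Y ∘ₗ CellData.dV = CellData.dV ∘ₗ gwψ Y := by
    refine Finsupp.lhom_ext' fun c => LinearMap.ext_ring ?_
    change gwψ Y (CellData.dV (single c 1)) = CellData.dV (gwψ Y (single c 1))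
    by_cases h : tp c.1 = 0
    · have h1 := gwφ_d (gwψ Y (single c 1))
      rw [gwφ_ψ c h] at h1
      rw [← h1, gwψ_φ]
    · rw [gwψ_single_of_ne c h, map_zero]
      refine gwψ_of_lab fun b hb => ?_
      have := (CellData.good_dV (D := GD)).spt _ _ hb
      rw [show tp b.1 = tp c.1 from this.2 trivial]
      exact h
  exact LinearMap.congr_fun this v

theorem gwψ_good : Good False 0 (gwψ Y) := by
  classical
  refine Good.lin ?_ ?_
  · exact (Cm.ite (CmP.eq (f := fun w : Tot (gw Y) => tp w) (g := fun _ => 0) (by fun_prop) (by fun_prop))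
      (CellData.cm_br.comp cm_ty) (Cm.const 0)).comp CellData.cm_val
  · intro a b hab
    split_ifs at hab with h0
    · have h := CellData.br_apply hab
      rw [CellData.deg_def, CellData.deg_def, h]
      exact ⟨by rw [add_zero]; rfl, False.elim⟩
    · exact (hab rfl).elim

theorem spt_gwφ : Spt (fun a b => deg b = deg a ∧ CSet.lab b = 0) (gwφ Y) := by
  refine Spt.lin fun a b hab => ?_
  have h := CellData.br_apply hab
  rw [CellData.deg_def, CellData.deg_def, CellData.lab_def, h]
  exact ⟨rfl, rfl⟩

/-- Since `π' P = 0`, the composite is `π' d P ι'`. The homotopy formula with `S ι' = 0` turns this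
into `π' ι' - π' P d ι'`, that is, the identity. -/
theorem gwκ_β (v : V (GD).Cell) : gwπ' Y (CellData.dV (gwι Y (gwπ Y (gwP Y (gwι' Y v))))) = v := by
  have h := gwP_hty (gwι' Y v)
  rw [gwS_ι', sub_zero] at h
  rw [gwι_π, gwπ'_P, map_zero, sub_zero, eq_sub_of_add_eq h, map_sub, gwπ'_ι', gwπ'_P, sub_zero]

/-- The homotopy formula gives `(dP + Pd) ι' = ι'`, because the push kills the last face, and `π ι'
= 0`. -/
theorem gwβ_d (v : V (GD).Cell) :
    CellData.dV (gwπ Y (gwP Y (gwι' Y v))) + gwπ Y (gwP Y (gwι' Y (CellData.dV v))) = 0 := by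
  have h := gwP_hty (gwι' Y v)
  rw [gwS_ι', sub_zero] at h
  rw [← gwπ_d, gwι'_d, ← map_add, h, gwπ_ι']

/-- The section `ι` is not a chain map: a boundary may have a component on the last face, and this
component is the connecting map `κ = π' d ι`. -/
theorem gwι_d (v : V (GD).Cell) :
    CellData.dV (gwι Y v) = gwι Y (CellData.dV v) + gwι' Y (gwπ' Y (CellData.dV (gwι Y v))) := by
  have h := gwι_π (CellData.dV (gwι Y v))
  rw [gwπ_d, gwπ_ι] at h
  rw [h, sub_add_cancel]

/-- Applying the differential to the formula for `d ι` gives zero; the component on the last face is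
the claim. -/
theorem gwκ_d (v : V (GD).Cell) : gwπ' Y (CellData.dV (gwι Y (CellData.dV v))) +
    CellData.dV (gwπ' Y (CellData.dV (gwι Y v))) = 0 := by
  have h := congrArg CellData.dV (gwι_d v)
  rw [CellData.dV_dV, map_add, ← gwι'_d] at h
  have h2 := congrArg (gwπ' Y) h
  rw [map_zero, map_add, gwπ'_ι'] at h2
  exact h2.symm

/-- Projecting the contraction of the horn pair to cells hitting the last vertex: the failure of `ι`
to be a chain map contributes exactly the term `β κ`. The hypothesis holds at positive labels. -/
theorem gwη_hty (v : V (GD).Cell) (hv : gwS Y (gwι Y v) = 0) :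
    CellData.dV (gwπ Y (gwP Y (gwι Y v))) + gwπ Y (gwP Y (gwι Y (CellData.dV v))) =
      v - gwπ Y (gwP Y (gwι' Y (gwπ' Y (CellData.dV (gwι Y v))))) := by
  have h := gwP_hty (gwι Y v)
  rw [hv, sub_zero, gwι_d, map_add] at h
  have h2 := congrArg (gwπ Y) h
  rw [gwπ_ι, map_add, map_add, gwπ_d] at h2
  rw [eq_sub_iff_add_eq, add_assoc]
  exact h2

theorem spt_comp_good {A B C : Type*} [CSet A] [CSet B] [CSet C] {g : V B →ₗ[ℤ] V C} {f : V A →ₗ[ℤ] V B}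
    (hg : Spt (fun a b => deg b = deg a ∧ CSet.lab b + 1 = CSet.lab a) g) (hf : Good True (-1) f) :
    Spt (fun a b => deg b + 1 = deg a ∧ CSet.lab b + 1 = CSet.lab a) (g ∘ₗ f) := by
  refine hg.comp hf.spt ?_
  rintro a b c ⟨h1, h2⟩ ⟨h3, h4⟩
  have := h2 trivial
  exact ⟨by omega, by omega⟩

theorem good_comp_spt {A B C : Type*} [CSet A] [CSet B] [CSet C] {g : V B →ₗ[ℤ] V C} {f : V A →ₗ[ℤ] V B}
    (hg : Good True 1 g) (hf : Spt (fun a b => deg b = deg a ∧ CSet.lab b = CSet.lab a + 1) f) :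
    Spt (fun a b => deg b = deg a + 1 ∧ CSet.lab b = CSet.lab a + 1) (g ∘ₗ f) := by
  refine hg.spt.comp hf ?_
  rintro a b c ⟨h1, h2⟩ ⟨h3, h4⟩
  have := h4 trivial
  exact ⟨by omega, by omega⟩

variable (Y)

/-- The tower of the products of the standard simplices relative to their boundaries with `Y`. -/
def gwTower : Tower (GD).cx (allCells Y).cx where
  κ := gwπ' Y ∘ₗ CellData.dV ∘ₗ gwι Y
  β := gwπ Y ∘ₗ gwP Y ∘ₗ gwι' Y
  η := gwπ Y ∘ₗ gwP Y ∘ₗ gwι Y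
  φ := gwφ Y
  ψ := gwψ Y
  spt_κ := spt_comp_good spt_gwπ' ((CellData.good_dV (D := RD)).comp gwι_good (m := -1) (by ring))
  spt_β := good_comp_spt (g := gwπ Y ∘ₗ gwP Y) (f := gwι' Y) (gwπ_good.comp gwP_good (m := 1) (by ring)) spt_gwι'
  spt_φ := spt_gwφ
  good_η := gwπ_good.comp (gwP_good.comp gwι_good (m := 1) (by ring)) (by ring)
  good_ψ := gwψ_good
  cm_κ := cm_gwπ'.comp ((CellData.good_dV (D := RD)).cm.comp gwι_good.cm)
  cm_β := gwπ_good.cm.comp (gwP_good.cm.comp cm_gwι')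
  cm_φ := CellData.cm_mapV (D := allCells Y) (D' := GD) cm_baseMap
  κ_β := gwκ_β
  κ_d := gwκ_d
  β_d := gwβ_d
  hty b hb := eq_sub_iff_add_eq.1 (gwη_hty (single b 1)
    ((congrArg _ (gwι_single b)).trans (gwS_br_of_pos hb)))
  φ_d := gwφ_d
  ψ_d := gwψ_d
  ψ_φ := gwψ_φ
  φ_ψ := gwφ_ψ

end

end

/-! ### The nerve and the homotopy colimit as coded simplicial sets -/

section

open Coded Finsupp CSet Tot

/-! ### Finite coded sets -/

section finite

variable {A B : Type*} [Coded A] [CEq A] [Finite A] [Coded B]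

/-- A function on a finite set with decidable equality is a finite table. Composition, sources and
targets of morphisms of `I` are computable for this reason only. -/
theorem Cm.of_finite (f : A → B) : Cm f :=
  Cm.glue Cm.id fun i => (Cm.const (f i)).congr fun x => congrArg f x.2.symm

instance : CEq (List A) := by
  obtain ⟨n, ⟨e⟩⟩ := Finite.exists_equiv_fin A
  refine CEq.of_injective (B := List ℕ) (f := List.map fun x => (e x : ℕ)) ?_ ?_
  · exact Cm.list_map (f := fun p : List A × A => (e p.2 : ℕ)) ((Cm.of_finite fun x : A => (e x : ℕ)).comp Cm.snd) Cm.id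
  · exact List.map_injective_iff.2 (Fin.val_injective.comp e.injective)

end finite

/-! ### Simplices of the nerve of a category -/

section nerve

variable {I : Type u} [SmallCategory I]

theorem clampFin_le_max (n i j : ℕ) : clampFin n i ≤ clampFin n (max i j) := by
  simp [clampFin, Fin.le_def]

/-- The morphism from the `i`-th to the `j`-th object of a chain. -/
def car {n : ℕ} (σ : ComposableArrows I n) (i j : ℕ) : Arrow I :=
  Arrow.mk (σ.map (homOfLE (clampFin_le_max n i j)))

theorem car_of {n : ℕ} (σ : ComposableArrows I n) {a b : Fin (n + 1)} (h : a ≤ b) {i j : ℕ}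
    (hi : clampFin n i = a) (hj : clampFin n (max i j) = b) : car σ i j = Arrow.mk (σ.map (homOfLE h)) := by
  subst hi hj
  rfl

theorem car_congr {n : ℕ} (σ : ComposableArrows I n) {i j i' j' : ℕ} (hi : min i n = min i' n)
    (hj : min (max i j) n = min (max i' j') n) : car σ i j = car σ i' j' :=
  car_of σ _ (Fin.ext hi) (Fin.ext hj)

theorem car_self {n : ℕ} (σ : ComposableArrows I n) (i : ℕ) :
    car σ i i = Arrow.mk (𝟙 (σ.obj (clampFin n i))) := by
  rw [car_of σ (le_refl (clampFin n i)) rfl (by rw [max_self])]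
  exact congrArg Arrow.mk (σ.map_id _)

theorem car_map {n m : ℕ} (θ : ⦋m⦌ ⟶ ⦋n⦌) (σ : (nerve I) _⦋n⦌) (i j : ℕ) :
    car (n := m) ((nerve I).map θ.op σ) i j = car (n := n) σ (hv θ i) (hv θ j) := by
  refine Eq.symm (car_of (n := n) σ (θ.toOrderHom.monotone (clampFin_le_max m i j)) ?_ ?_)
  · exact clampFin_val _
  · have : max (hv θ i) (hv θ j) = hv θ (max i j) := by
      rcases le_total i j with h | h
      · rw [max_eq_right h, max_eq_right (hv_mono θ h)]
      · rw [max_eq_left h, max_eq_left (hv_mono θ h)]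
    rw [this]
    exact clampFin_val _

/-- The first object must be recorded besides the consecutive morphisms, because for a chain of
length zero there are none. -/
theorem nerve_ext {n : ℕ} {σ σ' : ComposableArrows I n} (h0 : car σ 0 0 = car σ' 0 0)
    (h : ∀ j < n, car σ j (j + 1) = car σ' j (j + 1)) : σ = σ' := by
  have h' : ∀ (j : ℕ) (hj : j < n), Arrow.mk (σ.map' j (j + 1)) = Arrow.mk (σ'.map' j (j + 1)) := by
    intro j hj
    have e : ∀ τ : ComposableArrows I n, car τ j (j + 1) = Arrow.mk (τ.map' j (j + 1)) := fun τ =>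
      car_of τ (a := ⟨j, by omega⟩) (b := ⟨j + 1, by omega⟩) (by simp)
        (by simp [clampFin]; omega) (by simp [clampFin]; omega)
    rw [← e, ← e, h j hj]
  have hobj : ∀ i : Fin (n + 1), σ.obj i = σ'.obj i := by
    rintro ⟨_ | k, hk⟩
    · rw [car_self, car_self] at h0
      have : clampFin n 0 = ⟨0, hk⟩ := by simp [clampFin]
      rw [this] at h0
      exact congrArg (fun f : Arrow I => f.left) h0
    · exact congrArg (fun f : Arrow I => f.right) (h' k (by omega))
  exact ComposableArrows.ext hobj fun i hi => ((Arrow.mk_eq_mk_iff _ _).1 (h' i hi)).2.2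

/-- The morphism from the `i`-th to the `j`-th object of a simplex of the nerve. -/
def ncar (τ : Tot (nerve I)) (i j : ℕ) : Arrow I := car (n := τ.dim) τ.val i j

theorem ncar_ext {τ τ' : Tot (nerve I)} (h : τ.dim = τ'.dim) (h0 : ncar τ 0 0 = ncar τ' 0 0)
    (h' : ∀ j < τ.dim, ncar τ j (j + 1) = ncar τ' j (j + 1)) : τ = τ' := by
  obtain ⟨n, σ⟩ := τ
  obtain ⟨m, σ'⟩ := τ'
  obtain rfl : n = m := h
  exact congrArg (Tot.mk n) (nerve_ext h0 h')

/-- The objects of a chain. -/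
def cob {n : ℕ} (σ : ComposableArrows I n) (i : Fin (n + 1)) : I := σ.obj i

/-- The first object. -/
def nob (τ : Tot (nerve I)) : I := cob (n := τ.dim) τ.val 0

theorem ncar_zero (τ : Tot (nerve I)) : ncar τ 0 0 = Arrow.mk (𝟙 (nob τ)) := by
  refine (car_self _ _).trans ?_
  have : clampFin τ.dim 0 = 0 := by simp [clampFin]
  rw [nob, ← this]
  rfl

/-- The first object, and the consecutive morphisms of a simplex of the nerve. -/
def ncode (τ : Tot (nerve I)) : I × List (Arrow I) :=
  (nob τ, (List.range τ.dim).map fun j => ncar τ j (j + 1))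

theorem ncode_injective : Function.Injective (ncode : Tot (nerve I) → _) := by
  intro τ τ' h
  simp only [ncode, Prod.mk.injEq] at h
  obtain ⟨h0, h⟩ := h
  have h1 := congrArg List.length h
  simp only [List.length_map, List.length_range] at h1
  refine ncar_ext h1 (by rw [ncar_zero, ncar_zero, h0]) fun j hj => ?_
  rw [← h1] at h
  exact List.map_inj_left.1 h j (by simpa using hj)

open Classical in
/-- The composition of morphisms; an arbitrary morphism if they are not composable. -/
def cmp (f g : Arrow I) : Arrow I := if h : f.right = g.left then Arrow.mk (f.hom ≫ eqToHom h ≫ g.hom) else f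

theorem cmp_mk {i j k : I} (f : i ⟶ j) (g : j ⟶ k) : cmp (Arrow.mk f) (Arrow.mk g) = Arrow.mk (f ≫ g) := by
  rw [cmp]
  refine (dif_pos (rfl : j = j)).trans ?_
  simp

theorem car_succ {n : ℕ} (σ : ComposableArrows I n) {i j : ℕ} (hi : i ≤ j) (hj : j < n) :
    car σ i (j + 1) = cmp (car σ i j) (car σ j (j + 1)) := by
  have h1 : (⟨i, by omega⟩ : Fin (n + 1)) ≤ ⟨j, by omega⟩ := hi
  have h2 : (⟨j, by omega⟩ : Fin (n + 1)) ≤ ⟨j + 1, by omega⟩ := by simp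
  rw [car_of σ (h1.trans h2) (by simp [clampFin]; omega) (by simp [clampFin]; omega),
    car_of σ h1 (by simp [clampFin]; omega) (by simp [clampFin]; omega),
    car_of σ h2 (by simp [clampFin]; omega) (by simp [clampFin]; omega), cmp_mk, ← σ.map_comp]
  rfl

/-- The identities. -/
def idA (i : I) : Arrow I := Arrow.mk (𝟙 i)

/-- The morphism of length `k` from the `i`-th object is computed from the consecutive ones. -/
theorem ncar_rec (τ : Tot (nerve I)) (i k : ℕ) :
    ncar τ i (i + k) = Nat.rec (motive := fun _ => Arrow I)
      (Nat.rec (motive := fun _ => Arrow I) (idA (nob τ))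
        (fun j g => (((ncode τ).2)[j]?).elim g fun f => idA f.right) i)
      (fun j g => (((ncode τ).2)[i + j]?).elim g fun f => cmp g f) k := by
  have hget : ∀ j, ((ncode τ).2)[j]? = if j < τ.dim then some (ncar τ j (j + 1)) else none := by
    intro j
    rw [ncode, List.getElem?_map]
    split_ifs with h
    · rw [List.getElem?_range h]; rfl
    · rw [List.getElem?_eq_none (by simpa using h)]; rfl
  induction k with
  | zero =>
    -- The inner recursion walks to the `i`-th object by taking targets. Past the end of the chain
    -- the value stays constant, in agreement with the truncation of indices in `car`.
    induction i with
    | zero => exact ncar_zero τ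
    | succ i ih =>
      simp only [hget] at ih ⊢
      split_ifs with h
      · refine (car_self _ _).trans (congrArg idA ?_)
        change _ = cob (n := τ.dim) τ.val (clampFin _ (max i (i + 1)))
        rw [max_eq_right (Nat.le_succ i)]
        rfl
      · refine Eq.trans ?_ ih
        exact car_congr _ (by omega) (by omega)
  | succ k ih =>
    simp only [hget] at ih ⊢
    split_ifs with h
    · refine (car_succ (n := τ.dim) τ.val (Nat.le_add_right i k) h).trans ?_
      exact congrArg (cmp · _) ih
    · exact Eq.trans (car_congr _ (by omega) (by omega)) ih

theorem ncar_eq (τ : Tot (nerve I)) (i j : ℕ) : ncar τ i j = ncar τ i (i + (j - i)) :=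
  car_congr _ rfl (by omega)

theorem ncar_clamp (τ : Tot (nerve I)) (i j : ℕ) : ncar τ i j = ncar τ (min i τ.dim) (min j τ.dim) :=
  car_congr _ (by omega) (by omega)

theorem ncar_map {n m : ℕ} (θ : ⦋m⦌ ⟶ ⦋n⦌) (σ : (nerve I) _⦋n⦌) (i j : ℕ) :
    ncar ⟨m, (nerve I).map θ.op σ⟩ i j = ncar ⟨n, σ⟩ (hv θ i) (hv θ j) := car_map θ σ i j

theorem ncar_face (i : ℕ) (τ : Tot (nerve I)) (j k : ℕ) :
    ncar (τ.face i) j k = if τ.dim = 0 then ncar τ j k else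
      ncar τ (if min j (τ.dim - 1) < min i τ.dim then min j (τ.dim - 1) else min j (τ.dim - 1) + 1)
        (if min k (τ.dim - 1) < min i τ.dim then min k (τ.dim - 1) else min k (τ.dim - 1) + 1) := by
  obtain ⟨_ | n, x⟩ := τ
  · rfl
  · rw [if_neg (by simp), ncar_clamp]
    refine (ncar_map (SimplexCategory.δ (clampFin (n + 1) i)) x _ _).trans ?_
    change ncar _ (hv (SimplexCategory.δ (clampFin (n + 1) i)) (min j n)) (hv (SimplexCategory.δ (clampFin (n + 1) i)) (min k n)) = _
    rw [hv_δ _ (min_le_right _ _), hv_δ _ (min_le_right _ _)]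
    rfl

theorem ncar_degen (i : ℕ) (τ : Tot (nerve I)) (j k : ℕ) :
    ncar (τ.degen i) j k =
      ncar τ (if min j (τ.dim + 1) ≤ min i τ.dim then min j (τ.dim + 1) else min j (τ.dim + 1) - 1)
        (if min k (τ.dim + 1) ≤ min i τ.dim then min k (τ.dim + 1) else min k (τ.dim + 1) - 1) := by
  obtain ⟨n, x⟩ := τ
  rw [ncar_clamp]
  refine (ncar_map (SimplexCategory.σ (clampFin n i)) x _ _).trans ?_
  change ncar _ (hv (SimplexCategory.σ (clampFin n i)) (min j (n + 1))) (hv (SimplexCategory.σ (clampFin n i)) (min k (n + 1))) = _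
  rw [hv_σ _ (min_le_right _ _), hv_σ _ (min_le_right _ _)]
  rfl

section coded

variable [Coded I] [Coded (Arrow I)] [CEq I] [CEq (Arrow I)] [Finite I] [Finite (Arrow I)]
  {X : Type*} [Coded X]

instance : Coded (Tot (nerve I)) := Coded.ofInj ncode ncode_injective

theorem cm_ncode : Cm (ncode : Tot (nerve I) → _) := Cm.id

@[fun_prop]
theorem cm_nob : Cm (nob : Tot (nerve I) → I) := cm_ncode.fst'

theorem cm_ndim : Cm fun τ : Tot (nerve I) => τ.dim :=
  (Cm.list_length cm_ncode.snd').congr fun τ => by simp [ncode]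

theorem cm_ncar : Cm fun p : Tot (nerve I) × ℕ × ℕ => ncar p.1 p.2.1 p.2.2 := by
  have hl : Cm fun τ : Tot (nerve I) => (ncode τ).2 := cm_ncode.snd'
  have h1 : Cm fun p : Tot (nerve I) × ℕ => Nat.rec (motive := fun _ => Arrow I) (idA (nob p.1))
        (fun j g => (((ncode p.1).2)[j]?).elim g fun f => idA f.right) p.2 := by
    refine Cm.nat_rec (X := Tot (nerve I) × ℕ)
      (s := fun q => (((ncode q.1.1).2)[q.2.1]?).elim q.2.2 fun f => idA f.right)
      ((Cm.of_finite idA).comp (by fun_prop)) ?_ Cm.snd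
    exact Cm.option_elim (g := fun q : ((Tot (nerve I) × ℕ) × ℕ × Arrow I) × Arrow I => idA q.2.right)
      (Cm.list_getElem? (hl.comp (by fun_prop)) (by fun_prop)) (by fun_prop)
      ((Cm.of_finite fun f : Arrow I => idA f.right).comp Cm.snd)
  have h2 : Cm fun p : Tot (nerve I) × ℕ × ℕ => Nat.rec (motive := fun _ => Arrow I)
      (Nat.rec (motive := fun _ => Arrow I) (idA (nob p.1))
        (fun j g => (((ncode p.1).2)[j]?).elim g fun f => idA f.right) p.2.1)
      (fun j g => (((ncode p.1).2)[p.2.1 + j]?).elim g fun f => cmp g f) (p.2.2 - p.2.1) := by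
    refine Cm.nat_rec (X := Tot (nerve I) × ℕ × ℕ)
      (s := fun q => (((ncode q.1.1).2)[q.1.2.1 + q.2.1]?).elim q.2.2 fun f => cmp q.2.2 f)
      (h1.comp (Cm.pair (by fun_prop) (by fun_prop))) ?_ (by fun_prop)
    exact Cm.option_elim (g := fun q : ((Tot (nerve I) × ℕ × ℕ) × ℕ × Arrow I) × Arrow I => cmp q.1.2.2 q.2)
      (Cm.list_getElem? (hl.comp (by fun_prop)) (by fun_prop)) (by fun_prop)
      ((Cm.of_finite fun f : Arrow I × Arrow I => cmp f.1 f.2).comp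
        (f := fun q : ((Tot (nerve I) × ℕ × ℕ) × ℕ × Arrow I) × Arrow I => (q.1.2.2, q.2)) (by fun_prop))
  exact h2.congr fun p => (ncar_rec _ _ _).symm.trans (ncar_eq _ _ _).symm

@[fun_prop]
theorem Cm.ncar {f : X → Tot (nerve I)} {i j : X → ℕ} (hf : Cm f) (hi : Cm i) (hj : Cm j) :
    Cm fun x => ncar (f x) (i x) (j x) :=
  cm_ncar.comp (hf.pair (hi.pair hj))

theorem Cm.nerve_of_list {f : X → Tot (nerve I)} (h0 : Cm fun x => nob (f x))
    (h : Cm fun x => (List.range (f x).dim).map fun j => EffHom.ncar (f x) j (j + 1)) : Cm f := h0.pair h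

theorem Cm.nerve {f : X → Tot (nerve I)} (h1 : Cm fun x => (f x).dim)
    (h2 : Cm fun p : X × ℕ × ℕ => EffHom.ncar (f p.1) p.2.1 p.2.2) : Cm f := by
  refine Cm.nerve_of_list ?_ ?_
  · have h3 : Cm fun x => EffHom.ncar (f x) 0 0 :=
      h2.comp (f := fun x => (x, 0, 0)) (by fun_prop)
    exact ((Cm.of_finite fun f : Arrow I => f.left).comp h3).congr fun x => by rw [ncar_zero]; rfl
  · exact Cm.list_map (f := fun p : X × ℕ => EffHom.ncar (f p.1) p.2 (p.2 + 1))
      (h2.comp (f := fun p : X × ℕ => (p.1, p.2, p.2 + 1)) (by fun_prop)) (Cm.list_range h1)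

theorem dim_face {W : SSet.{u}} (i : ℕ) (w : Tot W) : (w.face i).dim = w.dim - 1 := by
  obtain ⟨_ | n, x⟩ := w <;> rfl

instance : EffS (nerve I) where
  ceq := .of_injective cm_ncode ncode_injective
  cm_dim := cm_ndim
  cm_face := by
    classical
    have hd : Cm fun p : ℕ × Tot (nerve I) => p.2.dim := cm_ndim.comp Cm.snd
    refine Cm.nerve ((hd.nat_sub (Cm.const 1)).congr fun p => (dim_face _ _).symm) ?_
    refine Cm.congr ?_ fun p : (ℕ × Tot (nerve I)) × ℕ × ℕ => (ncar_face p.1.1 p.1.2 p.2.1 p.2.2).symm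
    have h1 : Cm fun p : (ℕ × Tot (nerve I)) × ℕ × ℕ => p.1.2.dim := hd.comp (by fun_prop)
    exact Cm.ite (CmP.eq h1 (Cm.const 0)) (by fun_prop) (Cm.ncar (by fun_prop)
      (Cm.ite (CmP.nat_lt (by fun_prop) (by fun_prop)) (by fun_prop) (by fun_prop))
      (Cm.ite (CmP.nat_lt (by fun_prop) (by fun_prop)) (by fun_prop) (by fun_prop)))
  cm_degen := by
    classical
    have hd : Cm fun p : ℕ × Tot (nerve I) => p.2.dim := cm_ndim.comp Cm.snd
    refine Cm.nerve ((hd.nat_add (Cm.const 1)).congr fun p => rfl) ?_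
    refine Cm.congr ?_ fun p : (ℕ × Tot (nerve I)) × ℕ × ℕ => (ncar_degen p.1.1 p.1.2 p.2.1 p.2.2).symm
    have h1 : Cm fun p : (ℕ × Tot (nerve I)) × ℕ × ℕ => p.1.2.dim := hd.comp (by fun_prop)
    exact Cm.ncar (by fun_prop)
      (Cm.ite (CmP.nat_le (by fun_prop) (by fun_prop)) (by fun_prop) (by fun_prop))
      (Cm.ite (CmP.nat_le (by fun_prop) (by fun_prop)) (by fun_prop) (by fun_prop))

end coded

end nerve

end

section

open Coded Finsupp CSet Tot

/-! ### Simplices of the homotopy colimit -/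

section hocolim

variable {I : Type u} [SmallCategory I] (X : I ⥤ SSet.{u})

variable {X} in
/-- The monotone map of a simplex of the disjoint union. -/
def zt {n : ℕ} (z : HocolimCell X (op ⦋n⦌)) : ⦋n⦌ ⟶ ⦋z.m⦌ := SSet.stdSimplex.objEquiv z.t

/-- The projection of the homotopy colimit to the nerve. -/
def hproj : hocolim X ⟶ nerve I where
  app n := ↾(Quot.lift (fun z : HocolimCell X n => (nerve I).map (SSet.stdSimplex.objEquiv z.t).op z.chain)
    fun _ _ h => by obtain ⟨θ, chain, t, x⟩ := h; rfl)
  naturality _ _ g := ConcreteCategory.hom_ext _ _ fun y => by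
    obtain ⟨z, rfl⟩ := Quot.exists_rep y
    rfl

variable {X}

theorem functor_comp_app {i j k : I} {f : i ⟶ j} {g : j ⟶ k} {h : i ⟶ k} (e : f ≫ g = h) {n : SimplexCategoryᵒᵖ}
    (x : (X.obj i).obj n) : (X.map g).app n ((X.map f).app n x) = (X.map h).app n x := by
  subst e
  rw [X.map_comp]
  rfl

/-- The simplex of the diagram obtained from a simplex of the disjoint union by moving it to the object
of its first vertex. -/
def zbase {n : ℕ} (z : HocolimCell X (op ⦋n⦌)) : Σ i, Tot (X.obj i) :=
  ⟨z.chain.obj ((zt z).toOrderHom 0), ⟨n,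
    (X.map (z.chain.map (homOfLE (Fin.zero_le ((zt z).toOrderHom 0))))).app _ z.x⟩⟩

/-- The gluing relation moves `x` along part of the path from `i₀` to the object of the first vertex
of the simplex; by functoriality the endpoint of the path is all that matters. -/
theorem zbase_eq {n : ℕ} {z z' : HocolimCell X (op ⦋n⦌)} (h : HocolimRel X _ z z') : zbase z = zbase z' := by
  obtain ⟨θ, chain, t, x⟩ := h
  refine congrArg (fun y => (⟨_, ⟨n, y⟩⟩ : Σ i, Tot (X.obj i))) ?_
  exact (functor_comp_app (Subsingleton.elim _ _ |> congrArg chain.map |> (chain.map_comp _ _).symm.trans) x).symm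

/-- The simplex of the diagram over the first object. -/
def hB (w : Tot (hocolim X)) : Σ i, Tot (X.obj i) :=
  Quot.lift (fun z : HocolimCell X (op ⦋w.dim⦌) => zbase z) (fun _ _ => zbase_eq) w.val

/-- The simplex of the nerve under a simplex of the homotopy colimit. -/
def hN (w : Tot (hocolim X)) : Tot (nerve I) := w.map (hproj X)

/-- The simplex given by a chain and a simplex over its first object. -/
def hcanon {n : ℕ} (σ : ComposableArrows I n) (x : (X.obj (σ.obj 0)).obj (op ⦋n⦌)) : HocolimCell X (op ⦋n⦌) :=
  ⟨n, σ, SSet.stdSimplex.objEquiv.symm (𝟙 _), x⟩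

/-- The gluing relation is used with `θ` equal to the monotone map `t` of the simplex and with the
identity simplex: `(t, x)` over a chain is identified with the identity simplex over the chain
pulled back along `t`. -/
theorem hocolimMk_canon {n : ℕ} (z : HocolimCell X (op ⦋n⦌)) :
    hocolimMk z = hocolimMk (hcanon ((nerve I).map (zt z).op z.chain) (zbase z).2.val) := by
  have h := HocolimRel.glue (X := X) (n := op ⦋n⦌) (zt z) z.chain (SSet.stdSimplex.objEquiv.symm (𝟙 _)) z.x
  refine Eq.trans (congrArg (fun t => hocolimMk (⟨z.m, z.chain, t, z.x⟩ : HocolimCell X (op ⦋n⦌))) ?_) (Quot.sound h)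
  apply SSet.stdSimplex.objEquiv.injective
  exact (Category.id_comp _).symm

/-- The canonical representative is determined by these two invariants, so no decision about the
generated equivalence relation is ever needed. -/
theorem hocolim_ext {w w' : Tot (hocolim X)} (h1 : hN w = hN w') (h2 : hB w = hB w') : w = w' := by
  obtain ⟨n, y⟩ := w
  obtain ⟨m, y'⟩ := w'
  obtain rfl : n = m := congrArg Tot.dim h1
  obtain ⟨z, rfl⟩ := Quot.exists_rep y
  obtain ⟨z', rfl⟩ := Quot.exists_rep y'
  have h1 := ext_val h1
  refine congrArg (Tot.mk n) ((hocolimMk_canon z).trans (Eq.trans ?_ (hocolimMk_canon z').symm))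
  have key : ∀ {σ σ' : ComposableArrows I n} (x : (X.obj (σ.obj 0)).obj (op ⦋n⦌))
      (x' : (X.obj (σ'.obj 0)).obj (op ⦋n⦌)), σ = σ' →
      (⟨σ.obj 0, ⟨n, x⟩⟩ : Σ i, Tot (X.obj i)) = ⟨σ'.obj 0, ⟨n, x'⟩⟩ → hcanon σ x = hcanon σ' x' := by
    rintro σ σ' x x' rfl h
    rw [Sigma.mk.injEq] at h
    rw [ext_val (eq_of_heq h.2)]
  exact congrArg hocolimMk (key _ _ h1 h2)

open Classical in
variable (X) in
/-- The image of a simplex of the diagram under a morphism; the simplex itself if it does not lie over the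
source of the morphism. -/
def push (f : Arrow I) (s : Σ i, Tot (X.obj i)) : Σ i, Tot (X.obj i) :=
  if h : s.1 = f.left then ⟨f.right, (tr (fun i => Tot (X.obj i)) h s.2).map (X.map f.hom)⟩ else s

theorem push_mk {i j : I} (f : i ⟶ j) (w : Tot (X.obj i)) :
    push X (Arrow.mk f) ⟨i, w⟩ = ⟨j, w.map (X.map f)⟩ := by
  rw [push]
  exact dif_pos (rfl : i = i)

theorem push_of_ne {f : Arrow I} {s : Σ i, Tot (X.obj i)} (h : s.1 ≠ f.left) : push X f s = s := dif_neg h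

theorem push_id (i : I) (w : Tot (X.obj i)) : push X (Arrow.mk (𝟙 i)) ⟨i, w⟩ = ⟨i, w⟩ := by
  rw [push_mk, X.map_id]
  rfl

theorem car_zero {n : ℕ} (σ : ComposableArrows I n) (j : Fin (n + 1)) :
    car σ 0 j = Arrow.mk (σ.map (homOfLE (Fin.zero_le j))) :=
  car_of σ _ (by simp [clampFin]) (by rw [Nat.zero_max, clampFin_val])

theorem zbase_eq_push {n : ℕ} (z : HocolimCell X (op ⦋n⦌)) :
    zbase z = push X (car z.chain 0 (hv (zt z) 0)) ⟨z.chain.obj 0, ⟨n, z.x⟩⟩ := by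
  have : hv (zt z) 0 = ((zt z).toOrderHom 0).val := hv_fin (zt z) 0
  rw [this, car_zero, push_mk]
  rfl

/-- A simplicial operator may change the first vertex; the simplex over it then has to be moved by
the morphism from the old first object to the new one. -/
theorem zbase_map {n m : ℕ} (θ : ⦋m⦌ ⟶ ⦋n⦌) (z : HocolimCell X (op ⦋n⦌)) :
    zbase (z.map θ.op) = push X (ncar (hN ⟨n, hocolimMk z⟩) 0 (hv θ 0))
      ⟨(hB ⟨n, hocolimMk z⟩).1, ⟨m, (X.obj (zbase z).1).map θ.op (zbase z).2.val⟩⟩ := by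
  have h0 : hv θ 0 = (θ.toOrderHom 0).val := hv_fin θ 0
  have h1 : ncar (hN ⟨n, hocolimMk z⟩) 0 (hv θ 0) = Arrow.mk (z.chain.map
      (homOfLE ((zt z).toOrderHom.monotone (Fin.zero_le (θ.toOrderHom 0))))) := by
    rw [h0]
    exact car_zero (n := n) ((nerve I).map (zt z).op z.chain) (θ.toOrderHom 0)
  rw [h1]
  refine Eq.trans ?_ (push_mk (X := X) (z.chain.map
      (homOfLE ((zt z).toOrderHom.monotone (Fin.zero_le (θ.toOrderHom 0))))) _).symm
  refine congrArg (fun y => (⟨_, ⟨m, y⟩⟩ : Σ i, Tot (X.obj i))) ?_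
  have h2 := ConcreteCategory.congr_hom ((X.map (z.chain.map (homOfLE (Fin.zero_le ((zt z).toOrderHom 0))))).naturality θ.op) z.x
  refine Eq.trans ?_ (congrArg _ h2)
  exact (functor_comp_app (Subsingleton.elim _ _ |> congrArg z.chain.map |> (z.chain.map_comp _ _).symm.trans) _).symm

theorem hN_face (i : ℕ) (w : Tot (hocolim X)) : hN (w.face i) = (hN w).face i := by
  obtain ⟨_ | n, y⟩ := w
  · rfl
  · obtain ⟨z, rfl⟩ := Quot.exists_rep y
    rfl

theorem hN_degen (i : ℕ) (w : Tot (hocolim X)) : hN (w.degen i) = (hN w).degen i := by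
  obtain ⟨n, y⟩ := w
  obtain ⟨z, rfl⟩ := Quot.exists_rep y
  rfl

/-- Only the zeroth face changes the first vertex; all other faces are taken in the diagram without
moving. -/
theorem hB_face (i : ℕ) (w : Tot (hocolim X)) : hB (w.face i) = if w.dim = 0 then hB w else
    push X (ncar (hN w) 0 (if i = 0 then 1 else 0)) ⟨(hB w).1, (hB w).2.face i⟩ := by
  obtain ⟨_ | n, y⟩ := w
  · rfl
  · obtain ⟨z, rfl⟩ := Quot.exists_rep y
    rw [if_neg (by simp)]
    refine (zbase_map (SimplexCategory.δ (clampFin (n + 1) i)) z).trans ?_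
    have : hv (SimplexCategory.δ (clampFin (n + 1) i)) 0 = if i = 0 then 1 else 0 := by
      rw [hv_δ _ (Nat.zero_le _)]
      by_cases h : i = 0
      · simp [h, clampFin]
      · rw [if_neg h, if_pos]
        change 0 < min i (n + 1)
        omega
    rw [this]
    rfl

theorem hB_degen (i : ℕ) (w : Tot (hocolim X)) : hB (w.degen i) = ⟨(hB w).1, (hB w).2.degen i⟩ := by
  obtain ⟨n, y⟩ := w
  obtain ⟨z, rfl⟩ := Quot.exists_rep y
  refine (zbase_map (SimplexCategory.σ (clampFin n i)) z).trans ?_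
  rw [hv_σ _ (Nat.zero_le _), if_pos (Nat.zero_le _), ncar_zero]
  exact push_id _ _

section coded

variable [Coded I] [Coded (Arrow I)] [CEq I] [CEq (Arrow I)] [Finite I] [Finite (Arrow I)]
  [∀ i, EffS (X.obj i)] {A : Type*} [Coded A]

variable (X) in
/-- The morphisms of a diagram act by algorithms. -/
class EffD : Prop where
  cm_map : ∀ {i j : I} (f : i ⟶ j), Cm fun w : Tot (X.obj i) => w.map (X.map f)

/-- There are finitely many pairs of an object and a morphism, and each morphism has its own
algorithm. -/
theorem cm_push [EffD X] : Cm fun p : (Σ i, Tot (X.obj i)) × Arrow I => push X p.2 p.1 := by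
  refine Cm.sigma_finite_prod (F := fun i => Tot (X.obj i)) (f := fun i p => push X p.2 ⟨i, p.1⟩) fun i => ?_
  refine Cm.glue (c := fun p : Tot (X.obj i) × Arrow I => p.2) Cm.snd fun f => ?_
  by_cases h : i = f.left
  · subst h
    refine (Cm.sigma_mk_const (F := fun i => Tot (X.obj i)) f.right
      ((EffD.cm_map f.hom).comp (Cm.fst.comp Cm.val))).congr ?_
    rintro ⟨⟨w, f'⟩, h'⟩
    obtain rfl : f' = f := h'
    exact (push_mk f'.hom w).symm
  · refine (Cm.sigma_mk_const (F := fun i => Tot (X.obj i)) i (Cm.fst.comp Cm.val)).congr ?_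
    rintro ⟨⟨w, f'⟩, h'⟩
    obtain rfl : f' = f := h'
    exact (push_of_ne h).symm

@[fun_prop]
theorem Cm.push [EffD X] {f : A → Arrow I} {s : A → Σ i, Tot (X.obj i)} (hf : Cm f) (hs : Cm s) :
    Cm fun x => push X (f x) (s x) := cm_push.comp (hs.pair hf)

theorem hcode_injective : Function.Injective fun w : Tot (hocolim X) => (hN w, hB w) := fun w w' h => by
  simp only [Prod.mk.injEq] at h
  exact hocolim_ext h.1 h.2

instance : Coded (Tot (hocolim X)) := Coded.ofInj _ hcode_injective

theorem cm_hcode : Cm fun w : Tot (hocolim X) => (hN w, hB w) := Cm.id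

@[fun_prop]
theorem cm_hN : Cm (hN : Tot (hocolim X) → Tot (nerve I)) := cm_hcode.fst'

@[fun_prop]
theorem cm_hB : Cm (hB : Tot (hocolim X) → Σ i, Tot (X.obj i)) := cm_hcode.snd'

theorem Cm.hocolim {f : A → Tot (hocolim X)} (h1 : Cm fun x => hN (f x)) (h2 : Cm fun x => hB (f x)) : Cm f :=
  h1.pair h2

theorem cm_hdim : Cm fun w : Tot (hocolim X) => w.dim := (EffS.cm_dim (W := nerve I)).comp cm_hN

instance [EffD X] : EffS (hocolim X) where
  ceq := .of_injective cm_hcode hcode_injective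
  cm_dim := cm_hdim
  cm_face := by
    classical
    refine Cm.hocolim ((Cm.face Cm.fst (cm_hN.comp Cm.snd)).congr fun p => (hN_face _ _).symm)
      (Cm.congr ?_ fun p => (hB_face p.1 p.2).symm)
    refine Cm.ite (CmP.eq (cm_hdim.comp Cm.snd) (Cm.const 0)) (by fun_prop) (Cm.push ?_ ?_)
    · exact Cm.ncar (by fun_prop) (by fun_prop) (Cm.ite (CmP.eq (by fun_prop) (by fun_prop)) (by fun_prop) (by fun_prop))
    · exact (Cm.sigma_finite_prod (F := fun i => Tot (X.obj i)) (X := ℕ) (f := fun i p => (⟨i, p.1.face p.2⟩ : Σ i, Tot (X.obj i)))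
        fun i => Cm.sigma_mk_const (F := fun i => Tot (X.obj i)) i (by fun_prop)).comp (f := fun p : ℕ × Tot (hocolim X) => (hB p.2, p.1)) (by fun_prop)
  cm_degen := by
    refine Cm.hocolim ((Cm.degen Cm.fst (cm_hN.comp Cm.snd)).congr fun p => (hN_degen _ _).symm)
      (Cm.congr ?_ fun p => (hB_degen p.1 p.2).symm)
    exact (Cm.sigma_finite_prod (F := fun i => Tot (X.obj i)) (X := ℕ) (f := fun i p => (⟨i, p.1.degen p.2⟩ : Σ i, Tot (X.obj i)))
      fun i => Cm.sigma_mk_const (F := fun i => Tot (X.obj i)) i (by fun_prop)).comp (f := fun p : ℕ × Tot (hocolim X) => (hB p.2, p.1)) (by fun_prop)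

end coded

end hocolim

end

/-! ### Strata of the homotopy colimit over nondegenerate chains -/

section

open Coded Finsupp CSet Tot

/-! ### Decomposition of the simplices of the homotopy colimit -/

section

variable {I : Type u} [SmallCategory I] {X : I ⥤ SSet.{u}}

/-- The objects of a simplex of the nerve. -/
def nobj (τ : Tot (nerve I)) (j : ℕ) : I := cob (n := τ.dim) τ.val (clampFin τ.dim j)

theorem ncar_self (τ : Tot (nerve I)) (j : ℕ) : ncar τ j j = idA (nobj τ j) := car_self _ _

theorem ncar_right (τ : Tot (nerve I)) {j k : ℕ} (h : j ≤ k) : (ncar τ j k).right = nobj τ k := by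
  change cob (n := τ.dim) τ.val (clampFin _ (max j k)) = _
  rw [max_eq_right h]
  rfl

theorem cmp_idA (f : Arrow I) {i : I} (h : f.right = i) : cmp f (idA i) = f := by
  subst h
  refine (cmp_mk f.hom (𝟙 f.right)).trans (congrArg Arrow.mk ?_)
  exact Category.comp_id _

/-- The monotone map which truncates the values. -/
def clampMap (p q : ℕ) : ⦋p⦌ ⟶ ⦋q⦌ :=
  homMk p q (fun j => min j q) (fun _ _ h _ => min_le_min_right _ h) (min_le_right _ _)

theorem hv_clampMap {n p : ℕ} (t : ⦋n⦌ ⟶ ⦋p⦌) (q j : ℕ) : hv (t ≫ clampMap p q) j = min (hv t j) q := by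
  rw [hv_comp]
  exact hv_homMk _ _ (hv_le _ _)

/-- If the `k`-th morphism were an identity, deleting the `k`-th object and duplicating its
neighbour would give back the chain, so the chain would be degenerate. -/
theorem nD_not_id {τ : Tot (nerve I)} (h : τ.ND) {k : ℕ} (hk : k < τ.dim) (i : I) :
    ncar τ k (k + 1) ≠ idA i := by
  intro hi
  obtain ⟨_ | n, σ⟩ := τ
  · exact absurd hk (Nat.not_lt_zero _)
  refine (not_nD_iff σ).2 ⟨⟨k, hk⟩, ?_⟩ h
  have hl' : nobj ⟨n + 1, σ⟩ k = i := congrArg (fun f : Arrow I => f.left) hi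
  have hl : ncar ⟨n + 1, σ⟩ k k = idA i := by rw [ncar_self, hl']
  have hr : ncar ⟨n + 1, σ⟩ (k + 1) (k + 1) = idA i := by
    rw [ncar_self, ← ncar_right _ (Nat.le_succ k), hi]
    rfl
  have e : ∀ j j', ncar ⟨n + 1, (nerve I).σ ⟨k, hk⟩ ((nerve I).δ (Fin.castSucc ⟨k, hk⟩) σ)⟩ j j' =
      ncar ⟨n + 1, σ⟩ (if min j (n + 1) = k then k + 1 else min j (n + 1))
        (if min j' (n + 1) = k then k + 1 else min j' (n + 1)) := by
    have e0 : ∀ j, j ≤ n + 1 → hv (SimplexCategory.δ (Fin.castSucc (⟨k, hk⟩ : Fin (n + 1)))) (hv (SimplexCategory.σ (⟨k, hk⟩ : Fin (n + 1))) j) =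
        if j = k then k + 1 else j := by
      intro j hj
      rw [hv_σ _ hj, hv_δ _ (by split_ifs <;> omega)]
      simp only [Fin.val_castSucc]
      split_ifs <;> omega
    intro j j'
    rw [ncar_clamp]
    refine (ncar_map (SimplexCategory.σ ⟨k, hk⟩) _ _ _).trans ((ncar_map (SimplexCategory.δ (Fin.castSucc ⟨k, hk⟩)) σ _ _).trans ?_)
    rw [e0 _ (min_le_right _ _), e0 _ (min_le_right _ _)]
  refine ext_val (W := nerve I) (ncar_ext rfl ?_ fun j hj => ?_)
  · rw [e]
    by_cases h0 : 0 = k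
    · subst h0
      rw [if_pos (by simp), hl, hr]
    · rw [if_neg (by simpa using h0)]
      rfl
  · change j < n + 1 at hj
    rw [e, min_eq_left (by omega : j ≤ n + 1), min_eq_left (by omega : j + 1 ≤ n + 1)]
    by_cases h1 : j = k
    · subst h1
      rw [if_pos rfl, if_neg (by omega), hr, hi]
    · rw [if_neg h1]
      split_ifs with h2
      · have h3 : ncar ⟨n + 1, σ⟩ j (k + 1) = cmp (ncar ⟨n + 1, σ⟩ j k) (ncar ⟨n + 1, σ⟩ k (k + 1)) :=
          car_succ _ (by omega) hk
        rw [h3, h2, hi, cmp_idA _ ((ncar_right _ (by omega)).trans hl')]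
      · rfl

open Classical in
/-- The number of morphisms different from identities before the `j`-th object. -/
def cnt (σ : Tot (nerve I)) (j : ℕ) : ℕ :=
  Nat.rec 0 (fun k c => if ∃ i, ncar σ k (k + 1) = idA i then c else c + 1) j

theorem cnt_zero (σ : Tot (nerve I)) : cnt σ 0 = 0 := rfl

theorem cnt_succ_of_id {σ : Tot (nerve I)} {j : ℕ} {i : I} (h : ncar σ j (j + 1) = idA i) :
    cnt σ (j + 1) = cnt σ j := if_pos ⟨i, h⟩

theorem cnt_succ_of_not_id {σ : Tot (nerve I)} {j : ℕ} (h : ∀ i, ncar σ j (j + 1) ≠ idA i) :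
    cnt σ (j + 1) = cnt σ j + 1 := if_neg fun ⟨i, hi⟩ => h i hi

theorem cnt_succ (σ : Tot (nerve I)) (j : ℕ) : cnt σ (j + 1) = cnt σ j ∨ cnt σ (j + 1) = cnt σ j + 1 := by
  by_cases h : ∃ i, ncar σ j (j + 1) = idA i
  · exact Or.inl (cnt_succ_of_id h.choose_spec)
  · exact Or.inr (cnt_succ_of_not_id fun i hi => h ⟨i, hi⟩)

theorem exists_cnt (σ : Tot (nerve I)) (n : ℕ) : ∀ v ≤ cnt σ n, ∃ j ≤ n, cnt σ j = v := by
  induction n with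
  | zero => exact fun v hv => ⟨0, le_rfl, (Nat.le_zero.1 hv).symm⟩
  | succ n ih =>
    intro v hv
    by_cases h : v ≤ cnt σ n
    · obtain ⟨j, h1, h2⟩ := ih v h
      exact ⟨j, by omega, h2⟩
    · exact ⟨n + 1, le_rfl, by have := cnt_succ σ n; omega⟩

/-- The simplices of the homotopy colimit over a chain. -/
def cmap (τ : Tot (nerve I)) : gw (X.obj (nob τ)) ⟶ hocolim X where
  -- The truncation of vertices gives the formula a meaning for every `p`, so that one map is
  -- defined on all of `gw`. It is the identity for `p = τ.dim`, the only case used to decompose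
  -- simplices.
  app _ := ↾fun x => Quot.mk _ ⟨τ.dim, τ.val, SSet.stdSimplex.objEquiv.symm
    (GS.t x ≫ clampMap (GS.p x) τ.dim),
    GS.y x⟩
  naturality _ _ _ := ConcreteCategory.hom_ext _ _ fun _ => rfl

theorem ncar_cmap (τ : Tot (nerve I)) (w : Tot (gw (X.obj (nob τ)))) (i j : ℕ) :
    ncar (hN (w.map (cmap τ))) i j = ncar τ (tv w i) (tv w j) := by
  refine (ncar_map _ τ.val i j).trans ?_
  refine Eq.trans ?_ (ncar_clamp τ (tv w i) (tv w j)).symm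
  exact congrArg₂ (ncar τ) (hv_clampMap _ _ _) (hv_clampMap _ _ _)

theorem hB_cmap (τ : Tot (nerve I)) (w : Tot (gw (X.obj (nob τ)))) :
    hB (w.map (cmap τ)) = push X (ncar τ 0 (tv w 0)) ⟨nob τ, ty w⟩ := by
  refine (zbase_eq_push _).trans ?_
  refine congrArg (fun f => push X f ⟨nob τ, ty w⟩) ?_
  refine Eq.trans (congrArg (ncar τ 0) (hv_clampMap _ _ _)) ?_
  rw [ncar_clamp τ 0 (tv w 0), ncar_clamp τ 0 (min _ _), min_assoc, min_self]
  rfl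

/-- A step which repeats a vertex contributes an identity, so morphisms other than identities are
counted only where the vertex increases. -/
theorem cnt_cmap_le (τ : Tot (nerve I)) (w : Tot (gw (X.obj (nob τ)))) {j k : ℕ} (h : k ≤ j) :
    cnt (hN (w.map (cmap τ))) j + tv w k ≤ cnt (hN (w.map (cmap τ))) k + tv w j := by
  induction j, h using Nat.le_induction with
  | base => exact le_rfl
  | succ j h ih =>
    have h1 := tv_mono w (show j ≤ j + 1 by omega)
    by_cases h2 : tv w j = tv w (j + 1)
    · have : ncar (hN (w.map (cmap τ))) j (j + 1) = idA (nobj τ (tv w j)) := by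
        rw [ncar_cmap, ← h2]
        exact ncar_self _ _
      rw [cnt_succ_of_id this]
      omega
    · have := cnt_succ (hN (w.map (cmap τ))) j
      omega

/-- Simplices over nondegenerate chains, which hit all vertices. -/
structure Adm (τ : Tot (nerve I)) (w : Tot (gw (X.obj (nob τ)))) : Prop where
  nd : τ.ND
  tp_eq : tp w = τ.dim
  hits : ∀ v ≤ τ.dim, ∃ j, tv w j = v

/-- The count of nonidentities takes all intermediate values, and the bounds from both sides force
the vertices to equal the count when the total is as large as possible. -/
theorem hits_of_cnt {τ : Tot (nerve I)} {w : Tot (gw (X.obj (nob τ)))} (hp : tp w = τ.dim)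
    (h : τ.dim ≤ cnt (hN (w.map (cmap τ))) w.dim) : ∀ v ≤ τ.dim, ∃ j, tv w j = v := by
  intro v hv
  obtain ⟨j, hj, h1⟩ := exists_cnt _ _ v (hv.trans h)
  refine ⟨j, ?_⟩
  have h2 := cnt_cmap_le τ w hj
  have h3 := cnt_cmap_le τ w (Nat.zero_le j)
  rw [cnt_zero] at h3
  have h4 := tv_le w w.dim
  omega

/-- When all vertices are hit, each step raises the vertex by zero or one, giving an identity or, by
nondegeneracy of the chain, a nonidentity. So the vertices can be recovered from the image in the
nerve by counting nonidentities. -/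
theorem Adm.tv_eq {τ : Tot (nerve I)} {w : Tot (gw (X.obj (nob τ)))} (h : Adm τ w) {j : ℕ} (hj : j ≤ w.dim) :
    tv w j = cnt (hN (w.map (cmap τ))) j := by
  induction j with
  | zero =>
    obtain ⟨j, hj⟩ := h.hits 0 (Nat.zero_le _)
    have := tv_mono w (Nat.zero_le j)
    rw [cnt_zero]
    omega
  | succ j ih =>
    have ih := ih (by omega)
    have h1 := tv_mono w (show j ≤ j + 1 by omega)
    have h2 : tv w (j + 1) ≤ τ.dim := h.tp_eq ▸ tv_le w _
    by_cases h3 : tv w j = tv w (j + 1)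
    · have : ncar (hN (w.map (cmap τ))) j (j + 1) = idA (nobj τ (tv w j)) := by
        rw [ncar_cmap, ← h3]
        exact ncar_self _ _
      rw [cnt_succ_of_id this, ← ih, h3]
    · have h4 : tv w (j + 1) = tv w j + 1 := by
        obtain ⟨k, hk⟩ := h.hits (tv w j + 1) (by omega)
        rcases le_total k j with h5 | h5
        · have := tv_mono w h5
          omega
        · rcases Nat.eq_or_lt_of_le h5 with h6 | h6
          · subst h6; omega
          · have := tv_mono w (show j + 1 ≤ k from h6)
            omega
      rw [cnt_succ_of_not_id, ← ih, h4]
      intro i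
      rw [ncar_cmap, h4]
      exact nD_not_id h.nd (by omega) i

theorem Adm.tv_eq' {τ : Tot (nerve I)} {w : Tot (gw (X.obj (nob τ)))} (h : Adm τ w) (j : ℕ) :
    tv w j = cnt (hN (w.map (cmap τ))) (min j w.dim) := by
  rw [← tv_clamp, h.tv_eq (min_le_right _ _)]

theorem Adm.dim_eq {τ : Tot (nerve I)} {w : Tot (gw (X.obj (nob τ)))} (h : Adm τ w) :
    τ.dim = cnt (hN (w.map (cmap τ))) w.dim := by
  obtain ⟨j, hj⟩ := h.hits τ.dim le_rfl
  rw [← h.tv_eq le_rfl]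
  refine le_antisymm ?_ (h.tp_eq ▸ tv_le _ _)
  rw [← hj, ← tv_clamp]
  exact tv_mono w (min_le_right _ _)

theorem Adm.hB_eq {τ : Tot (nerve I)} {w : Tot (gw (X.obj (nob τ)))} (h : Adm τ w) :
    hB (w.map (cmap τ)) = ⟨nob τ, ty w⟩ := by
  rw [hB_cmap, h.tv_eq (Nat.zero_le _), cnt_zero, ncar_zero, push_id]

/-- The vertices are recovered by counting, the chain by reading its morphisms at positions where
given vertices occur, and the simplex of the diagram because the first vertex is zero and nothing
has been moved. -/
theorem Adm.injective {τ τ' : Tot (nerve I)} {w : Tot (gw (X.obj (nob τ)))} {w' : Tot (gw (X.obj (nob τ')))}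
    (h : Adm τ w) (h' : Adm τ' w') (e : w.map (cmap τ) = w'.map (cmap τ')) :
    (⟨τ, w⟩ : Σ τ : Tot (nerve I), Tot (gw (X.obj (nob τ)))) = ⟨τ', w'⟩ := by
  have hd : w.dim = w'.dim := congrArg Tot.dim e
  have hp : τ.dim = τ'.dim := by rw [h.dim_eq, h'.dim_eq, e, hd]
  have hv : ∀ j, tv w j = tv w' j := fun j => by rw [h.tv_eq', h'.tv_eq', e, hd]
  have hc : ∀ k k', k ≤ τ.dim → k' ≤ τ.dim → ncar τ k k' = ncar τ' k k' := by
    intro k k' hk hk'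
    obtain ⟨j, hj⟩ := h.hits k hk
    obtain ⟨j', hj'⟩ := h.hits k' hk'
    have h1 := ncar_cmap τ w j j'
    rw [e, ncar_cmap, ← hv, ← hv, hj, hj'] at h1
    exact h1.symm
  obtain rfl : τ = τ' := ncar_ext hp (hc _ _ (Nat.zero_le _) (Nat.zero_le _))
    fun j hj => hc _ _ hj.le hj
  have h2 := h.hB_eq
  rw [e, h'.hB_eq] at h2
  have h3 : ty w' = ty w := eq_of_heq (Sigma.mk.inj h2).2
  rw [gw_ext (w := w) (w' := w') (h.tp_eq.trans h'.tp_eq.symm) (fun j _ => hv j) h3.symm]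

theorem hB_fst (w : Tot (hocolim X)) : (hB w).1 = nob (hN w) := by
  obtain ⟨n, y⟩ := w
  obtain ⟨z, rfl⟩ := Quot.exists_rep y
  rfl

theorem hB_dim (w : Tot (hocolim X)) : (hB w).2.dim = w.dim := by
  obtain ⟨n, y⟩ := w
  obtain ⟨z, rfl⟩ := Quot.exists_rep y
  rfl

/-- The nerve simplex is a degeneracy of a nondegenerate chain along a surjective monotone map; this
map is the simplex of the standard simplex. Being surjective, it sends the first vertex to zero, so
the simplex of the diagram lies over the first object of the chain. -/
theorem exists_adm (w : Tot (hocolim X)) : ∃ (τ : Tot (nerve I)) (w' : Tot (gw (X.obj (nob τ)))),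
    Adm τ w' ∧ w'.map (cmap τ) = w := by
  obtain ⟨m, f, hf, y, hy⟩ := (nerve I).exists_nonDegenerate (hN w).val
  have hs : Function.Surjective f.toOrderHom := SimplexCategory.epi_iff_surjective.1 hf
  have h0 : f.toOrderHom 0 = 0 := by
    obtain ⟨j, hj⟩ := hs 0
    exact le_antisymm (hj ▸ f.toOrderHom.monotone (Fin.zero_le j)) (Fin.zero_le _)
  have hN' : hN w = ⟨w.dim, (nerve I).map f.op y.1⟩ := by
    rw [← hy]; rfl
  have hob : (hB w).1 = nob ⟨m, y.1⟩ := by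
    rw [hB_fst, hN']
    change cob (n := m) y.1 (f.toOrderHom 0) = _
    rw [h0]
    rfl
  obtain ⟨x, hx⟩ : ∃ x : (X.obj (nob ⟨m, y.1⟩)) _⦋w.dim⦌,
      hB w = ⟨nob ⟨m, y.1⟩, ⟨w.dim, x⟩⟩ := by
    have hd := hB_dim w
    generalize hB w = s at hob hd
    obtain ⟨i, n, x⟩ := s
    obtain rfl : i = _ := hob
    obtain rfl : n = _ := hd
    exact ⟨x, rfl⟩
  have hA : Adm (X := X) ⟨m, y.1⟩ ⟨w.dim, ⟨m, f, x⟩⟩ := by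
    refine ⟨y.2, rfl, fun v hv => ?_⟩
    obtain ⟨j, hj⟩ := hs ⟨v, Nat.lt_succ_of_le hv⟩
    exact ⟨j, (hv_fin f j).trans (by rw [hj])⟩
  refine ⟨⟨m, y.1⟩, ⟨w.dim, ⟨m, f, x⟩⟩, hA, hocolim_ext ?_ ?_⟩
  · have e : ∀ j j', ncar (hN (Tot.map (cmap (X := X) ⟨m, y.1⟩) ⟨w.dim, ⟨m, f, x⟩⟩)) j j' = ncar (hN w) j j' := by
      intro j j'
      rw [ncar_cmap, hN']
      exact (ncar_map f y.1 j j').symm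
    exact ncar_ext rfl (e _ _) fun j _ => e _ _
  · rw [hA.hB_eq, hx]
    rfl

theorem Adm.nD_iff {τ : Tot (nerve I)} {w : Tot (gw (X.obj (nob τ)))} (h : Adm τ w) :
    (w.map (cmap τ)).ND ↔ w.ND := by
  refine ⟨fun h1 => by_contra fun h2 => not_nD_map (cmap τ) h2 h1, fun h1 => by_contra fun h2 => ?_⟩
  obtain ⟨m, hm, i, y, hy⟩ := exists_σ (W := hocolim X) h2
  obtain ⟨τ', w', h', e⟩ := exists_adm ⟨m, y⟩
  obtain ⟨d, x⟩ := w'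
  obtain rfl : d = m := congrArg Tot.dim e
  have e' := ext_val e
  -- If the image is degenerate, say `s_i y`, the decomposition of `y` can be degenerated by `s_i`:
  -- repeating a vertex keeps all vertices hit. Uniqueness of decompositions then makes the given
  -- simplex degenerate.
  have h3 : Adm τ' (⟨d + 1, (gw (X.obj (nob τ'))).σ i x⟩ : Tot (gw (X.obj (nob τ')))) := by
    refine ⟨h'.nd, h'.tp_eq, fun v hv => ?_⟩
    obtain ⟨j, hj⟩ := h'.hits v hv
    rw [← tv_clamp] at hj
    change tv _ (min j d) = v at hj
    refine ⟨if min j d ≤ i then min j d else min j d + 1, ?_⟩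
    change EffHom.hv (SimplexCategory.σ i ≫ GS.t x) _ = _
    rw [hv_comp, hv_σ _ (by split_ifs <;> omega)]
    change tv ⟨d, x⟩ _ = _
    rw [← hj]
    congr 1
    split_ifs <;> omega
  have h4 := h.injective h3 (by
    refine hy.trans (congrArg (Tot.mk (d + 1)) ?_)
    rw [← e']
    exact (ConcreteCategory.congr_hom (SimplicialObject.σ_naturality (cmap τ') i) x).symm)
  obtain rfl : τ = τ' := congrArg Sigma.fst h4
  obtain rfl := eq_of_heq (Sigma.mk.inj h4).2
  exact not_nD_σ i x h1

end

end

section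

open Coded Finsupp CSet Tot

/-! ### Computable isomorphisms -/

section equiv

/-- The map of chains induced by a bijection of bases. -/
def reV {A B : Type*} (φ : A ≃ B) : V A →ₗ[ℤ] V B :=
  ((Finsupp.domLCongr φ : V A ≃ₗ[ℤ] V B) : V A →ₗ[ℤ] V B)

theorem reV_single {A B : Type*} (φ : A ≃ B) (a : A) (z : ℤ) : reV φ (single a z) = single (φ a) z :=
  Finsupp.domLCongr_single _ _ _

theorem reV_symm_reV {A B : Type*} (φ : A ≃ B) (v : V A) : reV φ.symm (reV φ v) = v := by
  ext b
  exact congrArg v (φ.symm_apply_apply b)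

theorem reV_reV_symm {A B : Type*} (φ : A ≃ B) (v : V B) : reV φ (reV φ.symm v) = v := by
  ext b
  exact congrArg v (φ.apply_symm_apply b)

theorem good_reV {A B : Type*} [CSet A] [CSet B] (φ : A ≃ B) (h : Cm φ) (hd : ∀ a, deg (φ a) = deg a) :
    Good False 0 (reV φ) where
  cm := Cm.linear ((Cm.v_single (b := φ) (z := fun _ => 1) h (Cm.const 1)).congr fun a =>
    (reV_single φ a 1).symm)
  spt a b hab := by
    rw [reV_single, single_apply_ne_zero] at hab
    obtain ⟨rfl, _⟩ := hab
    exact ⟨by rw [hd]; simp, False.elim⟩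

variable {C D : Cx.{u} False}

/-- Complexes with isomorphic bases and the same differentials are equivalent. -/
def HEq.ofEquiv (φ : C.B ≃ D.B) (h : Cm φ) (h' : Cm φ.symm) (hd : ∀ a, deg (φ a) = deg a)
    (hc : ∀ v, reV φ (C.d v) = D.d (reV φ v)) : HEq C D where
  f := reV φ
  g := reV φ.symm
  h := 0
  k := 0
  f_d := hc
  g_d v := by
    have := hc (reV φ.symm v)
    rw [reV_reV_symm] at this
    rw [← this, reV_symm_reV]
  hty_h v := by
    rw [LinearMap.zero_apply, LinearMap.zero_apply, map_zero, add_zero, reV_symm_reV, sub_self]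
  hty_k v := by
    rw [LinearMap.zero_apply, LinearMap.zero_apply, map_zero, add_zero, reV_reV_symm, sub_self]
  good_f := good_reV φ h hd
  good_g := good_reV φ.symm h' fun a => by rw [← hd, φ.apply_symm_apply]
  good_h := Good.zero
  good_k := Good.zero

end equiv

/-- A complex with a filtration, whose associated graded complex is `C`, is equivalent to a perturbation of
any complex which is equivalent to `C`. -/
theorem HEq.of_filtered {C D : Cx.{u} True} (e : HEq C D) (E : Cx.{u} False) (φ : C.B ≃ E.B) (h : Cm φ)
    (h' : Cm φ.symm) (hd : ∀ a, deg (φ a) = deg a)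
    (hl : ∀ a b, E.d (single (φ a) 1) (φ b) ≠ C.d (single a 1) b → lab b < lab a) :
    ∃ (δ : V D.B →ₗ[ℤ] V D.B) (h : ∀ v, D.d (δ v) + δ (D.d v) + δ (δ v) = 0) (g : Good False (-1) δ),
      Nonempty (HEq E (D.pert δ h g)) := by
  -- The perturbation is the difference between the true differential, carried over to the basis of
  -- the graded complex, and the graded one; `hl` says precisely that it lowers labels.
  let δ : V C.B →ₗ[ℤ] V C.B := reV φ.symm ∘ₗ E.d ∘ₗ reV φ - C.d
  have hδ : ∀ v, δ v = reV φ.symm (E.d (reV φ v)) - C.d v := fun v => rfl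
  have h1 : ∀ v, C.d (δ v) + δ (C.d v) + δ (δ v) = 0 := by
    intro v
    have h2 : ∀ v, C.d v + δ v = reV φ.symm (E.d (reV φ v)) := fun v => by rw [hδ]; abel
    have h3 : C.d (C.d v) = 0 := C.d_d v
    have h4 : C.d (C.d v + δ v) + δ (C.d v + δ v) = 0 := by
      rw [h2, h2, reV_reV_symm, E.d_d, map_zero]
    rw [map_add, map_add, h3] at h4
    rw [← h4]
    abel
  have g : Good False (-1) δ := by
    refine Good.sub (Good.comp (k := 0) (l := -1) ?_ (Good.comp (k := -1) (l := 0) E.good ?_ rfl) rfl) C.good.weaken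
    · exact good_reV φ.symm h' fun a => by rw [← hd, φ.apply_symm_apply]
    · exact good_reV φ h hd
  obtain ⟨M, δ', h2, g', ⟨r⟩, ⟨r'⟩⟩ := e.perturbation δ h1 g (fun a b hab => hl a b fun h0 => hab (by
    rw [hδ, Finsupp.sub_apply, sub_eq_zero, ← h0, reV_single]
    rfl))
  refine ⟨δ', h2, g', ⟨(HEq.symm ?_).trans (r.toHEq.symm.trans r'.toHEq)⟩⟩
  have h5 : ∀ v, reV φ (C.d v + δ v) = E.d (reV φ v) := fun v => by
    rw [hδ, add_sub_cancel, reV_reV_symm]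
  exact HEq.ofEquiv (C := C.pert δ h1 g) φ h h' hd h5

/-! ### The bases of the homotopy colimit and of the pull-back -/

section cells

variable (I : Type u) [SmallCategory I]

/-- The nondegenerate simplices of the nerve. -/
abbrev NDN : Type u := {τ : Tot (nerve I) // τ.ND}

variable {I}

/-- The first object. -/
def npi (j : NDN I) : I := nob j.1

/-- The dimension. -/
def ndm (j : NDN I) : ℕ := j.1.dim

variable [Coded I] [Coded (Arrow I)] [CEq I] [CEq (Arrow I)] [Finite I] [Finite (Arrow I)]

theorem cm_npi : Cm (npi : NDN I → I) := cm_nob.comp Cm.val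

theorem cm_ndm : Cm (ndm : NDN I → ℕ) := cm_ndim.comp Cm.val

variable (X : I ⥤ SSet.{u}) [∀ i, EffS (X.obj i)]

/-- Pairs of a nondegenerate chain and of a simplex over it which hits all vertices. -/
abbrev HCell : Type u := PB npi ndm fun i => (gwData (X.obj i) 1).Cell

variable {X}

theorem covers_iff_hits {Y : SSet.{u}} [EffS Y] {w : Tot (gw Y)} {n : ℕ} (hp : tp w = n) :
    Covers w (tp w + 1) ↔ ∀ v ≤ n, ∃ j, tv w j = v := by
  subst hp
  rw [covers_iff]
  exact forall_congr' fun v => by rw [Nat.lt_succ_iff]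

theorem HCell.adm (x : HCell X) : Adm x.1.1 x.2.1.1 where
  nd := x.1.2
  tp_eq := x.2.2
  hits := (covers_iff_hits x.2.2).1 (not_not.1 x.2.1.2.2)

/-- The pair over a nondegenerate chain. -/
def HCell.mk' {τ : Tot (nerve I)} {w : Tot (gw (X.obj (nob τ)))} (h : Adm τ w) (hw : w.ND) : HCell X :=
  ⟨⟨τ, h.nd⟩, ⟨w, hw, not_not.2 ((covers_iff_hits h.tp_eq).2 h.hits)⟩, h.tp_eq⟩

variable [EffD X]

/-- The simplex of the homotopy colimit. -/
def toCell (x : HCell X) : (allCells (hocolim X)).Cell :=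
  ⟨x.2.1.1.map (cmap x.1.1), x.adm.nD_iff.2 x.2.1.2.1, not_false⟩

theorem toCell_injective : Function.Injective (toCell (X := X)) := by
  intro x y h
  have h1 := x.adm.injective y.adm (congrArg Subtype.val h)
  obtain ⟨⟨τ, hτ⟩, ⟨w, hw⟩, hl⟩ := x
  obtain ⟨⟨τ', hτ'⟩, ⟨w', hw'⟩, hl'⟩ := y
  obtain rfl : τ = τ' := congrArg Sigma.fst h1
  obtain rfl : w = w' := eq_of_heq (Sigma.mk.inj h1).2
  rfl

theorem toCell_surjective : Function.Surjective (toCell (X := X)) := by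
  rintro ⟨w, hw, hA⟩
  obtain ⟨τ, w', h, rfl⟩ := exists_adm w
  exact ⟨HCell.mk' h (h.nD_iff.1 hw), rfl⟩

variable (X) in
/-- The bijection of bases. -/
def cellEquiv : HCell X ≃ (allCells (hocolim X)).Cell := Equiv.ofBijective _ ⟨toCell_injective, toCell_surjective⟩

theorem tp_face_map (τ : Tot (nerve I)) (n : ℕ) (i : Fin (n + 2)) (x : (gw (X.obj (nob τ))) _⦋n + 1⦌) :
    (hocolim X).δ i ((cmap τ).app _ x) = (cmap τ).app (op ⦋n⦌) ((gw (X.obj (nob τ))).δ i x) :=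
  (ConcreteCategory.congr_hom (SimplicialObject.δ_naturality (cmap τ) i) x).symm

/-- If the simplex hits all vertices, both sides are the same cell, or both are zero. Otherwise the
relative term vanishes, and the image comes from a strictly shorter chain because it has fewer than
`dim τ` nonidentities. -/
theorem br_cell_low {j : NDN I} (w : Tot (gw (X.obj (npi j)))) (hp : tp w = ndm j) (b : HCell X)
    (h : (allCells (hocolim X)).br (w.map (cmap j.1)) (toCell b) ≠
      inP npi ndm j ((gwData (X.obj (npi j)) 1).br w) b) : ndm b.1 < ndm j := by
  by_cases hc : ∀ v ≤ j.1.dim, ∃ k, tv w k = v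
  · exfalso
    have ha : Adm j.1 w := ⟨j.2, hp, hc⟩
    apply h
    by_cases hw : w.ND
    · have e1 : (gwData (X.obj (npi j)) 1).br w = single (HCell.mk' ha hw).2.1 1 :=
        CellData.br_cell (D := gwData (X.obj (npi j)) 1) (HCell.mk' ha hw).2.1
      have e2 : (allCells (hocolim X)).br (w.map (cmap j.1)) = single (toCell (HCell.mk' ha hw)) 1 :=
        CellData.br_cell (D := allCells (hocolim X)) (toCell (HCell.mk' ha hw))
      have e3 : inP npi ndm j (single (HCell.mk' ha hw).2.1 1) = single (HCell.mk' ha hw) 1 :=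
        inP_single npi ndm (A := fun i => (gwData (X.obj i) 1).Cell) hp 1
      rw [e1, e2]
      refine Eq.trans ?_ (congrArg (fun v => v b) e3).symm
      change single (toCell (HCell.mk' ha hw)) 1 (toCell b) = single (HCell.mk' ha hw) 1 b
      by_cases hb : HCell.mk' ha hw = b
      · rw [hb, single_eq_same, single_eq_same]
      · rw [single_eq_of_ne (Ne.symm hb), single_eq_of_ne (toCell_injective.ne (Ne.symm hb))]
    · rw [CellData.br_of_not_nD (D := gwData (X.obj (npi j)) 1) hw,
        CellData.br_of_not_nD (D := allCells (hocolim X)) (mt ha.nD_iff.1 hw), map_zero]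
      rfl
  · rw [CellData.br_of_A (D := gwData (X.obj (npi j)) 1) (fun hA => hc ((covers_iff_hits hp).1 hA)), map_zero] at h
    have h1 := CellData.br_apply (D := allCells (hocolim X)) h
    have h2 := b.adm.dim_eq
    have h3 : b.2.1.1.map (cmap b.1.1) = w.map (cmap j.1) := h1
    have h4 : b.2.1.1.dim = w.dim := congrArg Tot.dim h3
    rw [h3, h4] at h2
    by_contra h5
    exact hc (hits_of_cnt hp (h2 ▸ not_lt.1 h5))

/-- The relative boundary over the chain is the associated graded of the boundary of the homotopy
colimit: face by face, the two agree up to cells over shorter chains. -/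
theorem toCell_low (a b : HCell X)
    (h : (CellData.dV (single (toCell a) 1) : V (allCells (hocolim X)).Cell) (toCell b) ≠
      inP npi ndm a.1 (CellData.dV (single a.2.1 1) : V (gwData (X.obj (npi a.1)) 1).Cell) b) :
    ndm b.1 < ndm a.1 := by
  have e1 : single a.2.1 1 = (gwData (X.obj (npi a.1)) 1).br a.2.1.1 := (CellData.br_cell _).symm
  have e2 : single (toCell a) 1 = (allCells (hocolim X)).br (a.2.1.1.map (cmap a.1.1)) :=
    (CellData.br_cell (D := allCells (hocolim X)) (toCell a)).symm
  rw [e1, e2] at h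
  have hp : tp a.2.1.1 = ndm a.1 := a.2.2
  clear e1 e2
  obtain ⟨j, ⟨⟨w, hw⟩, hl⟩⟩ := a
  change tp w = ndm j at hp
  obtain ⟨_ | n, x⟩ := w
  · exact (h (by
      refine (congrArg (fun v => v (toCell b)) (CellData.dV_br_zero (D := allCells (hocolim X)) ((cmap j.1).app _ x))).trans ?_
      refine Eq.symm ((congrArg (fun v => inP npi ndm j v b) (CellData.dV_br_zero (D := gwData (X.obj (npi j)) 1) x)).trans ?_)
      rw [map_zero]
      rfl)).elim
  · by_contra hlt
    apply h
    refine (congrArg (fun v => v (toCell b)) (CellData.dV_br_succ (D := allCells (hocolim X)) ((cmap j.1).app _ x))).trans ?_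
    refine Eq.symm ((congrArg (fun v => inP npi ndm j v b) (CellData.dV_br_succ (D := gwData (X.obj (npi j)) 1) x)).trans ?_)
    rw [map_sum, Finsupp.finsetSum_apply, Finsupp.finsetSum_apply]
    refine Finset.sum_congr rfl fun i _ => ?_
    rw [map_zsmul, Finsupp.smul_apply, Finsupp.smul_apply]
    congr 1
    by_contra hne
    refine hlt (br_cell_low ⟨n, (gw (X.obj (npi j))).δ i x⟩ hp b fun h0 => hne ?_)
    rw [← h0]
    exact congrArg (fun y => (allCells (hocolim X)).br ⟨n, y⟩ (toCell b)) (tp_face_map j.1 n i x).symm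

end cells

end

section

open Coded Finsupp CSet Tot

/-! ### Computability of the bijection of bases -/

section

theorem computable_pair_left : Computable fun k : ℕ => k.unpair.1 := Computable.fst.comp Computable.unpair

theorem computable_pair_right : Computable fun k : ℕ => k.unpair.2 := Computable.snd.comp Computable.unpair

theorem computable_natPair {f g : ℕ → ℕ} (hf : Computable f) (hg : Computable g) :
    Computable fun k => Nat.pair (f k) (g k) :=
  Primrec₂.natPair.to_comp.comp hf hg

/-- Functions which are computed on the level of codes. -/
theorem Cm.of_code {A B C : Type*} [Coded A] [Coded B] [Coded C] {f : A → B} {g : A → C} (hf : Cm f) {c : ℕ → ℕ}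
    (hc : Computable c) (h : ∀ k a, IsCode k (f a) → IsCode (c k) (g a)) : Cm g := by
  obtain ⟨φ, h1, h2⟩ := hf
  refine ⟨fun k => (φ k).map c, h1.map (hc.comp Computable.snd).to₂, fun k a hk => ?_⟩
  obtain ⟨m, hm, hm'⟩ := h2 k a hk
  exact ⟨c m, Part.mem_map c hm, h m a hm'⟩

theorem Cm.exists_find {X : Type*} [Coded X] {P : X × ℕ → Prop} (hP : CmP P) (h : ∀ x, ∃ n, P (x, n)) :
    ∃ u : X → ℕ, Cm u ∧ ∀ x, P (x, u x) := by
  classical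
  exact ⟨_, Cm.nat_find hP h, fun x => Nat.find_spec (h x)⟩

/-- The code of the label-and-index data is a rearrangement of these two codes; the index in `I` is
redundant and discarded. -/
theorem Cm.to_pull {I J : Type*} [Coded I] [Coded J] {π : J → I} {q : J → ℕ} {A : I → Type*} [∀ i, CSet (A i)]
    {X : Type*} [Coded X] {f : X → PB π q A} (h1 : Cm fun x => (f x).1)
    (h2 : Cm fun x => (⟨π (f x).1, (f x).2.1⟩ : Σ i, A i)) : Cm f :=
  Cm.of_code (h1.pair h2)
    (computable_natPair computable_pair_left (computable_pair_right.comp computable_pair_right))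
    fun k x hk => by
      change IsCode (Nat.unpair (Nat.pair _ _)).1 _ ∧ IsCode (Nat.unpair (Nat.pair _ _)).2 _
      rw [Nat.unpair_pair]
      exact ⟨hk.1, hk.2.2⟩

variable {I : Type u} [Coded I] [CEq I] [Finite I] {X : Type*} [Coded X]

theorem Cm.sigma_gw {Y : I → SSet.{u}} [∀ i, EffS (Y i)] {f : X → Σ i, Tot (EffHom.gw (Y i))}
    (h1 : Cm fun x => tp (f x).2) (h2 : Cm fun p : X × ℕ => EffHom.tv (f p.1).2 p.2)
    (h3 : Cm fun x => (⟨(f x).1, ty (f x).2⟩ : Σ i, Tot (Y i))) : Cm f := by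
  have hd : Cm fun x => (f x).2.dim :=
    (Cm.sigma_finite (F := fun i => Tot (Y i)) (f := fun i w => w.dim) fun i => EffS.cm_dim).comp h3
  refine Cm.of_code (h1.pair (Cm.pair (Cm.list_map (f := fun p : X × ℕ => EffHom.tv (f p.1).2 p.2) h2
    (Cm.list_range (Cm.nat_add hd (Cm.const 1)))) h3))
    (c := fun k => Nat.pair k.unpair.2.unpair.2.unpair.1
      (Nat.pair k.unpair.1 (Nat.pair k.unpair.2.unpair.1 k.unpair.2.unpair.2.unpair.2)))
    (computable_natPair (computable_pair_left.comp (computable_pair_right.comp computable_pair_right))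
      (computable_natPair computable_pair_left (computable_natPair (computable_pair_left.comp computable_pair_right)
        (computable_pair_right.comp (computable_pair_right.comp computable_pair_right)))))
    fun k x hk => ?_
  change IsCode (Nat.unpair (Nat.pair _ _)).1 _ ∧ IsCode (Nat.unpair (Nat.unpair (Nat.pair _ _)).2).1 _ ∧
    IsCode (Nat.unpair (Nat.unpair (Nat.unpair (Nat.pair _ _)).2).2).1 _ ∧ IsCode (Nat.unpair (Nat.unpair (Nat.unpair (Nat.pair _ _)).2).2).2 _
  simp only [Nat.unpair_pair]
  exact ⟨hk.2.2.1, hk.1, hk.2.1, hk.2.2.2⟩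

end

section cells

variable {I : Type u} [SmallCategory I] [Coded I] [Coded (Arrow I)] [CEq I] [CEq (Arrow I)] [Finite I]
  [Finite (Arrow I)] {X : I ⥤ SSet.{u}} [∀ i, EffS (X.obj i)]

theorem Cm.cnt {A : Type*} [Coded A] {f : A → Tot (CategoryTheory.nerve I)} {j : A → ℕ} (hf : Cm f) (hj : Cm j) :
    Cm fun x => EffHom.cnt (f x) (j x) := by
  classical
  have h : CmP fun f : Arrow I => ∃ i, f = idA i := Cm.of_finite _
  refine (Cm.nat_rec (X := A) (z := fun _ => 0) (s := fun p => if ∃ i, EffHom.ncar (f p.1) p.2.1 (p.2.1 + 1) = idA i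
    then p.2.2 else p.2.2 + 1) (n := j) (Cm.const 0) ?_ hj).congr fun x => ?_
  · exact Cm.ite (h.comp (Cm.ncar (by fun_prop) (by fun_prop) (by fun_prop))) (by fun_prop) (by fun_prop)
  · refine congrArg (fun s : ℕ → ℕ → ℕ => Nat.rec (motive := fun _ => ℕ) 0 s (j x)) ?_
    funext k c
    congr

/-- The simplex over the chain. -/
def cellGw (x : HCell X) : Σ i, Tot (gw (X.obj i)) := ⟨npi x.1, x.2.1.1⟩

theorem cm_cellGw : Cm (cellGw (X := X)) :=
  Cm.pull cm_npi (fun i p => (⟨i, p.2.1⟩ : Σ i, Tot (gw (X.obj i))))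
    (fun i => Cm.sigma_mk_const (F := fun i => Tot (gw (X.obj i))) i (Cm.val.comp Cm.snd)) fun _ => rfl

variable [EffD X]

theorem cm_cellEquiv : Cm (cellEquiv X) := by
  refine Cm.of_val (Cm.hocolim ?_ ?_)
  · have ht : Cm fun p : HCell X × ℕ => EffHom.tv p.1.2.1.1 p.2 :=
      (Cm.sigma_finite_prod (F := fun i => Tot (gw (X.obj i))) (X := ℕ) (f := fun i p => EffHom.tv p.1 p.2)
        fun i => cm_tv).comp (f := fun p : HCell X × ℕ => (cellGw p.1, p.2)) ((cm_cellGw.comp Cm.fst).pair Cm.snd)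
    refine Cm.nerve ?_ ?_
    · exact (Cm.sigma_finite (F := fun i => Tot (gw (X.obj i))) (f := fun i w => w.dim) fun i => cm_gw_dim).comp cm_cellGw
    · have h1 : Cm fun p : HCell X × ℕ × ℕ => ncar p.1.1.1 (EffHom.tv p.1.2.1.1 p.2.1) (EffHom.tv p.1.2.1.1 p.2.2) :=
        Cm.ncar (Cm.val.comp (Cm.sigma_fst.comp Cm.fst))
          (ht.comp (f := fun p : HCell X × ℕ × ℕ => (p.1, p.2.1)) (by fun_prop))
          (ht.comp (f := fun p : HCell X × ℕ × ℕ => (p.1, p.2.2)) (by fun_prop))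
      exact h1.congr fun p => (ncar_cmap _ _ _ _).symm
  · have h1 : Cm fun x : HCell X => (⟨npi x.1, ty x.2.1.1⟩ : Σ i, Tot (X.obj i)) :=
      (Cm.sigma_finite (F := fun i => Tot (gw (X.obj i))) (f := fun i w => (⟨i, ty w⟩ : Σ i, Tot (X.obj i)))
        fun i => Cm.sigma_mk_const (F := fun i => Tot (X.obj i)) i cm_ty).comp cm_cellGw
    exact h1.congr fun x => x.adm.hB_eq.symm

/-- The nondegenerate chain under a simplex is computed, not merely known to exist: vertices and
length by counting nonidentities, and morphisms by locating positions at which their endpoints occur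
as vertices. -/
theorem cm_cellEquiv_symm : Cm (cellEquiv X).symm := by
  classical
  have hN' : Cm fun c : (allCells (hocolim X)).Cell => hN c.1 := cm_hN.comp Cm.val
  have hd : Cm fun c : (allCells (hocolim X)).Cell => c.1.dim := cm_hdim.comp Cm.val
  have key : ∀ c, ((cellEquiv X).symm c).2.1.1.map (cmap ((cellEquiv X).symm c).1.1) = c.1 := fun c =>
    congrArg Subtype.val ((cellEquiv X).apply_symm_apply c)
  have hdim : ∀ c, ((cellEquiv X).symm c).2.1.1.dim = c.1.dim := fun c => congrArg Tot.dim (key c)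
  have ktv : ∀ c j, EffHom.tv ((cellEquiv X).symm c).2.1.1 j = EffHom.cnt (hN c.1) (min j c.1.dim) := fun c j =>
    (((cellEquiv X).symm c).adm.tv_eq' j).trans (by rw [key, hdim])
  have kdim : ∀ c, ((cellEquiv X).symm c).1.1.dim = EffHom.cnt (hN c.1) c.1.dim := fun c =>
    ((cellEquiv X).symm c).adm.dim_eq.trans (by rw [key, hdim])
  have htv : Cm fun p : (allCells (hocolim X)).Cell × ℕ => EffHom.tv ((cellEquiv X).symm p.1).2.1.1 p.2 :=
    (Cm.cnt (hN'.comp Cm.fst) (Cm.nat_min Cm.snd (hd.comp Cm.fst))).congr fun p => (ktv _ _).symm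
  have hdm : Cm fun c => ((cellEquiv X).symm c).1.1.dim := (Cm.cnt hN' hd).congr fun c => (kdim c).symm
  have hex : ∀ p : (allCells (hocolim X)).Cell × ℕ, ∃ j, EffHom.tv ((cellEquiv X).symm p.1).2.1.1 j =
      min p.2 ((cellEquiv X).symm p.1).1.1.dim := fun p =>
    ((cellEquiv X).symm p.1).adm.hits _ (min_le_right _ _)
  -- A position at which a given vertex occurs is found by search. The vertex is truncated to the
  -- length of the chain so that the search halts for every input.
  obtain ⟨u, hu, hu'⟩ : ∃ u : (allCells (hocolim X)).Cell × ℕ → ℕ, Cm u ∧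
      ∀ p, EffHom.tv ((cellEquiv X).symm p.1).2.1.1 (u p) = min p.2 ((cellEquiv X).symm p.1).1.1.dim :=
    Cm.exists_find (P := fun q : ((allCells (hocolim X)).Cell × ℕ) × ℕ =>
      EffHom.tv ((cellEquiv X).symm q.1.1).2.1.1 q.2 = min q.1.2 ((cellEquiv X).symm q.1.1).1.1.dim)
      (CmP.eq (htv.comp (f := fun q : ((allCells (hocolim X)).Cell × ℕ) × ℕ => (q.1.1, q.2)) (by fun_prop))
        (Cm.nat_min (by fun_prop) (hdm.comp (by fun_prop))))
      hex
  refine Cm.to_pull (Cm.of_val (Cm.nerve hdm ?_)) ?_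
  · refine (Cm.ncar (f := fun p : (allCells (hocolim X)).Cell × ℕ × ℕ => hN p.1.1)
      (i := fun p => u (p.1, p.2.1)) (j := fun p => u (p.1, p.2.2))
      (hN'.comp Cm.fst) (hu.comp (f := fun p : (allCells (hocolim X)).Cell × ℕ × ℕ => (p.1, p.2.1)) (by fun_prop))
      (hu.comp (f := fun p : (allCells (hocolim X)).Cell × ℕ × ℕ => (p.1, p.2.2)) (by fun_prop))).congr fun p => ?_
    have h3 := ncar_cmap ((cellEquiv X).symm p.1).1.1 ((cellEquiv X).symm p.1).2.1.1 (u (p.1, p.2.1)) (u (p.1, p.2.2))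
    rw [key] at h3
    exact h3.trans ((congrArg₂ _ (hu' (p.1, p.2.1)) (hu' (p.1, p.2.2))).trans (ncar_clamp _ _ _).symm)
  · have h1 : Cm fun c => cellGw ((cellEquiv X).symm c) := by
      refine Cm.sigma_gw (hdm.congr fun c => ((cellEquiv X).symm c).2.2.symm) htv ?_
      refine (cm_hB.comp Cm.val).congr fun c => ?_
      rw [← key c]
      exact ((cellEquiv X).symm c).adm.hB_eq
    exact h1

end cells

end

/-! ### Finiteness in each degree -/

section

open Coded Finsupp CSet Tot

/-! ### Lists of the basis elements of a given degree -/

theorem Cm.list_of_map_val {A X : Type*} [Coded A] [Coded X] {P : A → Prop} {f : X → List {a // P a}}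
    (h : Cm fun x => (f x).map Subtype.val) : Cm f :=
  Cm.of_code h Computable.id fun k x hk => (isCode_list_map (f := Subtype.val) (fun _ _ => Iff.rfl) (f x) k).1 hk

section nerve

variable {I : Type u} [SmallCategory I]

/-- The chain extended by a morphism on the left. -/
def pre (f : Arrow I) (τ : Tot (nerve I)) (h : f.right = nob τ) : Tot (nerve I) :=
  ⟨τ.dim + 1, ComposableArrows.precomp (show ComposableArrows I τ.dim from τ.val) (f.hom ≫ eqToHom h)⟩

theorem ncar_pre_zero {f : Arrow I} {τ : Tot (nerve I)} (h : f.right = nob τ) : ncar (pre f τ h) 0 1 = f := by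
  refine (car_of (n := τ.dim + 1) _ (a := 0) (b := 1) (Fin.zero_le _) (by simp [clampFin]) ?_).trans ?_
  · ext
    simp [clampFin]
  · refine Eq.trans (b := Arrow.mk (f.hom ≫ eqToHom h)) rfl ?_
    generalize hi : nob τ = i at h
    subst h
    simp

theorem ncar_pre_succ {f : Arrow I} {τ : Tot (nerve I)} (h : f.right = nob τ) {j : ℕ} (hj : j < τ.dim) :
    ncar (pre f τ h) (j + 1) (j + 1 + 1) = ncar τ j (j + 1) := by
  refine (car_of (n := τ.dim + 1) _ (a := ⟨j + 1, by omega⟩) (b := ⟨j + 1 + 1, by omega⟩) (by simp) ?_ ?_).trans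
    (car_of (n := τ.dim) _ (a := ⟨j, by omega⟩) (b := ⟨j + 1, by omega⟩) (by simp) ?_ ?_).symm
  all_goals
    ext
    simp [clampFin]
    omega

theorem ncode_pre {f : Arrow I} {τ : Tot (nerve I)} (h : f.right = nob τ) :
    ncode (pre f τ h) = (f.left, f :: (ncode τ).2) := by
  refine Prod.ext rfl ?_
  change (List.range (τ.dim + 1)).map _ = _
  rw [List.range_succ_eq_map, List.map_cons, List.map_map]
  refine congrArg₂ List.cons (ncar_pre_zero h) (List.map_congr_left fun j hj => ?_)
  exact ncar_pre_succ h (List.mem_range.1 hj)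

/-- Removing the first object leaves a chain of length `n`, from which the original is recovered by
its first morphism. So chains of length `n + 1` are listed by extending those of length `n` in all
possible ways. -/
theorem exists_pre {τ : Tot (nerve I)} {n : ℕ} (hn : τ.dim = n + 1) :
    ∃ f τ', ∃ h : f.right = nob τ', τ'.dim = n ∧ pre f τ' h = τ := by
  have h1 : (τ.face 0).dim = n := by rw [dim_face, hn]; rfl
  have h2 : ∀ j k, j ≤ n → k ≤ n → ncar (τ.face 0) j k = ncar τ (j + 1) (k + 1) := by
    intro j k hj hk
    rw [ncar_face, if_neg (by omega), if_neg (by simp), if_neg (by simp), min_eq_left (by omega),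
      min_eq_left (by omega)]
  have h3 : (ncar τ 0 1).right = nob (τ.face 0) := by
    have h4 := h2 0 0 (Nat.zero_le _) (Nat.zero_le _)
    rw [ncar_zero, ncar_self] at h4
    rw [ncar_right _ zero_le_one]
    exact (congrArg (fun f : Arrow I => f.left) h4).symm
  refine ⟨ncar τ 0 1, τ.face 0, h3, h1, ?_⟩
  refine ncode_injective ?_
  rw [ncode_pre, ncode, ncode, h1, hn, List.range_succ_eq_map, List.map_cons, List.map_map]
  refine Prod.ext ?_ (congrArg (List.cons _) (List.map_congr_left fun j hj => ?_))
  · have := ncar_zero τ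
    rw [ncar_self] at this
    exact congrArg (fun f : Arrow I => f.left) this
  · rw [List.mem_range] at hj
    exact h2 j (j + 1) (by omega) (by omega)

variable [Coded I] [Coded (Arrow I)] [CEq I] [CEq (Arrow I)] [Finite I] [Finite (Arrow I)]

open Classical in
/-- The extension of a chain by a morphism, if it is defined. -/
def preList (f : Arrow I) (τ : Tot (nerve I)) : List (Tot (nerve I)) :=
  if h : f.right = nob τ then [pre f τ h] else []

theorem cm_preList : Cm fun p : Tot (nerve I) × Arrow I => preList p.2 p.1 := by
  refine Cm.glue_prop (P := fun p : Tot (nerve I) × Arrow I => p.2.right = nob p.1)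
    (CmP.eq ((Cm.of_finite fun f : Arrow I => f.right).comp Cm.snd) (by fun_prop)) ?_ ?_
  · refine Cm.congr (f := fun p => [pre p.1.2 p.1.1 p.2]) (Cm.list_cons ?_ (Cm.const []))
      fun p => by rw [preList, dif_pos p.2]
    have h1 : Cm fun p : {p : Tot (nerve I) × Arrow I // p.2.right = nob p.1} => (p.1.2.left, p.1.2 :: (ncode p.1.1).2) :=
      Cm.pair ((Cm.of_finite fun f : Arrow I => f.left).comp (Cm.snd.comp Cm.val))
        (Cm.list_cons (Cm.snd.comp Cm.val) (cm_ncode.snd'.comp (Cm.fst.comp Cm.val)))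
    have h2 : Cm fun p : {p : Tot (nerve I) × Arrow I // p.2.right = nob p.1} => ncode (pre p.1.2 p.1.1 p.2) :=
      h1.congr fun p => (ncode_pre p.2).symm
    exact h2
  · exact (Cm.const []).congr fun p => by rw [preList, dif_neg p.2]

theorem exists_list_univ (A : Type*) [Finite A] : ∃ l : List A, ∀ a, a ∈ l := by
  have := Fintype.ofFinite A
  exact ⟨Finset.univ.toList, fun a => Finset.mem_toList.2 (Finset.mem_univ a)⟩

/-- The simplices of the nerve of any given dimension can be listed. -/
theorem exists_nerve_list : ∃ L : ℕ → List (Tot (nerve I)), Cm L ∧ ∀ n τ, τ ∈ L n ↔ τ.dim = n := by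
  obtain ⟨la, ha⟩ := exists_list_univ (Arrow I)
  obtain ⟨lo, ho⟩ := exists_list_univ I
  let L0 : List (Tot (nerve I)) := lo.map fun i => ⟨0, ComposableArrows.mk₀ i⟩
  let L : ℕ → List (Tot (nerve I)) := fun n => Nat.rec L0 (fun _ l => l.flatMap fun τ => la.flatMap fun f => preList f τ) n
  refine ⟨L, ?_, fun n => ?_⟩
  · refine Cm.nat_rec (X := ℕ) (z := fun _ => L0)
      (s := fun p => p.2.2.flatMap fun τ => la.flatMap fun f => preList f τ) (n := fun n => n) (Cm.const _) ?_ Cm.id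
    refine Cm.list_flatMap (f := fun q : (ℕ × ℕ × List (Tot (nerve I))) × Tot (nerve I) => la.flatMap fun f => preList f q.2)
      (Cm.list_flatMap (f := fun r : ((ℕ × ℕ × List (Tot (nerve I))) × Tot (nerve I)) × Arrow I => preList r.2 r.1.2)
        (cm_preList.comp (f := fun r : ((ℕ × ℕ × List (Tot (nerve I))) × Tot (nerve I)) × Arrow I => (r.1.2, r.2)) (by fun_prop)) (Cm.const la)) (by fun_prop)
  · induction n with
    | zero =>
      intro τ
      constructor
      · intro h
        obtain ⟨i, _, rfl⟩ := List.mem_map.1 h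
        rfl
      · intro h
        refine List.mem_map.2 ⟨nob τ, ho _, ncode_injective (Prod.ext rfl ?_)⟩
        change _ = (List.range τ.dim).map _
        rw [h]
        rfl
    | succ n ih =>
      intro τ
      change τ ∈ (L n).flatMap _ ↔ _
      simp only [List.mem_flatMap]
      constructor
      · rintro ⟨τ', h1, f, _, h2⟩
        rw [preList] at h2
        split_ifs at h2 with h
        · obtain rfl := List.mem_singleton.1 h2
          exact congrArg (· + 1) ((ih τ').1 h1)
        · exact (List.not_mem_nil h2).elim
      · intro h
        obtain ⟨f, τ', h1, h2, h3⟩ := exists_pre h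
        exact ⟨τ', (ih τ').2 h2, f, ha f, by rw [preList, dif_pos h1, h3]; exact List.mem_singleton.2 rfl⟩

theorem exists_nDN_list : ∃ L : ℕ → List (NDN I), Cm L ∧ ∀ n j, j ∈ L n ↔ ndm j = n := by
  classical
  obtain ⟨L, h1, h2⟩ := exists_nerve_list (I := I)
  refine ⟨fun n => ((L n).filter fun τ => τ.ND).attachWith _ fun τ hτ => of_decide_eq_true (List.mem_filter.1 hτ).2, ?_, fun n j => ?_⟩
  · refine Cm.list_of_map_val (Cm.congr (f := fun n => (L n).filter fun τ => τ.ND) ?_ fun n => ?_)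
    · exact Cm.list_filter (P := fun p : ℕ × Tot (nerve I) => p.2.ND) (cmP_nD.comp Cm.snd) h1
    · simp
  · rw [List.mem_attachWith, List.mem_filter, h2]
    exact and_iff_left (decide_eq_true j.2)

end nerve

section pull

variable {I J : Type u} [Coded I] [CEq I] [Finite I] [Coded J] [CEq J] {π : J → I} {q : J → ℕ}

/-- The shift by `q j` leaves, over each `j`, the elements of `D` of degree `n - q j`, and only the
finitely many `j` with `q j ≤ n` contribute in degree `n`. -/
theorem FinB.pull {D : I → Type u} [∀ i, CSet (D i)] (hD : ∀ i, FinB (D i)) (hπ : Cm π) (hq : Cm q)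
    (hJ : ∃ L : ℕ → List J, Cm L ∧ ∀ n j, j ∈ L n ↔ q j = n) :
    letI := CSet.pull (A := fun i => ℕ × D i) hπ hq
    FinB (PB π q fun i => ℕ × D i) := by
  obtain ⟨LJ, hJ1, hJ2⟩ := hJ
  choose L hL1 hL2 using hD
  let F : ℕ × J → List (PB π q fun i => ℕ × D i) := fun p =>
    (L (π p.2) (p.1 - q p.2)).map fun d => ⟨p.2, (q p.2, d), rfl⟩
  have hF : Cm F := by
    refine Cm.glue (c := fun p : ℕ × J => π p.2) (hπ.comp (f := fun p : ℕ × J => p.2) Cm.snd) fun i => ?_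
    refine Cm.congr (f := fun p : {p : ℕ × J // π p.2 = i} => (L i (p.1.1 - q p.1.2)).map
      fun d => (⟨p.1.2, ⟨(q p.1.2, tr D p.2.symm d), rfl⟩⟩ : PB π q fun i => ℕ × D i)) ?_ ?_
    · refine Cm.list_map (f := fun r : {p : ℕ × J // π p.2 = i} × D i =>
        (⟨r.1.1.2, ⟨(q r.1.1.2, tr D r.1.2.symm r.2), rfl⟩⟩ : PB π q fun i => ℕ × D i)) ?_
        ((hL1 i).comp (by fun_prop))
      refine Cm.of_code (f := fun r : {p : ℕ × J // π p.2 = i} × D i => (r.1.1.2, q r.1.1.2, r.2)) (by fun_prop)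
        Computable.id fun k r hk => ⟨hk.1, hk.2.1, isCode_tr _ hk.2.2⟩
    · rintro ⟨p, rfl⟩
      rfl
  -- Truncated subtraction in `F` is exact here because `p` runs only up to `n`.
  refine ⟨fun n => (List.range (n + 1)).flatMap fun p => (LJ p).flatMap fun j => F (n, j), ?_, ?_⟩
  · refine Cm.list_flatMap (f := fun r : ℕ × ℕ => (LJ r.2).flatMap fun j => F (r.1, j))
      (Cm.list_flatMap (f := fun r : (ℕ × ℕ) × J => F (r.1.1, r.2)) (hF.comp (f := fun r : (ℕ × ℕ) × J => (r.1.1, r.2)) (by fun_prop)) (by fun_prop)) (by fun_prop)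
  · rintro n ⟨j, ⟨p, d⟩, hp⟩
    change p = q j at hp
    subst hp
    change _ ↔ q j + deg d = n
    simp only [List.mem_flatMap, List.mem_range, hJ2]
    constructor
    · rintro ⟨p, hp, j', rfl, h⟩
      obtain ⟨d', h1, h2⟩ := List.mem_map.1 h
      obtain rfl : j' = j := congrArg Sigma.fst h2
      have h3 : d' = d := congrArg (fun x : ℕ × D (π j') => x.2) (congrArg Subtype.val (eq_of_heq (Sigma.mk.inj h2).2))
      subst h3
      have := (hL2 _ _ _).1 h1
      dsimp only at this
      omega
    · intro h
      refine ⟨q j, by omega, j, rfl, List.mem_map.2 ⟨d, (hL2 _ _ _).2 ?_, rfl⟩⟩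
      dsimp only
      omega

end pull

end

/-! ### The encoding of the homotopy colimit and the conclusion -/

section

open Coded Finsupp CSet Tot

/-! ### Locally effective simplicial sets from computable operators -/

section

theorem Cm.encode {A B : Type*} [Coded A] [Primcodable B] [Coded B] [Lawful B] {f : A → B} (hf : Cm f) :
    Cm fun x => Encodable.encode (f x) :=
  Cm.of_code hf Computable.id fun k x hk =>
    show k = Encodable.encode (f x) from (Lawful.iff k _).1 hk

/-- The value of a computable function with numerical values is determined by the algorithm. -/
theorem Cm.exists_nat {A : Type*} [Coded A] {f : A → ℕ} (hf : Cm f) :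
    ∃ φ : ℕ →. ℕ, Partrec φ ∧ ∀ k a, IsCode k a → f a ∈ φ k := by
  obtain ⟨φ, h1, h2⟩ := hf
  refine ⟨φ, h1, fun k a hk => ?_⟩
  obtain ⟨m, h3, h4⟩ := h2 k a hk
  obtain rfl : m = f a := h4
  exact h3

section eff

variable {W : SSet.{u}} (E E' : EffS W)

/-- The algorithms enter the type of the chains but not their values. This permits comparing the
chains of the same simplicial set for two encodings. -/
theorem br_eff (w : Tot W) : @CellData.br _ (@allCells W E) w = @CellData.br _ (@allCells W E') w := by
  unfold CellData.br
  rfl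

theorem dT_eff (w : Tot W) : @CellData.dT _ (@allCells W E) w = @CellData.dT _ (@allCells W E') w := by
  obtain ⟨_ | n, x⟩ := w
  · rfl
  · exact Finset.sum_congr rfl fun i _ => congrArg _ (br_eff E E' _)

theorem reV_refl {A : Type*} (v : V A) : reV (Equiv.refl A) v = v := by
  ext b
  rfl

/-- The differential does not depend on the codes. -/
theorem dV_eff : @CellData.dV _ (@allCells W E) = @CellData.dV _ (@allCells W E') := by
  refine Finsupp.lhom_ext' fun c => LinearMap.ext_ring ?_
  change CellData.dV (D := @allCells W E) (single c 1) = CellData.dV (D := @allCells W E') (single c 1)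
  refine (Finsupp.linearCombination_single _ _ _).trans (Eq.trans ?_ (Finsupp.linearCombination_single _ _ _).symm)
  rw [one_smul, one_smul, dT_eff E E']

/-- The chains do not depend on the codes. -/
def heq_eff (h : @Cm (Tot W) (Tot W) E.toCoded E'.toCoded fun w => w)
    (h' : @Cm (Tot W) (Tot W) E'.toCoded E.toCoded fun w => w) : HEq (@allCells W E).cx (@allCells W E').cx where
  f := reV (Equiv.refl {w : Tot W // w.ND ∧ ¬ False})
  g := reV (Equiv.refl {w : Tot W // w.ND ∧ ¬ False})
  h := 0
  k := 0
  f_d v := (reV_refl _).trans ((LinearMap.congr_fun (dV_eff E E') v).trans (congrArg _ (reV_refl v).symm))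
  g_d v := (reV_refl _).trans ((LinearMap.congr_fun (dV_eff E' E) v).trans (congrArg _ (reV_refl v).symm))
  hty_h v := by
    rw [LinearMap.zero_apply, LinearMap.zero_apply, map_zero, add_zero]
    exact (sub_eq_zero.2 (((reV_refl _).trans (reV_refl v)).symm)).symm
  hty_k v := by
    rw [LinearMap.zero_apply, LinearMap.zero_apply, map_zero, add_zero]
    exact (sub_eq_zero.2 (((reV_refl _).trans (reV_refl v)).symm)).symm
  good_f := @good_reV (@allCells W E).Cell (@allCells W E').Cell _ _ (Equiv.refl _)
    (by obtain ⟨φ, h1, h2⟩ := h; exact ⟨φ, h1, fun k w hk => h2 k w.1 hk⟩) fun _ => rfl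
  good_g := @good_reV (@allCells W E').Cell (@allCells W E).Cell _ _ (Equiv.refl _)
    (by obtain ⟨φ, h1, h2⟩ := h'; exact ⟨φ, h1, fun k w hk => h2 k w.1 hk⟩) fun _ => rfl
  good_h := Good.zero
  good_k := Good.zero

end eff

/-- The chains of a locally effective simplicial set, in terms of codes which can be computed from and into the
given ones. -/
def cells_heq {W : SSet.{u}} [E : EffS W] (e : LocallyEffective W) (h1 : Cm fun w : Tot W => e.code w.dim w.val)
    (h2 : ∃ ψ : ℕ →. ℕ, Partrec ψ ∧ ∀ n x, ∃ l ∈ ψ (Nat.pair n (e.code n x)), IsCode l (⟨n, x⟩ : Tot W)) :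
    HEq e.cells.cx (allCells W).cx := by
  refine heq_eff e.effS E ?_ ?_
  · obtain ⟨ψ, hψ, h3⟩ := h2
    refine ⟨ψ, hψ, fun k w hk => ?_⟩
    obtain ⟨n, x⟩ := w
    obtain ⟨l, h5, h6⟩ := h3 n x
    obtain ⟨h7, h8⟩ : k.unpair.1 = n ∧ k.unpair.2 = e.code n x := hk
    obtain rfl : k = Nat.pair n (e.code n x) := (Nat.pair_unpair k).symm.trans (congrArg₂ Nat.pair h7 h8)
    exact ⟨l, h5, h6⟩
  · have hd : Cm fun w : Tot W => (w.dim, e.code w.dim w.val) := EffS.cm_dim.pair h1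
    exact hd

variable {W : SSet.{u}} [EffS W] {c : ∀ n, W _⦋n⦌ → ℕ}

/-- A locally effective structure given by codes which can be computed from and into the given ones. -/
def mkLocallyEffective (h1 : Cm fun w : Tot W => c w.dim w.val)
    (h2 : ∃ ψ : ℕ →. ℕ, Partrec ψ ∧ ∀ n x, ∃ l ∈ ψ (Nat.pair n (c n x)), IsCode l (⟨n, x⟩ : Tot W)) :
    LocallyEffective W where
  code := c
  code_injective n x y h := by
    obtain ⟨ψ, _, h3⟩ := h2
    obtain ⟨l, h4, h5⟩ := h3 n x
    obtain ⟨m, h6, h7⟩ := h3 n y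
    rw [h] at h4
    obtain rfl := Part.mem_unique h4 h6
    exact ext_val (eq_of_isCode h5 h7)
  face_computable := by
    obtain ⟨ψ, hψ, h3⟩ := h2
    obtain ⟨γ, hγ, h4⟩ := (h1.comp (f := fun p : ℕ × Tot W => p.2.face p.1) (by fun_prop)).exists_nat
    refine ⟨fun p => (ψ (Nat.pair (p.1 + 1) p.2.2)).bind fun l => γ (Nat.pair p.2.1 l), ?_, fun n i x => ?_⟩
    · refine Partrec.bind (hψ.comp (Primrec₂.natPair.to_comp.comp (Computable.succ.comp Computable.fst)
        (Computable.snd.comp Computable.snd))) (hγ.comp (Primrec₂.natPair.to_comp.comp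
        (Computable.fst.comp (Computable.snd.comp Computable.fst)) Computable.snd)).to₂
    · obtain ⟨l, h5, h6⟩ := h3 (n + 1) x
      refine Part.mem_bind h5 ?_
      have := h4 (Nat.pair i l) ((i : ℕ), ⟨n + 1, x⟩) ⟨by simp; rfl, by simpa using h6⟩
      dsimp only at this
      rwa [face_val] at this
  degeneracy_computable := by
    obtain ⟨ψ, hψ, h3⟩ := h2
    obtain ⟨γ, hγ, h4⟩ := (h1.comp (f := fun p : ℕ × Tot W => p.2.degen p.1) (by fun_prop)).exists_nat
    refine ⟨fun p => (ψ (Nat.pair p.1 p.2.2)).bind fun l => γ (Nat.pair p.2.1 l), ?_, fun n i x => ?_⟩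
    · refine Partrec.bind (hψ.comp (Primrec₂.natPair.to_comp.comp Computable.fst
        (Computable.snd.comp Computable.snd))) (hγ.comp (Primrec₂.natPair.to_comp.comp
        (Computable.fst.comp (Computable.snd.comp Computable.fst)) Computable.snd)).to₂
    · obtain ⟨l, h5, h6⟩ := h3 n x
      refine Part.mem_bind h5 ?_
      have := h4 (Nat.pair i l) ((i : ℕ), ⟨n, x⟩) ⟨by simp; rfl, by simpa using h6⟩
      dsimp only at this
      rwa [degen_val] at this

end

/-! ### The codes of the simplices of the homotopy colimit -/

section

variable {I : Type u} [SmallCategory I] {X : I ⥤ SSet.{u}} (a : Arrow I ↪ ℕ) (e : ∀ i, LocallyEffective (X.obj i))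

/-- Rewrites the prescribed code in terms of the data from which nerve simplices and monotone maps
are encoded here. -/
theorem zcode_eq {n : ℕ} (z : HocolimCell X (op ⦋n⦌)) :
    z.code a e = Encodable.encode (a (idA (z.chain.obj 0)), (ncode ⟨z.m, z.chain⟩).2.map a,
      (List.range (n + 1)).map (hv (zt z)), (e (z.chain.obj 0)).code n z.x) := by
  have h1 : List.ofFn (fun j : Fin z.m => a (Arrow.mk (z.chain.map' j (j + 1)))) = (ncode ⟨z.m, z.chain⟩).2.map a := by
    refine List.ext_getElem (by simp [ncode]) fun j h _ => ?_
    simp only [ncode, List.getElem_ofFn, List.getElem_map, List.getElem_range]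
    rw [List.length_ofFn] at h
    refine congrArg a (car_of z.chain (a := ⟨j, by omega⟩) (b := ⟨j + 1, by omega⟩) (by simp) ?_ ?_).symm
    all_goals
      ext
      simp [clampFin]
      omega
  have h2 : List.ofFn (fun j : Fin (n + 1) => ((SSet.stdSimplex.objEquiv z.t).toOrderHom j).val) =
      (List.range (n + 1)).map (hv (zt z)) := by
    refine List.ext_getElem (by simp) fun j h _ => ?_
    rw [List.length_ofFn] at h
    simp only [List.getElem_ofFn, List.getElem_map, List.getElem_range]
    exact (hv_fin (zt z) ⟨j, h⟩).symm
  rw [HocolimCell.code]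
  exact congrArg Encodable.encode (congrArg (Prod.mk _) (congrArg₂ Prod.mk h1 (congrArg₂ Prod.mk h2 rfl)))

/-- The code of a simplex of the homotopy colimit: the code of its canonical representative. -/
def hcode (n : ℕ) (y : (hocolim X) _⦋n⦌) : ℕ :=
  Encodable.encode (a (idA (hB ⟨n, y⟩).1), (ncode (hN ⟨n, y⟩)).2.map a, List.range (n + 1),
    (e (hB ⟨n, y⟩).1).code (hB ⟨n, y⟩).2.dim (hB ⟨n, y⟩).2.val)

theorem exists_rep_hcode {n : ℕ} (y : (hocolim X) _⦋n⦌) :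
    ∃ z : HocolimCell X (op ⦋n⦌), hocolimMk z = y ∧ z.code a e = hcode a e n y := by
  obtain ⟨z, rfl⟩ := Quot.exists_rep y
  refine ⟨hcanon ((nerve I).map (zt z).op z.chain) (zbase z).2.val, (hocolimMk_canon z).symm, ?_⟩
  rw [zcode_eq]
  have h3 : (List.range (n + 1)).map (hv (𝟙 ⦋n⦌)) = List.range (n + 1) := by
    refine (List.map_congr_left fun j hj => ?_).trans (List.map_id _)
    exact hv_id (by have := List.mem_range.1 hj; omega)
  exact congrArg Encodable.encode (congrArg (Prod.mk _) (congrArg (Prod.mk _) (congrArg₂ Prod.mk h3 rfl)))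

/-- The simplices of the disjoint union. -/
abbrev ZTot (X : I ⥤ SSet.{u}) : Type u := Σ n : ℕ, HocolimCell X (op ⦋n⦌)

/-- The chain, the vertices, and the simplex of the diagram. -/
def zkey (z : ZTot X) : Tot (nerve I) × List ℕ × Σ i, Tot (X.obj i) :=
  (⟨z.2.m, z.2.chain⟩, (List.range (z.1 + 1)).map (hv (zt z.2)), ⟨z.2.chain.obj 0, ⟨z.1, z.2.x⟩⟩)

theorem zkey_injective : Function.Injective (zkey (X := X)) := by
  rintro ⟨n, ⟨m, σ, t, x⟩⟩ ⟨n', ⟨m', σ', t', x'⟩⟩ h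
  simp only [zkey, Prod.mk.injEq] at h
  obtain ⟨h1, h2, h3⟩ := h
  obtain rfl : m = m' := congrArg Tot.dim h1
  obtain rfl : σ = σ' := ext_val (W := nerve I) h1
  have h4 : (⟨n, x⟩ : Tot (X.obj (σ.obj 0))) = ⟨n', x'⟩ := eq_of_heq (Sigma.mk.inj h3).2
  obtain rfl : n = n' := congrArg Tot.dim h4
  obtain rfl := ext_val h4
  obtain rfl : t = t' := by
    apply SSet.stdSimplex.objEquiv.injective
    refine hv_ext fun j hj => ?_
    exact List.map_inj_left.1 h2 j (List.mem_range.2 (by omega))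
  rfl

end

section

variable {I : Type u} [SmallCategory I] {X : I ⥤ SSet.{u}} (a : Arrow I ↪ ℕ) (e : ∀ i, LocallyEffective (X.obj i))
  [Coded I] [Coded (Arrow I)] [CEq I] [CEq (Arrow I)] [Finite I] [Finite (Arrow I)]
  [∀ i, EffS (X.obj i)] [EffD X]

instance : Coded (ZTot X) := Coded.ofInj zkey zkey_injective

theorem cm_zkey : Cm (zkey (X := X)) := Cm.id

/-- The normal form of a represented simplex is explicit: the chain is reindexed by the vertices,
and the simplex of the diagram is pushed to the object of the first vertex. -/
theorem cm_zmk : Cm fun z : ZTot X => (⟨z.1, hocolimMk z.2⟩ : Tot (hocolim X)) := by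
  have h1 : Cm fun z : ZTot X => (⟨z.2.m, z.2.chain⟩ : Tot (nerve I)) := cm_zkey.fst'
  have h2 : Cm fun z : ZTot X => (List.range (z.1 + 1)).map (hv (zt z.2)) := cm_zkey.snd'.fst'
  have h3 : Cm fun z : ZTot X => (⟨z.2.chain.obj 0, ⟨z.1, z.2.x⟩⟩ : Σ i, Tot (X.obj i)) := cm_zkey.snd'.snd'
  have hn : Cm fun z : ZTot X => z.1 :=
    (Cm.sigma_finite (F := fun i => Tot (X.obj i)) (f := fun i w => w.dim) fun i => EffS.cm_dim).comp h3
  have hvc : Cm fun p : ZTot X × ℕ => hv (zt p.1.2) p.2 := by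
    refine (Cm.option_elim (o := fun p : ZTot X × ℕ => ((List.range (p.1.1 + 1)).map (hv (zt p.1.2)))[min p.2 p.1.1]?)
      (f := fun _ => 0) (g := fun q : (ZTot X × ℕ) × ℕ => q.2) (Cm.list_getElem? (h2.comp Cm.fst) (Cm.nat_min Cm.snd (hn.comp Cm.fst)))
      (Cm.const 0) Cm.snd).congr fun p => ?_
    rw [List.getElem?_map, List.getElem?_range (by omega)]
    exact hv_clamp _ _
  refine Cm.hocolim (Cm.nerve hn ?_) ?_
  · refine Cm.congr (f := fun p : ZTot X × ℕ × ℕ => ncar ⟨p.1.2.m, p.1.2.chain⟩ (hv (zt p.1.2) p.2.1) (hv (zt p.1.2) p.2.2)) ?_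
      fun p => (ncar_map (zt p.1.2) p.1.2.chain _ _).symm
    exact Cm.ncar (h1.comp Cm.fst) (hvc.comp (f := fun p : ZTot X × ℕ × ℕ => (p.1, p.2.1)) (by fun_prop))
      (hvc.comp (f := fun p : ZTot X × ℕ × ℕ => (p.1, p.2.2)) (by fun_prop))
  · refine Cm.congr (f := fun z : ZTot X => push X (ncar ⟨z.2.m, z.2.chain⟩ 0 (hv (zt z.2) 0)) ⟨z.2.chain.obj 0, ⟨z.1, z.2.x⟩⟩) ?_
      fun z => (zbase_eq_push z.2).symm
    exact Cm.push (Cm.ncar h1 (Cm.const 0) (hvc.comp (f := fun z : ZTot X => (z, 0)) (by fun_prop))) h3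

variable {a e} (ha : ∀ (f : Arrow I) k, IsCode k f ↔ k = a f) (ho : ∀ (i : I) k, IsCode k i ↔ k = a (idA i))
  (he : ∀ i (w : Tot (X.obj i)) k, IsCode k w ↔ k = Nat.pair w.dim ((e i).code w.dim w.val))

include ha in
theorem isCode_map_iff (l : List (Arrow I)) (k : ℕ) : IsCode k l ↔ k = Encodable.encode (l.map a) := by
  rw [← isCode_list_map (f := a) (fun f k => (ha f k).symm) l k]
  exact Lawful.iff k (l.map a)

include he in
theorem cm_hcode_num : Cm fun w : Tot (hocolim X) => hcode a e w.dim w.val := by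
  refine Cm.encode ?_
  have hN' := cm_hN (X := X)
  have hB' := cm_hB (X := X)
  refine Cm.pair ((Cm.of_finite fun i : I => a (idA i)).comp (Cm.sigma_fst.comp hB')) (Cm.pair ?_ (Cm.pair ?_ ?_))
  · exact Cm.list_map (f := fun p : Tot (hocolim X) × Arrow I => a p.2) ((Cm.of_finite a).comp Cm.snd)
      (cm_ncode.snd'.comp hN')
  · exact Cm.list_range (Cm.nat_add cm_hdim (Cm.const 1))
  · refine (Cm.sigma_finite (F := fun i => Tot (X.obj i)) (f := fun i w => (e i).code w.dim w.val) fun i => ?_).comp hB'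
    refine Cm.of_code (f := fun w : Tot (X.obj i) => w) Cm.id computable_pair_right fun k w hk => ?_
    rw [he] at hk
    subst hk
    rw [Nat.unpair_pair]
    rfl

include ha ho he in
-- Both encodings contain the same data: first object, morphisms, dimension and code of the simplex
-- of the diagram. Passing between them only rearranges nested pairs.
theorem exists_decode_hcode : ∃ ψ : ℕ →. ℕ, Partrec ψ ∧ ∀ n (y : (hocolim X) _⦋n⦌),
    ∃ l ∈ ψ (Nat.pair n (hcode a e n y)), IsCode l (⟨n, y⟩ : Tot (hocolim X)) := by
  refine ⟨fun k => Part.some (Nat.pair (Nat.pair k.unpair.2.unpair.1 k.unpair.2.unpair.2.unpair.1)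
    (Nat.pair k.unpair.2.unpair.1 (Nat.pair k.unpair.1 k.unpair.2.unpair.2.unpair.2.unpair.2))), ?_, fun n y => ⟨_, Part.mem_some _, ?_⟩⟩
  · have h2 := computable_pair_right
    have h1 := computable_pair_left
    exact computable_natPair (computable_natPair (h1.comp h2) (h1.comp (h2.comp h2)))
      (computable_natPair (h1.comp h2) (computable_natPair h1 (h2.comp (h2.comp (h2.comp h2)))))
  · rw [hcode]
    simp only [Encodable.encode_prod_val, Nat.unpair_pair]
    change (IsCode (Nat.unpair (Nat.unpair (Nat.pair _ _)).1).1 (nob _) ∧ IsCode (Nat.unpair (Nat.unpair (Nat.pair _ _)).1).2 (ncode _).2) ∧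
      IsCode (Nat.unpair (Nat.unpair (Nat.pair _ _)).2).1 (hB _).1 ∧ IsCode (Nat.unpair (Nat.unpair (Nat.pair _ _)).2).2 (hB _).2
    simp only [Nat.unpair_pair]
    refine ⟨⟨(ho _ _).2 ?_, (isCode_map_iff ha _ _).2 rfl⟩, (ho _ _).2 rfl, (he _ _ _).2 ?_⟩
    · rw [hB_fst]
      rfl
    · exact congrArg (fun d => Nat.pair d _) (hB_dim ⟨n, y⟩).symm

/-- The locally effective structure of the homotopy colimit. -/
def hocolimEff : LocallyEffective (hocolim X) :=
  mkLocallyEffective (c := hcode a e) (cm_hcode_num he) (exists_decode_hcode ha ho he)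

theorem hocolimEff_isCompatible : IsCompatible a e (hocolimEff ha ho he) where
  mk_computable := by
    obtain ⟨γ, hγ, h⟩ := ((cm_hcode_num he).comp (cm_zmk (X := X))).exists_nat
    -- The prescribed code of a representative is rearranged into a code of its chain, its vertices
    -- and its simplex of the diagram; the first object is needed twice.
    refine ⟨fun p => γ (Nat.pair (Nat.pair p.2.unpair.1 p.2.unpair.2.unpair.1) (Nat.pair p.2.unpair.2.unpair.2.unpair.1
      (Nat.pair p.2.unpair.1 (Nat.pair p.1 p.2.unpair.2.unpair.2.unpair.2)))), ?_, fun n z => ?_⟩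
    · have h2 := computable_pair_right
      have h1 := computable_pair_left
      have hp := Primrec₂.natPair.to_comp
      have hs : Computable (Prod.snd : ℕ × ℕ → ℕ) := Computable.snd
      exact hγ.comp (hp.comp (hp.comp (h1.comp hs) (h1.comp (h2.comp hs))) (hp.comp (h1.comp (h2.comp (h2.comp hs)))
        (hp.comp (h1.comp hs) (hp.comp Computable.fst (h2.comp (h2.comp (h2.comp hs)))))))
    · refine h _ ⟨n, z⟩ ?_
      dsimp only
      rw [zcode_eq]
      simp only [Encodable.encode_prod_val, Nat.unpair_pair]
      change (IsCode (Nat.unpair (Nat.unpair (Nat.pair _ _)).1).1 (nob _) ∧ IsCode (Nat.unpair (Nat.unpair (Nat.pair _ _)).1).2 (ncode _).2) ∧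
        IsCode (Nat.unpair (Nat.unpair (Nat.pair _ _)).2).1 (zkey _).2.1 ∧
        IsCode (Nat.unpair (Nat.unpair (Nat.unpair (Nat.pair _ _)).2).2).1 (zkey _).2.2.1 ∧
        IsCode (Nat.unpair (Nat.unpair (Nat.unpair (Nat.pair _ _)).2).2).2 (zkey _).2.2.2
      simp only [Nat.unpair_pair]
      exact ⟨⟨(ho _ _).2 rfl, (isCode_map_iff ha _ _).2 rfl⟩, (Lawful.iff _ _).2 rfl, (ho _ _).2 rfl, (he _ _ _).2 rfl⟩
  rep_computable := by
    -- The code of a simplex was defined as the code of its canonical representative, so the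
    -- algorithm returns its input.
    refine ⟨fun p => Part.some p.2, Computable.snd.partrec, fun n y => ?_⟩
    obtain ⟨z, h1, h2⟩ := exists_rep_hcode a e y
    exact ⟨z, h1, by rw [h2]; exact Part.mem_some _⟩

end

end

section

open Coded Finsupp CSet Tot

/-! ### Effective homology of the homotopy colimit -/

section

variable {W : SSet.{u}} (e : LocallyEffective W)

/-- The span of reductions becomes a single equivalence between the presenting complexes, by
inverting one leg and composing with the other. -/
theorem exists_heq_of_hasEffectiveHomology (h : e.HasEffectiveHomology) :
    ∃ D : Cx.{u} False, FinB D.B ∧ Nonempty (HEq e.cells.cx D) := by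
  obtain ⟨_, C', D, K', L, ρ, ρ', ⟨h1, ι, b, h2⟩, ⟨h3, κ, c, h4, h5⟩, hρ, hρ'⟩ := h
  let P := basisPres b h1 h2
  let Q := basisPres c h3 h4
  exact ⟨_, basis_finB c h3 h4 h5,
    ⟨(Pres.toRed P (normPres e) ρ hρ).toHEq.symm.trans (Pres.toRed P Q ρ' hρ').toHEq⟩⟩

/-- Conversely, the mapping cylinder of the equivalence is the locally effective complex in the
middle of the span. -/
theorem hasEffectiveHomology_of_heq {D : Cx.{u} False} (hD : FinB D.B) (h : HEq e.cells.cx D) :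
    e.HasEffectiveHomology := by
  obtain ⟨M, ⟨r⟩, ⟨r'⟩⟩ := h.exists_red
  exact ⟨(normPres e).isLocallyEffective, _, _, _, _, Pres.ofRed M.pres (normPres e) r, Pres.ofRed M.pres D.pres r',
    M.pres.isLocallyEffective, D.pres.isEffective hD, Pres.ofRed_isComputable _ _ r, Pres.ofRed_isComputable _ _ r'⟩

end

section

variable {I : Type u} [SmallCategory I] (X : I ⥤ SSet.{u}) [Coded I] [Coded (Arrow I)] [CEq I] [CEq (Arrow I)]
  [Finite I] [Finite (Arrow I)] [∀ i, EffS (X.obj i)] [EffD X]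

theorem pullV_single {I J : Type*} {π : J → I} {q : J → ℕ} {A B : I → Type*} [∀ i, CSet (A i)] [∀ i, CSet (B i)]
    (f : ∀ i, V (A i) →ₗ[ℤ] V (B i)) (x : PB π q A) :
    pullV π q f (single x 1) = inP π q x.1 (f (π x.1) (single x.2.1 1)) :=
  (Finsupp.linearCombination_single _ _ _).trans (one_smul _ _)

theorem exists_heq_hocolim (h : ∀ i, ∃ D : Cx.{u} False, FinB D.B ∧ Nonempty (HEq (allCells (X.obj i)).cx D)) :
    ∃ G : Cx.{u} False, FinB G.B ∧ Nonempty (HEq (allCells (hocolim X)).cx G) := by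
  choose D hD hE using h
  -- Over each object, for all `p` at once: relative chains of `(Δ^p, ∂Δ^p) × X(i)`, shifts of
  -- `C_*(X(i))`, shifts of the effective complex `D i`.
  let ε : ∀ i, HEq (gwData (X.obj i) 1).cx (shiftCx (D i)) := fun i =>
    (gwTower (X.obj i)).heq.trans (HEq.shift (hE i).some)
  -- The graded complex is the pull-back of this family along the nondegenerate chains, each chain
  -- selecting its first object and, as label, its length.
  obtain ⟨δ, h1, g, hG⟩ := (HEq.pull ε (cm_npi (I := I)) (cm_ndm (I := I))).of_filtered (allCells (hocolim X)).cx
    (cellEquiv X) cm_cellEquiv cm_cellEquiv_symm (fun _ => rfl) (fun a b hab => toCell_low a b fun h0 => hab (h0.trans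
      (DFunLike.congr_fun (pullV_single (fun i => (gwData (X.obj i) 1).cx.d) a) b).symm))
  exact ⟨_, FinB.pull hD cm_npi cm_ndm exists_nDN_list, hG⟩

end

theorem hocolim_hasEffectiveHomology {I : Type u} [SmallCategory I] [FinCategory I] (a : Arrow I ↪ ℕ)
    (X : I ⥤ SSet.{u}) (e : ∀ i, LocallyEffective (X.obj i)) (hX : ∀ i, (e i).HasEffectiveHomology)
    (hf : ∀ (i j : I) (f : i ⟶ j), IsComputableMap (e i) (e j) (X.map f)) :
    ∃ E : LocallyEffective (hocolim X), IsCompatible a e E ∧ E.HasEffectiveHomology := by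
  have hid : Function.Injective fun i : I => a (idA i) := fun i j h =>
    congrArg (fun f : Arrow I => f.left) (a.injective h)
  -- An object is encoded by the code of its identity, which is the convention used in
  -- `HocolimCell.code`.
  let _ : Coded I := Coded.ofInj (fun i : I => a (idA i)) hid
  let _ : Coded (Arrow I) := Coded.ofInj a a.injective
  have : CEq I := .of_injective (B := ℕ) (f := fun i : I => a (idA i)) Cm.id hid
  have : CEq (Arrow I) := .of_injective (B := ℕ) (f := a) Cm.id a.injective
  have : Finite (Arrow I) := Finite.of_injective (fun f : Arrow I => (⟨f.left, f.right, f.hom⟩ : Σ i j : I, i ⟶ j))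
    fun f g h => by
      obtain ⟨i, j, f⟩ := f
      obtain ⟨i', j', g⟩ := g
      simp only [Sigma.mk.injEq] at h
      obtain ⟨rfl, h⟩ := h
      obtain ⟨rfl, h⟩ := Sigma.mk.inj (eq_of_heq h)
      obtain rfl := eq_of_heq h
      rfl
  let _ : ∀ i, EffS (X.obj i) := fun i => (e i).effS
  have he : ∀ i (w : Tot (X.obj i)) k, IsCode k w ↔ k = Nat.pair w.dim ((e i).code w.dim w.val) :=
    fun i w k => Lawful.iff k (w.dim, (e i).code w.dim w.val)
  have : EffD X := ⟨fun {i j} f => by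
    obtain ⟨φ, hφ, h⟩ := hf i j f
    have h1 : Cm fun w : Tot (X.obj i) => (w.dim, (e i).code w.dim w.val) := Cm.id
    have h2 : Cm fun w : Tot (X.obj i) => (w.dim, (e j).code w.dim ((X.map f).app _ w.val)) :=
      Cm.pair h1.fst' (Cm.of_partrec hφ h1 fun w => h _ _)
    exact h2⟩
  refine ⟨hocolimEff (a := a) (e := e) (fun _ _ => Iff.rfl) (fun _ _ => Iff.rfl) he, hocolimEff_isCompatible _ _ he, ?_⟩
  obtain ⟨G, hG, ⟨r⟩⟩ := exists_heq_hocolim X fun i => exists_heq_of_hasEffectiveHomology (e i) (hX i)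
  exact hasEffectiveHomology_of_heq _ hG ((cells_heq _ (cm_hcode_num he) (exists_decode_hcode (fun _ _ => Iff.rfl) (fun _ _ => Iff.rfl) he)).trans r)

end

end EffHom


theorem proposition1 {I : Type u} [SmallCategory I] [FinCategory I] (a : Arrow I ↪ ℕ)
    (X : I ⥤ SSet.{u}) (e : ∀ i, LocallyEffective (X.obj i))
    (hX : ∀ i, (e i).HasEffectiveHomology)
    (hf : ∀ (i j : I) (f : i ⟶ j), IsComputableMap (e i) (e j) (X.map f)) :
    ∃ E : LocallyEffective (hocolim X), IsCompatible a e E ∧ E.HasEffectiveHomology := by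
  exact EffHom.hocolim_hasEffectiveHomology a X e hX hf
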